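/- **Setting.** For each security parameter $\sigma$ let public parameters $(p,q,g)$ be drawn from some distribution, where $p,q$ are primes, $g$ generates the subgroup $\mathbb G$ of order $q$ of $(\mathbb Z/p\mathbb Z)^*$, and $p<2^{L(\sigma)}$ for a fixed polynomial $L$. Let $h_3,h_4,h_5$ be independent random oracles with $\ell(\sigma)$-bit values, $\ell$ a polynomial. Machines are probabilistic and polynomial-time in $\sigma$. A function of $\sigma$ is *negligible* if it is eventually smaller than every inverse polynomial. The *Diffie–Hellman (DH) assumption* says that every such machine, given $\sigma$, $(p,q,g)$, $g^a$, $g^b$ with $a,b$ uniform modulo $q$, outputs $g^{ab}$ with negligible probability only. **Protocol.** The secret of a group $G$ of nodes is a random generator $s$ of $\mathbb G$; a node belongs to at most one group, and a node without a group uses a fresh random generator in each run. Alice, with secret $s_a$, picks a random $x$ modulo $q$ and sends $s_a^x$; Bob, with secret $s_b$, receives it as $v$, picks a random $y$ and sends $s_b^y$, which Alice receives as $u$. Alice sends $h_4(u^x)$. Bob receives $m$, outputs his group if $m=h_4(v^y)$ and nothing otherwise, and sends $h_5(v^y)$. Alice receives $m'$ and outputs her group if $m'=h_5(u^x)$ and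 nothing otherwise. The session keys are $h_3(u^x)$ and $h_3(v^y)$. A received $u$ or $v$ that is not in $\mathbb G$ ends the run. **Adversary.** A probabilistic polynomial-time adversary $\mathcal A$ decides which groups and nodes there are (the group of a node being fixed at its creation), makes nodes start runs in either role, delivers all messages of its choice, in any interleaving, queries the random oracles, reveals session keys and outputs of runs, and corrupts nodes, which gives it their group secrets and the generators and exponents of their runs. Once, it selects a node $i$ in a group $G$ and a role for the *test run*, in which it plays the peer $j$ itself. No member of $G$ is ever corrupted ($\mathcal A\notin G$). Other runs of members of $G$, unlimited in number, do not overlap in time with the test run: earlier ones that are unfinished when it starts are aborted, and new ones may start only when it is over; runs of nodes not in $G$ are not restricted. The test run is executed either by the honest member $i\in G$ with the secret of $G$, or by a simulator, which does not know this secret and follows the protocol with a fresh random generator. The *advantage* of $\mathcal A$ is the absolute difference between the probabilities that it outputs $1$ in the two cases. **Lemma (resistance to detection).** Under the DH assumption, the advantage of every such adversary $\mathcal A$ is negligible. Moreover, if for every constant $k$ every probabilistic polynomial-time machine solves the DH problem above with probability less than $2^{-k\sigma}$ for all sufficiently large $\sigma$, then the advantage of every such adversary is less than $2^{-\sigma}$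 for all sufficiently large $\sigma$. -/

import Mathlib

namespace Handshake

/-! ### Probabilistic polynomial-time machines

A machine is a program of a small imperative language over finitely many variables. Variables hold
finite binary trees with natural numbers at the leaves. Each step costs one unit of time; a step
adds a bounded number of bits to the numbers and a bounded number of tree nodes (subtrees are
shared), and each primitive operation is polynomial-time in the length of its arguments, so that
polynomial time here is the usual polynomial time. -/

/-- Values: binary trees with natural numbers at the leaves. -/
inductive Data where
  | num (n : ℕ) : Data
  | pair (a b : Data) : Data

/-- The number at a leaf; `0` for a proper tree. -/
def Data.toNat : Data → ℕ
  | .num n => n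
  | .pair _ _ => 0

def Data.fst : Data → Data
  | .num _ => .num 0
  | .pair a _ => a

def Data.snd : Data → Data
  | .num _ => .num 0
  | .pair _ b => b

/-- `1` for a proper tree, `0` for a leaf. -/
def Data.isPair : Data → Data
  | .num _ => .num 0
  | .pair _ _ => .num 1

def Data.ofBool (b : Bool) : Data := .num (if b then 1 else 0)

/-- A list as a right-nested tree. -/
def Data.ofList : List Data → Data
  | [] => .num 0
  | d :: l => .pair d (Data.ofList l)

abbrev Store := ℕ → Data

/-- Side-effect free expressions. There is no unrestricted multiplication, only multiplication and
exponentiation modulo a number, so that numbers grow by at most one bit per operation. -/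
inductive Exp where
  | var (i : ℕ) : Exp
  | lit (n : ℕ) : Exp
  | pair (a b : Exp) : Exp
  | fst (a : Exp) : Exp
  | snd (a : Exp) : Exp
  | isPair (a : Exp) : Exp
  | eq (a b : Exp) : Exp
  | lt (a b : Exp) : Exp
  | add (a b : Exp) : Exp
  | sub (a b : Exp) : Exp
  | div (a b : Exp) : Exp
  | mod (a b : Exp) : Exp
  | mulMod (a b m : Exp) : Exp
  | powMod (a b m : Exp) : Exp

def Exp.eval (st : Store) : Exp → Data
  | .var i => st i
  | .lit n => .num n
  | .pair a b => .pair (a.eval st) (b.eval st)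
  | .fst a => (a.eval st).fst
  | .snd a => (a.eval st).snd
  | .isPair a => (a.eval st).isPair
  | .eq a b => .ofBool (decide ((a.eval st).toNat = (b.eval st).toNat))
  | .lt a b => .ofBool (decide ((a.eval st).toNat < (b.eval st).toNat))
  | .add a b => .num ((a.eval st).toNat + (b.eval st).toNat)
  | .sub a b => .num ((a.eval st).toNat - (b.eval st).toNat)
  | .div a b => .num ((a.eval st).toNat / (b.eval st).toNat)
  | .mod a b => .num ((a.eval st).toNat % (b.eval st).toNat)
  | .mulMod a b m =>
      if (m.eval st).toNat = 0 then .num 0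
      else .num ((a.eval st).toNat * (b.eval st).toNat % (m.eval st).toNat)
  | .powMod a b m =>
      if (m.eval st).toNat = 0 then .num 0
      else .num ((a.eval st).toNat ^ (b.eval st).toNat % (m.eval st).toNat)

/-- Programs. `rand x e` stores in `x` a uniform number below the value of `e`;
`call x e` sends the value of `e` to the environment and stores the answer in `x`. -/
inductive Cmd where
  | assign (x : ℕ) (e : Exp) : Cmd
  | rand (x : ℕ) (e : Exp) : Cmd
  | call (x : ℕ) (e : Exp) : Cmd
  | seq (a b : Cmd) : Cmd
  | ite (e : Exp) (a b : Cmd) : Cmd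
  | loop (e : Exp) (a : Cmd) : Cmd

/-- The uniform distribution on `{0, …, n - 1}` (the point mass at `0` if `n = 0`). -/
noncomputable def unif (n : ℕ) : PMF ℕ :=
  if h : n = 0 then PMF.pure 0
  else PMF.uniformOfFinset (Finset.range n) (Finset.nonempty_range_iff.mpr h)

/-- Runs the commands on the stack for at most the given number of steps, against a probabilistic
environment `O` with states in `S`. The result is the value of variable `0` at the end, or `none`
if the program has not halted in time. -/
noncomputable def exec {S : Type} (O : S → Data → PMF (Data × S)) :
    ℕ → List Cmd → Store → S → PMF (Option Data)
  | _, [], st, _ => PMF.pure (some (st 0))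
  | 0, _ :: _, _, _ => PMF.pure none
  | n + 1, .assign x e :: K, st, s => exec O n K (Function.update st x (e.eval st)) s
  | n + 1, .rand x e :: K, st, s =>
      (unif (e.eval st).toNat).bind fun r => exec O n K (Function.update st x (.num r)) s
  | n + 1, .call x e :: K, st, s =>
      (O s (e.eval st)).bind fun r => exec O n K (Function.update st x r.1) r.2
  | n + 1, .seq a b :: K, st, s => exec O n (a :: b :: K) st s
  | n + 1, .ite e a b :: K, st, s =>
      if (e.eval st).toNat ≠ 0 then exec O n (a :: K) st s else exec O n (b :: K) st s
  | n + 1, .loop e a :: K, st, s =>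
      if (e.eval st).toNat ≠ 0 then exec O n (a :: .loop e a :: K) st s else exec O n K st s

/-- A probabilistic polynomial-time machine: a program with a polynomial clock that stops it. -/
structure PPT where
  prog : Cmd
  clock : Polynomial ℕ

/-- The output of a machine on an input, with security parameter `σ`. -/
noncomputable def PPT.run {S : Type} (M : PPT) (σ : ℕ) (O : S → Data → PMF (Data × S)) (s : S)
    (input : Data) : PMF (Option Data) :=
  exec O (M.clock.eval σ) [M.prog] (Function.update (fun _ => .num 0) 0 input) s

/-- Negligible: eventually smaller than every inverse polynomial. -/
def Negligible (f : ℕ → ℝ) : Prop :=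
  Asymptotics.SuperpolynomialDecay Filter.atTop (fun σ : ℕ => (σ : ℝ)) f

/-! ### The group and the Diffie-Hellman assumption -/

/-- Public parameters: the subgroup of prime order `q`, generated by `g`, of the multiplicative
group modulo the prime `p`. Group elements are represented by numbers below `p`. -/
structure Params where
  p : ℕ
  q : ℕ
  g : ℕ
  prime_p : p.Prime
  prime_q : q.Prime
  g_lt : g < p
  g_ne_one : g ≠ 1
  g_pow : g ^ q % p = 1

/-- `v` represents an element of the subgroup of order `q`. -/
def Params.IsElt (pp : Params) (v : ℕ) : Prop := v < pp.p ∧ v ^ pp.q % pp.p = 1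

instance (pp : Params) (v : ℕ) : Decidable (pp.IsElt v) :=
  inferInstanceAs (Decidable (_ ∧ _))

def Params.toData (pp : Params) : Data := .pair (.num pp.p) (.pair (.num pp.q) (.num pp.g))

/-- A uniformly random generator of the group. -/
noncomputable def Params.randGenerator (pp : Params) : PMF ℕ :=
  (unif (pp.q - 1)).map fun r => pp.g ^ (r + 1) % pp.p

/-- The probability that `B` computes `g^(ab)` from `g^a` and `g^b`, for uniform `a`, `b`. -/
noncomputable def dhSuccess (gen : ℕ → PMF Params) (B : PPT) (σ : ℕ) : ℝ :=
  (((gen σ).bind fun pp => (unif pp.q).bind fun a => (unif pp.q).bind fun b =>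
    (B.run σ (fun (_ : Unit) _ => PMF.pure (.num 0, ())) ()
      (.pair (.num σ) (.pair pp.toData
        (.pair (.num (pp.g ^ a % pp.p)) (.num (pp.g ^ b % pp.p)))))).map
      fun o => o.map Data.toNat = some (pp.g ^ (a * b) % pp.p)) True).toReal

/-- The (computational) Diffie-Hellman assumption. -/
def DHAssumption (gen : ℕ → PMF Params) : Prop :=
  ∀ B : PPT, Negligible (dhSuccess gen B)

/-- The Diffie-Hellman assumption with exponentially small success probabilities, of any rate. -/
def StrongDHAssumption (gen : ℕ → PMF Params) : Prop :=
  ∀ (B : PPT) (k : ℕ), ∀ᶠ σ in Filter.atTop, dhSuccess gen B σ < 1 / 2 ^ (k * σ)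

/-! ### The single membership protocol, and the system attacked by the adversary -/

/-- The local state of a node in one run of the protocol. -/
structure Session where
  /-- the node that runs the protocol -/
  node : ℕ
  /-- `true` for Alice (who sends the first message), `false` for Bob -/
  initiator : Bool
  /-- the group secret: the generator used -/
  base : ℕ
  /-- the secret exponent -/
  exp : ℕ
  /-- the group element received from the other side -/
  peer : Option ℕ
  /-- the output is the node's group (`true`), or the empty set (`false`) -/
  accepted : Bool
  /-- the run is over -/
  closed : Bool

/-- The run is over, with the given output. -/
def Session.finish (r : Session) (b : Bool) : Session := { r with accepted := b, closed := true }

/-- The state of the whole system. -/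
structure Sys where
  /-- the secrets of the groups -/
  groups : List ℕ
  /-- the nodes, with the group to which each belongs (if any) -/
  nodes : List (Option ℕ)
  /-- the groups of which the adversary has corrupted a member -/
  corrupted : List ℕ
  sessions : List Session
  /-- the session of the test run, and the group of the node tested -/
  test : Option (ℕ × ℕ)
  /-- the values of the random oracles so far -/
  oracle : ℕ × ℕ → Option ℕ

def Sys.init : Sys := ⟨[], [], [], [], none, fun _ => none⟩

/-- The group `a` is the one whose member is tested. -/
def Sys.isTarget (S : Sys) (a : Option ℕ) : Bool :=
  match S.test with
  | none => false
  | some (_, G) => decide (a = some G)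

/-- The test run has begun and is not over. -/
def Sys.testRunning (S : Sys) : Bool :=
  match S.test with
  | none => false
  | some (k, _) => match S.sessions[k]? with
    | none => false
    | some s => !s.closed

/-- The hash function `h_t` at `v`, a random oracle with `len`-bit values, sampled lazily. -/
noncomputable def Sys.hash (len t v : ℕ) (S : Sys) : PMF (ℕ × Sys) :=
  match S.oracle (t, v) with
  | some h => PMF.pure (h, S)
  | none => (unif (2 ^ len)).map fun h =>
      (h, { S with oracle := Function.update S.oracle (t, v) (some h) })

/-- What the adversary can do. The argument `v` of `start` and `test` is `none` to make the node
initiate a run (as Alice), and the first message `v` to make it respond to one (as Bob). -/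
inductive Query where
  | newGroup : Query
  | newNode (a : Option ℕ) : Query
  | start (i : ℕ) (v : Option ℕ) : Query
  | test (i : ℕ) (v : Option ℕ) : Query
  | deliver (k m : ℕ) : Query
  | reveal (k : ℕ) : Query
  | corrupt (i : ℕ) : Query
  | hash (t v : ℕ) : Query

/-- `0` stands for `none` and `n + 1` for `some n`. -/
def optNat : ℕ → Option ℕ
  | 0 => none
  | n + 1 => some n

/-- Queries are encoded as triples `(tag, (x, y))`. -/
def Query.decode (d : Data) : Option Query :=
  let x := d.snd.fst.toNat
  let y := d.snd.snd.toNat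
  match d.fst.toNat with
  | 0 => some .newGroup
  | 1 => some (.newNode (optNat x))
  | 2 => some (.start x (optNat y))
  | 3 => some (.test x (optNat y))
  | 4 => some (.deliver x y)
  | 5 => some (.reveal x)
  | 6 => some (.corrupt x)
  | 7 => some (.hash x y)
  | _ => none

/-- The answer to a query that is not allowed; nothing happens. -/
noncomputable def Sys.refuse (S : Sys) : PMF (Data × Sys) := PMF.pure (.num 0, S)

/-- The first message received, if any, has to be a group element. -/
def validFirst (pp : Params) (v : Option ℕ) : Prop := ∀ w ∈ v, pp.IsElt w

instance (pp : Params) (v : Option ℕ) : Decidable (validFirst pp v) := by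
  unfold validFirst
  cases v with
  | none => exact isTrue (by simp)
  | some w => exact decidable_of_iff (pp.IsElt w) (by simp)

/-- Node `i` begins a run with generator `base`: it picks an exponent `x` and sends `base ^ x`. -/
noncomputable def Sys.openSession (pp : Params) (i base : ℕ) (v : Option ℕ) (S : Sys) :
    PMF (Data × Sys) :=
  (unif pp.q).map fun x =>
    (.pair (.num S.sessions.length) (.num (base ^ x % pp.p)),
      { S with sessions := S.sessions ++ [⟨i, v.isNone, base, x, v, false, false⟩] })

/-- Node `i` begins a run, with its group secret, or with a fresh random one if it has no group.
Members of the group of the tested node do not begin a run while the test run is going on. -/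
noncomputable def Sys.start (pp : Params) (i : ℕ) (v : Option ℕ) (S : Sys) : PMF (Data × Sys) :=
  match S.nodes[i]? with
  | none => S.refuse
  | some a =>
    if validFirst pp v ∧ ¬ (S.isTarget a = true ∧ S.testRunning = true) then
      match a with
      | none => pp.randGenerator.bind fun s => S.openSession pp i s v
      | some G => S.openSession pp i (S.groups.getD G 0) v
    else S.refuse

/-- The test run begins, with a node `i` of a group `G` none of whose members is corrupted. It is
run by `i` if `real = true`. Otherwise it is run by the simulator, which does not know the secret
of `G` and follows the protocol with a fresh random generator. Earlier runs of members of `G` that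
are not over are aborted. -/
noncomputable def Sys.startTest (pp : Params) (real : Bool) (i : ℕ) (v : Option ℕ) (S : Sys) :
    PMF (Data × Sys) :=
  match S.nodes[i]? with
  | some (some G) =>
    if validFirst pp v ∧ S.test = none ∧ G ∉ S.corrupted then
      (if real then PMF.pure (S.groups.getD G 0) else pp.randGenerator).bind fun s =>
        Sys.openSession pp i s v
          { S with
            test := some (S.sessions.length, G)
            sessions := S.sessions.map fun r =>
              { r with closed := r.closed || decide (S.nodes[r.node]? = some (some G)) } }
    else S.refuse
  | _ => S.refuse

/-- Message `m` is delivered in session `k`.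
Alice first receives `u`, and answers `h₄(u^x)`; a message that is not a group element makes her
abort. Then she receives `m'` and accepts if it is `h₅(u^x)`.
Bob, who has received `v` and has sent his group element, receives `m`, accepts if it is
`h₄(v^y)`, and in any case sends `h₅(v^y)`. -/
noncomputable def Sys.deliver (pp : Params) (len k m : ℕ) (S : Sys) : PMF (Data × Sys) :=
  match S.sessions[k]? with
  | none => S.refuse
  | some r =>
    if r.closed then S.refuse
    else match r.peer with
      | none =>
        if pp.IsElt m then
          (S.hash len 4 (m ^ r.exp % pp.p)).map fun z =>
            (.num z.1, { z.2 with sessions := z.2.sessions.set k { r with peer := some m } })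
        else
          PMF.pure (.num 0, { S with sessions := S.sessions.set k { r with closed := true } })
      | some u =>
        if r.initiator then
          (S.hash len 5 (u ^ r.exp % pp.p)).map fun z =>
            (.num 0, { z.2 with sessions := z.2.sessions.set k (r.finish (decide (m = z.1))) })
        else
          (S.hash len 4 (u ^ r.exp % pp.p)).bind fun z =>
            (z.2.hash len 5 (u ^ r.exp % pp.p)).map fun w =>
              (.num w.1, { w.2 with sessions := w.2.sessions.set k (r.finish (decide (m = z.1))) })

/-- Reveals the session key `h₃(u^x)` and the output of session `k`. -/
noncomputable def Sys.reveal (pp : Params) (len k : ℕ) (S : Sys) : PMF (Data × Sys) :=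
  match S.sessions[k]? with
  | none => S.refuse
  | some r => match r.peer with
    | none => S.refuse
    | some u => (S.hash len 3 (u ^ r.exp % pp.p)).map fun z =>
        (.pair (.num z.1) (.ofBool r.accepted), z.2)

/-- Corrupts node `i`: reveals its group secret, and the generator and exponent of each of its
runs. Members of the group of the tested node cannot be corrupted. -/
noncomputable def Sys.corrupt (i : ℕ) (S : Sys) : PMF (Data × Sys) :=
  match S.nodes[i]? with
  | none => S.refuse
  | some a =>
    if S.isTarget a then S.refuse
    else PMF.pure
      (.pair (.num ((a.map fun G => S.groups.getD G 0).getD 0))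
        (.ofList ((S.sessions.filter fun r => r.node = i).map fun r =>
          .pair (.num r.base) (.num r.exp))),
        { S with corrupted := a.toList ++ S.corrupted })

/-- The environment of the adversary. Creating a group draws its secret, a random generator. The
membership of a node is fixed when the node is created. -/
noncomputable def Sys.answer (pp : Params) (len : ℕ) (real : Bool) (S : Sys) (d : Data) :
    PMF (Data × Sys) :=
  match Query.decode d with
  | none => S.refuse
  | some .newGroup => pp.randGenerator.map fun s =>
      (.num S.groups.length, { S with groups := S.groups ++ [s] })
  | some (.newNode a) =>
      if ∀ G ∈ a.toList, G < S.groups.length then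
        PMF.pure (.num S.nodes.length, { S with nodes := S.nodes ++ [a] })
      else S.refuse
  | some (.start i v) => S.start pp i v
  | some (.test i v) => S.startTest pp real i v
  | some (.deliver k m) => S.deliver pp len k m
  | some (.reveal k) => S.reveal pp len k
  | some (.corrupt i) => S.corrupt i
  | some (.hash t v) => (S.hash len t v).map fun z => (.num z.1, z.2)

/-- The probability that adversary `A` outputs `1` when the test run is with the honest group
member (`real = true`), or with the simulator (`real = false`). -/
noncomputable def outputsOne (gen : ℕ → PMF Params) (len : Polynomial ℕ) (A : PPT) (real : Bool)
    (σ : ℕ) : ℝ :=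
  (((gen σ).bind fun pp =>
    (A.run σ (Sys.answer pp (len.eval σ) real) Sys.init (.pair (.num σ) pp.toData)).map
      fun o => o.map Data.toNat = some 1) True).toReal

/-- The advantage of `A` in telling the group member from the simulator. -/
noncomputable def detectionAdvantage (gen : ℕ → PMF Params) (len : Polynomial ℕ) (A : PPT)
    (σ : ℕ) : ℝ :=
  |outputsOne gen len A true σ - outputsOne gen len A false σ|

end Handshake

namespace Handshake

/-! ### Polynomial-time computable functions -/

/-! The groups are exchanged one at a time. In the hybrid with number `m` the honest member executes
the test run for groups numbered below `m`, the simulator does so for the others; since a clock of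
`T` steps allows at most `T` groups, `T + 1` hybrids lead from the simulator to the member
(`hybrid`). Neighbours differ only in the test run for one group `γ`. If its secret is `g^β`, the
test run uses `g^β'`, with `β' = β` in one case and an independent `β'` in the other; both exponents
may be drawn in advance (`val_eager`).

The two systems are compared with one ideal experiment in which neither `β` nor `β'` occurs. A run
of a member of `γ` with exponent `x` for the base `g^β` is described by `e = xβ`, which is again
uniform; it sends `g^e`. Its common secret `w = u^x` is unknown, but `w^β = u^e` is not, so the
oracle values of these runs are filed under `u^e` in a table of their own, those of the test run in
another one, and those asked for openly under `w` in a third. Raising to the power `β` is a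
bijection, so this reproduces the real system for either choice of `β'`, until two tables contain
the same point `w` (`Simulates.step`, `val_le_val_add_bad`).

As the ideal experiment does not involve `β` and `β'`, these can be drawn after it. A coincidence
with the public table, or of the private tables for independent exponents, determines one of the
exponents from a pair of table entries, and so has probability of order `n²/q` (`badProb_le`). What
remains is the case `β = β'`, where a run of a member and the test run have the same `u^e`.

Here the prohibition of overlap enters. Of the two runs one, `i`, is over or aborted when the other,
`j`, begins, so its value `Z = g^ζ` is fixed by then (`ev_coll_le`). Run `j` sends a fresh `g^e` and
the adversary has to reply with `u = g^(ζ/e)`. The exponent `e` is not used before that reply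
(`ev_chain_same`), so a challenge can be planted, randomised by a power `ρ`: from this configuration
the adversary inverts any exponent, up to the unknown but constant factor `ζ` (`NC.finds_attempt`).
From `1/x - 1/(x+1) = 1/(x²+x)` one more inversion yields `g^(x²+x)` without `ζ`, and applying this
to `a + b` and `a - b` yields `g^(ab)` (`Finds.square`, `Finds.solve`). This takes six continuations
from the same configuration; by Jensen's inequality for the sixth power, the sixth power of the
collision probability is at most a polynomial times the success for Diffie-Hellman.

The bound `1/q` is itself a success probability, namely that of a machine that always answers `1`
(`inv_le_success`). Together, `detectionAdvantage ^ 6` is at most a polynomial times two success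
probabilities (`advantage_pow_le`), which gives both asymptotic statements.

The reduction has to be a program of the given language. `Comp` and `PTime` are calculi of
deterministic and randomised polynomial time, with the depth of a tree as the measure of size. The
adversary is interpreted step by step, its commands being represented by their numbers in its fixed
program. -/

theorem poly_mono (p : Polynomial ℕ) : Monotone (fun n => p.eval n) := by
  intro a b h
  simp only [Polynomial.eval_eq_sum_range]
  gcongr

/-- The depth of a tree. -/
def Data.depth : Data → ℕ
  | .num _ => 0
  | .pair a b => max a.depth b.depth + 1

/-- The command `c` deterministically turns the store `st` into `st'` in at most `t` steps. -/
def SStep (c : Cmd) (t : ℕ) (st st' : Store) : Prop :=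
  ∃ t' ≤ t, ∀ {S : Type} (O : S → Data → PMF (Data × S)) (n : ℕ) (K : List Cmd) (s : S),
    exec O (n + t') (c :: K) st s = exec O n K st' s

theorem SStep.mono {c t t' st st'} (h : SStep c t st st') (ht : t ≤ t') : SStep c t' st st' := by
  obtain ⟨u, hu, h⟩ := h
  exact ⟨u, hu.trans ht, h⟩

theorem SStep.assign (x : ℕ) (e : Exp) (st : Store) :
    SStep (.assign x e) 1 st (Function.update st x (e.eval st)) :=
  ⟨1, le_rfl, fun _ _ _ _ => by simp [exec]⟩

theorem SStep.seq {a b t u st st' st''} (ha : SStep a t st st') (hb : SStep b u st' st'') :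
    SStep (.seq a b) (t + u + 1) st st'' := by
  obtain ⟨t', ht, ha⟩ := ha
  obtain ⟨u', hu, hb⟩ := hb
  refine ⟨u' + t' + 1, by omega, fun O n K s => ?_⟩
  rw [← add_assoc, exec, ← add_assoc, ha, hb]

theorem SStep.loop_true {e a t u st st' st''} (he : (e.eval st).toNat ≠ 0)
    (ha : SStep a t st st') (hb : SStep (.loop e a) u st' st'') :
    SStep (.loop e a) (t + u + 1) st st'' := by
  obtain ⟨t', ht, ha⟩ := ha
  obtain ⟨u', hu, hb⟩ := hb
  refine ⟨u' + t' + 1, by omega, fun O n K s => ?_⟩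
  rw [← add_assoc, exec, if_pos he, ← add_assoc, ha, hb]

theorem SStep.loop_false {e a st} (he : (e.eval st).toNat = 0) : SStep (.loop e a) 1 st st :=
  ⟨1, le_rfl, fun O n K s => by simp [exec, he]⟩

/-- The command `c` turns the contents `x` of register `b` into `y` in at most `t` steps, and does
not change the registers below `b`. -/
def Step (c : Cmd) (b t : ℕ) (x y : Data) : Prop :=
  ∀ st : Store, st b = x → ∃ st' : Store, st' b = y ∧ (∀ i < b, st' i = st i) ∧ SStep c t st st'

theorem Step.mono {c b t t' x y} (h : Step c b t x y) (ht : t ≤ t') : Step c b t' x y :=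
  fun st hst => let ⟨st', h1, h2, h3⟩ := h st hst; ⟨st', h1, h2, h3.mono ht⟩

theorem Step.seq {c d b t u x y z} (h : Step c b t x y) (h' : Step d b u y z) :
    Step (.seq c d) b (t + u + 1) x z := by
  intro st hst
  obtain ⟨st', h1, h2, h3⟩ := h st hst
  obtain ⟨st'', h4, h5, h6⟩ := h' st' h1
  exact ⟨st'', h4, fun i hi => (h5 i hi).trans (h2 i hi), h3.seq h6⟩

theorem Step.assign {b : ℕ} {e : Exp} {x y : Data}
    (h : ∀ st : Store, st b = x → e.eval st = y) : Step (.assign b e) b 1 x y := by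
  intro st hst
  refine ⟨_, ?_, ?_, SStep.assign b e st⟩
  · simp [h st hst]
  · intro i hi
    simp [Function.update_of_ne hi.ne]

/-- Types whose elements are encoded as trees. -/
class Enc (α : Type) where
  toData : α → Data

/-- The encoding of `a`. -/
def enc {α : Type} [Enc α] (a : α) : Data := Enc.toData a

instance : Enc Data := ⟨id⟩
instance : Enc ℕ := ⟨.num⟩
instance {α β : Type} [Enc α] [Enc β] : Enc (α × β) := ⟨fun x => .pair (enc x.1) (enc x.2)⟩
instance {α : Type} [Enc α] : Enc (List α) := ⟨fun l => Data.ofList (l.map enc)⟩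

@[simp] theorem enc_data (d : Data) : enc d = d := rfl
@[simp] theorem enc_nat (n : ℕ) : enc n = .num n := rfl
@[simp] theorem enc_prod {α β : Type} [Enc α] [Enc β] (x : α × β) :
    enc x = .pair (enc x.1) (enc x.2) := rfl
@[simp] theorem enc_nil {α : Type} [Enc α] : enc ([] : List α) = .num 0 := rfl
@[simp] theorem enc_cons {α : Type} [Enc α] (a : α) (l : List α) :
    enc (a :: l) = .pair (enc a) (enc l) := rfl

/-- The depth of the encoding. -/
def edepth {α : Type} [Enc α] (a : α) : ℕ := (enc a).depth

/-- Functions computed by a deterministic program in time polynomial in the depth of the argument,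
with values of depth larger by at most a constant. The program works on the registers from any
given one on. -/
@[fun_prop]
def Comp {α β : Type} [Enc α] [Enc β] (f : α → β) : Prop :=
  ∃ (c : ℕ → Cmd) (p : Polynomial ℕ) (C : ℕ), ∀ a, edepth (f a) ≤ edepth a + C ∧
    ∀ b, Step (c b) b (p.eval (edepth a)) (enc a) (enc (f a))

section

variable {α β γ δ : Type} [Enc α] [Enc β] [Enc γ] [Enc δ]

/-- A single assignment does the work, so the time is constant and only the growth of the depth is
left to check. -/
theorem Comp.ofExp {f : α → β} (e : ℕ → Exp) (C : ℕ) (hC : ∀ a, edepth (f a) ≤ edepth a + C)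
    (h : ∀ a b (st : Store), st b = enc a → (e b).eval st = enc (f a)) : Comp f :=
  ⟨fun b => .assign b (e b), 1, C, fun a => ⟨hC a, fun b => by
    simpa using Step.assign (h a b)⟩⟩

@[fun_prop]
theorem Comp.id : Comp (fun a : α => a) :=
  .ofExp (fun b => .var b) 0 (fun _ => le_rfl) (fun _ _ _ h => by simp [Exp.eval, h])

/-- An expression for a given tree. -/
def Data.toExp : Data → Exp
  | .num n => .lit n
  | .pair a b => .pair a.toExp b.toExp

theorem Data.eval_toExp (st : Store) : ∀ d : Data, d.toExp.eval st = d
  | .num n => rfl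
  | .pair a b => by simp [Data.toExp, Exp.eval, Data.eval_toExp st a, Data.eval_toExp st b]

@[fun_prop]
theorem Comp.const (y : β) : Comp (fun _ : α => y) :=
  .ofExp (fun _ => (enc y).toExp) (edepth y) (fun _ => by omega)
    (fun _ _ _ _ => Data.eval_toExp _ _)

@[fun_prop]
-- Since depth grows by a constant only, the time of `g` at `f a` is a shifted polynomial in the
-- depth of `a`, and the growth constants add up.
theorem Comp.comp {g : β → γ} {f : α → β} (hg : Comp g) (hf : Comp f) :
    Comp (fun a => g (f a)) := by
  obtain ⟨cg, pg, Cg, hg⟩ := hg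
  obtain ⟨cf, pf, Cf, hf⟩ := hf
  refine ⟨fun b => .seq (cf b) (cg b), pf + pg.comp (.X + .C Cf) + 1, Cg + Cf, fun a => ⟨?_, ?_⟩⟩
  · have h1 := (hf a).1; have h2 := (hg (f a)).1
    exact h2.trans (by omega)
  · intro b
    refine (((hf a).2 b).seq ((hg (f a)).2 b)).mono ?_
    have := poly_mono pg (hf a).1
    simp only [Polynomial.eval_add, Polynomial.eval_comp, Polynomial.eval_X, Polynomial.eval_C,
      Polynomial.eval_one]
    simp only at this
    omega

@[simp] theorem edepth_pair (x : α × β) : edepth x = max (edepth x.1) (edepth x.2) + 1 := rfl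
@[simp] theorem edepth_nat (n : ℕ) : edepth n = 0 := rfl

@[fun_prop]
theorem Comp.prodMk {f : α → β} {g : α → γ} (hf : Comp f) (hg : Comp g) :
    Comp (fun a => (f a, g a)) := by
  obtain ⟨cf, pf, Cf, hf⟩ := hf
  obtain ⟨cg, pg, Cg, hg⟩ := hg
  -- The argument stays in register `b` while `f` works from `b+1` and `g` from `b+2`. The `7`
  -- counts three assignments and four sequencing steps.
  refine ⟨fun b => .seq (.assign (b+1) (.var b)) (.seq (cf (b+1)) (.seq (.assign (b+2) (.var b))
    (.seq (cg (b+2)) (.assign b (.pair (.var (b+1)) (.var (b+2))))))), pf + pg + 7, Cf + Cg + 1,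
    fun a => ⟨?_, ?_⟩⟩
  · have := (hf a).1; have := (hg a).1; simp; omega
  · intro b st hst
    have s1 := SStep.assign (b+1) (.var b) st
    obtain ⟨st2, e2, f2, s2⟩ := (hf a).2 (b+1) (Function.update st (b+1) ((Exp.var b).eval st))
      (by simp [Exp.eval, hst])
    have s3 := SStep.assign (b+2) (.var b) st2
    have hb : st2 b = enc a := by simp [f2 b (by omega), hst]
    obtain ⟨st4, e4, f4, s4⟩ := (hg a).2 (b+2) (Function.update st2 (b+2) ((Exp.var b).eval st2))
      (by simp [Exp.eval, hb])
    have hb1 : st4 (b+1) = enc (f a) := by simp [f4 (b+1) (by omega), e2]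
    have s5 := SStep.assign b (.pair (.var (b+1)) (.var (b+2))) st4
    refine ⟨_, ?_, ?_, (s1.seq (s2.seq (s3.seq (s4.seq s5)))).mono ?_⟩
    · simp [Exp.eval, hb1, e4]
    · intro i hi
      rw [Function.update_of_ne hi.ne, f4 i (by omega), Function.update_of_ne (by omega),
        f2 i (by omega), Function.update_of_ne (by omega)]
    · simp; omega

@[fun_prop]
theorem Comp.fst {f : α → β × γ} (hf : Comp f) : Comp (fun a => (f a).1) :=
  Comp.comp (g := Prod.fst) (.ofExp (fun b => .fst (.var b)) 0 (fun a => by simp; omega)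
    (fun a b st h => by simp [Exp.eval, h, Data.fst])) hf

@[fun_prop]
theorem Comp.snd {f : α → β × γ} (hf : Comp f) : Comp (fun a => (f a).2) :=
  Comp.comp (g := Prod.snd) (.ofExp (fun b => .snd (.var b)) 0 (fun a => by simp; omega)
    (fun a b st h => by simp [Exp.eval, h, Data.snd])) hf

/-! Natural numbers and trees -/

/-- Numbers have depth `0` whatever their size, so arithmetic costs nothing in the bound on depth.
-/
theorem Comp.natOp {f : α → ℕ} {g : α → ℕ} (op : ℕ → ℕ → ℕ) (e : Exp → Exp → Exp)
    (he : ∀ a b st, (e a b).eval st = .num (op (a.eval st).toNat (b.eval st).toNat))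
    (hf : Comp f) (hg : Comp g) : Comp (fun a => op (f a) (g a)) :=
  Comp.comp (g := fun x : ℕ × ℕ => op x.1 x.2)
    (.ofExp (fun b => e (.fst (.var b)) (.snd (.var b))) 0 (fun a => by simp)
      (fun a b st h => by simp [he, Exp.eval, h, Data.fst, Data.snd, Data.toNat])) (hf.prodMk hg)

@[fun_prop]
theorem Comp.add {f g : α → ℕ} (hf : Comp f) (hg : Comp g) : Comp (fun a => f a + g a) :=
  natOp (· + ·) .add (fun _ _ _ => rfl) hf hg

@[fun_prop]
theorem Comp.sub {f g : α → ℕ} (hf : Comp f) (hg : Comp g) : Comp (fun a => f a - g a) :=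
  natOp (· - ·) .sub (fun _ _ _ => rfl) hf hg

@[fun_prop]
theorem Comp.mod {f g : α → ℕ} (hf : Comp f) (hg : Comp g) : Comp (fun a => f a % g a) :=
  natOp (· % ·) .mod (fun _ _ _ => rfl) hf hg

/-- Exponentiation modulo `m`. -/
def pm (a b m : ℕ) : ℕ := if m = 0 then 0 else a ^ b % m

/-- Multiplication modulo `m`. -/
def mm (a b m : ℕ) : ℕ := if m = 0 then 0 else a * b % m

@[fun_prop]
theorem Comp.pm {f g h : α → ℕ} (hf : Comp f) (hg : Comp g) (hh : Comp h) :
    Comp (fun a => pm (f a) (g a) (h a)) :=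
  Comp.comp (g := fun x : ℕ × ℕ × ℕ => Handshake.pm x.1 x.2.1 x.2.2)
    (.ofExp (fun b => .powMod (.fst (.var b)) (.fst (.snd (.var b))) (.snd (.snd (.var b)))) 0
      (fun a => by simp)
      (fun a b st h => by
        simp only [Exp.eval, h, Data.fst, Data.snd, Data.toNat, Handshake.pm, enc_prod, enc_nat]
        split_ifs <;> rfl)) (hf.prodMk (hg.prodMk hh))

@[fun_prop]
theorem Comp.mm {f g h : α → ℕ} (hf : Comp f) (hg : Comp g) (hh : Comp h) :
    Comp (fun a => mm (f a) (g a) (h a)) :=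
  Comp.comp (g := fun x : ℕ × ℕ × ℕ => Handshake.mm x.1 x.2.1 x.2.2)
    (.ofExp (fun b => .mulMod (.fst (.var b)) (.fst (.snd (.var b))) (.snd (.snd (.var b)))) 0
      (fun a => by simp)
      (fun a b st h => by
        simp only [Exp.eval, h, Data.fst, Data.snd, Data.toNat, Handshake.mm, enc_prod, enc_nat]
        split_ifs <;> rfl)) (hf.prodMk (hg.prodMk hh))

-- The encoding of the leaf is that of the number, so the program is unchanged; the same applies to
-- pairs and to encodings below.
@[fun_prop]
theorem Comp.dataNum {f : α → ℕ} (hf : Comp f) : Comp (fun a => Data.num (f a)) := hf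

@[fun_prop]
theorem Comp.dataPair {f g : α → Data} (hf : Comp f) (hg : Comp g) :
    Comp (fun a => Data.pair (f a) (g a)) := hf.prodMk hg

@[fun_prop]
theorem Comp.encode {f : α → β} (hf : Comp f) : Comp (fun a => enc (f a)) := hf

@[fun_prop]
theorem Comp.toNat {f : α → Data} (hf : Comp f) : Comp (fun a => (f a).toNat) :=
  Comp.comp (.ofExp (fun b => .add (.var b) (.lit 0)) 0 (fun a => by simp)
    (fun a b st h => by simp [Exp.eval, h, Data.toNat])) hf

theorem Data.depth_fst (d : Data) : d.fst.depth ≤ d.depth := by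
  cases d <;> simp [Data.fst, Data.depth]; omega

theorem Data.depth_snd (d : Data) : d.snd.depth ≤ d.depth := by
  cases d <;> simp [Data.snd, Data.depth]; omega

@[fun_prop]
theorem Comp.dataFst {f : α → Data} (hf : Comp f) : Comp (fun a => (f a).fst) :=
  Comp.comp (.ofExp (fun b => .fst (.var b)) 0 (fun a => a.depth_fst)
    (fun a b st h => by simp [Exp.eval, h])) hf

@[fun_prop]
theorem Comp.dataSnd {f : α → Data} (hf : Comp f) : Comp (fun a => (f a).snd) :=
  Comp.comp (.ofExp (fun b => .snd (.var b)) 0 (fun a => a.depth_snd)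
    (fun a b st h => by simp [Exp.eval, h])) hf

@[fun_prop]
theorem Comp.dataIsPair {f : α → Data} (hf : Comp f) : Comp (fun a => (f a).isPair) :=
  Comp.comp (.ofExp (fun b => .isPair (.var b)) 0 (fun a => by
      cases a <;> simp [Data.isPair, edepth, Data.depth])
    (fun a b st h => by simp [Exp.eval, h])) hf

/-! Case distinctions -/

/-- `a` if `n` is not `0`, otherwise `b`. -/
def sel {α : Type} (n : ℕ) (a b : α) : α := if n ≠ 0 then a else b

@[fun_prop]
theorem Comp.sel {n : α → ℕ} {f g : α → β} (hn : Comp n) (hf : Comp f) (hg : Comp g) :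
    Comp (fun a => sel (n a) (f a) (g a)) := by
  refine Comp.comp (g := fun x : ℕ × β × β => Handshake.sel x.1 x.2.1 x.2.2)
    ⟨fun b => .ite (.fst (.var b)) (.assign b (.fst (.snd (.var b))))
      (.assign b (.snd (.snd (.var b)))), 2, 0, fun x => ⟨?_, ?_⟩⟩ (hn.prodMk (hf.prodMk hg))
  · simp only [Handshake.sel]
    split_ifs <;> simp <;> omega
  · intro b st hst
    obtain ⟨n, y, z⟩ := x
    refine ⟨Function.update st b (enc (Handshake.sel n y z)), by simp,
      fun i hi => by simp [Function.update_of_ne hi.ne], 2, by simp, fun O m K s => ?_⟩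
    by_cases h : n = 0 <;>
      simp [exec, Exp.eval, hst, Data.fst, Data.snd, Data.toNat, Handshake.sel, h]

@[fun_prop]
theorem Comp.ite_eq {m n : α → ℕ} {f g : α → β} (hm : Comp m) (hn : Comp n) (hf : Comp f)
    (hg : Comp g) : Comp (fun a => if m a = n a then f a else g a) := by
  have h : Comp fun a => if m a = n a then 1 else 0 :=
    natOp (fun x y => if x = y then 1 else 0) .eq (fun a b st => by simp [Exp.eval, Data.ofBool])
      hm hn
  convert h.sel hf hg using 2
  unfold Handshake.sel
  split_ifs <;> simp_all

@[fun_prop]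
theorem Comp.ite_lt {m n : α → ℕ} {f g : α → β} (hm : Comp m) (hn : Comp n) (hf : Comp f)
    (hg : Comp g) : Comp (fun a => if m a < n a then f a else g a) := by
  have h : Comp fun a => if m a < n a then 1 else 0 :=
    natOp (fun x y => if x < y then 1 else 0) .lt (fun a b st => by simp [Exp.eval, Data.ofBool])
      hm hn
  convert h.sel hf hg using 2
  unfold Handshake.sel
  split_ifs <;> simp_all

/-- The list is fixed, so a nest of finitely many tests, decreasing the number each time, selects
the function. This is how an interpreter of a fixed program chooses the command to execute. -/
theorem Comp.dispatch {ι : Type} (F : ι → α → β) (hF : ∀ i, Comp (F i)) (d : ι) :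
    ∀ l : List ι, Comp (fun x : ℕ × α => F (l.getD x.1 d) x.2)
  | [] => by simpa using (hF d).comp (Comp.snd Comp.id)
  | i :: l => by
    have h1 : Comp fun x : ℕ × α => F (l.getD (x.1 - 1) d) x.2 :=
      (Comp.dispatch F hF d l).comp (f := fun x : ℕ × α => (x.1 - 1, x.2)) (by fun_prop)
    have h2 : Comp fun x : ℕ × α => F i x.2 := (hF i).comp (Comp.snd Comp.id)
    convert Comp.ite_eq (m := fun x : ℕ × α => x.1) (n := fun _ => 0) (by fun_prop) (by fun_prop)
      h2 h1 using 2 with x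
    obtain ⟨n, x⟩ := x
    cases n <;> simp

/-! Lists -/

@[fun_prop]
theorem Comp.cons {f : α → β} {g : α → List β} (hf : Comp f) (hg : Comp g) :
    Comp (fun a => f a :: g a) := hf.prodMk hg

@[fun_prop]
theorem Comp.headD {f : α → List β} (y : β) (hf : Comp f) : Comp (fun a => (f a).headD y) := by
  refine Comp.comp (g := fun l : List β => l.headD y) ?_ hf
  refine ⟨fun b => .ite (.isPair (.var b)) (.assign b (.fst (.var b)))
    (.assign b (enc y).toExp), 2, edepth y, fun l => ⟨?_, ?_⟩⟩
  · cases l with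
    | nil => simp
    | cons a l => simp [edepth, Data.depth]; omega
  · intro b st hst
    refine ⟨Function.update st b (enc (l.headD y)), by simp,
      fun i hi => by simp [Function.update_of_ne hi.ne], 2, by simp, fun O m K s => ?_⟩
    cases l <;> simp [exec, Exp.eval, hst, Data.isPair, Data.fst, Data.toNat, Data.eval_toExp]

@[fun_prop]
theorem Comp.tail {f : α → List β} (hf : Comp f) : Comp (fun a => (f a).tail) :=
  Comp.comp (.ofExp (fun b => .snd (.var b)) 0
    (fun l => by cases l <;> simp [edepth, Data.depth]; omega)
    (fun l b st h => by cases l <;> simp [Exp.eval, h, Data.snd])) hf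

theorem edepth_tail (x : β) (l : List β) : edepth l ≤ edepth (x :: l) ∧
    edepth x ≤ edepth (x :: l) := by
  simp only [edepth, enc_cons, Data.depth]; omega

theorem length_le_edepth (l : List β) : l.length ≤ edepth l := by
  induction l with
  | nil => simp
  | cons x l ih => simp only [edepth, enc_cons, Data.depth, List.length_cons] at *; omega

/-- A constant growth per iteration would not give a constant growth overall, so a bound on all
intermediate results has to be supplied; it also bounds the time of each iteration uniformly. -/
theorem Comp.foldl {l : α → List β} {i : α → γ} {g : α × γ × β → γ} (hl : Comp l) (hi : Comp i)
    (hg : Comp g) (C : ℕ) (hC : ∀ a, ∀ m, m <+: l a →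
      edepth (m.foldl (fun y x => g (a, y, x)) (i a)) ≤ edepth a + C) :
    Comp (fun a => (l a).foldl (fun y x => g (a, y, x)) (i a)) := by
  obtain ⟨cl, pl, Cl, hl⟩ := hl
  obtain ⟨ci, pi, Ci, hi⟩ := hi
  obtain ⟨cg, pg, Cg, hg⟩ := hg
  -- Registers: `b` the argument, `b+1` the rest of the list, `b+2` the accumulator, `b+3` workspace
  -- for one application of `g`.
  let body (b : ℕ) : Cmd := .seq
    (.assign (b+3) (.pair (.var b) (.pair (.var (b+2)) (.fst (.var (b+1))))))
    (.seq (cg (b+3)) (.seq (.assign (b+2) (.var (b+3))) (.assign (b+1) (.snd (.var (b+1))))))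
  let lp (b : ℕ) : Cmd := .loop (.isPair (.var (b+1))) (body b)
  -- The triple `(a, y, x)` is deeper than `a` by at most `C` or `Cl`, plus `2` for two pairings.
  -- The `7` counts three assignments, three sequencing steps and the test of the loop.
  let P : Polynomial ℕ := pg.comp (.X + .C (C + Cl + 2)) + 7
  refine ⟨fun b => .seq (.assign (b+1) (.var b)) (.seq (cl (b+1)) (.seq (.assign (b+2) (.var b))
    (.seq (ci (b+2)) (.seq (lp b) (.assign b (.var (b+2))))))),
    pl + pi + (.X + .C Cl) * P + 12, C, fun a => ⟨hC a _ (List.prefix_refl _), ?_⟩⟩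
  intro b st hst
  -- The loop invariant: `m` has been processed, `m'` is still to come.
  have key : ∀ (m' m : List β) (st : Store), l a = m ++ m' → st b = enc a →
      st (b+1) = enc m' →
      st (b+2) = enc (m.foldl (fun y x => g (a, y, x)) (i a)) →
      ∃ st', (∀ j < b, st' j = st j) ∧
        st' (b+2) = enc ((l a).foldl (fun y x => g (a, y, x)) (i a)) ∧
        SStep (lp b) (m'.length * P.eval (edepth a) + 1) st st' := by
    intro m'
    induction m' with
    | nil =>
      intro m st hm h0 h1 h2
      refine ⟨st, fun _ _ => rfl, by simpa [hm] using h2, ?_⟩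
      simpa using SStep.loop_false (e := .isPair (.var (b+1))) (a := body b) (st := st)
        (by simp [Exp.eval, h1, Data.isPair, Data.toNat])
    | cons x m' ih =>
      intro m st hm h0 h1 h2
      set y := m.foldl (fun y x => g (a, y, x)) (i a) with hy
      have s1 := SStep.assign (b+3) (.pair (.var b) (.pair (.var (b+2)) (.fst (.var (b+1))))) st
      obtain ⟨st2, e2, f2, s2⟩ := (hg (a, y, x)).2 (b+3)
        (Function.update st (b+3) ((Exp.pair (.var b) (.pair (.var (b+2))
          (.fst (.var (b+1))))).eval st)) (by simp [Exp.eval, h0, h1, h2, Data.fst])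
      have s3 := SStep.assign (b+2) (.var (b+3)) st2
      have s4 := SStep.assign (b+1) (.snd (.var (b+1)))
        (Function.update st2 (b+2) ((Exp.var (b+3)).eval st2))
      have k1 : st2 (b+1) = enc (x :: m') := by rw [f2 _ (by omega)]; simpa using h1
      obtain ⟨st', g1, g2, g3⟩ := ih (m ++ [x]) (Function.update (Function.update st2 (b+2)
        ((Exp.var (b+3)).eval st2)) (b+1) ((Exp.snd (.var (b+1))).eval
          (Function.update st2 (b+2) ((Exp.var (b+3)).eval st2)))) (by simp [hm])
        (by rw [Function.update_of_ne (by omega), Function.update_of_ne (by omega),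
          f2 _ (by omega)]; simpa using h0)
        (by simp [Exp.eval, k1, Data.snd]) (by simp [Exp.eval, e2, ← hy])
      refine ⟨st', fun j hj => ?_, g2, ((s1.seq (s2.seq (s3.seq s4))).loop_true ?_ g3).mono ?_⟩
      · rw [g1 j hj, Function.update_of_ne (by omega), Function.update_of_ne (by omega),
          f2 _ (by omega), Function.update_of_ne (by omega)]
      · simp [Exp.eval, h1, Data.isPair, Data.toNat]
      · have d1 : edepth y ≤ edepth a + C := hC a m (by simp [hm])
        have d2 : edepth x ≤ edepth a + Cl := by
          refine le_trans ?_ (hl a).1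
          have : ∀ m : List β, edepth x ≤ edepth (m ++ x :: m') := by
            intro m
            induction m with
            | nil => exact (edepth_tail x m').2
            | cons z m ih => exact ih.trans (edepth_tail z _).1
          rw [hm]; exact this m
        have d3 : edepth (a, y, x) ≤ edepth a + (C + Cl + 2) := by simp; omega
        have := poly_mono pg d3
        simp only at this
        simp only [P, Polynomial.eval_add, Polynomial.eval_comp, Polynomial.eval_X,
          Polynomial.eval_C, Polynomial.eval_ofNat, List.length_cons, Nat.add_mul, one_mul]
        omega
  have s1 := SStep.assign (b+1) (.var b) st
  obtain ⟨st2, e2, f2, s2⟩ := (hl a).2 (b+1) (Function.update st (b+1) ((Exp.var b).eval st))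
    (by simp [Exp.eval, hst])
  have s3 := SStep.assign (b+2) (.var b) st2
  have hb : st2 b = enc a := by simp [f2 b (by omega), hst]
  obtain ⟨st4, e4, f4, s4⟩ := (hi a).2 (b+2) (Function.update st2 (b+2) ((Exp.var b).eval st2))
    (by simp [Exp.eval, hb])
  obtain ⟨st5, f5, e5, s5⟩ := key (l a) [] st4 rfl (by simp [f4 b (by omega), hb])
    (by simp [f4 (b+1) (by omega), e2]) e4
  have s6 := SStep.assign b (.var (b+2)) st5
  refine ⟨_, ?_, ?_, (s1.seq (s2.seq (s3.seq (s4.seq (s5.seq s6))))).mono ?_⟩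
  · simp [Exp.eval, e5]
  · intro j hj
    rw [Function.update_of_ne hj.ne, f5 j hj, f4 j (by omega), Function.update_of_ne (by omega),
      f2 j (by omega), Function.update_of_ne (by omega)]
  · have := (length_le_edepth (l a)).trans (hl a).1
    have := Nat.mul_le_mul_right (P.eval (edepth a)) this
    simp only [Polynomial.eval_add, Polynomial.eval_mul, Polynomial.eval_X, Polynomial.eval_C,
      Polynomial.eval_ofNat]
    omega

end

end Handshake

/-! ### Expected values, and the value of a program run against an environment. -/

namespace Handshake

open scoped ENNReal
open Classical in
/-- The indicator of a proposition. -/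
noncomputable def ind (P : Prop) : ℝ≥0∞ := if P then 1 else 0

theorem ind_true {P : Prop} (h : P) : ind P = 1 := if_pos h
theorem ind_false {P : Prop} (h : ¬ P) : ind P = 0 := if_neg h
theorem ind_le_one (P : Prop) : ind P ≤ 1 := by unfold ind; split_ifs <;> simp
theorem ind_mono {P Q : Prop} (h : P → Q) : ind P ≤ ind Q := by
  unfold ind; split_ifs <;> simp_all

theorem ind_or_le (P Q : Prop) : ind (P ∨ Q) ≤ ind P + ind Q := by
  unfold ind; split_ifs <;> simp_all

theorem ind_exists_le {ι : Type*} (F : Finset ι) (P : ι → Prop) :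
    ind (∃ i ∈ F, P i) ≤ ∑ i ∈ F, ind (P i) := by
  by_cases h : ∃ i ∈ F, P i
  · obtain ⟨i, hi, hp⟩ := h
    refine (ind_le_one _).trans ?_
    rw [← ind_true hp]
    exact Finset.single_le_sum (f := fun i => ind (P i)) (fun _ _ => zero_le) hi
  · simp [ind_false h]

/-- Expected value. -/
noncomputable def ev {α : Type*} (p : PMF α) (f : α → ℝ≥0∞) : ℝ≥0∞ := ∑' a, p a * f a

section

variable {α β : Type*}

@[simp] theorem ev_pure (a : α) (f : α → ℝ≥0∞) : ev (PMF.pure a) f = f a := by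
  rw [ev, tsum_eq_single a (fun b hb => by simp [PMF.pure_apply, hb])]
  simp

@[simp] theorem ev_bind (p : PMF α) (k : α → PMF β) (f : β → ℝ≥0∞) :
    ev (p.bind k) f = ev p fun a => ev (k a) f := by
  simp only [ev, PMF.bind_apply, ← ENNReal.tsum_mul_right, ← ENNReal.tsum_mul_left]
  rw [ENNReal.tsum_comm]
  simp only [mul_assoc]

@[simp] theorem ev_map (p : PMF α) (k : α → β) (f : β → ℝ≥0∞) :
    ev (p.map k) f = ev p fun a => f (k a) := by
  simp [PMF.map, Function.comp_def]

@[simp] theorem ev_const (p : PMF α) (c : ℝ≥0∞) : ev p (fun _ => c) = c := by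
  simp [ev, ENNReal.tsum_mul_right, p.tsum_coe]

theorem ev_mono {p : PMF α} {f g : α → ℝ≥0∞} (h : ∀ a ∈ p.support, f a ≤ g a) :
    ev p f ≤ ev p g := by
  refine ENNReal.tsum_le_tsum fun a => ?_
  by_cases ha : a ∈ p.support
  · gcongr; exact h a ha
  · simp [(PMF.apply_eq_zero_iff p a).mpr ha]

theorem ev_congr {p : PMF α} {f g : α → ℝ≥0∞} (h : ∀ a ∈ p.support, f a = g a) :
    ev p f = ev p g :=
  le_antisymm (ev_mono fun a ha => (h a ha).le) (ev_mono fun a ha => (h a ha).ge)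

theorem ev_le {p : PMF α} {f : α → ℝ≥0∞} {c : ℝ≥0∞} (h : ∀ a ∈ p.support, f a ≤ c) :
    ev p f ≤ c := (ev_mono h).trans (ev_const p c).le

theorem le_ev {p : PMF α} {f : α → ℝ≥0∞} {c : ℝ≥0∞} (h : ∀ a ∈ p.support, c ≤ f a) :
    c ≤ ev p f := (ev_const p c).ge.trans (ev_mono h)

theorem ev_add (p : PMF α) (f g : α → ℝ≥0∞) :
    ev p (fun a => f a + g a) = ev p f + ev p g := by
  simp [ev, mul_add, ENNReal.tsum_add]

theorem ev_mul (p : PMF α) (c : ℝ≥0∞) (f : α → ℝ≥0∞) :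
    ev p (fun a => c * f a) = c * ev p f := by
  simp only [ev, ← ENNReal.tsum_mul_left]
  exact tsum_congr fun a => by ring

/-- Sums of nonnegative terms commute. This allows independent choices to be made in any order, in
particular the secrets after the ideal experiment. -/
theorem ev_comm (p : PMF α) (q : PMF β) (f : α → β → ℝ≥0∞) :
    ev p (fun a => ev q (f a)) = ev q fun b => ev p fun a => f a b := by
  simp only [ev, ← ENNReal.tsum_mul_left]
  rw [ENNReal.tsum_comm]
  exact tsum_congr fun a => tsum_congr fun b => by ring

theorem ev_sum {ι : Type*} (p : PMF α) (F : Finset ι) (f : ι → α → ℝ≥0∞) :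
    ev p (fun a => ∑ i ∈ F, f i a) = ∑ i ∈ F, ev p (f i) := by
  classical
  induction F using Finset.induction_on with
  | empty => simp
  | insert i F hi ih => simp only [Finset.sum_insert hi, ev_add, ih]

/-- A Bernoulli-type substitute for Jensen's inequality. -/
theorem ev_pow_six (p : PMF α) (f : α → ℝ≥0∞) (hf : ∀ a, f a ≤ 1) :
    (ev p f) ^ 6 ≤ ev p fun a => f a ^ 6 := by
  set t := ev p f with ht
  have ht1 : t ≤ 1 := ev_le fun a _ => hf a
  -- The graph of the convex function `x ↦ x^6` lies above its tangent at the mean `t`; averaging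
  -- then gives the claim.
  have key : ∀ a, 6 * t ^ 5 * f a ≤ f a ^ 6 + 5 * t ^ 6 := by
    intro a
    have h1 : f a ≠ ⊤ := ((hf a).trans_lt ENNReal.one_lt_top).ne
    have h2 : t ≠ ⊤ := (ht1.trans_lt ENNReal.one_lt_top).ne
    lift f a to NNReal using h1 with x
    lift t to NNReal using h2 with y
    norm_cast
    rw [← NNReal.coe_le_coe]
    push_cast
    have hx := x.coe_nonneg
    have hy := y.coe_nonneg
    generalize (x : ℝ) = x at *
    generalize (y : ℝ) = y at *
    -- The product supplied is exactly `x^6 - 6xy^5 + 5y^6`.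
    nlinarith [mul_nonneg (sq_nonneg (x - y)) (by positivity :
      0 ≤ x ^ 4 + 2 * x ^ 3 * y + 3 * x ^ 2 * y ^ 2 + 4 * x * y ^ 3 + 5 * y ^ 4)]
  have h := ev_mono (p := p) fun a _ => key a
  rw [ev_mul, ev_add, ev_const, ← ht] at h
  have h2 : t ^ 6 + 5 * t ^ 6 ≤ (ev p fun a => f a ^ 6) + 5 * t ^ 6 := by
    calc t ^ 6 + 5 * t ^ 6 = 6 * t ^ 5 * t := by ring
      _ ≤ _ := h
  have h3 : 5 * t ^ 6 ≠ ⊤ := by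
    have : t ≠ ⊤ := (ht1.trans_lt ENNReal.one_lt_top).ne
    finiteness
  exact (ENNReal.add_le_add_iff_right h3).mp h2

/-! ### Uniform distributions -/

theorem unif_apply {n : ℕ} (hn : n ≠ 0) (r : ℕ) :
    unif n r = if r < n then (n : ℝ≥0∞)⁻¹ else 0 := by
  simp [unif, hn, PMF.uniformOfFinset_apply]

theorem ev_unif {n : ℕ} (hn : n ≠ 0) (f : ℕ → ℝ≥0∞) :
    ev (unif n) f = (∑ r ∈ Finset.range n, f r) * (n : ℝ≥0∞)⁻¹ := by
  rw [ev, tsum_eq_sum (s := Finset.range n), Finset.sum_mul]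
  · refine Finset.sum_congr rfl fun r hr => ?_
    rw [unif_apply hn, if_pos (Finset.mem_range.mp hr), mul_comm]
  · intro r hr
    rw [unif_apply hn, if_neg (by simpa using hr), zero_mul]

theorem mem_support_unif {n r : ℕ} (hn : n ≠ 0) (h : r ∈ (unif n).support) : r < n := by
  by_contra hr
  rw [PMF.mem_support_iff, unif_apply hn, if_neg hr] at h
  exact h rfl

theorem ev_unif_ind_le {n c : ℕ} (hn : n ≠ 0) (P : ℕ → Prop) (F : Finset ℕ) (hc : F.card ≤ c)
    (hF : ∀ r < n, P r → r ∈ F) : ev (unif n) (fun r => ind (P r)) ≤ c * (n : ℝ≥0∞)⁻¹ := by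
  classical
  rw [ev_unif hn]
  gcongr
  calc ∑ r ∈ Finset.range n, ind (P r)
      = ((Finset.range n).filter P).card := by
        simp [ind]
    _ ≤ F.card := by
        gcongr
        intro r hr
        rw [Finset.mem_filter, Finset.mem_range] at hr
        exact hF r hr.1 hr.2
    _ ≤ c := by gcongr

theorem ev_unif_ind_le_one {n : ℕ} (hn : n ≠ 0) (P : ℕ → Prop)
    (h : ∀ r < n, ∀ r' < n, P r → P r' → r = r') :
    ev (unif n) (fun r => ind (P r)) ≤ (n : ℝ≥0∞)⁻¹ := by
  by_cases hP : ∃ r < n, P r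
  · obtain ⟨r, hr, hp⟩ := hP
    simpa using ev_unif_ind_le hn P {r} (by simp : _ ≤ 1)
      (fun r' hr' hp' => by simpa using h r' hr' r hr hp' hp)
  · refine (ev_unif_ind_le hn P ∅ (by simp : _ ≤ 0) fun r hr hp => absurd ⟨r, hr, hp⟩ hP).trans ?_
    simp

theorem single_le_ev_unif {n r : ℕ} (hn : n ≠ 0) (hr : r < n) (f : ℕ → ℝ≥0∞) :
    f r * (n : ℝ≥0∞)⁻¹ ≤ ev (unif n) f := by
  rw [ev_unif hn]
  gcongr
  exact Finset.single_le_sum (f := f) (fun _ _ => zero_le) (Finset.mem_range.mpr hr)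

theorem unif_map_perm {n : ℕ} (hn : n ≠ 0) (e : ℕ → ℕ) (he : ∀ r < n, e r < n)
    (hinj : ∀ r < n, ∀ r' < n, e r = e r' → r = r') : (unif n).map e = unif n := by
  have hmaps : Set.MapsTo e (Finset.range n) (Finset.range n) := fun r hr => by
    simpa using he r (by simpa using hr)
  have hi : Set.InjOn e (Finset.range n) := fun r hr r' hr' h =>
    hinj r (by simpa using hr) r' (by simpa using hr') h
  have hsurj := Finset.surjOn_of_injOn_of_card_le e hmaps hi le_rfl
  ext y
  rw [PMF.map_apply, unif_apply hn]
  by_cases hy : y < n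
  · obtain ⟨x, hx, rfl⟩ := hsurj (by simpa using hy : y ∈ (Finset.range n : Set ℕ))
    rw [if_pos hy, tsum_eq_single x]
    · rw [if_pos rfl, unif_apply hn, if_pos (by simpa using hx)]
    · intro x' hx'
      split_ifs with h
      · rw [unif_apply hn]
        split_ifs with h'
        · exact absurd (hi hx (by simpa using h') h).symm hx'
        · rfl
      · rfl
  · rw [if_neg hy, ENNReal.tsum_eq_zero]
    intro x
    split_ifs with h
    · rw [unif_apply hn, if_neg]
      intro hx
      exact hy (h ▸ he x hx)
    · rfl

theorem ev_unif_perm {n : ℕ} (hn : n ≠ 0) (e : ℕ → ℕ) (he : ∀ r < n, e r < n)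
    (hinj : ∀ r < n, ∀ r' < n, e r = e r' → r = r') (f : ℕ → ℝ≥0∞) :
    ev (unif n) (fun r => f (e r)) = ev (unif n) f := by
  conv_rhs => rw [← unif_map_perm hn e he hinj, ev_map]

end

/-! ### Programs with an environment -/

abbrev Env (S : Type) := S → Data → PMF (Data × S)

/-- The expected value of `post` of the output. -/
noncomputable def val {S : Type} (O : Env S) (post : Option Data → ℝ≥0∞) (n : ℕ) (K : List Cmd)
    (st : Store) (s : S) : ℝ≥0∞ := ev (exec O n K st s) post

section

variable {S : Type}

theorem val_nil (O : Env S) (post) (n : ℕ) (st : Store) (s : S) :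
    val O post n [] st s = post (some (st 0)) := by cases n <;> simp [val, exec]

theorem val_zero (O : Env S) (post) (c K) (st : Store) (s : S) :
    val O post 0 (c :: K) st s = post none := by simp [val, exec]

theorem val_assign (O : Env S) (post) (n x e K) (st : Store) (s : S) :
    val O post (n + 1) (.assign x e :: K) st s
      = val O post n K (Function.update st x (e.eval st)) s := by simp [val, exec]

theorem val_rand (O : Env S) (post) (n x e K) (st : Store) (s : S) :
    val O post (n + 1) (.rand x e :: K) st s = ev (unif (e.eval st).toNat) fun r =>
      val O post n K (Function.update st x (.num r)) s := by simp [val, exec]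

theorem val_call (O : Env S) (post) (n x e K) (st : Store) (s : S) :
    val O post (n + 1) (.call x e :: K) st s = ev (O s (e.eval st)) fun r =>
      val O post n K (Function.update st x r.1) r.2 := by simp [val, exec]

theorem val_seq (O : Env S) (post) (n a b K) (st : Store) (s : S) :
    val O post (n + 1) (.seq a b :: K) st s = val O post n (a :: b :: K) st s := by
  simp [val, exec]

theorem val_ite (O : Env S) (post) (n e a b K) (st : Store) (s : S) :
    val O post (n + 1) (.ite e a b :: K) st s =
      val O post n ((if (e.eval st).toNat ≠ 0 then a else b) :: K) st s := by
  simp only [val, exec]; split_ifs <;> rfl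

theorem val_loop (O : Env S) (post) (n e a K) (st : Store) (s : S) :
    val O post (n + 1) (.loop e a :: K) st s =
      val O post n (if (e.eval st).toNat ≠ 0 then a :: .loop e a :: K else K) st s := by
  simp only [val, exec]; split_ifs <;> rfl

/-- Environments that agree on the states that can be reached within the time left. -/
theorem val_congr {O O' : Env S} (post) (I : ℕ → S → Prop)
    (h1 : ∀ n s, I (n + 1) s → I n s)
    (h2 : ∀ n s d, I (n + 1) s → O s d = O' s d ∧ ∀ x ∈ (O s d).support, I n x.2) :
    ∀ n K st s, I n s → val O post n K st s = val O' post n K st s := by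
  intro n
  induction n with
  | zero =>
    intro K st s _
    cases K with
    | nil => simp [val_nil]
    | cons c K => simp [val_zero]
  | succ n ih =>
    intro K st s hs
    have ih' := fun K st => ih K st s (h1 n s hs)
    cases K with
    | nil => simp [val_nil]
    | cons c K =>
      cases c with
      | assign x e => simp only [val_assign, ih']
      | rand x e => simp only [val_rand, ih']
      | call x e =>
        simp only [val_call, ← (h2 n s _ hs).1]
        exact ev_congr fun r hr => ih K _ _ ((h2 n s _ hs).2 r hr)
      | seq a b => simp only [val_seq, ih']
      | ite e a b => simp only [val_ite, ih']
      | loop e a => simp only [val_loop, ih']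

/-- A random choice that the environment makes at most once may be made in advance. -/
theorem val_eager {B : Type} (μ : PMF B) {O : Env S} {O' : B → Env S} (post) (P : S → Prop)
    (h0 : ∀ s, ¬ P s → ∀ d, (∀ b, O' b s d = O s d) ∧ ∀ x ∈ (O s d).support, ¬ P x.2)
    (h1 : ∀ s, P s → ∀ d, (∀ b, O' b s d = O s d) ∨
      (O s d = μ.bind (fun b => O' b s d) ∧ ∀ b, ∀ x ∈ (O' b s d).support, ¬ P x.2)) :
    ∀ n K st s, val O post n K st s = ev μ fun b => val (O' b) post n K st s := by
  -- `P` says that the choice has not been made yet. Once it fails, fixing the choice beforehand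
  -- changes nothing.
  have hc : ∀ b n K st s, ¬ P s → val (O' b) post n K st s = val O post n K st s := by
    intro b n K st s hs
    refine val_congr post (fun _ s => ¬ P s) (fun _ _ h => h) (fun n s d h => ?_) n K st s hs
    rw [(h0 s h d).1 b]
    exact ⟨rfl, (h0 s h d).2⟩
  intro n
  induction n with
  | zero =>
    intro K st s
    cases K with
    | nil => simp [val_nil]
    | cons c K => simp [val_zero]
  | succ n ih =>
    intro K st s
    by_cases hs : P s
    swap
    · simp [hc _ _ _ _ _ hs]
    cases K with
    | nil => simp [val_nil]
    | cons c K =>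
      cases c with
      | assign x e => simp only [val_assign, ih]
      | rand x e => simp only [val_rand, ih]; rw [ev_comm]
      | call x e =>
        simp only [val_call]
        rcases h1 s hs (e.eval st) with h | ⟨h, h'⟩
        · simp only [h, ih]; rw [ev_comm]
        -- This query makes the choice, so its random value can be identified with the one drawn in
        -- advance; from here on `hc` applies.
        · rw [h, ev_bind]
          refine ev_congr fun b _ => ev_congr fun r hr => ?_
          rw [hc b _ _ _ _ (h' b r hr)]
      | seq a b => simp only [val_seq, ih]
      | ite e a b => simp only [val_ite, ih]
      | loop e a => simp only [val_loop, ih]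

/-- More time does not hurt, if running out of time has no value. -/
theorem val_mono (O : Env S) (post) (hpost : post none = 0) :
    ∀ n m K st s, n ≤ m → val O post n K st s ≤ val O post m K st s := by
  intro n
  induction n with
  | zero =>
    intro m K st s _
    cases K with
    | nil => simp [val_nil]
    | cons c K => simp [val_zero, hpost]
  | succ n ih =>
    intro m K st s hm
    obtain ⟨m, rfl⟩ := Nat.exists_eq_succ_of_ne_zero (by omega : m ≠ 0)
    have ih' := fun K st s => ih m K st s (by omega)
    cases K with
    | nil => simp [val_nil]
    | cons c K =>
      cases c with
      | assign x e => simp only [val_assign, ih', Nat.succ_eq_add_one]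
      | rand x e => simp only [val_rand, Nat.succ_eq_add_one]; exact ev_mono fun _ _ => ih' _ _ _
      | call x e => simp only [val_call, Nat.succ_eq_add_one]; exact ev_mono fun _ _ => ih' _ _ _
      | seq a b => simp only [val_seq, ih', Nat.succ_eq_add_one]
      | ite e a b => simp only [val_ite, ih', Nat.succ_eq_add_one]
      | loop e a => simp only [val_loop, ih', Nat.succ_eq_add_one]

end

end Handshake

namespace Handshake

/-! ### The group -/

namespace Params

variable (pp : Params)

instance : Fact pp.p.Prime := ⟨pp.prime_p⟩

/-- The powers of the generator. -/
def gp (n : ℕ) : ℕ := pp.g ^ n % pp.p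

theorem p_pos : 0 < pp.p := pp.prime_p.pos
theorem q_pos : 0 < pp.q := pp.prime_q.pos
theorem q_ne : pp.q ≠ 0 := pp.q_pos.ne'
theorem q1_ne : pp.q - 1 ≠ 0 := by have := pp.prime_q.two_le; omega

theorem cast_eq {a b : ℕ} (ha : a < pp.p) (hb : b < pp.p) (h : (a : ZMod pp.p) = b) : a = b := by
  have := (ZMod.natCast_eq_natCast_iff a b pp.p).mp h
  rwa [Nat.ModEq, Nat.mod_eq_of_lt ha, Nat.mod_eq_of_lt hb] at this

theorem cast_gp (n : ℕ) : (pp.gp n : ZMod pp.p) = (pp.g : ZMod pp.p) ^ n := by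
  simp [gp]

theorem gp_lt (n : ℕ) : pp.gp n < pp.p := Nat.mod_lt _ pp.p_pos

theorem order_g : orderOf (pp.g : ZMod pp.p) = pp.q := by
  have : Fact pp.q.Prime := ⟨pp.prime_q⟩
  refine orderOf_eq_prime ?_ ?_
  · have h : ((pp.g ^ pp.q % pp.p : ℕ) : ZMod pp.p) = 1 := by rw [pp.g_pow]; simp
    simpa using h
  · intro h
    exact pp.g_ne_one (pp.cast_eq pp.g_lt pp.prime_p.one_lt (by simpa using h))

theorem gp_eq_iff {a b : ℕ} : pp.gp a = pp.gp b ↔ a ≡ b [MOD pp.q] := by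
  have hp : IsPrimitiveRoot (pp.g : ZMod pp.p) pp.q := pp.order_g ▸ IsPrimitiveRoot.orderOf _
  constructor
  · intro h
    have h1 : (pp.g : ZMod pp.p) ^ a = (pp.g : ZMod pp.p) ^ b := by rw [← cast_gp, h, cast_gp]
    rw [← pow_mod_orderOf, ← pow_mod_orderOf _ b, pp.order_g] at h1
    exact hp.pow_inj (Nat.mod_lt _ pp.q_pos) (Nat.mod_lt _ pp.q_pos) h1
  · intro h
    refine pp.cast_eq (pp.gp_lt a) (pp.gp_lt b) ?_
    rw [cast_gp, cast_gp, ← pow_mod_orderOf, ← pow_mod_orderOf _ b, pp.order_g, h]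

theorem gp_zero : pp.gp 0 = 1 := by simp [gp, Nat.mod_eq_of_lt pp.prime_p.one_lt]

theorem gp_one : pp.gp 1 = pp.g := by simp [gp, Nat.mod_eq_of_lt pp.g_lt]

theorem gp_eq_one_iff {a : ℕ} : pp.gp a = 1 ↔ pp.q ∣ a := by
  rw [← pp.gp_zero, gp_eq_iff, Nat.modEq_zero_iff_dvd]

/-- In the field `ZMod p` the roots of `X^q = 1` are exactly the powers of the primitive root `g`,
so the membership test provides an exponent. -/
theorem isElt_iff {v : ℕ} : pp.IsElt v ↔ ∃ r < pp.q, v = pp.gp r := by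
  have hp : IsPrimitiveRoot (pp.g : ZMod pp.p) pp.q := pp.order_g ▸ IsPrimitiveRoot.orderOf _
  have : NeZero pp.q := ⟨pp.q_ne⟩
  constructor
  · rintro ⟨h1, h2⟩
    have h3 : (v : ZMod pp.p) ^ pp.q = 1 := by
      have h : ((v ^ pp.q % pp.p : ℕ) : ZMod pp.p) = 1 := by rw [h2]; simp
      simpa using h
    obtain ⟨r, hr, h⟩ := hp.eq_pow_of_pow_eq_one h3
    exact ⟨r, hr, pp.cast_eq h1 (pp.gp_lt r) (by rw [cast_gp, h])⟩
  · rintro ⟨r, -, rfl⟩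
    refine ⟨pp.gp_lt r, pp.cast_eq (Nat.mod_lt _ pp.p_pos) pp.prime_p.one_lt ?_⟩
    simp only [ZMod.natCast_mod, Nat.cast_pow, cast_gp, Nat.cast_one]
    rw [← pow_mul, mul_comm, pow_mul, hp.pow_eq_one, one_pow]

theorem isElt_gp (n : ℕ) : pp.IsElt (pp.gp n) := by
  rw [isElt_iff]
  exact ⟨n % pp.q, Nat.mod_lt _ pp.q_pos, pp.gp_eq_iff.mpr (Nat.mod_modEq _ _).symm⟩

theorem gp_pow (a x : ℕ) : pp.gp a ^ x % pp.p = pp.gp (a * x) := by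
  rw [gp, gp, pow_mul, ← Nat.pow_mod]

theorem gp_mul (a b : ℕ) : pp.gp a * pp.gp b % pp.p = pp.gp (a + b) := by
  rw [gp, gp, gp, pow_add, ← Nat.mul_mod]

theorem pm_p (a b : ℕ) : pm a b pp.p = a ^ b % pp.p := by simp [pm, pp.p_pos.ne']

theorem mm_p (a b : ℕ) : mm a b pp.p = a * b % pp.p := by simp [mm, pp.p_pos.ne']

/-- The inverse modulo `q`. -/
def inv (a : ℕ) : ℕ := a ^ (pp.q - 2) % pp.q

theorem mul_inv {a : ℕ} (ha : ¬ pp.q ∣ a) : a * pp.inv a ≡ 1 [MOD pp.q] := by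
  have h2 := pp.prime_q.two_le
  have : Fact pp.q.Prime := ⟨pp.prime_q⟩
  have h := ZMod.pow_card_sub_one_eq_one (p := pp.q) (a := (a : ZMod pp.q))
    (by rwa [Ne, ZMod.natCast_eq_zero_iff])
  rw [← ZMod.natCast_eq_natCast_iff]
  simp only [inv, Nat.cast_mul, ZMod.natCast_mod, Nat.cast_pow, Nat.cast_one]
  rw [← h, ← pow_succ']
  congr 1
  omega

theorem coprime {a : ℕ} (ha : ¬ pp.q ∣ a) : pp.q.Coprime a :=
  (Nat.Prime.coprime_iff_not_dvd pp.prime_q).mpr ha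

theorem inv_not_dvd {a : ℕ} (ha : ¬ pp.q ∣ a) : ¬ pp.q ∣ pp.inv a := by
  intro h
  have h1 := pp.mul_inv ha
  have h2 : a * pp.inv a ≡ 0 [MOD pp.q] := (Nat.modEq_zero_iff_dvd).mpr (h.mul_left a)
  have h3 : pp.q ∣ 1 := (Nat.modEq_zero_iff_dvd).mp (h1.symm.trans h2)
  exact pp.prime_q.one_lt.ne' (Nat.dvd_one.mp h3)

theorem succ_not_dvd {r : ℕ} (hr : r < pp.q - 1) : ¬ pp.q ∣ r + 1 := by
  intro h
  have := Nat.le_of_dvd (by omega) h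
  omega

end Params

end Handshake

namespace Handshake

section

variable {α β : Type} [Enc α] [Enc β]

/-! ### Lookups -/

@[fun_prop]
theorem Comp.length {f : α → List β} (hf : Comp f) : Comp (fun a => (f a).length) := by
  have h : ∀ (l : List β) (n : ℕ), l.foldl (fun y _ => y + 1) n = n + l.length := by
    intro l
    induction l with
    | nil => simp
    | cons x l ih => intro n; simp only [List.foldl_cons, ih, List.length_cons]; omega
  have := Comp.foldl (i := fun _ => 0) (g := fun x : α × ℕ × β => x.2.1 + 1) hf (by fun_prop)
    (by fun_prop) 0 (by simp)
  simpa [h] using this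

/-- The `k`-th element from the end. -/
def rnth {β : Type} (l : List β) (k : ℕ) (d : β) : β := l.reverse.getD k d

/-- A counter of the elements still to come identifies the position from the end while the list is
read from its head: the element wanted is met when the counter is `k + 1`. -/
theorem rnth_eq_foldl {β : Type} (k : ℕ) (l : List β) : ∀ d : β, rnth l k d =
    (l.foldl (fun y x => if y.1 = k + 1 then (y.1 - 1, x) else (y.1 - 1, y.2)) (l.length, d)).2 := by
  induction l with
  | nil => simp [rnth]
  | cons x l ih =>
    intro d
    simp only [List.foldl_cons, List.length_cons, Nat.add_right_cancel_iff]
    have : ∀ y : β, (l.foldl (fun y x => if y.1 = k + 1 then (y.1 - 1, x) else (y.1 - 1, y.2))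
      (l.length, y)).2 = rnth l k y := fun y => (ih y).symm
    split_ifs with h
    · rw [Nat.add_sub_cancel, this]
      simp [rnth, List.getD_eq_getElem?_getD, ← h]
    · rw [Nat.add_sub_cancel, this]
      simp only [rnth, List.getD_eq_getElem?_getD, List.reverse_cons]
      by_cases hk : k < l.length
      · rw [List.getElem?_append_left (by simpa using hk)]
      · have h1 : (l.reverse ++ [x])[k]? = none :=
          List.getElem?_eq_none (by simp only [List.length_append, List.length_reverse,
            List.length_singleton]; omega)
        have h2 : l.reverse[k]? = none := List.getElem?_eq_none (by simpa using hk)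
        rw [h1, h2]

/-- The fold keeps a list element or the default, so a uniform bound on the depth of all elements of
the type makes it admissible. -/
theorem Comp.rnth_of_depth {l : α → List β} {k : α → ℕ} (B : ℕ) (hB : ∀ x : β, edepth x ≤ B)
    (d : β) (hl : Comp l) (hk : Comp k) : Comp (fun a => rnth (l a) (k a) d) := by
  simp only [rnth_eq_foldl]
  refine Comp.snd (Comp.foldl (l := l) (i := fun a => ((l a).length, d))
    (g := fun x : α × (ℕ × β) × β => if x.2.1.1 = k x.1 + 1 then (x.2.1.1 - 1, x.2.2)
      else (x.2.1.1 - 1, x.2.1.2)) hl (by fun_prop) (by fun_prop) (B + 1) ?_)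
  intro a m _
  simp only [edepth_pair, edepth_nat]
  have := hB (m.foldl (fun y x => if y.1 = k a + 1 then (y.1 - 1, x) else (y.1 - 1, y.2))
    ((l a).length, d)).2
  omega

@[fun_prop]
theorem Comp.rnth_nat {l : α → List ℕ} {k : α → ℕ} (hl : Comp l) (hk : Comp k) (d : ℕ) :
    Comp (fun a => rnth (l a) (k a) d) :=
  Comp.rnth_of_depth 0 (fun _ => le_rfl) d hl hk

/-- Association lists. -/
abbrev Table := List ((ℕ × ℕ × ℕ) × ℕ)

/-- The successor of the oldest value for the key `k`, or `0` if there is none. -/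
def look : Table → ℕ × ℕ × ℕ → ℕ
  | [], _ => 0
  | x :: l, k => if look l k = 0 then (if x.1 = k then x.2 + 1 else 0) else look l k

-- The fold goes from the newest entry to the oldest and every match overwrites, so the oldest one
-- wins. Hence writing to a key that is already present has no effect on lookups, as befits a lazily
-- sampled oracle.
@[fun_prop]
theorem Comp.look {l : α → Table} {k : α → ℕ × ℕ × ℕ} (hl : Comp l) (hk : Comp k) :
    Comp (fun a => look (l a) (k a)) := by
  have h : ∀ (l : Table) (k : ℕ × ℕ × ℕ) (n : ℕ),
      l.foldl (fun y x => if x.1.1 = k.1 then if x.1.2.1 = k.2.1 then if x.1.2.2 = k.2.2 then x.2 + 1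
        else y else y else y) n = if Handshake.look l k = 0 then n else Handshake.look l k := by
    intro l k
    induction l with
    | nil => simp [Handshake.look]
    | cons x l ih =>
      intro n
      obtain ⟨⟨a, b, c⟩, v⟩ := x
      obtain ⟨a', b', c'⟩ := k
      simp only [List.foldl_cons, ih, Handshake.look, Prod.mk.injEq]
      split_ifs <;> simp_all
  have := Comp.foldl (i := fun _ => 0) (g := fun x : α × ℕ × ((ℕ × ℕ × ℕ) × ℕ) =>
    if x.2.2.1.1 = (k x.1).1 then if x.2.2.1.2.1 = (k x.1).2.1 then
      if x.2.2.1.2.2 = (k x.1).2.2 then x.2.2.2 + 1 else x.2.1 else x.2.1 else x.2.1) hl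
    (by fun_prop) (by fun_prop) 0 (by simp)
  simp only [h] at this
  convert this using 2 with a
  split_ifs with h0 <;> simp [h0]

end

/-! ### The ideal system -/

/-- A run. The kind is `0` for nodes outside of the target group; for its members it is `1` before,
`2` for, and `3` after the test run, and then `exp` is the exponent with respect to `g`. The first
message received is `v - 1`, if `v` is not `0`. -/
structure SR where
  node : ℕ
  kind : ℕ
  v : ℕ
  base : ℕ
  exp : ℕ

/-- The state of the ideal system; all lists have their newest element first. The table holds
messages received (`2`), outputs (`3`), and values of oracles, separate ones for the target group
(`6`) and the test run (`7`). -/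
structure IS where
  groups : List ℕ
  nodes : List ℕ
  ss : List SR
  tst : ℕ
  db : Table
  cor : List ℕ

/-- Public parameters, and the number of the target group. -/
structure Ctx where
  p : ℕ
  q : ℕ
  g : ℕ
  γ : ℕ

/-- Random choices, and the first message of a member of the target group. -/
structure Dr where
  r1 : ℕ
  r2 : ℕ
  gx : ℕ
  h1 : ℕ
  h2 : ℕ

instance : Enc SR := ⟨fun r => enc (r.node, r.kind, r.v, r.base, r.exp)⟩
-- The list `cor` is deliberately left out. No step of the ideal system depends on it; it is carried
-- along only for the comparison with the real system.
instance : Enc IS := ⟨fun s => enc (s.groups, s.nodes, s.ss, s.tst, s.db)⟩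
instance : Enc Ctx := ⟨fun c => enc (c.p, c.q, c.g, c.γ)⟩
instance : Enc Dr := ⟨fun r => enc (r.r1, r.r2, r.gx, r.h1, r.h2)⟩

/-! ### Computability of the fields and constructors of the records. -/

section

variable {α β : Type} [Enc α] [Enc β]

/-- Types with the same encodings. -/
theorem Comp.cast {f : α → β} {γ : Type} [Enc γ] (h : β → γ) (hh : ∀ y, enc (h y) = enc y)
    (hf : Comp f) : Comp (fun a => h (f a)) := by
  refine Comp.comp (g := h) ?_ hf
  exact .ofExp (fun b => .var b) 0 (fun y => by simp [edepth, hh])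
    (fun _ _ _ h => by simp [Exp.eval, h, hh])

theorem Comp.sr {f : α → SR} (hf : Comp f) :
    Comp (fun a => ((f a).node, (f a).kind, (f a).v, (f a).base, (f a).exp)) :=
  Comp.cast (fun r : SR => (r.node, r.kind, r.v, r.base, r.exp)) (fun _ => rfl) hf

@[fun_prop]
theorem Comp.sr_node {f : α → SR} (hf : Comp f) : Comp (fun a => (f a).node) := hf.sr.fst

@[fun_prop]
theorem Comp.sr_kind {f : α → SR} (hf : Comp f) : Comp (fun a => (f a).kind) := hf.sr.snd.fst

@[fun_prop]
theorem Comp.sr_v {f : α → SR} (hf : Comp f) : Comp (fun a => (f a).v) := hf.sr.snd.snd.fst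

@[fun_prop]
theorem Comp.sr_base {f : α → SR} (hf : Comp f) : Comp (fun a => (f a).base) :=
  hf.sr.snd.snd.snd.fst

@[fun_prop]
theorem Comp.sr_exp {f : α → SR} (hf : Comp f) : Comp (fun a => (f a).exp) :=
  hf.sr.snd.snd.snd.snd

@[fun_prop]
theorem Comp.sr_mk {a b c d e : α → ℕ} (ha : Comp a) (hb : Comp b) (hc : Comp c) (hd : Comp d)
    (he : Comp e) : Comp (fun x => SR.mk (a x) (b x) (c x) (d x) (e x)) :=
  Comp.cast (fun y : ℕ × ℕ × ℕ × ℕ × ℕ => SR.mk y.1 y.2.1 y.2.2.1 y.2.2.2.1 y.2.2.2.2)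
    (fun _ => rfl) (f := fun x => (a x, b x, c x, d x, e x)) (by fun_prop)

theorem Comp.is {f : α → IS} (hf : Comp f) :
    Comp (fun a => ((f a).groups, (f a).nodes, (f a).ss, (f a).tst, (f a).db)) :=
  Comp.cast (fun s : IS => (s.groups, s.nodes, s.ss, s.tst, s.db)) (fun _ => rfl) hf

@[fun_prop]
theorem Comp.is_groups {f : α → IS} (hf : Comp f) : Comp (fun a => (f a).groups) := hf.is.fst

@[fun_prop]
theorem Comp.is_nodes {f : α → IS} (hf : Comp f) : Comp (fun a => (f a).nodes) := hf.is.snd.fst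

@[fun_prop]
theorem Comp.is_ss {f : α → IS} (hf : Comp f) : Comp (fun a => (f a).ss) := hf.is.snd.snd.fst

@[fun_prop]
theorem Comp.is_tst {f : α → IS} (hf : Comp f) : Comp (fun a => (f a).tst) :=
  hf.is.snd.snd.snd.fst

@[fun_prop]
theorem Comp.is_db {f : α → IS} (hf : Comp f) : Comp (fun a => (f a).db) :=
  hf.is.snd.snd.snd.snd

@[fun_prop]
theorem Comp.is_mk {a b : α → List ℕ} {c : α → List SR} {d : α → ℕ} {e : α → Table}
    {i : α → List ℕ} (ha : Comp a) (hb : Comp b) (hc : Comp c) (hd : Comp d) (he : Comp e) :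
    Comp (fun x => IS.mk (a x) (b x) (c x) (d x) (e x) (i x)) := by
  have h : Comp fun x => (a x, b x, c x, d x, e x) := by fun_prop
  exact h

theorem Comp.ctx {f : α → Ctx} (hf : Comp f) :
    Comp (fun a => ((f a).p, (f a).q, (f a).g, (f a).γ)) :=
  Comp.cast (fun c : Ctx => (c.p, c.q, c.g, c.γ)) (fun _ => rfl) hf

@[fun_prop]
theorem Comp.ctx_p {f : α → Ctx} (hf : Comp f) : Comp (fun a => (f a).p) := hf.ctx.fst

@[fun_prop]
theorem Comp.ctx_q {f : α → Ctx} (hf : Comp f) : Comp (fun a => (f a).q) := hf.ctx.snd.fst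

@[fun_prop]
theorem Comp.ctx_g {f : α → Ctx} (hf : Comp f) : Comp (fun a => (f a).g) := hf.ctx.snd.snd.fst

@[fun_prop]
theorem Comp.ctx_γ {f : α → Ctx} (hf : Comp f) : Comp (fun a => (f a).γ) := hf.ctx.snd.snd.snd

@[fun_prop]
theorem Comp.ctx_mk {a b c d : α → ℕ} (ha : Comp a) (hb : Comp b) (hc : Comp c) (hd : Comp d) :
    Comp (fun x => Ctx.mk (a x) (b x) (c x) (d x)) := by
  have h : Comp fun x => (a x, b x, c x, d x) := by fun_prop
  exact h

theorem Comp.dr {f : α → Dr} (hf : Comp f) :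
    Comp (fun a => ((f a).r1, (f a).r2, (f a).gx, (f a).h1, (f a).h2)) :=
  Comp.cast (fun r : Dr => (r.r1, r.r2, r.gx, r.h1, r.h2)) (fun _ => rfl) hf

@[fun_prop]
theorem Comp.dr_r1 {f : α → Dr} (hf : Comp f) : Comp (fun a => (f a).r1) := hf.dr.fst

@[fun_prop]
theorem Comp.dr_r2 {f : α → Dr} (hf : Comp f) : Comp (fun a => (f a).r2) := hf.dr.snd.fst

@[fun_prop]
theorem Comp.dr_gx {f : α → Dr} (hf : Comp f) : Comp (fun a => (f a).gx) := hf.dr.snd.snd.fst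

@[fun_prop]
theorem Comp.dr_h1 {f : α → Dr} (hf : Comp f) : Comp (fun a => (f a).h1) :=
  hf.dr.snd.snd.snd.fst

@[fun_prop]
theorem Comp.dr_h2 {f : α → Dr} (hf : Comp f) : Comp (fun a => (f a).h2) :=
  hf.dr.snd.snd.snd.snd

@[fun_prop]
theorem Comp.dr_mk {a b c d e : α → ℕ} (ha : Comp a) (hb : Comp b) (hc : Comp c) (hd : Comp d)
    (he : Comp e) : Comp (fun x => Dr.mk (a x) (b x) (c x) (d x) (e x)) := by
  have h : Comp fun x => (a x, b x, c x, d x, e x) := by fun_prop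
  exact h

@[fun_prop]
theorem Comp.rnth_sr {l : α → List SR} {k : α → ℕ} (hl : Comp l) (hk : Comp k) (d : SR) :
    Comp (fun a => rnth (l a) (k a) d) := by
  refine Comp.rnth_of_depth 4 (fun x => ?_) d hl hk
  change edepth (x.node, x.kind, x.v, x.base, x.exp) ≤ 4
  simp

end

/-- `1` for group elements, `0` otherwise. -/
def eltN (c : Ctx) (v : ℕ) : ℕ := if v < c.p then if pm v c.q c.p = 1 then 1 else 0 else 0

/-- `1` if the optional first message, encoded as a number, is valid. -/
def validN (c : Ctx) (y : ℕ) : ℕ := if y = 0 then 1 else eltN c (y - 1)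

/-- `1` while the test run is going on. -/
def IS.running (s : IS) : ℕ :=
  if s.tst = 0 then 0 else if look s.db (3, s.tst - 1, 0) = 0 then 1 else 0

def qx (d : Data) : ℕ := d.snd.fst.toNat
def qy (d : Data) : ℕ := d.snd.snd.toNat

/-- The successor of the kind of the run that the query begins, or `0` if it does not begin one. -/
def opens (c : Ctx) (s : IS) (d : Data) : ℕ :=
  if qx d < s.nodes.length then
    if validN c (qy d) = 1 then
      if d.fst.toNat = 2 then
        if rnth s.nodes (qx d) 0 = c.γ + 1 then
          if s.running = 1 then 0 else if s.tst = 0 then 2 else 4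
        else 1
      else if d.fst.toNat = 3 then
        if rnth s.nodes (qx d) 0 = c.γ + 1 then if s.tst = 0 then 3 else 0 else 0
      else 0
    else 0
  else 0

/-- The generator used in a run of kind `0`. -/
def baseOf (c : Ctx) (s : IS) (d : Data) (R : Dr) : ℕ :=
  if rnth s.nodes (qx d) 0 = 0 then pm c.g (R.r1 + 1) c.p
  else rnth s.groups (rnth s.nodes (qx d) 0 - 1) 0

/-- A member of the target group sends `R.gx` whatever its secret is. In the experiment this is `g`
to the power `R.r2`, but keeping the two apart lets the reduction plant a message of unknown
exponent. The base `0` is a placeholder that is never used. -/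
def opening (c : Ctx) (s : IS) (d : Data) (R : Dr) : Data × IS :=
  if opens c s d = 1 then
    (.pair (.num s.ss.length) (.num (pm (baseOf c s d R) R.r2 c.p)),
      ⟨s.groups, s.nodes, ⟨qx d, 0, qy d, baseOf c s d R, R.r2⟩ :: s.ss, s.tst, s.db, s.cor⟩)
  else
    (.pair (.num s.ss.length) (.num R.gx),
      ⟨s.groups, s.nodes, ⟨qx d, opens c s d - 1, qy d, 0, R.r2⟩ :: s.ss,
        if opens c s d = 3 then s.ss.length + 1 else s.tst, s.db, s.cor⟩)

def SR.zero : SR := ⟨0, 0, 0, 0, 0⟩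

/-- Run number `k`. -/
def IS.sess (s : IS) (k : ℕ) : SR := rnth s.ss k .zero

/-- The successor of the element received in run `k`, if any. -/
def IS.peer (s : IS) (k : ℕ) : ℕ := if (s.sess k).v = 0 then look s.db (2, k, 0) else (s.sess k).v

/-- `1` if run `k` is over. -/
def IS.closed (s : IS) (k : ℕ) : ℕ :=
  if look s.db (3, k, 0) = 0 then
    if (s.sess k).kind = 1 then if s.tst = 0 then 0 else 1 else 0
  else 1

/-- The common secret of run `k` with element `u` received, for the target group with respect to
the exponents for `g`. -/
def IS.zed (c : Ctx) (s : IS) (k u : ℕ) : ℕ := pm u (s.sess k).exp c.p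

/-- Where the value of oracle `t` for the secret of run `k` is found. -/
def IS.key (c : Ctx) (s : IS) (k u t : ℕ) : ℕ × ℕ × ℕ :=
  (if (s.sess k).kind = 0 then 5 else if s.zed c k u = 1 then 5
    else if (s.sess k).kind = 2 then 7 else 6, t, s.zed c k u)

def IS.put (s : IS) (k : ℕ × ℕ × ℕ) (v : ℕ) : IS :=
  ⟨s.groups, s.nodes, s.ss, s.tst, (k, v) :: s.db, s.cor⟩

def IS.get (s : IS) (k : ℕ × ℕ × ℕ) : ℕ := look s.db k - 1

/-- Oracle values are written unconditionally and read back: since the oldest entry counts, a fresh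
random value is used only if the key is new. -/
def IS.deliver (c : Ctx) (s : IS) (k m : ℕ) (R : Dr) : Data × IS :=
  if k < s.ss.length then
    if s.closed k = 0 then
      if s.peer k = 0 then
        if eltN c m = 1 then
          (.num (((s.put (2, k, 0) m).put (s.key c k m 4) R.h1).get (s.key c k m 4)),
            (s.put (2, k, 0) m).put (s.key c k m 4) R.h1)
        else (.num 0, s.put (3, k, 0) 0)
      else if (s.sess k).v = 0 then
        (.num 0, (s.put (s.key c k (s.peer k - 1) 5) R.h1).put (3, k, 0)
          (if m = (s.put (s.key c k (s.peer k - 1) 5) R.h1).get (s.key c k (s.peer k - 1) 5)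
            then 1 else 0))
      else
        (.num (((s.put (s.key c k (s.peer k - 1) 4) R.h1).put
            (s.key c k (s.peer k - 1) 5) R.h2).get (s.key c k (s.peer k - 1) 5)),
          ((s.put (s.key c k (s.peer k - 1) 4) R.h1).put (s.key c k (s.peer k - 1) 5) R.h2).put
            (3, k, 0)
            (if m = (s.put (s.key c k (s.peer k - 1) 4) R.h1).get (s.key c k (s.peer k - 1) 4)
              then 1 else 0))
    else (.num 0, s)
  else (.num 0, s)

def IS.reveal (c : Ctx) (s : IS) (k : ℕ) (R : Dr) : Data × IS :=
  if k < s.ss.length then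
    if s.peer k = 0 then (.num 0, s)
    else (.pair (.num ((s.put (s.key c k (s.peer k - 1) 3) R.h1).get (s.key c k (s.peer k - 1) 3)))
      (.num (if look s.db (3, k, 0) = 2 then 1 else 0)), s.put (s.key c k (s.peer k - 1) 3) R.h1)
  else (.num 0, s)

/-- Folding over a list with its newest element first restores the chronological order of the real
system. -/
def IS.secrets (s : IS) (i : ℕ) : List (ℕ × ℕ) :=
  s.ss.foldl (fun l r => if r.node = i then (r.base, r.exp) :: l else l) []

/-- The target group is protected at all times here, in the real system only after its test run has
begun. `Abort` takes care of the difference. -/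
def IS.corrupt (c : Ctx) (s : IS) (i : ℕ) : Data × IS :=
  if i < s.nodes.length then
    if rnth s.nodes i 0 = c.γ + 1 then (.num 0, s)
    else (.pair (.num (if rnth s.nodes i 0 = 0 then 0 else rnth s.groups (rnth s.nodes i 0 - 1) 0))
      (enc (s.secrets i)), ⟨s.groups, s.nodes, s.ss, s.tst, s.db,
        (if rnth s.nodes i 0 = 0 then [] else [rnth s.nodes i 0 - 1]) ++ s.cor⟩)
  else (.num 0, s)

/-- The queries that do not begin a run. -/
def IS.other (c : Ctx) (s : IS) (d : Data) (R : Dr) : Data × IS :=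
  if d.fst.toNat = 0 then
    (.num s.groups.length,
      ⟨pm c.g (R.r1 + 1) c.p :: s.groups, s.nodes, s.ss, s.tst, s.db, s.cor⟩)
  else if d.fst.toNat = 1 then
    if qx d < s.groups.length + 1 then
      (.num s.nodes.length, ⟨s.groups, qx d :: s.nodes, s.ss, s.tst, s.db, s.cor⟩)
    else (.num 0, s)
  else if d.fst.toNat = 4 then s.deliver c (qx d) (qy d) R
  else if d.fst.toNat = 5 then s.reveal c (qx d) R
  else if d.fst.toNat = 6 then s.corrupt c (qx d)
  else if d.fst.toNat = 7 then
    (.num ((s.put (5, qx d, qy d) R.h1).get (5, qx d, qy d)), s.put (5, qx d, qy d) R.h1)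
  else (.num 0, s)

/-- A step of the ideal system. -/
def IS.step (c : Ctx) (s : IS) (d : Data) (R : Dr) : Data × IS :=
  if opens c s d = 0 then s.other c d R else opening c s d R

/-! ### Computability of a step of the ideal system. -/

section

variable {α β : Type} [Enc α] [Enc β]

@[fun_prop]
theorem Comp.eltN {c : α → Ctx} {v : α → ℕ} (hc : Comp c) (hv : Comp v) :
    Comp (fun a => eltN (c a) (v a)) := by unfold Handshake.eltN; fun_prop

@[fun_prop]
theorem Comp.validN {c : α → Ctx} {v : α → ℕ} (hc : Comp c) (hv : Comp v) :
    Comp (fun a => validN (c a) (v a)) := by unfold Handshake.validN; fun_prop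

@[fun_prop]
theorem Comp.running {s : α → IS} (hs : Comp s) : Comp (fun a => (s a).running) := by
  unfold IS.running; fun_prop

@[fun_prop]
theorem Comp.qx {d : α → Data} (hd : Comp d) : Comp (fun a => qx (d a)) := by
  unfold Handshake.qx; fun_prop

@[fun_prop]
theorem Comp.qy {d : α → Data} (hd : Comp d) : Comp (fun a => qy (d a)) := by
  unfold Handshake.qy; fun_prop

@[fun_prop]
theorem Comp.opens {c : α → Ctx} {s : α → IS} {d : α → Data} (hc : Comp c) (hs : Comp s)
    (hd : Comp d) : Comp (fun a => opens (c a) (s a) (d a)) := by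
  unfold Handshake.opens; fun_prop

@[fun_prop]
theorem Comp.baseOf {c : α → Ctx} {s : α → IS} {d : α → Data} {R : α → Dr} (hc : Comp c)
    (hs : Comp s) (hd : Comp d) (hR : Comp R) :
    Comp (fun a => baseOf (c a) (s a) (d a) (R a)) := by
  unfold Handshake.baseOf; fun_prop

@[fun_prop]
theorem Comp.opening {c : α → Ctx} {s : α → IS} {d : α → Data} {R : α → Dr} (hc : Comp c)
    (hs : Comp s) (hd : Comp d) (hR : Comp R) :
    Comp (fun a => opening (c a) (s a) (d a) (R a)) := by
  unfold Handshake.opening; fun_prop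

@[fun_prop]
theorem Comp.is_sess {s : α → IS} {k : α → ℕ} (hs : Comp s) (hk : Comp k) :
    Comp (fun a => (s a).sess (k a)) := by
  unfold IS.sess; fun_prop

@[fun_prop]
theorem Comp.is_peer {s : α → IS} {k : α → ℕ} (hs : Comp s) (hk : Comp k) :
    Comp (fun a => (s a).peer (k a)) := by
  unfold IS.peer; fun_prop

@[fun_prop]
theorem Comp.is_closed {s : α → IS} {k : α → ℕ} (hs : Comp s) (hk : Comp k) :
    Comp (fun a => (s a).closed (k a)) := by
  unfold IS.closed; fun_prop

@[fun_prop]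
theorem Comp.is_zed {c : α → Ctx} {s : α → IS} {k u : α → ℕ} (hc : Comp c) (hs : Comp s)
    (hk : Comp k) (hu : Comp u) : Comp (fun a => (s a).zed (c a) (k a) (u a)) := by
  unfold IS.zed; fun_prop

@[fun_prop]
theorem Comp.is_key {c : α → Ctx} {s : α → IS} {k u t : α → ℕ} (hc : Comp c) (hs : Comp s)
    (hk : Comp k) (hu : Comp u) (ht : Comp t) :
    Comp (fun a => (s a).key (c a) (k a) (u a) (t a)) := by
  unfold IS.key; fun_prop

@[fun_prop]
theorem Comp.is_put {s : α → IS} {k : α → ℕ × ℕ × ℕ} {v : α → ℕ} (hs : Comp s) (hk : Comp k)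
    (hv : Comp v) : Comp (fun a => (s a).put (k a) (v a)) := by
  unfold IS.put; fun_prop

@[fun_prop]
theorem Comp.is_get {s : α → IS} {k : α → ℕ × ℕ × ℕ} (hs : Comp s) (hk : Comp k) :
    Comp (fun a => (s a).get (k a)) := by
  unfold IS.get; fun_prop

@[fun_prop]
theorem Comp.is_deliver {c : α → Ctx} {s : α → IS} {k m : α → ℕ} {R : α → Dr} (hc : Comp c)
    (hs : Comp s) (hk : Comp k) (hm : Comp m) (hR : Comp R) :
    Comp (fun a => (s a).deliver (c a) (k a) (m a) (R a)) := by
  unfold IS.deliver; fun_prop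

@[fun_prop]
theorem Comp.is_reveal {c : α → Ctx} {s : α → IS} {k : α → ℕ} {R : α → Dr} (hc : Comp c)
    (hs : Comp s) (hk : Comp k) (hR : Comp R) :
    Comp (fun a => (s a).reveal (c a) (k a) (R a)) := by
  unfold IS.reveal; fun_prop

@[fun_prop]
theorem Comp.is_secrets {s : α → IS} {i : α → ℕ} (hs : Comp s) (hi : Comp i) :
    Comp (fun a => (s a).secrets (i a)) := by
  refine Comp.comp (g := fun x : IS × ℕ => x.1.secrets x.2) (f := fun a => (s a, i a)) ?_
    (by fun_prop)
  unfold IS.secrets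
  refine Comp.foldl (l := fun x : IS × ℕ => x.1.ss) (i := fun _ => [])
    (g := fun x : (IS × ℕ) × List (ℕ × ℕ) × SR => if x.2.2.node = x.1.2 then
      (x.2.2.base, x.2.2.exp) :: x.2.1 else x.2.1) (by fun_prop) (by fun_prop) (by fun_prop)
    2 ?_
  intro x m hm
  -- Pairs of numbers have depth `1`, so the depth of the accumulator is controlled by its length,
  -- and this by the number of runs.
  have h1 : ∀ l : List (ℕ × ℕ), edepth l ≤ l.length + 1 := by
    intro l
    induction l with
    | nil => simp [edepth, Data.depth]
    | cons x l ih => simp [edepth, Data.depth] at *; omega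
  have h2 : ∀ (m : List SR) (l : List (ℕ × ℕ)), (m.foldl (fun y r => if r.node = x.2 then
      (r.base, r.exp) :: y else y) l).length ≤ m.length + l.length := by
    intro m
    induction m with
    | nil => simp
    | cons r m ih =>
      intro l
      simp only [List.foldl_cons, List.length_cons]
      split_ifs
      · refine (ih _).trans ?_
        simp only [List.length_cons]; omega
      · exact (ih _).trans (by omega)
  have h3 := hm.length_le
  have h4 := length_le_edepth x.1.ss
  have h5 : edepth x.1.ss ≤ edepth x := by
    change _ ≤ edepth ((x.1.groups, x.1.nodes, x.1.ss, x.1.tst, x.1.db), x.2)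
    simp only [edepth_pair]
    omega
  have h6 := h2 m []
  have h7 := h1 (m.foldl (fun y r => if r.node = x.2 then (r.base, r.exp) :: y else y) [])
  simp only [List.length_nil] at h6
  simp only
  omega

@[fun_prop]
theorem Comp.is_corrupt {c : α → Ctx} {s : α → IS} {i : α → ℕ} (hc : Comp c)
    (hs : Comp s) (hi : Comp i) : Comp (fun a => (s a).corrupt (c a) (i a)) := by
  unfold IS.corrupt; fun_prop

@[fun_prop]
theorem Comp.is_other {c : α → Ctx} {s : α → IS} {d : α → Data} {R : α → Dr} (hc : Comp c)
    (hs : Comp s) (hd : Comp d) (hR : Comp R) :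
    Comp (fun a => (s a).other (c a) (d a) (R a)) := by
  unfold IS.other; fun_prop

@[fun_prop]
theorem Comp.is_step {c : α → Ctx} {s : α → IS} {d : α → Data} {R : α → Dr} (hc : Comp c)
    (hs : Comp s) (hd : Comp d) (hR : Comp R) :
    Comp (fun a => (s a).step (c a) (d a) (R a)) := by
  unfold IS.step; fun_prop

end

end Handshake

namespace Handshake

/-! ### Tables -/

theorem look_cons (x : (ℕ × ℕ × ℕ) × ℕ) (l : Table) (k : ℕ × ℕ × ℕ) :
    look (x :: l) k = if look l k = 0 then (if x.1 = k then x.2 + 1 else 0) else look l k := rfl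

theorem look_cons_of_ne {x : (ℕ × ℕ × ℕ) × ℕ} {l : Table} {k : ℕ × ℕ × ℕ} (h : x.1 ≠ k) :
    look (x :: l) k = look l k := by
  rw [look_cons, if_neg h]; split_ifs with h <;> simp [h]

theorem look_cons_self {k : ℕ × ℕ × ℕ} {v : ℕ} {l : Table} :
    look ((k, v) :: l) k = if look l k = 0 then v + 1 else look l k := by
  rw [look_cons]; simp

theorem look_cons_of_look {x : (ℕ × ℕ × ℕ) × ℕ} {l : Table} {k : ℕ × ℕ × ℕ} (h : look l k ≠ 0) :
    look (x :: l) k = look l k := by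
  rw [look_cons, if_neg h]

/-- New entries are put in front and the oldest one counts, so values are permanent. -/
theorem look_suffix {l l' : Table} (hl : l <:+ l') {k : ℕ × ℕ × ℕ} (h : look l k ≠ 0) :
    look l' k = look l k := by
  obtain ⟨m, rfl⟩ := hl
  induction m with
  | nil => rfl
  | cons x m ih => rw [List.cons_append, look_cons_of_look (by rwa [ih]), ih]

theorem look_ne_zero_iff {l : Table} {k : ℕ × ℕ × ℕ} : look l k ≠ 0 ↔ ∃ v, (k, v) ∈ l := by
  induction l with
  | nil => simp [look]
  | cons x l ih =>
    obtain ⟨k', v'⟩ := x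
    rw [look_cons]
    by_cases h : look l k = 0
    · have h' : ¬ ∃ v, (k, v) ∈ l := fun h' => ih.mpr h' h
      push Not at h'
      by_cases hk : k' = k
      · simp [h, hk]
      · simp only [h, hk, if_true, if_false, List.mem_cons, Prod.mk.injEq]
        simp only [ne_eq, not_true_eq_false, false_iff, not_exists, not_or, not_and]
        exact fun v => ⟨fun h => absurd h.symm hk, h' v⟩
    · simp only [if_neg h, List.mem_cons]
      exact ⟨fun _ => (ih.mp h).imp fun v hv => .inr hv, fun _ => h⟩

theorem rnth_cons_lt {β : Type} {x : β} {l : List β} {k : ℕ} {d : β} (h : k < l.length) :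
    rnth (x :: l) k d = rnth l k d := by
  simp only [rnth, List.getD_eq_getElem?_getD, List.reverse_cons]
  rw [List.getElem?_append_left (by simpa using h)]

theorem rnth_cons_length {β : Type} {x : β} {l : List β} {d : β} :
    rnth (x :: l) l.length d = x := by
  simp [rnth, List.getD_eq_getElem?_getD]

theorem reverse_getElem? {β : Type} {l : List β} {k : ℕ} (d : β) (h : k < l.length) :
    l.reverse[k]? = some (rnth l k d) := by
  simp [rnth, List.getD_eq_getElem?_getD, h]

theorem rnth_mem {β : Type} {l : List β} {k : ℕ} {d : β} (h : k < l.length) : rnth l k d ∈ l := by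
  rw [← List.mem_reverse]
  exact List.mem_of_getElem? (reverse_getElem? d h)

/-! ### Invariants of the ideal system -/

namespace IS

variable (c : Ctx) (s : IS) (k : ℕ × ℕ × ℕ) (v : ℕ)

@[simp] theorem put_groups : (s.put k v).groups = s.groups := rfl
@[simp] theorem put_nodes : (s.put k v).nodes = s.nodes := rfl
@[simp] theorem put_ss : (s.put k v).ss = s.ss := rfl
@[simp] theorem put_tst : (s.put k v).tst = s.tst := rfl
@[simp] theorem put_cor : (s.put k v).cor = s.cor := rfl
@[simp] theorem put_db : (s.put k v).db = (k, v) :: s.db := rfl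
@[simp] theorem put_sess (i : ℕ) : (s.put k v).sess i = s.sess i := rfl
@[simp] theorem put_key (i u t : ℕ) : (s.put k v).key c i u t = s.key c i u t := rfl

end IS

/-- The context for parameters `pp` and target group `γ`. -/
def Params.ctx (pp : Params) (γ : ℕ) : Ctx := ⟨pp.p, pp.q, pp.g, γ⟩

variable {pp : Params} {γ : ℕ}

theorem eltN_eq_one {v : ℕ} : eltN (pp.ctx γ) v = 1 ↔ pp.IsElt v := by
  simp only [eltN, Params.ctx, Params.IsElt, pp.pm_p]
  split_ifs <;> simp_all

theorem validN_eq_one {y : ℕ} : validN (pp.ctx γ) y = 1 ↔ validFirst pp (optNat y) := by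
  cases y with
  | zero => simp [validN, validFirst, optNat]
  | succ n => simp [validN, validFirst, optNat, eltN_eq_one]

/-- Beyond well-formedness, two kinds of facts matter. Runs of the target group are ordered: kind
`1` precedes the test run, kind `3` begins after it is over. And every entry of a private table, `6`
or `7`, is the common secret, different from `1`, of an actual run of the right kind; from such an
entry a collision of two runs is recovered later. -/
structure Inv (pp : Params) (γ : ℕ) (s : IS) : Prop where
  node_mem : γ + 1 ∈ s.nodes → γ < s.groups.length
  node_lt : ∀ k < s.ss.length, (s.sess k).node < s.nodes.length
  kind_iff : ∀ k < s.ss.length,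
    ((s.sess k).kind ≠ 0 ↔ rnth s.nodes (s.sess k).node 0 = γ + 1)
  kind_le : ∀ k < s.ss.length, (s.sess k).kind ≤ 3
  kind_two : ∀ k < s.ss.length, ((s.sess k).kind = 2 ↔ s.tst = k + 1)
  tst_le : s.tst ≤ s.ss.length
  kind_one : ∀ k < s.ss.length, (s.sess k).kind = 1 → s.tst ≠ 0 → k + 1 < s.tst
  kind_three : ∀ k < s.ss.length, (s.sess k).kind = 3 →
    s.tst ≠ 0 ∧ s.tst < k + 1 ∧ look s.db (3, s.tst - 1, 0) ≠ 0
  peer_elt : ∀ k < s.ss.length, s.peer k ≠ 0 → pp.IsElt (s.peer k - 1)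
  look_ge : ∀ k, s.ss.length ≤ k → look s.db (2, k, 0) = 0 ∧ look s.db (3, k, 0) = 0
  key_six : ∀ t z, look s.db (6, t, z) ≠ 0 → ∃ k < s.ss.length, (s.sess k).kind ≠ 0 ∧
    (s.sess k).kind ≠ 2 ∧ s.peer k ≠ 0 ∧ s.zed (pp.ctx γ) k (s.peer k - 1) = z ∧ z ≠ 1
  key_seven : ∀ t z, look s.db (7, t, z) ≠ 0 → ∃ k < s.ss.length,
    (s.sess k).kind = 2 ∧ s.peer k ≠ 0 ∧ s.zed (pp.ctx γ) k (s.peer k - 1) = z ∧ z ≠ 1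
  cor : γ ∉ s.cor

def IS.init : IS := ⟨[], [], [], 0, [], []⟩

theorem Inv.init : Inv pp γ .init := by
  constructor <;> simp [IS.init, look]

theorem peer_put_of_ne {s : IS} {k : ℕ × ℕ × ℕ} {v i : ℕ} (h : k ≠ (2, i, 0)) :
    (s.put k v).peer i = s.peer i := by
  simp only [IS.peer, IS.put_sess, IS.put_db, look_cons_of_ne (x := (k, v)) h]

theorem peer_put_of_peer {s : IS} {k : ℕ × ℕ × ℕ} {v i : ℕ} (h : s.peer i ≠ 0) :
    (s.put k v).peer i = s.peer i := by
  simp only [IS.peer, IS.put_sess, IS.put_db] at *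
  by_cases h1 : (s.sess i).v = 0
  · simp only [h1, if_true] at *
    exact look_cons_of_look h
  · simp only [if_neg h1]
    exact if_neg h1

theorem peer_put_self {s : IS} {v i : ℕ} (h : s.peer i = 0) :
    (s.put (2, i, 0) v).peer i = v + 1 := by
  simp only [IS.peer, IS.put_sess, IS.put_db] at *
  by_cases h1 : (s.sess i).v = 0
  · simp only [h1, if_true] at *
    rw [look_cons_self, if_pos h]
  · simp only [if_neg h1] at h
    exact absurd h h1

/-- A table entry for oracle `t` may be added if it belongs to a run with the given message, or to
the public oracle. -/
theorem Inv.put_hash {s : IS} (h : Inv pp γ s) {k : ℕ × ℕ × ℕ} {v : ℕ} (h2 : k.1 ≠ 2)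
    (h3 : k.1 ≠ 3)
    (h6 : k.1 = 6 → ∃ i < s.ss.length, (s.sess i).kind ≠ 0 ∧
      (s.sess i).kind ≠ 2 ∧ s.peer i ≠ 0 ∧ s.zed (pp.ctx γ) i (s.peer i - 1) = k.2.2 ∧ k.2.2 ≠ 1)
    (h7 : k.1 = 7 → ∃ i < s.ss.length,
      (s.sess i).kind = 2 ∧ s.peer i ≠ 0 ∧ s.zed (pp.ctx γ) i (s.peer i - 1) = k.2.2 ∧ k.2.2 ≠ 1) :
    Inv pp γ (s.put k v) := by
  have hp : ∀ i, (s.put k v).peer i = s.peer i := fun i =>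
    peer_put_of_ne (by rintro rfl; exact h2 rfl)
  have hl : ∀ i, look (s.put k v).db (3, i, 0) = look s.db (3, i, 0) := fun i =>
    look_cons_of_ne (by rintro rfl; exact h3 rfl)
  have hl2 : ∀ i, look (s.put k v).db (2, i, 0) = look s.db (2, i, 0) := fun i =>
    look_cons_of_ne (by rintro rfl; exact h2 rfl)
  refine ⟨h.node_mem, h.node_lt, h.kind_iff, h.kind_le, h.kind_two, h.tst_le, h.kind_one, ?_, ?_,
    ?_, ?_, ?_, h.cor⟩
  · intro i hi; rw [hl]; exact h.kind_three i hi
  · intro i hi; rw [hp]; exact h.peer_elt i hi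
  · intro i hi; rw [hl, hl2]; exact h.look_ge i hi
  · intro t z hz
    by_cases hk : k = (6, t, z)
    · subst hk; simp only [hp]; exact h6 rfl
    · simp only [hp]; exact h.key_six t z (by simpa [look_cons_of_ne (x := (k, v)) hk] using hz)
  · intro t z hz
    by_cases hk : k = (7, t, z)
    · subst hk; simp only [hp]; exact h7 rfl
    · simp only [hp]; exact h.key_seven t z (by simpa [look_cons_of_ne (x := (k, v)) hk] using hz)

theorem Inv.put_done {s : IS} (h : Inv pp γ s) {i v : ℕ} (hi : i < s.ss.length) :
    Inv pp γ (s.put (3, i, 0) v) := by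
  have hp : ∀ j, (s.put (3, i, 0) v).peer j = s.peer j := fun j => peer_put_of_ne (by simp)
  refine ⟨h.node_mem, h.node_lt, h.kind_iff, h.kind_le, h.kind_two, h.tst_le, h.kind_one, ?_, ?_,
    ?_, ?_, ?_, h.cor⟩
  · intro j hj hk
    obtain ⟨h1, h2, h3⟩ := h.kind_three j hj hk
    exact ⟨h1, h2, by rw [IS.put_db, IS.put_tst, look_cons_of_look h3]; exact h3⟩
  · intro j hj; rw [hp]; exact h.peer_elt j hj
  · intro j hj
    rw [IS.put_db, look_cons_of_ne (by simp), look_cons_of_ne]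
    · exact h.look_ge j hj
    · simp only [IS.put_ss] at hj; simp; omega
  · intro t z hz
    simp only [hp]; exact h.key_six t z (by simpa [look_cons_of_ne] using hz)
  · intro t z hz
    simp only [hp]; exact h.key_seven t z (by simpa [look_cons_of_ne] using hz)

theorem Inv.put_peer {s : IS} (h : Inv pp γ s) {i u : ℕ} (hi : i < s.ss.length) (hu : pp.IsElt u) :
    Inv pp γ (s.put (2, i, 0) u) := by
  have hl : ∀ t j, look (s.put (2, i, 0) u).db (3, j, t) = look s.db (3, j, t) := fun t j =>
    look_cons_of_ne (by simp)
  have hp : ∀ j, s.peer j ≠ 0 → (s.put (2, i, 0) u).peer j = s.peer j := fun j =>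
    peer_put_of_peer
  refine ⟨h.node_mem, h.node_lt, h.kind_iff, h.kind_le, h.kind_two, h.tst_le, h.kind_one, ?_, ?_,
    ?_, ?_, ?_, h.cor⟩
  · intro j hj; rw [hl]; exact h.kind_three j hj
  · intro j hj hj0
    by_cases h1 : s.peer j = 0
    · by_cases hij : i = j
      · subst hij; rw [peer_put_self h1]; exact hu
      · rw [peer_put_of_ne (by simpa using hij)] at hj0; exact absurd h1 hj0
    · rw [hp j h1]; exact h.peer_elt j hj h1
  · intro j hj
    rw [hl, IS.put_db, look_cons_of_ne]
    · exact h.look_ge j hj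
    · simp only [IS.put_ss] at hj; simp; omega
  · intro t z hz
    obtain ⟨j, hj, h1, h2, h3, h4⟩ := h.key_six t z (by simpa [look_cons_of_ne] using hz)
    exact ⟨j, hj, h1, h2, by rwa [hp j h3], by rwa [hp j h3]⟩
  · intro t z hz
    obtain ⟨j, hj, h1, h3, h4⟩ := h.key_seven t z (by simpa [look_cons_of_ne] using hz)
    exact ⟨j, hj, h1, by rwa [hp j h3], by rwa [hp j h3]⟩

theorem key_fst (c : Ctx) (s : IS) (k u t : ℕ) :
    (s.key c k u t).1 = 5 ∨ (s.key c k u t).1 = 6 ∨ (s.key c k u t).1 = 7 := by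
  simp only [IS.key]; split_ifs <;> simp

/-- The value of an oracle for the secret of a run is recorded. -/
theorem Inv.put_key {s : IS} (h : Inv pp γ s) {i t v : ℕ} (hi : i < s.ss.length)
    (hp : s.peer i ≠ 0) : Inv pp γ (s.put (s.key (pp.ctx γ) i (s.peer i - 1) t) v) := by
  refine h.put_hash ?_ ?_ ?_ ?_
  · have := key_fst (pp.ctx γ) s i (s.peer i - 1) t; omega
  · have := key_fst (pp.ctx γ) s i (s.peer i - 1) t; omega
  · intro h6
    refine ⟨i, hi, ?_⟩
    simp only [IS.key] at *
    split_ifs at h6 <;> simp_all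
  · intro h7
    refine ⟨i, hi, ?_⟩
    simp only [IS.key] at *
    split_ifs at h7 <;> simp_all

theorem Inv.deliver {s : IS} (h : Inv pp γ s) (k m : ℕ) (R : Dr) :
    Inv pp γ (s.deliver (pp.ctx γ) k m R).2 := by
  unfold IS.deliver
  split_ifs with h1 h2 h3 h4 h5
  · have h6 := (h.put_peer h1 (eltN_eq_one.mp h4)).put_key (i := k) (t := 4)
      (v := R.h1) h1 (by rw [peer_put_self h3]; simp)
    rwa [peer_put_self h3] at h6
  · exact h.put_done h1
  · exact (h.put_key h1 h3).put_done h1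
  · exact (h.put_key h1 h3).put_done h1
  · have h6 := (h.put_key (t := 4) (v := R.h1) h1 h3).put_key (t := 5) (v := R.h2) (i := k) h1
      (by rwa [peer_put_of_peer h3])
    rw [peer_put_of_peer h3] at h6
    exact h6.put_done h1
  · have h6 := (h.put_key (t := 4) (v := R.h1) h1 h3).put_key (t := 5) (v := R.h2) (i := k) h1
      (by rwa [peer_put_of_peer h3])
    rw [peer_put_of_peer h3] at h6
    exact h6.put_done h1
  · exact h
  · exact h

theorem Inv.other {s : IS} (h : Inv pp γ s) (d : Data) (R : Dr) :
    Inv pp γ (s.other (pp.ctx γ) d R).2 := by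
  unfold IS.other
  split_ifs with h1 h2 h3 h4 h5 h6 h7
  · exact { h with node_mem := fun hm => by have := h.node_mem hm; simp; omega }
  · refine { h with node_mem := ?_, node_lt := ?_, kind_iff := ?_ }
    · intro hm
      rcases List.mem_cons.mp hm with hm | hm
      · simp only; omega
      · exact h.node_mem hm
    · intro k hk
      have := h.node_lt k hk
      simp only [List.length_cons]
      exact Nat.lt_succ_of_lt this
    · intro k hk
      have := h.node_lt k hk
      have h' := h.kind_iff k hk
      simp only [IS.sess] at *
      rw [rnth_cons_lt this]
      exact h'
  · exact h
  · exact h.deliver _ _ _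
  · unfold IS.reveal
    split_ifs <;> first | exact h | exact h.put_key ‹_› ‹_›
  · unfold IS.corrupt
    split_ifs with h8 h9 h10
    · exact h
    · exact { h with }
    · refine { h with cor := ?_ }
      have := h.cor
      simp only [Params.ctx] at h9
      simp only [List.singleton_append, List.mem_cons]
      push Not
      exact ⟨by omega, this⟩
    · exact h
  · exact h.put_hash (by simp) (by simp) (by simp) (by simp)
  · exact h

theorem sess_opening_lt {s : IS} {d : Data} {R : Dr} {k : ℕ} (hk : k < s.ss.length) :
    (opening (pp.ctx γ) s d R).2.sess k = s.sess k := by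
  unfold opening IS.sess
  split_ifs <;> exact rnth_cons_lt hk

theorem sess_opening_self {s : IS} {d : Data} {R : Dr} :
    (opening (pp.ctx γ) s d R).2.sess s.ss.length =
      ⟨qx d, opens (pp.ctx γ) s d - 1, qy d,
        if opens (pp.ctx γ) s d = 1 then baseOf (pp.ctx γ) s d R else 0, R.r2⟩ := by
  unfold opening IS.sess
  by_cases h : opens (pp.ctx γ) s d = 1
  · simp only [h, if_true, rnth_cons_length]
  · simp only [h, if_false, rnth_cons_length]

theorem opening_length {s : IS} {d : Data} {R : Dr} :
    (opening (pp.ctx γ) s d R).2.ss.length = s.ss.length + 1 := by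
  unfold opening; split_ifs <;> simp

theorem opening_db {s : IS} {d : Data} {R : Dr} :
    (opening (pp.ctx γ) s d R).2.db = s.db := by
  unfold opening; split_ifs <;> simp

theorem opening_nodes {s : IS} {d : Data} {R : Dr} :
    (opening (pp.ctx γ) s d R).2.nodes = s.nodes := by
  unfold opening; split_ifs <;> simp

theorem opening_groups {s : IS} {d : Data} {R : Dr} :
    (opening (pp.ctx γ) s d R).2.groups = s.groups := by
  unfold opening; split_ifs <;> simp

theorem opening_cor {s : IS} {d : Data} {R : Dr} :
    (opening (pp.ctx γ) s d R).2.cor = s.cor := by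
  unfold opening; split_ifs <;> simp

theorem opening_tst {s : IS} {d : Data} {R : Dr} :
    (opening (pp.ctx γ) s d R).2.tst
      = if opens (pp.ctx γ) s d = 3 then s.ss.length + 1 else s.tst := by
  unfold opening; split_ifs <;> simp_all

/-- What is known if a query begins a run. -/
theorem opens_spec {s : IS} {d : Data} (h : opens (pp.ctx γ) s d ≠ 0) :
    qx d < s.nodes.length ∧ validN (pp.ctx γ) (qy d) = 1 ∧ opens (pp.ctx γ) s d ≤ 4 ∧
      (opens (pp.ctx γ) s d ≠ 1 ↔ rnth s.nodes (qx d) 0 = γ + 1) ∧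
      (opens (pp.ctx γ) s d = 2 → s.tst = 0) ∧ (opens (pp.ctx γ) s d = 3 → s.tst = 0) ∧
      (opens (pp.ctx γ) s d = 4 → s.tst ≠ 0 ∧ look s.db (3, s.tst - 1, 0) ≠ 0) := by
  unfold opens at *
  unfold IS.running at *
  simp only [show (pp.ctx γ).γ = γ from rfl] at *
  split_ifs at * <;> simp_all

theorem peer_opening_lt {s : IS} {d : Data} {R : Dr} {k : ℕ} (hk : k < s.ss.length) :
    (opening (pp.ctx γ) s d R).2.peer k = s.peer k := by
  simp only [IS.peer, sess_opening_lt hk, opening_db]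

theorem Inv.peer_opening_self {s : IS} (h : Inv pp γ s) {d : Data} {R : Dr} :
    (opening (pp.ctx γ) s d R).2.peer s.ss.length = qy d := by
  simp only [IS.peer, sess_opening_self, opening_db, (h.look_ge _ le_rfl).1]
  split_ifs with h <;> simp [h]

theorem Inv.opening {s : IS} (h : Inv pp γ s) {d : Data} (hd : opens (pp.ctx γ) s d ≠ 0) (R : Dr) :
    Inv pp γ (opening (pp.ctx γ) s d R).2 := by
  obtain ⟨h1, h2, h3, h4, h5, h6, h7⟩ := opens_spec hd
  have key : ∀ {P : ℕ → Prop}, (∀ k < s.ss.length, P k) → P s.ss.length →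
      ∀ k < (Handshake.opening (pp.ctx γ) s d R).2.ss.length, P k := by
    intro P hP hP' k hk
    rw [opening_length] at hk
    rcases Nat.lt_succ_iff_lt_or_eq.mp hk with hk | rfl
    exacts [hP k hk, hP']
  have htst := h.tst_le
  refine ⟨?_, key ?_ ?_, key ?_ ?_, key ?_ ?_, key ?_ ?_, ?_, key ?_ ?_, key ?_ ?_, key ?_ ?_,
    ?_, ?_, ?_, ?_⟩
  · rw [opening_nodes, opening_groups]; exact h.node_mem
  · intro k hk; rw [sess_opening_lt hk, opening_nodes]; exact h.node_lt k hk
  · rw [sess_opening_self, opening_nodes]; exact h1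
  · intro k hk; rw [sess_opening_lt hk, opening_nodes]; exact h.kind_iff k hk
  · rw [sess_opening_self, opening_nodes]; simp only; rw [← h4]; omega
  · intro k hk; rw [sess_opening_lt hk]; exact h.kind_le k hk
  · rw [sess_opening_self]; simp only; omega
  · intro k hk; rw [sess_opening_lt hk, opening_tst, h.kind_two k hk]
    split_ifs with h8
    · have := h6 h8; omega
    · rfl
  · rw [sess_opening_self, opening_tst]; simp only
    split_ifs with h8
    · simp [h8]
    · omega
  · rw [opening_tst, opening_length]; split_ifs <;> omega
  · intro k hk; rw [sess_opening_lt hk, opening_tst]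
    split_ifs with h8
    · intros; omega
    · exact h.kind_one k hk
  · rw [sess_opening_self, opening_tst]; simp only
    intro h8
    have := h5 (by omega)
    rw [if_neg (by omega)]
    simp [this]
  · intro k hk; rw [sess_opening_lt hk, opening_tst, opening_db]
    intro h8
    have := h.kind_three k hk h8
    rwa [if_neg (fun h9 => this.1 (h6 h9))]
  · rw [sess_opening_self, opening_tst, opening_db]; simp only
    intro h8
    have := h7 (by omega)
    rw [if_neg (by omega)]
    exact ⟨this.1, by omega, this.2⟩
  · intro k hk; rw [peer_opening_lt hk]; exact h.peer_elt k hk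
  · rw [h.peer_opening_self]
    intro h8
    rw [validN, if_neg h8] at h2
    exact eltN_eq_one.mp h2
  · intro k hk; rw [opening_length] at hk; rw [opening_db]; exact h.look_ge k (by omega)
  · intro t z hz
    rw [opening_db] at hz
    obtain ⟨k, hk, hk'⟩ := h.key_six t z hz
    refine ⟨k, by rw [opening_length]; omega, ?_⟩
    simpa only [IS.zed, sess_opening_lt hk, peer_opening_lt hk] using hk'
  · intro t z hz
    rw [opening_db] at hz
    obtain ⟨k, hk, hk'⟩ := h.key_seven t z hz
    refine ⟨k, by rw [opening_length]; omega, ?_⟩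
    simpa only [IS.zed, sess_opening_lt hk, peer_opening_lt hk] using hk'
  · rw [opening_cor]; exact h.cor

theorem Inv.step {s : IS} (h : Inv pp γ s) (d : Data) (R : Dr) :
    Inv pp γ (s.step (pp.ctx γ) d R).2 := by
  unfold IS.step
  split_ifs with hd
  · exact h.other d R
  · exact h.opening hd R

/-- The largest number of entries is made by the last message to Bob: two oracle values and the
outcome. -/
theorem step_db_suffix (s : IS) (d : Data) (R : Dr) :
    s.db <:+ (s.step (pp.ctx γ) d R).2.db ∧
      (s.step (pp.ctx γ) d R).2.db.length ≤ s.db.length + 3 := by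
  unfold IS.step
  split_ifs
  · unfold IS.other
    split_ifs
    all_goals try unfold IS.deliver
    all_goals try unfold IS.reveal
    all_goals try unfold IS.corrupt
    all_goals try split_ifs
    all_goals refine ⟨?_, ?_⟩
    all_goals try simp
    all_goals try
      first
      | exact (List.suffix_cons _ _).trans (List.suffix_cons _ _)
      | exact (List.suffix_cons _ _).trans ((List.suffix_cons _ _).trans (List.suffix_cons _ _))
  · rw [opening_db]; simp

end Handshake

namespace Handshake

/-! ### The real systems that correspond to a state of the ideal system -/

section

variable (pp : Params) (γ β β' : ℕ)

/-- A run, when the secret of the target group is `g ^ β` and that of the test run `g ^ β'`. -/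
def SR.toSession (r : SR) (peer done closed : ℕ) : Session where
  node := r.node
  initiator := decide (r.v = 0)
  base := if r.kind = 0 then r.base else if r.kind = 2 then pp.gp β' else pp.gp β
  exp := if r.kind = 0 then r.exp else if r.kind = 2 then r.exp * pp.inv β' % pp.q
    else r.exp * pp.inv β % pp.q
  peer := optNat peer
  accepted := decide (done = 2)
  closed := decide (closed ≠ 0)

def IS.session (s : IS) (k : ℕ) : Session :=
  (s.sess k).toSession pp β β' (s.peer k) (look s.db (3, k, 0)) (s.closed k)

/-- The successor of the value of oracle `t` at `w`, or `0`. -/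
def IS.orc (s : IS) (t w : ℕ) : ℕ :=
  if look s.db (5, t, w) ≠ 0 then look s.db (5, t, w)
  else if pp.IsElt w ∧ w ≠ 1 then
    if look s.db (6, t, w ^ β % pp.p) ≠ 0 then look s.db (6, t, w ^ β % pp.p)
    else look s.db (7, t, w ^ β' % pp.p)
  else 0

/-- If group `γ` exists, the secret drawn for it in the ideal system is discarded in favour of
`g^β`; otherwise `set` has no effect. -/
def IS.sys (s : IS) : Sys where
  groups := s.groups.reverse.set γ (pp.gp β)
  nodes := s.nodes.reverse.map optNat
  corrupted := s.cor
  sessions := (List.range s.ss.length).map (s.session pp β β')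
  test := if s.tst = 0 then none else some (s.tst - 1, γ)
  oracle := fun x => optNat (s.orc pp β β' x.1 x.2)

/-- Values of separate oracles are asked for at the same point. -/
def IS.Bad (s : IS) : Prop := ∃ t w, pp.IsElt w ∧ w ≠ 1 ∧
  ((look s.db (5, t, w) ≠ 0 ∧ look s.db (6, t, w ^ β % pp.p) ≠ 0) ∨
    (look s.db (5, t, w) ≠ 0 ∧ look s.db (7, t, w ^ β' % pp.p) ≠ 0) ∨
    (look s.db (6, t, w ^ β % pp.p) ≠ 0 ∧ look s.db (7, t, w ^ β' % pp.p) ≠ 0))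

/-- The point of an oracle in the real system. -/
def Corr (κ v w : ℕ) : Prop := (κ = 5 ∧ v = w) ∨
  (κ = 6 ∧ pp.IsElt w ∧ w ≠ 1 ∧ w ^ β % pp.p = v) ∨
  (κ = 7 ∧ pp.IsElt w ∧ w ≠ 1 ∧ w ^ β' % pp.p = v)

end

variable {pp : Params} {γ β β' : ℕ}

/-- `β` is invertible modulo the order `q` of the group. -/
theorem Params.pow_inj {β w w' : ℕ} (hβ : ¬ pp.q ∣ β) (hw : pp.IsElt w) (hw' : pp.IsElt w')
    (h : w ^ β % pp.p = w' ^ β % pp.p) : w = w' := by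
  obtain ⟨r, -, rfl⟩ := pp.isElt_iff.mp hw
  obtain ⟨r', -, rfl⟩ := pp.isElt_iff.mp hw'
  rw [pp.gp_pow, pp.gp_pow, pp.gp_eq_iff] at h
  rw [pp.gp_eq_iff]
  exact Nat.ModEq.cancel_right_of_coprime (pp.coprime hβ) h

theorem IS.Bad.mono {s s' : IS} (h : s.Bad pp β β') (hs : s.db <:+ s'.db) : s'.Bad pp β β' := by
  obtain ⟨t, w, h1, h2, h3⟩ := h
  have key : ∀ k, look s.db k ≠ 0 → look s'.db k ≠ 0 := fun k hk => by rwa [look_suffix hs hk]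
  exact ⟨t, w, h1, h2, h3.imp (.imp (key _) (key _)) (.imp (.imp (key _) (key _))
    (.imp (key _) (key _)))⟩

/-- Outside of bad states a point occurs in at most one table, so the order in which `orc` consults
them does not matter. -/
theorem orc_eq {s : IS} {κ t v w : ℕ} (hc : Corr pp β β' κ v w) (hb : ¬ s.Bad pp β β')
    (hne : look s.db (κ, t, v) ≠ 0) : s.orc pp β β' t w = look s.db (κ, t, v) := by
  unfold IS.orc
  rcases hc with ⟨rfl, rfl⟩ | ⟨rfl, h1, h2, rfl⟩ | ⟨rfl, h1, h2, rfl⟩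
  · rw [if_pos hne]
  · rw [if_neg (fun h => hb ⟨t, w, h1, h2, .inl ⟨h, hne⟩⟩), if_pos ⟨h1, h2⟩, if_pos hne]
  · rw [if_neg (fun h => hb ⟨t, w, h1, h2, .inr (.inl ⟨h, hne⟩)⟩), if_pos ⟨h1, h2⟩,
      if_neg (fun h => hb ⟨t, w, h1, h2, .inr (.inr ⟨h, hne⟩)⟩)]

/-- If the point had a value in another table, the new entry would make the state bad. -/
theorem orc_zero {s : IS} {κ t v w h : ℕ} (hc : Corr pp β β' κ v w)
    (hb : ¬ (s.put (κ, t, v) h).Bad pp β β') (h0 : look s.db (κ, t, v) = 0) :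
    s.orc pp β β' t w = 0 := by
  have h1 : look (s.put (κ, t, v) h).db (κ, t, v) ≠ 0 := by
    rw [IS.put_db, look_cons_self, if_pos h0]; simp
  have key : ∀ k, look s.db k ≠ 0 → look (s.put (κ, t, v) h).db k ≠ 0 := fun k hk => by
    rwa [IS.put_db, look_cons_of_look hk]
  by_contra hne
  unfold IS.orc at hne
  split_ifs at hne with h5 he h6
  · rcases hc with ⟨rfl, rfl⟩ | ⟨rfl, h3, h2, rfl⟩ | ⟨rfl, h3, h2, rfl⟩
    · exact h5 h0
    · exact hb ⟨t, w, h3, h2, .inl ⟨key _ h5, h1⟩⟩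
    · exact hb ⟨t, w, h3, h2, .inr (.inl ⟨key _ h5, h1⟩)⟩
  · rcases hc with ⟨rfl, rfl⟩ | ⟨rfl, h3, h2, rfl⟩ | ⟨rfl, h3, h2, rfl⟩
    · exact hb ⟨t, v, he.1, he.2, .inl ⟨h1, key _ h6⟩⟩
    · exact h6 h0
    · exact hb ⟨t, w, h3, h2, .inr (.inr ⟨key _ h6, h1⟩)⟩
  · rcases hc with ⟨rfl, rfl⟩ | ⟨rfl, h3, h2, rfl⟩ | ⟨rfl, h3, h2, rfl⟩
    · exact hb ⟨t, v, he.1, he.2, .inr (.inl ⟨h1, key _ hne⟩)⟩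
    · exact hb ⟨t, w, h3, h2, .inr (.inr ⟨h1, key _ hne⟩)⟩
    · exact hne h0
  · exact hne rfl

/-- By injectivity of the powers with exponents `β` and `β'`, a new entry concerns one point of the
real oracle only. -/
theorem orc_other (hβ : ¬ pp.q ∣ β) (hβ' : ¬ pp.q ∣ β') {s : IS} {κ t v w h t' w' : ℕ}
    (hc : Corr pp β β' κ v w) (hne : (t', w') ≠ (t, w)) :
    (s.put (κ, t, v) h).orc pp β β' t' w' = s.orc pp β β' t' w' := by
  have h5 : look (s.put (κ, t, v) h).db (5, t', w') = look s.db (5, t', w') := by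
    refine look_cons_of_ne ?_
    rcases hc with ⟨rfl, rfl⟩ | ⟨rfl, h3, h2, rfl⟩ | ⟨rfl, h3, h2, rfl⟩ <;> simp_all
    rintro rfl h
    exact hne rfl h.symm
  unfold IS.orc
  rw [h5]
  by_cases he : pp.IsElt w' ∧ w' ≠ 1
  swap
  · simp only [if_neg he]
  have h6 : look (s.put (κ, t, v) h).db (6, t', w' ^ β % pp.p)
      = look s.db (6, t', w' ^ β % pp.p) := by
    refine look_cons_of_ne fun h => ?_
    simp only [Prod.mk.injEq] at h
    obtain ⟨rfl, rfl, h⟩ := h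
    rcases hc with ⟨h', -⟩ | ⟨-, h3, h2, rfl⟩ | ⟨h', -⟩ <;> try simp at h'
    exact hne (by rw [pp.pow_inj hβ h3 he.1 h])
  have h7 : look (s.put (κ, t, v) h).db (7, t', w' ^ β' % pp.p)
      = look s.db (7, t', w' ^ β' % pp.p) := by
    refine look_cons_of_ne fun h => ?_
    simp only [Prod.mk.injEq] at h
    obtain ⟨rfl, rfl, h⟩ := h
    rcases hc with ⟨h', -⟩ | ⟨h', -⟩ | ⟨-, h3, h2, rfl⟩ <;> try simp at h'
    exact hne (by rw [pp.pow_inj hβ' h3 he.1 h])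
  rw [h6, h7]

/-- The answer of an oracle, given the random value used if it is new. -/
def Sys.hashR (S : Sys) (t v h : ℕ) : ℕ × Sys :=
  match S.oracle (t, v) with
  | some z => (z, S)
  | none => (h, { S with oracle := Function.update S.oracle (t, v) (some h) })

theorem Sys.hash_eq (S : Sys) (len t v : ℕ) :
    S.hash len t v = (unif (2 ^ len)).map (S.hashR t v) := by
  unfold Sys.hash Sys.hashR
  cases S.oracle (t, v) with
  | none => rfl
  | some z => exact (PMF.map_const _ _).symm

theorem closed_put_of_ne {s : IS} {k : ℕ × ℕ × ℕ} {v i : ℕ} (h : k ≠ (3, i, 0)) :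
    (s.put k v).closed i = s.closed i := by
  have : look (s.put k v).db (3, i, 0) = look s.db (3, i, 0) := look_cons_of_ne h
  simp only [IS.closed, this]
  rfl

theorem session_put_hash {s : IS} {k : ℕ × ℕ × ℕ} {v i : ℕ} (h2 : k.1 ≠ 2) (h3 : k.1 ≠ 3) :
    (s.put k v).session pp β β' i = s.session pp β β' i := by
  have h4 : k ≠ (3, i, 0) := by rintro rfl; exact h3 rfl
  have h5 : (s.put k v).peer i = s.peer i := peer_put_of_ne (by rintro rfl; exact h2 rfl)
  have h6 : look (s.put k v).db (3, i, 0) = look s.db (3, i, 0) := look_cons_of_ne h4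
  unfold IS.session
  rw [h5, h6, closed_put_of_ne h4, IS.put_sess]

/-- Without a bad state, a key is new in its table exactly if the point is new for the real oracle,
so the same random value `h` produces the same answer and corresponding states. -/
theorem hashR_sys (hβ : ¬ pp.q ∣ β) (hβ' : ¬ pp.q ∣ β') {s : IS} {κ t v w h : ℕ}
    (hc : Corr pp β β' κ v w) (hb : ¬ (s.put (κ, t, v) h).Bad pp β β') :
    (s.sys pp γ β β').hashR t w h
      = ((s.put (κ, t, v) h).get (κ, t, v), (s.put (κ, t, v) h).sys pp γ β β') := by
  have hκ2 : κ ≠ 2 := by rcases hc with h | h | h <;> omega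
  have hκ3 : κ ≠ 3 := by rcases hc with h | h | h <;> omega
  have hb' : ¬ s.Bad pp β β' := fun h' => hb (h'.mono (List.suffix_cons _ _))
  have h1 : look (s.put (κ, t, v) h).db (κ, t, v) ≠ 0 := by
    rw [IS.put_db, look_cons_self]; split_ifs <;> simp_all
  have ho : (s.put (κ, t, v) h).sys pp γ β β' = { s.sys pp γ β β' with
      oracle := fun x => optNat ((s.put (κ, t, v) h).orc pp β β' x.1 x.2) } := by
    simp only [IS.sys, IS.put_groups, IS.put_nodes, IS.put_cor, IS.put_ss, IS.put_tst]
    congr 1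
    exact List.map_congr_left fun i _ => session_put_hash hκ2 hκ3
  unfold Sys.hashR
  have hS : (s.sys pp γ β β').oracle (t, w) = optNat (s.orc pp β β' t w) := rfl
  rw [hS]
  by_cases h0 : look s.db (κ, t, v) = 0
  · rw [orc_zero hc hb h0]
    simp only [optNat, IS.get]
    rw [ho, IS.put_db, look_cons_self, if_pos h0]
    congr 2
    funext x
    obtain ⟨t', w'⟩ := x
    by_cases hx : (t', w') = (t, w)
    · rw [hx, Function.update_self]
      simp only
      cases hx
      rw [orc_eq hc hb h1, IS.put_db, look_cons_self, if_pos h0]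
      rfl
    · rw [Function.update_of_ne hx]
      simp only [orc_other hβ hβ' hc hx]
      rfl
  · rw [orc_eq hc hb' h0]
    obtain ⟨z, hz⟩ := Nat.exists_eq_succ_of_ne_zero h0
    rw [hz]
    simp only [optNat, IS.get]
    rw [ho, IS.put_db, look_cons_of_look h0, hz]
    have hf : (fun x : ℕ × ℕ => optNat ((s.put (κ, t, v) h).orc pp β β' x.1 x.2))
        = (s.sys pp γ β β').oracle := by
      funext x
      obtain ⟨t', w'⟩ := x
      by_cases hx : (t', w') = (t, w)
      · cases hx
        simp only
        rw [orc_eq hc hb h1, IS.put_db, look_cons_of_look h0, hS, orc_eq hc hb' h0]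
      · simp only [orc_other hβ hβ' hc hx]
        rfl
    rw [hf]
    rfl

/-- The real secret is `w = u^(e/β)`, and `w^β = u^e` is computed without `β`. The neutral element
can be recognised without `β` too, as `w = 1` exactly if `u^e = 1`; it is therefore left to the
public table, and the private ones contain only points that determine exponents. -/
theorem key_corr (hβ : ¬ pp.q ∣ β) (hβ' : ¬ pp.q ∣ β') (s : IS) (k u t : ℕ) (hu : pp.IsElt u) :
    ∃ κ v, s.key (pp.ctx γ) k u t = (κ, t, v) ∧
      Corr pp β β' κ v (u ^ (s.session pp β β' k).exp % pp.p) := by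
  refine ⟨_, _, rfl, ?_⟩
  have hz : s.zed (pp.ctx γ) k u = u ^ (s.sess k).exp % pp.p := pp.pm_p _ _
  rw [hz]
  obtain ⟨r, hr, rfl⟩ := pp.isElt_iff.mp hu
  set e := (s.sess k).exp
  -- The factor `b` cancels against its inverse in the exponent of the session.
  have key : ∀ b, ¬ pp.q ∣ b →
      (pp.gp r ^ (e * pp.inv b % pp.q) % pp.p) ^ b % pp.p = pp.gp r ^ e % pp.p := by
    intro b hb
    rw [pp.gp_pow, pp.gp_pow, pp.gp_pow, pp.gp_eq_iff]
    calc r * (e * pp.inv b % pp.q) * b ≡ r * (e * pp.inv b) * b [MOD pp.q] :=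
          ((Nat.mod_modEq _ _).mul_left r).mul_right b
      _ = r * e * (b * pp.inv b) := by ring
      _ ≡ r * e * 1 [MOD pp.q] := (pp.mul_inv hb).mul_left _
      _ = r * e := by ring
  have key1 : ∀ b, ¬ pp.q ∣ b → pp.gp r ^ e % pp.p = 1 →
      pp.gp r ^ (e * pp.inv b % pp.q) % pp.p = 1 := by
    intro b hb h
    have h' := key b hb
    rw [h, ← pp.gp_zero, pp.gp_pow, pp.gp_pow, pp.gp_eq_iff] at h'
    rw [pp.gp_pow, ← pp.gp_zero, pp.gp_eq_iff]
    refine Nat.ModEq.cancel_right_of_coprime (pp.coprime hb) (h'.trans ?_)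
    rw [zero_mul]
  have key2 : ∀ b, ¬ pp.q ∣ b → pp.gp r ^ e % pp.p ≠ 1 →
      pp.gp r ^ (e * pp.inv b % pp.q) % pp.p ≠ 1 := by
    intro b hb h h'
    have h'' := key b hb
    rw [h', one_pow, Nat.mod_eq_of_lt pp.prime_p.one_lt] at h''
    exact h h''.symm
  simp only [IS.session, SR.toSession, Corr]
  split_ifs with h0 h1 h2 h3
  · exact .inl ⟨rfl, rfl⟩
  · exact .inl ⟨rfl, by rw [h1, key1 _ hβ' h1]⟩
  · exact .inl ⟨rfl, by rw [h1, key1 _ hβ h1]⟩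
  · exact .inr (.inr ⟨rfl, by rw [pp.gp_pow]; exact pp.isElt_gp _, key2 _ hβ' h1, key _ hβ'⟩)
  · exact .inr (.inl ⟨rfl, by rw [pp.gp_pow]; exact pp.isElt_gp _, key2 _ hβ h1, key _ hβ⟩)

/-- The oracle at the secret of a run. -/
theorem hashR_key (hβ : ¬ pp.q ∣ β) (hβ' : ¬ pp.q ∣ β') {s : IS} {k u t h : ℕ} (hu : pp.IsElt u)
    (hb : ¬ (s.put (s.key (pp.ctx γ) k u t) h).Bad pp β β') :
    (s.sys pp γ β β').hashR t (u ^ (s.session pp β β' k).exp % pp.p) h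
      = ((s.put (s.key (pp.ctx γ) k u t) h).get (s.key (pp.ctx γ) k u t),
        (s.put (s.key (pp.ctx γ) k u t) h).sys pp γ β β') := by
  obtain ⟨κ, v, hk, hc⟩ := key_corr (γ := γ) hβ hβ' s k u t hu
  rw [hk] at hb ⊢
  exact hashR_sys hβ hβ' hc hb

theorem sys_put_oracle {s : IS} {i v t : ℕ} (hi : i = 2 ∨ i = 3) :
    (fun x : ℕ × ℕ => optNat ((s.put (i, t, 0) v).orc pp β β' x.1 x.2))
      = fun x => optNat (s.orc pp β β' x.1 x.2) := by
  funext x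
  unfold IS.orc
  have : ∀ κ t' w, 5 ≤ κ → look (s.put (i, t, 0) v).db (κ, t', w) = look s.db (κ, t', w) :=
    fun κ t' w h => look_cons_of_ne (by simp; omega)
  rw [this _ _ _ (by omega), this _ _ _ (by omega), this _ _ _ (by omega)]

theorem map_range_set {α : Type} {f f' : ℕ → α} {n k : ℕ}
    (h : ∀ i < n, i ≠ k → f' i = f i) :
    (List.range n).map f' = ((List.range n).map f).set k (f' k) := by
  refine List.ext_getElem (by simp) fun i h1 h2 => ?_
  simp only [List.getElem_map, List.getElem_range, List.getElem_set]
  split_ifs with hik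
  · rw [hik]
  · exact h i (by simpa using h1) (Ne.symm hik)

theorem sys_put_peer {s : IS} {k m : ℕ} (h0 : s.peer k = 0) :
    (s.put (2, k, 0) m).sys pp γ β β' = { s.sys pp γ β β' with
      sessions := (s.sys pp γ β β').sessions.set k
        { s.session pp β β' k with peer := some m } } := by
  have hl : ∀ j, look (s.put (2, k, 0) m).db (3, j, 0) = look s.db (3, j, 0) := fun j =>
    look_cons_of_ne (by simp)
  have hc : ∀ j, (s.put (2, k, 0) m).closed j = s.closed j := fun j => closed_put_of_ne (by simp)
  unfold IS.sys
  rw [sys_put_oracle (.inl rfl)]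
  simp only [IS.put_groups, IS.put_nodes, IS.put_cor, IS.put_ss, IS.put_tst]
  congr 1
  rw [map_range_set (f := s.session pp β β') (k := k)]
  · congr 1
    unfold IS.session
    rw [hl, hc, IS.put_sess, peer_put_self h0]
    rfl
  · intro i _ hik
    unfold IS.session
    rw [hl, hc, IS.put_sess, peer_put_of_ne (by simpa using Ne.symm hik)]

theorem sys_put_done {s : IS} {k b : ℕ} (h0 : s.closed k = 0) :
    (s.put (3, k, 0) b).sys pp γ β β' = { s.sys pp γ β β' with
      sessions := (s.sys pp γ β β').sessions.set k
        ((s.session pp β β' k).finish (decide (b = 1))) } := by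
  have h1 : look s.db (3, k, 0) = 0 := by
    by_contra h
    simp [IS.closed, h] at h0
  have h2 : look (s.put (3, k, 0) b).db (3, k, 0) = b + 1 := by
    rw [IS.put_db, look_cons_self, if_pos h1]
  have h3 : (s.put (3, k, 0) b).closed k = 1 := by
    rw [IS.closed, h2, if_neg (by simp)]
  have hp : ∀ j, (s.put (3, k, 0) b).peer j = s.peer j := fun j => peer_put_of_ne (by simp)
  unfold IS.sys
  rw [sys_put_oracle (.inr rfl)]
  simp only [IS.put_groups, IS.put_nodes, IS.put_cor, IS.put_ss, IS.put_tst]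
  congr 1
  rw [map_range_set (f := s.session pp β β') (k := k)]
  · congr 1
    unfold IS.session
    rw [h2, h3, hp, IS.put_sess]
    simp [SR.toSession, Session.finish]
  · intro i _ hik
    have hne : (3, k, 0) ≠ (3, i, 0) := by simpa using Ne.symm hik
    unfold IS.session
    rw [hp, IS.put_sess, closed_put_of_ne hne, IS.put_db, look_cons_of_ne hne]

theorem sys_sessions_getElem? (s : IS) (k : ℕ) : (s.sys pp γ β β').sessions[k]?
    = if k < s.ss.length then some (s.session pp β β' k) else none := by
  simp only [IS.sys, List.getElem?_map]
  split_ifs with h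
  · simp [h]
  · simp [Nat.le_of_not_lt h]

theorem sys_nodes_getElem? (s : IS) (i : ℕ) : (s.sys pp γ β β').nodes[i]?
    = if i < s.nodes.length then some (optNat (rnth s.nodes i 0)) else none := by
  simp only [IS.sys, List.getElem?_map]
  split_ifs with h
  · rw [reverse_getElem? 0 h]; rfl
  · simp [Nat.le_of_not_lt h]

/-- The random choices of a step. -/
noncomputable def draws (pp : Params) (len : ℕ) : PMF Dr :=
  (unif (pp.q - 1)).bind fun r1 => (unif pp.q).bind fun r2 => (unif (2 ^ len)).bind fun h1 =>
    (unif (2 ^ len)).bind fun h2 => PMF.pure ⟨r1, r2, pp.gp r2, h1, h2⟩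

theorem draws_map {α : Type} (len : ℕ) (f : Dr → α) : (draws pp len).map f =
    (unif (pp.q - 1)).bind fun r1 => (unif pp.q).bind fun r2 => (unif (2 ^ len)).bind fun h1 =>
      (unif (2 ^ len)).bind fun h2 => PMF.pure (f ⟨r1, r2, pp.gp r2, h1, h2⟩) := by
  simp [draws, PMF.map_bind, PMF.pure_map]

theorem map_eq_bind_pure {α β : Type} (p : PMF α) (f : α → β) :
    p.map f = p.bind fun a => PMF.pure (f a) := rfl

theorem hash_draws (S : Sys) (len t v : ℕ) :
    S.hash len t v = (draws pp len).map fun R => S.hashR t v R.h1 := by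
  rw [draws_map, Sys.hash_eq]
  simp [map_eq_bind_pure]

/-- The real step agrees with the ideal one, unless the latter leads to a bad state. -/
def Simulates (pp : Params) (γ β β' len : ℕ) (p : PMF (Data × Sys)) (f : Dr → Data × IS) : Prop :=
  ∃ F : Dr → Data × Sys, p = (draws pp len).map F ∧ ∀ R, R.gx = pp.gp R.r2 →
    ¬ (f R).2.Bad pp β β' → F R = ((f R).1, (f R).2.sys pp γ β β')

theorem Simulates.pure {len : ℕ} {x : Data × Sys} {f : Dr → Data × IS}
    (h : ∀ R, ((f R).1, (f R).2.sys pp γ β β') = x) :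
    Simulates pp γ β β' len (PMF.pure x) f :=
  ⟨fun _ => x, (PMF.map_const _ _).symm, fun R _ _ => (h R).symm⟩

theorem Simulates.deliver (hβ : ¬ pp.q ∣ β) (hβ' : ¬ pp.q ∣ β') {s : IS} (h : Inv pp γ s)
    (len k m : ℕ) : Simulates pp γ β β' len ((s.sys pp γ β β').deliver pp len k m)
      (s.deliver (pp.ctx γ) k m) := by
  unfold Sys.deliver
  rw [sys_sessions_getElem?]
  by_cases hk : k < s.ss.length
  swap
  · rw [if_neg hk]
    exact .pure fun R => by simp [IS.deliver, hk]
  rw [if_pos hk]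
  simp only
  have hcl : (s.session pp β β' k).closed = decide (s.closed k ≠ 0) := rfl
  by_cases hc : s.closed k = 0
  swap
  · rw [if_pos (by simpa [hcl] using hc)]
    exact .pure fun R => by simp [IS.deliver, hk, hc]
  rw [if_neg (by simpa [hcl] using hc)]
  have hpe : (s.session pp β β' k).peer = optNat (s.peer k) := rfl
  by_cases hp : s.peer k = 0
  · rw [hpe, hp]
    simp only [optNat]
    by_cases hm : pp.IsElt m
    · rw [if_pos hm, hash_draws (pp := pp)]
      refine ⟨_, PMF.map_comp _ _ _, fun R _ hb => ?_⟩
      have hd : s.deliver (pp.ctx γ) k m R =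
          (.num (((s.put (2, k, 0) m).put (s.key (pp.ctx γ) k m 4) R.h1).get
            (s.key (pp.ctx γ) k m 4)), (s.put (2, k, 0) m).put (s.key (pp.ctx γ) k m 4) R.h1) := by
        simp [IS.deliver, hk, hc, hp, eltN_eq_one.mpr hm]
      rw [hd] at hb ⊢
      have h1 := hashR_key (γ := γ) hβ hβ' (s := s.put (2, k, 0) m) (k := k) (t := 4) hm hb
      have hx : ((s.put (2, k, 0) m).session pp β β' k).exp = (s.session pp β β' k).exp := rfl
      rw [hx, IS.put_key, sys_put_peer hp] at h1
      simp only [Function.comp]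
      unfold Sys.hashR at h1 ⊢
      simp only at h1 ⊢
      cases ho : (s.sys pp γ β β').oracle (4, m ^ (s.session pp β β' k).exp % pp.p) with
      | none => rw [ho] at h1; simp only [Prod.mk.injEq] at h1 ⊢; rw [← h1.2, ← h1.1]; simp
      | some z => rw [ho] at h1; simp only [Prod.mk.injEq] at h1 ⊢; rw [← h1.2, ← h1.1]; simp
    · rw [if_neg hm]
      refine .pure fun R => ?_
      have : eltN (pp.ctx γ) m ≠ 1 := fun h => hm (eltN_eq_one.mp h)
      simp only [IS.deliver, hk, hc, hp, this, if_true, if_false]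
      rw [sys_put_done hc]
      have hd : (s.session pp β β' k).accepted = decide (look s.db (3, k, 0) = 2) := rfl
      have h1 : look s.db (3, k, 0) = 0 := by
        by_contra h
        simp [IS.closed, h] at hc
      simp [Session.finish, hd, h1, hpe, hp, optNat]
  · obtain ⟨u, hu⟩ := Nat.exists_eq_succ_of_ne_zero hp
    have hue : pp.IsElt u := by simpa [hu] using h.peer_elt k hk hp
    rw [hpe, hu]
    simp only [optNat]
    have hi : (s.session pp β β' k).initiator = decide ((s.sess k).v = 0) := rfl
    have hk1 : ∀ t, (s.key (pp.ctx γ) k u t).1 ≠ 2 ∧ (s.key (pp.ctx γ) k u t).1 ≠ 3 := fun t => by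
      have := key_fst (pp.ctx γ) s k u t; omega
    have hcp : ∀ (s1 : IS) t v, (s1.put (s.key (pp.ctx γ) k u t) v).closed k = s1.closed k :=
      fun s1 t v => closed_put_of_ne fun h => (hk1 t).2 (by rw [h])
    by_cases hv : (s.sess k).v = 0
    · rw [if_pos (by simpa [hi] using hv), hash_draws (pp := pp)]
      refine ⟨_, PMF.map_comp _ _ _, fun R _ hb => ?_⟩
      have hd : s.deliver (pp.ctx γ) k m R =
          (.num 0, (s.put (s.key (pp.ctx γ) k u 5) R.h1).put (3, k, 0)
          (if m = (s.put (s.key (pp.ctx γ) k u 5) R.h1).get (s.key (pp.ctx γ) k u 5)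
            then 1 else 0)) := by
        simp only [IS.deliver, hk, hc, hv, if_true, if_neg hp]
        simp only [hu, Nat.succ_sub_one]
      rw [hd] at hb ⊢
      have h1 := hashR_key (γ := γ) hβ hβ' (s := s) (k := k) (t := 5) hue
        (fun h => hb (h.mono (List.suffix_cons _ _)))
      simp only [Function.comp, h1]
      rw [sys_put_done (s := s.put (s.key (pp.ctx γ) k u 5) R.h1) (by rw [hcp, hc]),
        session_put_hash (hk1 5).1 (hk1 5).2]
      congr 4
      split_ifs <;> simp_all
    · rw [if_neg (by simpa [hi] using hv)]
      have hd : ∀ R, s.deliver (pp.ctx γ) k m R =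
          (.num (((s.put (s.key (pp.ctx γ) k u 4) R.h1).put
            (s.key (pp.ctx γ) k u 5) R.h2).get (s.key (pp.ctx γ) k u 5)),
          ((s.put (s.key (pp.ctx γ) k u 4) R.h1).put (s.key (pp.ctx γ) k u 5) R.h2).put
            (3, k, 0)
            (if m = (s.put (s.key (pp.ctx γ) k u 4) R.h1).get (s.key (pp.ctx γ) k u 4)
              then 1 else 0)) := by
        intro R
        simp only [IS.deliver, hk, hc, if_true, if_neg hp, if_neg hv]
        simp only [hu, Nat.succ_sub_one]
      refine ⟨fun R => (fun z : ℕ × Sys => (fun w : ℕ × Sys =>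
        (Data.num w.1, { w.2 with
          sessions := w.2.sessions.set k ((s.session pp β β' k).finish (decide (m = z.1))) }))
        (z.2.hashR 5 (u ^ (s.session pp β β' k).exp % pp.p) R.h2))
        ((s.sys pp γ β β').hashR 4 (u ^ (s.session pp β β' k).exp % pp.p) R.h1), ?_,
        fun R _ hb => ?_⟩
      · rw [draws_map, Sys.hash_eq]
        simp only [Sys.hash_eq, map_eq_bind_pure, PMF.bind_bind, PMF.pure_bind]
        -- The choices `r1` and `r2` play no role here and average out.
        exact ((PMF.bind_const _ _).trans (PMF.bind_const _ _)).symm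
      · rw [hd] at hb ⊢
        have h1 := hashR_key (γ := γ) hβ hβ' (s := s) (k := k) (t := 4) hue
          (fun h => hb (h.mono ((List.suffix_cons _ _).trans (List.suffix_cons _ _))))
        have h2 := hashR_key (γ := γ) hβ hβ' (s := s.put (s.key (pp.ctx γ) k u 4) R.h1)
          (k := k) (t := 5) hue (fun h => hb (h.mono (List.suffix_cons _ _)))
        rw [session_put_hash (hk1 4).1 (hk1 4).2, IS.put_key] at h2
        simp only [h1, h2]
        rw [sys_put_done (s := (s.put (s.key (pp.ctx γ) k u 4) R.h1).put (s.key (pp.ctx γ) k u 5) R.h2)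
            (by rw [hcp, hcp, hc]), session_put_hash (hk1 5).1 (hk1 5).2,
          session_put_hash (hk1 4).1 (hk1 4).2]
        congr 4
        split_ifs <;> simp_all

end Handshake

/-! ### The remaining queries of the real system, expressed by the ideal one. -/

namespace Handshake

variable {pp : Params} {γ β β' : ℕ}

theorem Simulates.reveal (hβ : ¬ pp.q ∣ β) (hβ' : ¬ pp.q ∣ β') {s : IS} (h : Inv pp γ s)
    (len k : ℕ) : Simulates pp γ β β' len ((s.sys pp γ β β').reveal pp len k)
      (s.reveal (pp.ctx γ) k) := by
  unfold Sys.reveal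
  rw [sys_sessions_getElem?]
  by_cases hk : k < s.ss.length
  swap
  · rw [if_neg hk]
    exact .pure fun R => by simp [IS.reveal, hk]
  rw [if_pos hk]
  simp only
  have hpe : (s.session pp β β' k).peer = optNat (s.peer k) := rfl
  by_cases hp : s.peer k = 0
  · rw [hpe, hp]
    exact .pure fun R => by simp [IS.reveal, hk, hp]
  · obtain ⟨u, hu⟩ := Nat.exists_eq_succ_of_ne_zero hp
    have hue : pp.IsElt u := by simpa [hu] using h.peer_elt k hk hp
    rw [hpe, hu]
    simp only [optNat]
    rw [hash_draws (pp := pp)]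
    refine ⟨_, PMF.map_comp _ _ _, fun R _ hb => ?_⟩
    have hd : s.reveal (pp.ctx γ) k R = (.pair (.num ((s.put (s.key (pp.ctx γ) k u 3) R.h1).get
        (s.key (pp.ctx γ) k u 3))) (.num (if look s.db (3, k, 0) = 2 then 1 else 0)),
        s.put (s.key (pp.ctx γ) k u 3) R.h1) := by
      simp [IS.reveal, hk, hu]
    rw [hd] at hb ⊢
    have h1 := hashR_key (γ := γ) hβ hβ' (s := s) (k := k) (t := 3) hue hb
    simp only [Function.comp, h1]
    have ha : (s.session pp β β' k).accepted = decide (look s.db (3, k, 0) = 2) := rfl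
    rw [ha]
    simp [Data.ofBool]

theorem isTarget_sys (s : IS) (a : ℕ) : (s.sys pp γ β β').isTarget (optNat a) = true ↔
    s.tst ≠ 0 ∧ a = γ + 1 := by
  unfold Sys.isTarget
  simp only [IS.sys]
  by_cases h : s.tst = 0
  · simp [h]
  · cases a <;> simp [h, optNat]

theorem Inv.closed_test {s : IS} (h : Inv pp γ s) (ht : s.tst ≠ 0) :
    s.closed (s.tst - 1) ≠ 0 ↔ look s.db (3, s.tst - 1, 0) ≠ 0 := by
  have h1 : s.tst - 1 < s.ss.length := by have := h.tst_le; omega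
  have h2 : (s.sess (s.tst - 1)).kind = 2 := (h.kind_two _ h1).mpr (by omega)
  simp [IS.closed, h2]

theorem Inv.testRunning_sys {s : IS} (h : Inv pp γ s) :
    (s.sys pp γ β β').testRunning = true ↔ s.running = 1 := by
  unfold Sys.testRunning IS.running
  have ht : (s.sys pp γ β β').test = if s.tst = 0 then none else some (s.tst - 1, γ) := rfl
  rw [ht]
  by_cases h0 : s.tst = 0
  · simp [h0]
  · have h1 : s.tst - 1 < s.ss.length := by have := h.tst_le; omega
    simp only [h0, if_false, sys_sessions_getElem?, h1, if_true]
    have h2 := h.closed_test h0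
    have h3 : (s.session pp β β' (s.tst - 1)).closed = decide (s.closed (s.tst - 1) ≠ 0) := rfl
    rw [h3]
    by_cases h4 : look s.db (3, s.tst - 1, 0) = 0
    · have : s.closed (s.tst - 1) = 0 := by by_contra h; exact h2.mp h h4
      simp [h4, this]
    · simp [h4, h2.mpr h4]

theorem getD_groups (s : IS) {G : ℕ} (h : G ≠ γ) :
    (s.sys pp γ β β').groups.getD G 0 = rnth s.groups G 0 := by
  simp [IS.sys, rnth, List.getD_eq_getElem?_getD, Ne.symm h]

theorem getD_groups_self (s : IS) (h : γ < s.groups.length) :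
    (s.sys pp γ β β').groups.getD γ 0 = pp.gp β := by
  simp [IS.sys, List.getD_eq_getElem?_getD, h]

theorem sys_mk (s : IS) (g n c : List ℕ) :
    (IS.mk g n s.ss s.tst s.db c).sys pp γ β β' = ⟨g.reverse.set γ (pp.gp β),
      n.reverse.map optNat, c, (s.sys pp γ β β').sessions, (s.sys pp γ β β').test,
      (s.sys pp γ β β').oracle⟩ := rfl

theorem foldl_secrets (l : List SR) (i : ℕ) (m : List (ℕ × ℕ)) :
    l.foldl (fun l r => if r.node = i then (r.base, r.exp) :: l else l) m
      = ((l.reverse.filter fun r => r.node = i).map fun r => (r.base, r.exp)) ++ m := by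
  induction l generalizing m with
  | nil => simp
  | cons r l ih =>
    simp only [List.foldl_cons, ih, List.reverse_cons, List.filter_append, List.map_append]
    by_cases h : r.node = i <;> simp [h]

theorem ofList_map_pair (l : List (ℕ × ℕ)) :
    Data.ofList (l.map fun r => .pair (.num r.1) (.num r.2)) = enc l := by
  induction l with
  | nil => rfl
  | cons r l ih => simp only [List.map_cons, Data.ofList, ih]; rfl

theorem reverse_eq_map_range (l : List SR) :
    l.reverse = (List.range l.length).map fun k => rnth l k .zero := by
  refine List.ext_getElem (by simp) fun i h1 h2 => ?_
  simp [rnth, List.getD_eq_getElem?_getD, (by simpa using h1 : i < l.length)]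

/-- A node outside of the target group has runs of kind `0` only, and for these generator and
exponent are stored as they really are. -/
theorem Inv.secrets {s : IS} (h : Inv pp γ s) {i : ℕ} (hi : rnth s.nodes i 0 ≠ γ + 1) :
    Data.ofList (((s.sys pp γ β β').sessions.filter fun r => r.node = i).map fun r =>
      .pair (.num r.base) (.num r.exp)) = enc (s.secrets i) := by
  rw [← ofList_map_pair, IS.secrets, foldl_secrets, reverse_eq_map_range]
  simp only [IS.sys, List.filter_map, List.map_map, List.append_nil]
  congr 1
  refine List.map_congr_left fun k hk => ?_
  simp only [List.mem_filter, List.mem_range, Function.comp, decide_eq_true_eq] at hk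
  have h1 : (s.sess k).node = i := hk.2
  have h0 : (s.sess k).kind = 0 := by
    by_contra h0
    exact hi (h1 ▸ (h.kind_iff k hk.1).mp h0)
  simp only [Function.comp, IS.session, SR.toSession, h0, if_true]
  rfl

/-- The secret of the target group would be revealed, or the test run is for another group. -/
def Abort (pp : Params) (γ : ℕ) (s : IS) (d : Data) : Prop :=
  qx d < s.nodes.length ∧ s.tst = 0 ∧ ((d.fst.toNat = 6 ∧ rnth s.nodes (qx d) 0 = γ + 1) ∨
    (d.fst.toNat = 3 ∧ ∃ G, G ≠ γ ∧ rnth s.nodes (qx d) 0 = G + 1 ∧ validFirst pp (optNat (qy d)) ∧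
      G ∉ s.cor))

/-- The systems can disagree only if a member of the target group is corrupted before the test run,
which `ha` excludes. -/
theorem Simulates.corrupt {s : IS} (h : Inv pp γ s) (len i : ℕ)
    (ha : i < s.nodes.length → rnth s.nodes i 0 = γ + 1 → s.tst ≠ 0) :
    Simulates pp γ β β' len ((s.sys pp γ β β').corrupt i) (fun _ => s.corrupt (pp.ctx γ) i) := by
  unfold Sys.corrupt
  rw [sys_nodes_getElem?]
  by_cases hi : i < s.nodes.length
  swap
  · rw [if_neg hi]
    exact .pure fun R => by simp [IS.corrupt, hi]
  rw [if_pos hi]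
  simp only
  by_cases hγ : rnth s.nodes i 0 = γ + 1
  · rw [if_pos ((isTarget_sys _ _).mpr ⟨ha hi hγ, hγ⟩)]
    exact .pure fun R => by simp [IS.corrupt, hγ, Params.ctx]
  · rw [if_neg (fun h => hγ ((isTarget_sys _ _).mp h).2)]
    refine .pure fun R => ?_
    rw [h.secrets hγ]
    unfold IS.corrupt
    rw [if_pos hi, if_neg (by simpa [Params.ctx] using hγ)]
    cases hn : rnth s.nodes i 0 with
    | zero => rw [sys_mk]; simp [optNat, IS.sys]
    | succ G =>
      have hG : G ≠ γ := by rintro rfl; exact hγ hn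
      have := getD_groups (pp := pp) (β := β) (β' := β') s hG
      simp only [optNat, Option.map_some, Option.getD_some, this]
      rw [sys_mk]
      simp [IS.sys]

theorem Simulates.newGroup {s : IS} (len : ℕ)
    (hl : s.groups.length ≠ γ) : Simulates pp γ β β' len
      (pp.randGenerator.map fun b => (.num (s.sys pp γ β β').groups.length,
        { s.sys pp γ β β' with groups := (s.sys pp γ β β').groups ++ [b] }))
      (fun R => (.num s.groups.length,
        ⟨pm pp.g (R.r1 + 1) pp.p :: s.groups, s.nodes, s.ss, s.tst, s.db, s.cor⟩)) := by
  refine ⟨fun R => (.num (s.sys pp γ β β').groups.length, { s.sys pp γ β β' with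
    groups := (s.sys pp γ β β').groups ++ [pp.gp (R.r1 + 1)] }), ?_, fun R _ _ => ?_⟩
  · rw [draws_map]
    simp [Params.randGenerator, map_eq_bind_pure, Params.gp]
  · simp only
    rw [sys_mk s (_ :: _), pp.pm_p, List.reverse_cons, List.set_append]
    simp only [List.length_reverse, Prod.mk.injEq]
    refine ⟨by simp [IS.sys], ?_⟩
    -- Either group `γ` exists already and lies in the old part of the list, or it does not and, as
    -- `hl` says that it is not the new one, nothing is replaced.
    split_ifs with h1
    · rfl
    · rw [List.set_eq_of_length_le (by simp; omega)]
      simp only [IS.sys]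
      rw [List.set_eq_of_length_le (by simp; omega)]
      rfl

/-- When group `γ` itself is created, the random secret of the ideal system is overwritten by the
one fixed in advance. -/
theorem newGroup_self {s : IS} (hl : s.groups.length = γ) (R : Dr) :
    ((.num s.groups.length, (IS.mk (pm pp.g (R.r1 + 1) pp.p :: s.groups) s.nodes s.ss s.tst s.db
      s.cor).sys pp γ β β') : Data × Sys) = (.num (s.sys pp γ β β').groups.length,
        { s.sys pp γ β β' with groups := (s.sys pp γ β β').groups ++ [pp.gp β] }) := by
  simp only [IS.sys, Prod.mk.injEq, List.length_set, List.length_reverse, true_and]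
  rw [List.reverse_cons, List.set_append, if_neg (by simp; omega)]
  simp only [List.length_reverse, hl, Nat.sub_self, List.set_cons_zero]
  rw [List.set_eq_of_length_le (by simp; omega)]
  rfl

theorem Simulates.newNode (s : IS) (len a : ℕ) : Simulates pp γ β β' len
    (if ∀ G ∈ (optNat a).toList, G < (s.sys pp γ β β').groups.length then
      PMF.pure (.num (s.sys pp γ β β').nodes.length,
        { s.sys pp γ β β' with nodes := (s.sys pp γ β β').nodes ++ [optNat a] })
      else (s.sys pp γ β β').refuse)
    (fun _ => if a < s.groups.length + 1 then
      (.num s.nodes.length, ⟨s.groups, a :: s.nodes, s.ss, s.tst, s.db, s.cor⟩) else (.num 0, s)) := by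
  have hc : (∀ G ∈ (optNat a).toList, G < (s.sys pp γ β β').groups.length) ↔
      a < s.groups.length + 1 := by
    cases a <;> simp [optNat, IS.sys]
  by_cases ha : a < s.groups.length + 1
  · rw [if_pos (hc.mpr ha)]
    refine .pure fun R => ?_
    rw [if_pos ha]
    simp only [sys_mk]
    simp [IS.sys]
  · rw [if_neg (fun h => ha (hc.mp h))]
    exact .pure fun R => by rw [if_neg ha]

/-- The run begun in the ideal system, in the real one. -/
theorem sys_opening {s : IS} (h : Inv pp γ s) {d : Data} (hd : opens (pp.ctx γ) s d ≠ 0)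
    (R : Dr) : (opening (pp.ctx γ) s d R).2.sys pp γ β β' = { s.sys pp γ β β' with
      test := if opens (pp.ctx γ) s d = 3 then some (s.ss.length, γ) else
        (s.sys pp γ β β').test
      sessions := (if opens (pp.ctx γ) s d = 3 then (s.sys pp γ β β').sessions.map fun r =>
          { r with
            closed := r.closed || decide ((s.sys pp γ β β').nodes[r.node]? = some (some γ)) }
        else (s.sys pp γ β β').sessions) ++
        [⟨qx d, (optNat (qy d)).isNone,
          if opens (pp.ctx γ) s d = 1 then baseOf (pp.ctx γ) s d R
            else if opens (pp.ctx γ) s d = 3 then pp.gp β' else pp.gp β,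
          if opens (pp.ctx γ) s d = 1 then R.r2
            else if opens (pp.ctx γ) s d = 3 then R.r2 * pp.inv β' % pp.q
              else R.r2 * pp.inv β % pp.q, optNat (qy d), false, false⟩] } := by
  obtain ⟨h1, h2, h3, h4, h5, h6, h7⟩ := opens_spec hd
  have hs : ∀ k < s.ss.length, (opening (pp.ctx γ) s d R).2.session pp β β' k =
      if opens (pp.ctx γ) s d = 3 then { s.session pp β β' k with
        closed := (s.session pp β β' k).closed ||
          decide ((s.sys pp γ β β').nodes[(s.session pp β β' k).node]? = some (some γ)) }
        else s.session pp β β' k := by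
    intro k hk
    -- When the test run begins there are no runs of kinds `2` and `3` yet, so the runs of members
    -- that the real system aborts are those of kind `1`, which the ideal one regards as closed from
    -- then on.
    have hnode : opens (pp.ctx γ) s d = 3 → ((s.sess k).kind = 1 ↔
        (s.sys pp γ β β').nodes[(s.sess k).node]? = some (some γ)) := by
      intro h8
      have h13 := h.kind_iff k hk
      have h14 := h.kind_two k hk
      have h15 := h.kind_three k hk
      have h16 := h.kind_le k hk
      have h17 := h6 h8
      rw [sys_nodes_getElem?, if_pos (h.node_lt k hk)]
      have h18 : some (optNat (rnth s.nodes (s.sess k).node 0)) = some (some γ) ↔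
          rnth s.nodes (s.sess k).node 0 = γ + 1 := by
        cases rnth s.nodes (s.sess k).node 0 <;> simp [optNat]
      rw [h18]
      omega
    unfold IS.session IS.closed
    rw [sess_opening_lt hk, peer_opening_lt hk, opening_db, opening_tst]
    by_cases h8 : opens (pp.ctx γ) s d = 3
    · have hn : (if look s.db (3, k, 0) = 0 then if (s.sess k).kind = 1 then
          if (if opens (pp.ctx γ) s d = 3 then s.ss.length + 1 else s.tst) = 0 then 0 else 1
            else 0 else 1) ≠ 0 ↔ (if look s.db (3, k, 0) = 0 then if (s.sess k).kind = 1 then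
          if s.tst = 0 then 0 else 1 else 0 else 1) ≠ 0 ∨ (s.sess k).kind = 1 := by
        rw [if_pos h8, if_neg (Nat.succ_ne_zero _)]
        split_ifs <;> simp_all
      replace hn := hn.trans (or_congr_right (hnode h8))
      simp only [h8, if_true] at hn ⊢
      simp only [SR.toSession, Session.mk.injEq, true_and]
      rw [Bool.eq_iff_iff, Bool.or_eq_true]
      exact decide_eq_true_iff.trans
        (hn.trans (or_congr decide_eq_true_iff.symm decide_eq_true_iff.symm))
    · simp [h8]
  have hn : (opening (pp.ctx γ) s d R).2.session pp β β' s.ss.length =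
      ⟨qx d, (optNat (qy d)).isNone,
          if opens (pp.ctx γ) s d = 1 then baseOf (pp.ctx γ) s d R
            else if opens (pp.ctx γ) s d = 3 then pp.gp β' else pp.gp β,
          if opens (pp.ctx γ) s d = 1 then R.r2
            else if opens (pp.ctx γ) s d = 3 then R.r2 * pp.inv β' % pp.q
              else R.r2 * pp.inv β % pp.q, optNat (qy d), false, false⟩ := by
    unfold IS.session IS.closed
    rw [sess_opening_self, h.peer_opening_self, opening_db, opening_tst, (h.look_ge _ le_rfl).2]
    have e1 : opens (pp.ctx γ) s d - 1 = 0 ↔ opens (pp.ctx γ) s d = 1 := by omega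
    have e2 : opens (pp.ctx γ) s d - 1 = 2 ↔ opens (pp.ctx γ) s d = 3 := by omega
    have e3 : (decide (qy d = 0)) = (optNat (qy d)).isNone := by cases qy d <;> simp [optNat]
    have e4 : (if opens (pp.ctx γ) s d - 1 = 1 then
      if (if opens (pp.ctx γ) s d = 3 then s.ss.length + 1 else s.tst) = 0 then 0 else 1
        else 0) = 0 := by
      split_ifs <;> omega
    simp only [SR.toSession, e1, e2, e3, if_true, e4]
    simp
    split_ifs <;> rfl
  unfold IS.sys
  rw [opening_groups, opening_nodes, opening_cor, opening_length, opening_tst]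
  simp only [Sys.mk.injEq, true_and]
  refine ⟨?_, ?_, ?_⟩
  · rw [List.range_succ, List.map_append, List.map_singleton, hn]
    congr 1
    rw [List.map_congr_left (fun k hk => hs k (List.mem_range.mp hk))]
    by_cases h8 : opens (pp.ctx γ) s d = 3
    · simp only [h8, if_true, List.map_map]; rfl
    · simp only [h8, if_false]
  · split_ifs <;> simp_all
  · funext x
    unfold IS.orc
    rw [opening_db]

/-- The member of the group begins the test run with the given secret. -/
noncomputable def Sys.openTest (pp : Params) (i : ℕ) (v : Option ℕ) (G : ℕ) (S : Sys) (b : ℕ) :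
    PMF (Data × Sys) :=
  Sys.openSession pp i b v { S with
    test := some (S.sessions.length, G)
    sessions := S.sessions.map fun r =>
      { r with closed := r.closed || decide (S.nodes[r.node]? = some (some G)) } }

/-- Multiplication by an invertible residue permutes the residues. So the exponent for the base
`g^b` is uniform if that for `g` is. -/
theorem unif_exp {b : ℕ} (hb : ¬ pp.q ∣ b) :
    (unif pp.q).map (fun r => r * pp.inv b % pp.q) = unif pp.q := by
  refine unif_map_perm pp.q_ne _ (fun r _ => Nat.mod_lt _ pp.q_pos) fun r hr r' hr' h => ?_
  have h1 : r ≡ r' [MOD pp.q] :=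
    Nat.ModEq.cancel_right_of_coprime (pp.coprime (pp.inv_not_dvd hb)) h
  rwa [Nat.ModEq, Nat.mod_eq_of_lt hr, Nat.mod_eq_of_lt hr'] at h1

theorem gp_exp {b : ℕ} (hb : ¬ pp.q ∣ b) (r : ℕ) :
    pp.gp b ^ (r * pp.inv b % pp.q) % pp.p = pp.gp r := by
  rw [pp.gp_pow, pp.gp_eq_iff]
  calc b * (r * pp.inv b % pp.q) ≡ b * (r * pp.inv b) [MOD pp.q] :=
        (Nat.mod_modEq _ _).mul_left _
    _ = r * (b * pp.inv b) := by ring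
    _ ≡ r * 1 [MOD pp.q] := (pp.mul_inv hb).mul_left _
    _ = r := by ring

theorem Simulates.start_zero {s : IS} (h : Inv pp γ s) (len : ℕ) {d : Data}
    (hd : opens (pp.ctx γ) s d = 1) : Simulates pp γ β β' len
      ((match optNat (rnth s.nodes (qx d) 0) with
        | none => pp.randGenerator
        | some G => PMF.pure ((s.sys pp γ β β').groups.getD G 0)).bind fun b =>
          (s.sys pp γ β β').openSession pp (qx d) b (optNat (qy d)))
      (opening (pp.ctx γ) s d) := by
  obtain ⟨h1, h2, h3, h4, h5, h6, h7⟩ := opens_spec (by omega : opens (pp.ctx γ) s d ≠ 0)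
  have hγ : ¬ rnth s.nodes (qx d) 0 = γ + 1 := fun h => h4.mpr h hd
  refine ⟨fun R => ((opening (pp.ctx γ) s d R).1, (opening (pp.ctx γ) s d R).2.sys pp γ β β'),
    ?_, fun R _ _ => rfl⟩
  have e : ∀ R, ((opening (pp.ctx γ) s d R).1, (opening (pp.ctx γ) s d R).2.sys pp γ β β') =
    ((.pair (.num (s.sys pp γ β β').sessions.length)
      (.num (baseOf (pp.ctx γ) s d R ^ R.r2 % pp.p)),
      { s.sys pp γ β β' with sessions := (s.sys pp γ β β').sessions ++
        [⟨qx d, (optNat (qy d)).isNone, baseOf (pp.ctx γ) s d R, R.r2, optNat (qy d),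
          false, false⟩] }) : Data × Sys) := by
    intro R
    rw [sys_opening h (by rw [hd]; decide)]
    simp only [hd, opening, if_true, ← pp.pm_p]
    simp [IS.sys, Params.ctx]
  simp only [e]
  rw [draws_map]
  unfold baseOf
  cases hn : rnth s.nodes (qx d) 0 with
  | zero =>
    simp only [optNat, if_true, Params.randGenerator, map_eq_bind_pure, PMF.bind_bind,
      PMF.pure_bind, Sys.openSession, PMF.bind_const]
    simp only [Params.ctx, pp.pm_p]
  | succ G =>
    have hG : G ≠ γ := by rintro rfl; exact hγ hn
    simp only [optNat, PMF.pure_bind, Nat.succ_ne_zero, if_false, getD_groups s hG,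
      Nat.add_sub_cancel, Sys.openSession, map_eq_bind_pure, PMF.bind_const]

/-- With exponent `r/β` for the base `g^β` the message sent is `g^r`, in which `β` no longer occurs.
-/
theorem Simulates.start_target (hβ : ¬ pp.q ∣ β) {s : IS} (h : Inv pp γ s) (len : ℕ) {d : Data}
    (hd : opens (pp.ctx γ) s d = 2 ∨ opens (pp.ctx γ) s d = 4) : Simulates pp γ β β' len
      ((s.sys pp γ β β').openSession pp (qx d) (pp.gp β) (optNat (qy d)))
      (opening (pp.ctx γ) s d) := by
  refine ⟨fun R => (.pair (.num (s.sys pp γ β β').sessions.length)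
      (.num (pp.gp β ^ (R.r2 * pp.inv β % pp.q) % pp.p)),
      { s.sys pp γ β β' with sessions := (s.sys pp γ β β').sessions ++
        [⟨qx d, (optNat (qy d)).isNone, pp.gp β, R.r2 * pp.inv β % pp.q, optNat (qy d),
          false, false⟩] }), ?_, fun R hR _ => ?_⟩
  · rw [draws_map]
    simp only [PMF.bind_const]
    unfold Sys.openSession
    -- The uniform exponent of the real run is rewritten as `r/β` with `r` uniform, to match the
    -- ideal choice `r`.
    conv_lhs => rw [← unif_exp hβ, PMF.map_comp]
    rfl
  · beta_reduce
    rw [sys_opening h (by intro h0; rw [h0] at hd; omega), gp_exp hβ, ← hR]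
    have e1 : opens (pp.ctx γ) s d ≠ 1 := by omega
    have e3 : opens (pp.ctx γ) s d ≠ 3 := by omega
    simp only [e1, e3, opening, if_false]
    simp [IS.sys]

theorem Simulates.test (hβ' : ¬ pp.q ∣ β') {s : IS} (h : Inv pp γ s) (len : ℕ) {d : Data}
    (hd : opens (pp.ctx γ) s d = 3) : Simulates pp γ β β' len
      ((s.sys pp γ β β').openTest pp (qx d) (optNat (qy d)) γ (pp.gp β'))
      (opening (pp.ctx γ) s d) := by
  refine ⟨fun R => (.pair (.num (s.sys pp γ β β').sessions.length)
      (.num (pp.gp β' ^ (R.r2 * pp.inv β' % pp.q) % pp.p)),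
      { s.sys pp γ β β' with
        test := some ((s.sys pp γ β β').sessions.length, γ)
        sessions := ((s.sys pp γ β β').sessions.map fun r => { r with
          closed := r.closed || decide ((s.sys pp γ β β').nodes[r.node]? = some (some γ)) }) ++
        [⟨qx d, (optNat (qy d)).isNone, pp.gp β', R.r2 * pp.inv β' % pp.q, optNat (qy d),
          false, false⟩] }), ?_, fun R hR _ => ?_⟩
  · rw [draws_map]
    simp only [PMF.bind_const]
    unfold Sys.openTest Sys.openSession
    conv_lhs => rw [← unif_exp hβ', PMF.map_comp]
    simp only [List.length_map]
    rfl
  · beta_reduce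
    rw [sys_opening h (by rw [hd]; decide), gp_exp hβ', ← hR]
    simp only [hd, opening]
    simp [IS.sys]

end Handshake

/-! ### Systems with the secrets fixed in advance, and the simulation of an arbitrary query. -/

namespace Handshake

open scoped ENNReal

/-- The system in which the honest member executes the test run for the groups given by `ro`. -/
noncomputable def envRo (pp : Params) (len : ℕ) (ro : ℕ → Bool) : Env Sys := fun S d =>
  S.answer pp len (ro (((S.nodes[qx d]?).getD none).getD 0)) d

/-- The test run begins, for group `γ`. -/
def TestOK (pp : Params) (γ : ℕ) (S : Sys) (d : Data) : Prop :=
  d.fst.toNat = 3 ∧ S.nodes[qx d]? = some (some γ) ∧ validFirst pp (optNat (qy d)) ∧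
    S.test = none ∧ γ ∉ S.corrupted

open Classical in
/-- Group `γ` has the given secret. -/
noncomputable def envGroup (pp : Params) (len : ℕ) (ro : ℕ → Bool) (γ b : ℕ) : Env Sys := fun S d =>
  if d.fst.toNat = 0 ∧ S.groups.length = γ then
    PMF.pure (.num S.groups.length, { S with groups := S.groups ++ [pp.gp b] })
  else envRo pp len ro S d

open Classical in
/-- Group `γ` and the test run for it have the given secrets. -/
noncomputable def envTest (pp : Params) (len : ℕ) (ro : ℕ → Bool) (γ b b' : ℕ) : Env Sys := fun S d =>
  if TestOK pp γ S d then S.openTest pp (qx d) (optNat (qy d)) γ (pp.gp b')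
  else envGroup pp len ro γ b S d

variable {pp : Params} {γ β β' : ℕ}

theorem decode_eq (d : Data) : Query.decode d = match d.fst.toNat with
  | 0 => some .newGroup
  | 1 => some (.newNode (optNat (qx d)))
  | 2 => some (.start (qx d) (optNat (qy d)))
  | 3 => some (.test (qx d) (optNat (qy d)))
  | 4 => some (.deliver (qx d) (qy d))
  | 5 => some (.reveal (qx d))
  | 6 => some (.corrupt (qx d))
  | 7 => some (.hash (qx d) (qy d))
  | _ => none := rfl

theorem opens_zero_of_tag {s : IS} {d : Data} (h2 : d.fst.toNat ≠ 2) (h3 : d.fst.toNat ≠ 3) :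
    opens (pp.ctx γ) s d = 0 := by
  unfold opens; split_ifs <;> simp_all

theorem Simulates.refuse {len : ℕ} {s : IS} {d : Data} (h0 : opens (pp.ctx γ) s d = 0)
    (ht : d.fst.toNat = 2 ∨ d.fst.toNat = 3) :
    Simulates pp γ β β' len (s.sys pp γ β β').refuse (s.step (pp.ctx γ) d) := by
  refine .pure fun R => ?_
  unfold IS.step IS.other
  rw [if_pos h0]
  rcases ht with h | h <;> simp [h]

theorem Simulates.start (hβ : ¬ pp.q ∣ β) {s : IS} (h : Inv pp γ s) (len : ℕ) {d : Data}
    (hd : d.fst.toNat = 2) : Simulates pp γ β β' len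
      ((s.sys pp γ β β').start pp (qx d) (optNat (qy d))) (s.step (pp.ctx γ) d) := by
  have hγ : (pp.ctx γ).γ = γ := rfl
  unfold Sys.start
  rw [sys_nodes_getElem?]
  by_cases hi : qx d < s.nodes.length
  swap
  · rw [if_neg hi]
    exact .refuse (by simp [opens, hi]) (.inl hd)
  rw [if_pos hi]
  simp only
  by_cases hv : validFirst pp (optNat (qy d))
  swap
  · rw [if_neg (fun h => hv h.1)]
    exact .refuse (by simp [opens, validN_eq_one, hv]) (.inl hd)
  by_cases hn : rnth s.nodes (qx d) 0 = γ + 1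
  · have ho : opens (pp.ctx γ) s d = if s.running = 1 then 0 else if s.tst = 0 then 2 else 4 := by
      simp [opens, hi, validN_eq_one, hv, hd, hn, hγ]
    by_cases hr : s.running = 1
    · have ht : s.tst ≠ 0 := by intro ht; simp [IS.running, ht] at hr
      rw [if_neg (fun h' => h'.2 ⟨(isTarget_sys s _).mpr ⟨ht, hn⟩, h.testRunning_sys.mpr hr⟩)]
      exact .refuse (by rw [ho, if_pos hr]) (.inl hd)
    · rw [if_pos ⟨hv, fun h' => hr (h.testRunning_sys.mp h'.2)⟩]
      rw [if_neg hr] at ho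
      simp only [hn, optNat]
      rw [getD_groups_self s (h.node_mem (hn ▸ rnth_mem hi))]
      have e : s.step (pp.ctx γ) d = opening (pp.ctx γ) s d := by
        funext R
        rw [IS.step, if_neg (by rw [ho]; split_ifs <;> decide)]
      rw [e]
      exact Simulates.start_target hβ h len (by rw [ho]; split_ifs <;> decide)
  · have ho : opens (pp.ctx γ) s d = 1 := by
      simp [opens, hi, validN_eq_one, hv, hd, hn, hγ]
    rw [if_pos ⟨hv, fun h' => hn ((isTarget_sys s _).mp h'.1).2⟩]
    have e : s.step (pp.ctx γ) d = opening (pp.ctx γ) s d := by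
      funext R
      rw [IS.step, if_neg (by rw [ho]; decide)]
    rw [e]
    have := Simulates.start_zero (β := β) (β' := β') h len ho
    cases hc : optNat (rnth s.nodes (qx d) 0) with
    | none => simpa only [hc] using this
    | some G => simpa only [hc, PMF.pure_bind] using this

theorem testOK_sys {s : IS} (h : Inv pp γ s) {d : Data} :
    TestOK pp γ (s.sys pp γ β β') d ↔ d.fst.toNat = 3 ∧ opens (pp.ctx γ) s d = 3 := by
  have hγ : (pp.ctx γ).γ = γ := rfl
  have h1 : (s.sys pp γ β β').test = none ↔ s.tst = 0 := by
    simp [IS.sys]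
  have h2 : (s.sys pp γ β β').nodes[qx d]? = some (some γ) ↔
      qx d < s.nodes.length ∧ rnth s.nodes (qx d) 0 = γ + 1 := by
    rw [sys_nodes_getElem?]
    cases rnth s.nodes (qx d) 0 <;> simp [optNat]
  have h3 : γ ∉ (s.sys pp γ β β').corrupted := h.cor
  unfold TestOK
  rw [h1, h2, ← validN_eq_one (γ := γ)]
  unfold opens
  split_ifs <;> simp_all

/-- A step of the real system, and one of the ideal system. -/
theorem Simulates.step (hβ : ¬ pp.q ∣ β) (hβ' : ¬ pp.q ∣ β') {s : IS} (h : Inv pp γ s) (len : ℕ)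
    (ro : ℕ → Bool) {d : Data} (ha : ¬ Abort pp γ s d) : Simulates pp γ β β' len
      (envTest pp len ro γ β β' (s.sys pp γ β β') d) (s.step (pp.ctx γ) d) := by
  unfold envTest
  by_cases ho3 : d.fst.toNat = 3
  · by_cases ho : opens (pp.ctx γ) s d = 3
    · rw [if_pos ((testOK_sys h).mpr ⟨ho3, ho⟩)]
      have e : s.step (pp.ctx γ) d = opening (pp.ctx γ) s d := by
        funext R
        rw [IS.step, if_neg (by rw [ho]; decide)]
      rw [e]
      exact .test hβ' h len ho
    · have hT : ¬ TestOK pp γ (s.sys pp γ β β') d := fun h' => ho ((testOK_sys h).mp h').2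
      have ho0 : opens (pp.ctx γ) s d = 0 := by
        unfold opens at ho ⊢; split_ifs at * <;> simp_all
      rw [if_neg hT, envGroup, if_neg (by simp [ho3]), envRo, Sys.answer, decode_eq, ho3]
      simp only
      -- A test that the ideal system does not begin is refused by the real one as well, unless it
      -- is for another group, which `ha` excludes. So it is irrelevant who would execute it.
      have e : ∀ r, (s.sys pp γ β β').startTest pp r (qx d) (optNat (qy d))
          = (s.sys pp γ β β').refuse := by
        intro r
        unfold Sys.startTest
        cases hn : (s.sys pp γ β β').nodes[qx d]? with
        | none => rfl
        | some a =>
          cases a with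
          | none => rfl
          | some G =>
            refine if_neg fun ⟨h1, h2, h3⟩ => ?_
            by_cases hG : G = γ
            · subst hG
              exact hT ⟨ho3, hn, h1, h2, h3⟩
            · rw [sys_nodes_getElem?] at hn
              split_ifs at hn with hi
              refine ha ⟨hi, by simpa [IS.sys] using h2, .inr ⟨ho3, G, hG, ?_, h1, h3⟩⟩
              cases hr : rnth s.nodes (qx d) 0 with
              | zero => simp [hr, optNat] at hn
              | succ G' => simpa [hr, optNat] using hn
      rw [e]
      exact .refuse ho0 (.inr ho3)
  rw [if_neg (fun h' => ho3 h'.1)]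
  by_cases ho2 : d.fst.toNat = 2
  · rw [envGroup, if_neg (by simp [ho2]), envRo, Sys.answer, decode_eq, ho2]
    exact .start hβ h len ho2
  have ho : s.step (pp.ctx γ) d = s.other (pp.ctx γ) d := by
    funext R
    rw [IS.step, if_pos (opens_zero_of_tag ho2 ho3)]
  rw [ho]
  by_cases h0 : d.fst.toNat = 0
  · have e : s.other (pp.ctx γ) d = fun R => (.num s.groups.length,
        ⟨pm pp.g (R.r1 + 1) pp.p :: s.groups, s.nodes, s.ss, s.tst, s.db, s.cor⟩) := by
      funext R; rw [IS.other, if_pos h0]; rfl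
    rw [e]
    have hl : (s.sys pp γ β β').groups.length = s.groups.length := by simp [IS.sys]
    by_cases hg : s.groups.length = γ
    · rw [envGroup, if_pos ⟨h0, by rw [hl, hg]⟩]
      exact .pure fun R => newGroup_self hg R
    · rw [envGroup, if_neg (by rw [hl]; exact fun h => hg h.2), envRo, Sys.answer, decode_eq, h0]
      exact .newGroup len hg
  rw [envGroup, if_neg (fun h => h0 h.1), envRo, Sys.answer, decode_eq]
  unfold IS.other
  simp only [if_neg h0]
  match hd : d.fst.toNat with
  | 0 => exact absurd hd h0
  | 1 => exact .newNode s len _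
  | 2 => exact absurd hd ho2
  | 3 => exact absurd hd ho3
  | 4 => exact .deliver hβ hβ' h len _ _
  | 5 => exact .reveal hβ hβ' h len _
  | 6 => exact .corrupt h len _ fun h1 h2 h3 => ha ⟨h1, h3, .inl ⟨hd, h2⟩⟩
  | 7 =>
    simp only
    rw [hash_draws (pp := pp)]
    refine ⟨_, PMF.map_comp _ _ _, fun R _ hb => ?_⟩
    have := hashR_sys (γ := γ) hβ hβ' (s := s) (.inl ⟨rfl, rfl⟩) hb
    simp only [Function.comp, this]
    simp
  | n + 8 => exact .pure fun R => by simp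

end Handshake

namespace Handshake

open scoped ENNReal

/-! ### What a step of the real system leaves unchanged -/

/-- The changes that a query makes. -/
structure Sys.Frame (S : Sys) (d : Data) (S' : Sys) : Prop where
  groups : S'.groups = S.groups ∨ (d.fst.toNat = 0 ∧ ∃ b, S'.groups = S.groups ++ [b])
  nodes : ∀ G, some G ∈ S'.nodes → some G ∈ S.nodes ∨ G < S.groups.length
  test : S.test ≠ none → S'.test = S.test
  corrupted : S.corrupted ⊆ S'.corrupted

theorem Sys.Frame.of_eq {S S' : Sys} {d : Data} (hg : S'.groups = S.groups) (hn : S'.nodes = S.nodes)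
    (ht : S'.test = S.test) (hc : S'.corrupted = S.corrupted) : S.Frame d S' :=
  ⟨.inl hg, fun G h => .inl (hn ▸ h), fun _ => ht, by rw [hc]; exact fun _ h => h⟩

theorem Sys.Frame.refl (S : Sys) (d : Data) : S.Frame d S := .of_eq rfl rfl rfl rfl

theorem hash_support {S : Sys} {len t v : ℕ} {z : ℕ × Sys} (hz : z ∈ (S.hash len t v).support) :
    ∃ o, z.2 = { S with oracle := o } := by
  unfold Sys.hash at hz
  split at hz
  · simp only [PMF.support_pure, Set.mem_singleton_iff] at hz
    exact ⟨S.oracle, by rw [hz]⟩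
  · simp only [PMF.support_map, Set.mem_image] at hz
    obtain ⟨h, -, rfl⟩ := hz
    exact ⟨_, rfl⟩

theorem openSession_support {pp : Params} {S : Sys} {i b : ℕ} {v : Option ℕ} {x : Data × Sys}
    (hx : x ∈ (S.openSession pp i b v).support) : ∃ l, x.2 = { S with sessions := l } := by
  unfold Sys.openSession at hx
  simp only [PMF.support_map, Set.mem_image] at hx
  obtain ⟨h, -, rfl⟩ := hx
  exact ⟨_, rfl⟩

theorem refuse_support {S : Sys} {x : Data × Sys} (hx : x ∈ S.refuse.support) : x.2 = S := by
  simp only [Sys.refuse, PMF.support_pure, Set.mem_singleton_iff] at hx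
  rw [hx]

theorem openTest_support {pp : Params} {S : Sys} {i b G : ℕ} {v : Option ℕ} {x : Data × Sys}
    (hx : x ∈ (S.openTest pp i v G b).support) :
    ∃ l, x.2 = { S with sessions := l, test := some (S.sessions.length, G) } := by
  obtain ⟨l, h⟩ := openSession_support hx
  exact ⟨l, h⟩

theorem startTest_support {pp : Params} {S : Sys} {r : Bool} {i : ℕ} {v : Option ℕ}
    {x : Data × Sys} (hx : x ∈ (S.startTest pp r i v).support) :
    x.2 = S ∨ (S.test = none ∧ ∃ l G, S.nodes[i]? = some (some G) ∧
      x.2 = { S with sessions := l, test := some (S.sessions.length, G) }) := by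
  unfold Sys.startTest at hx
  split at hx
  · rename_i G hG
    split_ifs at hx with h
    · rw [PMF.mem_support_bind_iff] at hx
      obtain ⟨b, -, hx⟩ := hx
      obtain ⟨l, h'⟩ := openSession_support hx
      exact .inr ⟨h.2.1, l, G, hG, h'⟩
    · rw [PMF.mem_support_bind_iff] at hx
      obtain ⟨b, -, hx⟩ := hx
      obtain ⟨l, h'⟩ := openSession_support hx
      exact .inr ⟨h.2.1, l, G, hG, h'⟩
    · exact .inl (refuse_support hx)
  · exact .inl (refuse_support hx)

theorem decode_newGroup {d : Data} (h : Query.decode d = some .newGroup) : d.fst.toNat = 0 := by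
  rw [decode_eq] at h
  split at h <;> first | assumption | simp at h

/-- These few facts are all that the passage between systems needs: groups are only appended, the
choice of the test is final, and corruption is never undone. -/
theorem answer_frame {pp : Params} {len : ℕ} {r : Bool} {S : Sys} {d : Data} {x : Data × Sys}
    (hx : x ∈ (S.answer pp len r d).support) : S.Frame d x.2 := by
  unfold Sys.answer at hx
  split at hx
  · rw [refuse_support hx]; exact .refl S d
  · simp only [PMF.support_map, Set.mem_image] at hx
    obtain ⟨b, -, rfl⟩ := hx
    rename_i hd
    exact ⟨.inr ⟨decode_newGroup hd, b, rfl⟩, fun G h => .inl h, fun _ => rfl, fun _ h => h⟩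
  · rename_i a _
    split_ifs at hx with h
    · simp only [PMF.support_pure, Set.mem_singleton_iff] at hx
      rw [hx]
      refine ⟨.inl rfl, fun G hG => ?_, fun _ => rfl, fun _ h => h⟩
      simp only [List.mem_append, List.mem_singleton] at hG
      refine hG.imp id fun hG => h G ?_
      simp [← hG]
    · rw [refuse_support hx]; exact .refl S d
  · unfold Sys.start at hx
    split at hx
    · rw [refuse_support hx]; exact .refl S d
    · split_ifs at hx
      · split at hx
        · rw [PMF.mem_support_bind_iff] at hx
          obtain ⟨b, -, hx⟩ := hx
          obtain ⟨l, h⟩ := openSession_support hx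
          rw [h]; exact .of_eq rfl rfl rfl rfl
        · obtain ⟨l, h⟩ := openSession_support hx
          rw [h]; exact .of_eq rfl rfl rfl rfl
      · rw [refuse_support hx]; exact .refl S d
  · rcases startTest_support hx with h | ⟨h0, l, G, -, h⟩
    · rw [h]; exact .refl S d
    · rw [h]; exact ⟨.inl rfl, fun G h => .inl h, fun h => absurd h0 h, fun _ h => h⟩
  · unfold Sys.deliver at hx
    split at hx
    · rw [refuse_support hx]; exact .refl S d
    · rename_i s₁ _
      by_cases hcl : s₁.closed = true
      · rw [if_pos hcl] at hx
        rw [refuse_support hx]; exact .refl S d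
      · rw [if_neg hcl] at hx
        split at hx
        · split_ifs at hx
          · simp only [PMF.support_map, Set.mem_image] at hx
            obtain ⟨z, hz, rfl⟩ := hx
            obtain ⟨o, ho⟩ := hash_support hz
            rw [ho]; exact .of_eq rfl rfl rfl rfl
          · simp only [PMF.support_pure, Set.mem_singleton_iff] at hx
            rw [hx]; exact .of_eq rfl rfl rfl rfl
        · split_ifs at hx
          · simp only [PMF.support_map, Set.mem_image] at hx
            obtain ⟨z, hz, rfl⟩ := hx
            obtain ⟨o, ho⟩ := hash_support hz
            rw [ho]; exact .of_eq rfl rfl rfl rfl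
          · rw [PMF.mem_support_bind_iff] at hx
            obtain ⟨z, hz, hx⟩ := hx
            simp only [PMF.support_map, Set.mem_image] at hx
            obtain ⟨w, hw, rfl⟩ := hx
            obtain ⟨o, ho⟩ := hash_support hz
            obtain ⟨o', ho'⟩ := hash_support hw
            rw [ho', ho]; exact .of_eq rfl rfl rfl rfl
  · unfold Sys.reveal at hx
    split at hx
    · rw [refuse_support hx]; exact .refl S d
    · split at hx
      · rw [refuse_support hx]; exact .refl S d
      · simp only [PMF.support_map, Set.mem_image] at hx
        obtain ⟨z, hz, rfl⟩ := hx
        obtain ⟨o, ho⟩ := hash_support hz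
        rw [ho]; exact .of_eq rfl rfl rfl rfl
  · unfold Sys.corrupt at hx
    split at hx
    · rw [refuse_support hx]; exact .refl S d
    · split_ifs at hx
      · rw [refuse_support hx]; exact .refl S d
      · simp only [PMF.support_pure, Set.mem_singleton_iff] at hx
        rw [hx]
        exact ⟨.inl rfl, fun G h => .inl h, fun _ => rfl,
          fun _ h => List.mem_append_right _ h⟩
  · simp only [PMF.support_map, Set.mem_image] at hx
    obtain ⟨z, hz, rfl⟩ := hx
    obtain ⟨o, ho⟩ := hash_support hz
    rw [ho]; exact .of_eq rfl rfl rfl rfl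

/-- A test of group `G` is possible only if there is such a group, and `G` is what the query
selects. -/
theorem answer_congr {pp : Params} {len : ℕ} {r r' : Bool} {S : Sys} {d : Data}
    (h : r = r' ∨ d.fst.toNat ≠ 3 ∨ ∀ G, S.nodes[qx d]? ≠ some (some G)) :
    S.answer pp len r d = S.answer pp len r' d := by
  rcases h with rfl | h
  · rfl
  unfold Sys.answer
  rw [decode_eq]
  match hd : d.fst.toNat with
  | 0 => rfl
  | 1 => rfl
  | 2 => rfl
  | 3 =>
    have h := h.resolve_left (fun h => h hd)
    simp only [Sys.startTest]
  | 4 => rfl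
  | 5 => rfl
  | 6 => rfl
  | 7 => rfl
  | n + 8 => rfl

theorem envGroup_frame {pp : Params} {len γ b : ℕ} {ro : ℕ → Bool} {S : Sys} {d : Data}
    {x : Data × Sys} (hx : x ∈ (envGroup pp len ro γ b S d).support) : S.Frame d x.2 := by
  unfold envGroup at hx
  split_ifs at hx with h
  · simp only [PMF.support_pure, Set.mem_singleton_iff] at hx
    rw [hx]
    exact ⟨.inr ⟨h.1, _, rfl⟩, fun G h => .inl h, fun _ => rfl, fun _ h => h⟩
  · exact answer_frame hx

theorem envTest_frame {pp : Params} {len γ b b' : ℕ} {ro : ℕ → Bool} {S : Sys} {d : Data}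
    {x : Data × Sys} (hx : x ∈ (envTest pp len ro γ b b' S d).support) : S.Frame d x.2 := by
  unfold envTest at hx
  split_ifs at hx with h
  · obtain ⟨l, h'⟩ := openTest_support hx
    rw [h']
    exact ⟨.inl rfl, fun G h => .inl h, fun h' => absurd h.2.2.2.1 h', fun _ h => h⟩
  · exact envGroup_frame hx

end Handshake

namespace Handshake

open scoped ENNReal

/-! ### The ideal experiment -/

/-- A configuration: commands to be executed, values of variables, the ideal system. -/
structure CF where
  K : List Cmd
  st : Store
  s : IS

/-- The range of the random number that the program needs next. -/
def CF.range (x : CF) : ℕ :=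
  match x.K with
  | .rand _ e :: _ => (e.eval x.st).toNat
  | _ => 1

/-- All randomness, that of the program and that of the ideal system, comes as an argument, so that
a step is a deterministic function, which a program can compute. A halted configuration does not
change. -/
def CF.next (c : Ctx) (x : CF) (r : ℕ) (R : Dr) : CF :=
  match x.K with
  | [] => x
  | .assign y e :: K => ⟨K, Function.update x.st y (e.eval x.st), x.s⟩
  | .rand y _ :: K => ⟨K, Function.update x.st y (.num r), x.s⟩
  | .call y e :: K => ⟨K, Function.update x.st y (x.s.step c (e.eval x.st) R).1,
      (x.s.step c (e.eval x.st) R).2⟩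
  | .seq a b :: K => ⟨a :: b :: K, x.st, x.s⟩
  | .ite e a b :: K => ⟨(if (e.eval x.st).toNat ≠ 0 then a else b) :: K, x.st, x.s⟩
  | .loop e a :: K => ⟨if (e.eval x.st).toNat ≠ 0 then a :: .loop e a :: K else K, x.st, x.s⟩

/-- One step of the ideal experiment. -/
noncomputable def tick (pp : Params) (len γ : ℕ) (x : CF) : PMF CF :=
  (unif x.range).bind fun r => (draws pp len).map (x.next (pp.ctx γ) r)

noncomputable def chain (pp : Params) (len γ : ℕ) : ℕ → CF → PMF CF
  | 0, x => PMF.pure x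
  | n + 1, x => (tick pp len γ x).bind (chain pp len γ n)

variable {pp : Params} {γ : ℕ}

theorem ev_tick (len : ℕ) (x : CF) (f : CF → ℝ≥0∞) : ev (tick pp len γ x) f =
    ev (unif x.range) fun r => ev (draws pp len) fun R => f (x.next (pp.ctx γ) r R) := by
  simp [tick]

theorem ev_chain_succ (len n : ℕ) (x : CF) (f : CF → ℝ≥0∞) : ev (chain pp len γ (n + 1) x) f =
    ev (tick pp len γ x) fun y => ev (chain pp len γ n y) f := by
  simp [chain]

/-- A run ends only in states that satisfy the invariants of a step. -/
theorem chain_invariant (len : ℕ) {P : CF → Prop}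
    (hP : ∀ x r R, P x → P (x.next (pp.ctx γ) r R)) :
    ∀ n x, P x → ∀ y ∈ (chain pp len γ n x).support, P y := by
  intro n
  induction n with
  | zero => intro x hx y hy; simp [chain] at hy; exact hy ▸ hx
  | succ n ih =>
    intro x hx y hy
    simp only [chain, tick, PMF.mem_support_bind_iff, PMF.support_map, Set.mem_image] at hy
    obtain ⟨z, ⟨r, -, R, -, rfl⟩, hy⟩ := hy
    exact ih _ (hP x r R hx) y hy

theorem next_cases {P : IS → Prop} (x : CF) (r : ℕ) (R : Dr) (h0 : P x.s)
    (h1 : ∀ d, P (x.s.step (pp.ctx γ) d R).2) : P (x.next (pp.ctx γ) r R).s := by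
  unfold CF.next
  split <;> first | exact h0 | exact h1 _

theorem next_db_suffix (x : CF) (r : ℕ) (R : Dr) :
    x.s.db <:+ (x.next (pp.ctx γ) r R).s.db ∧
      (x.next (pp.ctx γ) r R).s.db.length ≤ x.s.db.length + 3 :=
  next_cases (P := fun s => x.s.db <:+ s.db ∧ s.db.length ≤ x.s.db.length + 3) x r R
    ⟨List.suffix_rfl, by omega⟩ (fun d => step_db_suffix x.s d R)

theorem Inv.next {x : CF} (h : Inv pp γ x.s) (r : ℕ) (R : Dr) :
    Inv pp γ (x.next (pp.ctx γ) r R).s :=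
  next_cases x r R h fun d => h.step d R

theorem draws_gx {len : ℕ} {R : Dr} (hR : R ∈ (draws pp len).support) :
    R.gx = pp.gp R.r2 := by
  simp only [draws, PMF.mem_support_bind_iff, PMF.support_pure, Set.mem_singleton_iff] at hR
  obtain ⟨_, -, _, -, _, -, _, -, rfl⟩ := hR
  rfl

/-- States of the ideal system before the test run do not depend on the secret for the test run. -/
theorem Inv.sys_congr {s : IS} (h : Inv pp γ s) (ht : s.tst = 0) (b b₁ b₂ : ℕ) :
    s.sys pp γ b b₁ = s.sys pp γ b b₂ := by
  have hk : ∀ k < s.ss.length, (s.sess k).kind ≠ 2 := fun k hk h2 => by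
    have := (h.kind_two k hk).mp h2; omega
  have h7 : ∀ t z, look s.db (7, t, z) = 0 := by
    intro t z
    by_contra h'
    obtain ⟨k, hk', h2, -⟩ := h.key_seven t z h'
    exact hk k hk' h2
  unfold IS.sys
  simp only [Sys.mk.injEq, true_and]
  constructor
  · refine List.map_congr_left fun k hk' => ?_
    simp only [IS.session, SR.toSession, if_neg (hk k (List.mem_range.mp hk'))]
  · funext x
    simp only [IS.orc, h7]

theorem testOK_false {S : Sys} {d : Data} (h : γ ∈ S.corrupted ∨ S.test ≠ none) :
    ¬ TestOK pp γ S d := fun h' => h.elim h'.2.2.2.2 (fun h => h h'.2.2.2.1)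

/-- Once the test run for group `γ` is impossible, its secret does not matter. -/
theorem val_envTest_congr (len : ℕ) (ro : ℕ → Bool) (b b₁ b₂ : ℕ) (post) (n K st) (S : Sys)
    (hS : γ ∈ S.corrupted ∨ S.test ≠ none) :
    val (envTest pp len ro γ b b₁) post n K st S = val (envTest pp len ro γ b b₂) post n K st S := by
  refine val_congr post (fun _ S => γ ∈ S.corrupted ∨ S.test ≠ none) (fun _ _ h => h) ?_ n K st S hS
  intro n S d h
  constructor
  · unfold envTest
    rw [if_neg (testOK_false h), if_neg (testOK_false h)]
  · intro x hx
    have hf := envTest_frame hx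
    exact h.imp (fun h => hf.corrupted h) (fun h => by rwa [hf.test h])

/-- After such a query a member of `γ` is corrupted or the only test has been spent on another
group. Either way there will be no test run for `γ`, and its exponent `β'` has become irrelevant. -/
theorem abort_step {s : IS} {d : Data} (ha : Abort pp γ s d) (len : ℕ)
    (ro : ℕ → Bool) (b b₁ b₂ : ℕ) :
    envTest pp len ro γ b b₁ (s.sys pp γ b b₂) d = envGroup pp len ro γ b (s.sys pp γ b b₂) d ∧
      ∀ x ∈ (envGroup pp len ro γ b (s.sys pp γ b b₂) d).support,
        γ ∈ x.2.corrupted ∨ x.2.test ≠ none := by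
  obtain ⟨hi, ht, ha⟩ := ha
  have hn := sys_nodes_getElem? (pp := pp) (γ := γ) (β := b) (β' := b₂) s (qx d)
  rw [if_pos hi] at hn
  have htest : (s.sys pp γ b b₂).test = none := by simp [IS.sys, ht]
  rcases ha with ⟨h6, hγ⟩ | ⟨h3, G, hG, hr, hv, hc⟩
  · constructor
    · exact if_neg fun h' => by have := h'.1; omega
    · rw [envGroup, if_neg (by simp [h6]), envRo, Sys.answer, decode_eq, h6]
      simp only [Sys.corrupt]
      have hn' : (s.sys pp γ b b₂).nodes[qx d]? = some (some γ) := by rw [hn, hγ]; rfl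
      rw [hn']
      dsimp only
      rw [if_neg (by simp [Sys.isTarget, htest])]
      intro x hx
      simp only [PMF.support_pure, Set.mem_singleton_iff] at hx
      rw [hx]
      simp
  · rw [hr] at hn
    constructor
    · refine if_neg fun h' => ?_
      have := h'.2.1
      rw [hn] at this
      simp only [optNat, Option.some.injEq] at this
      exact hG this
    · rw [envGroup, if_neg (by simp [h3]), envRo, Sys.answer, decode_eq, h3]
      simp only [Sys.startTest]
      have hn' : (s.sys pp γ b b₂).nodes[qx d]? = some (some G) := by rw [hn]; rfl
      rw [hn']
      dsimp only
      rw [if_pos ⟨hv, htest, hc⟩]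
      intro x hx
      rw [PMF.mem_support_bind_iff] at hx
      obtain ⟨_, -, hx⟩ := hx
      obtain ⟨l, h'⟩ := openSession_support hx
      rw [h']
      simp

/-- The ideal system is a faithful picture of the real one for either secret of the test run, unless
it runs into a bad state. -/
theorem val_le_val_add_bad {b b₁ b₂ : ℕ} (hb : ¬ pp.q ∣ b) (hb₁ : ¬ pp.q ∣ b₁) (hb₂ : ¬ pp.q ∣ b₂)
    (len : ℕ) (ro : ℕ → Bool) {post : Option Data → ℝ≥0∞} (hpost : ∀ o, post o ≤ 1) :
    ∀ n K st s, Inv pp γ s →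
      val (envTest pp len ro γ b b₁) post n K st (s.sys pp γ b b₁) ≤
        val (envTest pp len ro γ b b₂) post n K st (s.sys pp γ b b₂) +
        ev (chain pp len γ n ⟨K, st, s⟩) fun y => ind (y.s.Bad pp b b₁ ∨ y.s.Bad pp b b₂) := by
  intro n
  induction n with
  | zero =>
    intro K st s _
    cases K with
    | nil => simp [val_nil]
    | cons c K => simp [val_zero]
  | succ n ih =>
    intro K st s h
    cases K with
    | nil => simp [val_nil]
    | cons c K =>
      rw [ev_chain_succ, ev_tick]
      cases c with
      | assign x e => simpa [val_assign, CF.range, CF.next] using ih K _ s h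
      | rand x e =>
        simp only [val_rand, CF.range, CF.next]
        rw [← ev_add]
        refine ev_mono fun r _ => ?_
        simpa using ih K _ s h
      | seq a c => simpa [val_seq, CF.range, CF.next] using ih _ st s h
      | ite e a c => simpa only [val_ite, CF.range, CF.next, ev_const] using ih _ st s h
      | loop e a => simpa only [val_loop, CF.range, CF.next, ev_const] using ih _ st s h
      | call x e =>
        simp only [val_call, CF.range, CF.next, ev_const]
        by_cases ha : Abort pp γ s (e.eval st)
        -- The ideal system loses its meaning here, but the two real systems coincide: before the
        -- test their states do not depend on `β'`, and afterwards it is never used.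
        · refine le_add_right (le_of_eq ?_)
          obtain ⟨h1, h2⟩ := abort_step ha len ro b b₁ b₁
          obtain ⟨h3, -⟩ := abort_step ha len ro b b₂ b₁
          rw [h.sys_congr ha.2.1 b b₂ b₁, h1, h3]
          exact ev_congr fun y hy => val_envTest_congr len ro b b₁ b₂ post _ _ _ _ (h2 y hy)
        · obtain ⟨F₁, hp₁, hF₁⟩ := Simulates.step hb hb₁ h len ro ha
          obtain ⟨F₂, hp₂, hF₂⟩ := Simulates.step hb hb₂ h len ro ha
          rw [hp₁, hp₂, ev_map, ev_map, ← ev_add]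
          refine ev_mono fun R hR => ?_
          by_cases hbad : (s.step (pp.ctx γ) (e.eval st) R).2.Bad pp b b₁ ∨
              (s.step (pp.ctx γ) (e.eval st) R).2.Bad pp b b₂
          -- A bad state stays bad, as tables only grow. So the second summand is already `1`, which
          -- bounds every value.
          · refine le_add_left ((ev_le fun o _ => hpost o).trans (le_ev fun y hy => ?_))
            rw [ind_true]
            have hs := chain_invariant (pp := pp) (γ := γ) len
              (P := fun y => (s.step (pp.ctx γ) (e.eval st) R).2.db <:+ y.s.db)
              (fun x r R hx => hx.trans (next_db_suffix x r R).1) _ _ List.suffix_rfl y hy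
            exact hbad.imp (fun h => h.mono hs) (fun h => h.mono hs)
          -- With the same random choices both real systems follow the same ideal step, so the
          -- induction hypothesis applies to a common ideal state.
          · rw [hF₁ R (draws_gx hR) (fun h => hbad (.inl h)),
              hF₂ R (draws_gx hR) (fun h => hbad (.inr h))]
            exact ih K _ _ (h.step _ R)

end Handshake

namespace Handshake

open scoped ENNReal

/-! ### From the simulator to the group member, group by group -/

variable {pp : Params} {γ : ℕ}

theorem Sys.Frame.le {S S' : Sys} {d : Data} (h : S.Frame d S') :
    S.groups.length ≤ S'.groups.length ∧ S'.groups.length ≤ S.groups.length + 1 := by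
  rcases h.groups with h | ⟨-, b, h⟩ <;> rw [h] <;> simp

/-- All nodes belong to groups that exist. -/
def Sys.Wf (S : Sys) : Prop := ∀ G, some G ∈ S.nodes → G < S.groups.length

theorem Sys.Frame.wf {S S' : Sys} {d : Data} (h : S.Frame d S') (hS : S.Wf) : S'.Wf := fun G hG =>
  ((h.nodes G hG).elim (hS G) id).trans_le h.le.1

/-- The secret of group `γ` is drawn in advance. The choice is still open as long as there are at
most `γ` groups. -/
theorem val_envRo_eq (len : ℕ) (ro : ℕ → Bool) (post) (n K st) (S : Sys) :
    val (envRo pp len ro) post n K st S =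
      ev (unif (pp.q - 1)) fun r => val (envGroup pp len ro γ (r + 1)) post n K st S := by
  refine val_eager (unif (pp.q - 1)) (O' := fun r => envGroup pp len ro γ (r + 1)) post
    (fun S => S.groups.length ≤ γ) (fun S hS d => ⟨fun b => ?_, fun x hx => ?_⟩) (fun S hS d => ?_)
    n K st S
  · exact if_neg fun h => hS h.2.le
  · have := (answer_frame hx).le
    omega
  · by_cases h : d.fst.toNat = 0 ∧ S.groups.length = γ
    · right
      constructor
      · rw [envRo, Sys.answer, decode_eq, h.1]
        simp only [envGroup, if_pos h, Params.randGenerator, map_eq_bind_pure, PMF.bind_bind,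
          PMF.pure_bind]
        rfl
      · intro b x hx
        simp only [envGroup, if_pos h, PMF.support_pure, Set.mem_singleton_iff] at hx
        rw [hx]
        simp [h.2]
    · exact .inl fun b => if_neg h

/-- The simulator's generator is drawn in advance; the choice is open as long as no test has begun.
-/
theorem val_envGroup_eq (len : ℕ) {ro : ℕ → Bool} (hro : ro γ = false) (b : ℕ) (post) (n K st)
    (S : Sys) : val (envGroup pp len ro γ b) post n K st S =
      ev (unif (pp.q - 1)) fun r => val (envTest pp len ro γ b (r + 1)) post n K st S := by
  refine val_eager (unif (pp.q - 1)) (O' := fun r => envTest pp len ro γ b (r + 1)) post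
    (fun S => S.test = none) (fun S hS d => ⟨fun b => ?_, fun x hx => ?_⟩) (fun S hS d => ?_)
    n K st S
  · exact if_neg (testOK_false (.inr hS))
  · rw [(envGroup_frame hx).test hS]
    exact hS
  · by_cases h : TestOK pp γ S d
    · right
      constructor
      · obtain ⟨h1, h2, h3, h4, h5⟩ := id h
        simp only [envTest, if_pos h]
        rw [envGroup, if_neg (by simp [h1]), envRo, Sys.answer, decode_eq, h1]
        simp only [Sys.startTest]
        rw [h2]
        dsimp only
        rw [if_pos ⟨h3, h4, h5⟩]
        simp only [Option.getD_some, hro, Params.randGenerator, map_eq_bind_pure, Bool.false_eq_true,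
          if_false, PMF.bind_bind, PMF.pure_bind]
        rfl
      · intro b x hx
        simp only [envTest, if_pos h] at hx
        obtain ⟨l, h'⟩ := openTest_support hx
        rw [h']
        simp
    · exact .inl fun b => if_neg h

/-- The honest member executes the test run for group `γ`. -/
theorem val_envGroup_real (len : ℕ) {ro ro' : ℕ → Bool} (hro : ro' γ = true)
    (hne : ∀ G, G ≠ γ → ro' G = ro G) (b : ℕ) (post) (n K st) :
    val (envGroup pp len ro' γ b) post n K st Sys.init =
      val (envTest pp len ro γ b b) post n K st Sys.init := by
  refine val_congr post (fun _ S => S.Wf ∧ (γ < S.groups.length → S.groups.getD γ 0 = pp.gp b))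
    (fun n S (h : S.Wf ∧ _) => h) (fun n S d ⟨hw, hγ⟩ => ⟨?_, fun x hx => ⟨(envGroup_frame hx).wf hw, ?_⟩⟩)
    n K st _ ⟨by simp [Sys.Wf, Sys.init], by simp [Sys.init]⟩
  · by_cases h : TestOK pp γ S d
    · obtain ⟨h1, h2, h3, h4, h5⟩ := id h
      simp only [envTest, if_pos h]
      rw [envGroup, if_neg (by simp [h1]), envRo, Sys.answer, decode_eq, h1]
      simp only [Sys.startTest]
      rw [h2]
      dsimp only
      rw [if_pos ⟨h3, h4, h5⟩]
      simp only [Option.getD_some, hro, if_true, PMF.pure_bind]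
      rw [hγ (hw γ (List.mem_of_getElem? h2))]
      rfl
    · simp only [envTest, if_neg h, envGroup]
      split_ifs with h0
      · rfl
      unfold envRo
      cases hn : S.nodes[qx d]? with
      | none => exact answer_congr (.inr (.inr (by simp [hn])))
      | some a =>
        cases a with
        | none => exact answer_congr (.inr (.inr (by simp [hn])))
        | some G =>
          by_cases hG : G = γ
          swap
          · exact answer_congr (.inl (hne G hG))
          subst hG
          by_cases h3 : d.fst.toNat = 3
          swap
          · exact answer_congr (.inr (.inl h3))
          rw [Sys.answer, Sys.answer, decode_eq, h3]
          simp only [Sys.startTest]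
          rw [hn]
          dsimp only
          rw [if_neg fun h' => h ⟨h3, hn, h'⟩, if_neg fun h' => h ⟨h3, hn, h'⟩]
  · intro hl
    by_cases h0 : d.fst.toNat = 0 ∧ S.groups.length = γ
    · simp only [envGroup, if_pos h0, PMF.support_pure, Set.mem_singleton_iff] at hx
      rw [hx]
      simp [List.getD_eq_getElem?_getD, ← h0.2]
    · rcases (envGroup_frame hx).groups with hg | ⟨h0', c, hg⟩
      · rw [hg] at hl ⊢
        exact hγ hl
      · rw [hg] at hl ⊢
        have : γ < S.groups.length := by
          simp only [List.length_append, List.length_singleton] at hl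
          have : S.groups.length ≠ γ := fun h => h0 ⟨h0', h⟩
          omega
        rw [← hγ this, List.getD_eq_getElem?_getD, List.getD_eq_getElem?_getD,
          List.getElem?_append_left this]

/-- There are no more groups than steps. -/
theorem val_envRo_real (len T : ℕ) (post) (K st) :
    val (envRo pp len fun G => decide (G < T)) post T K st Sys.init =
      val (Sys.answer pp len true) post T K st Sys.init := by
  refine val_congr post (fun n S => S.Wf ∧ S.groups.length + n ≤ T) (fun n S h => ⟨h.1, by omega⟩)
    (fun n S d ⟨hw, hl⟩ => ⟨?_, fun x hx => ⟨(answer_frame hx).wf hw, ?_⟩⟩) T K st _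
    ⟨by simp [Sys.Wf, Sys.init], by simp [Sys.init]⟩
  · cases hn : S.nodes[qx d]? with
    | none => exact answer_congr (.inr (.inr (by simp [hn])))
    | some a =>
      cases a with
      | none => exact answer_congr (.inr (.inr (by simp [hn])))
      | some G =>
        refine answer_congr (.inl (decide_eq_true ?_))
        have := hw G (List.mem_of_getElem? hn)
        simp only [Option.getD_some]
        omega
  · have := (answer_frame hx).le
    omega

theorem val_envRo_sim (len : ℕ) (post) (n K st) (S : Sys) :
    val (envRo pp len fun G => decide (G < 0)) post n K st S =
      val (Sys.answer pp len false) post n K st S := by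
  refine val_congr post (fun _ _ => True) (fun _ _ _ => trivial)
    (fun n S d _ => ⟨?_, fun _ _ => trivial⟩) n K st S trivial
  exact answer_congr (.inl (by simp))

/-- The probability of a bad state of the ideal experiment for random secrets. -/
noncomputable def badProb (pp : Params) (len γ n : ℕ) (K : List Cmd) (st : Store) : ℝ≥0∞ :=
  ev (unif (pp.q - 1)) fun r => ev (unif (pp.q - 1)) fun r' =>
    ev (chain pp len γ n ⟨K, st, .init⟩) fun y =>
      ind (y.s.Bad pp (r + 1) (r + 1) ∨ y.s.Bad pp (r + 1) (r' + 1))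

theorem init_sys (b b' : ℕ) : IS.init.sys pp γ b b' = Sys.init := by
  simp only [IS.init, IS.sys, Sys.init, List.reverse_nil, List.set_nil, List.map_nil,
    List.length_nil, List.range_zero, if_true, Sys.mk.injEq, true_and]
  funext x
  simp [IS.orc, look, optNat]

/-- Averaged over the secrets, one hybrid uses the same exponent twice and the other an independent
second one. Both are compared with the same ideal experiment, so bad states for either pair have to
be counted; the second average in `h1` is a dummy. -/
theorem hybrid_step (len : ℕ) {post : Option Data → ℝ≥0∞} (hpost : ∀ o, post o ≤ 1) (n K st) :
    val (envRo pp len fun G => decide (G < γ + 1)) post n K st Sys.init ≤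
        val (envRo pp len fun G => decide (G < γ)) post n K st Sys.init + badProb pp len γ n K st ∧
      val (envRo pp len fun G => decide (G < γ)) post n K st Sys.init ≤
        val (envRo pp len fun G => decide (G < γ + 1)) post n K st Sys.init
          + badProb pp len γ n K st := by
  have h1 : val (envRo pp len fun G => decide (G < γ + 1)) post n K st Sys.init =
      ev (unif (pp.q - 1)) fun r => ev (unif (pp.q - 1)) fun _ =>
        val (envTest pp len (fun G => decide (G < γ)) γ (r + 1) (r + 1)) post n K st Sys.init := by
    rw [val_envRo_eq (γ := γ)]
    simp only [ev_const]
    refine ev_congr fun r _ => val_envGroup_real len (by simp) (fun G hG => ?_) _ _ _ _ _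
    rw [decide_eq_decide]
    omega
  have h2 : val (envRo pp len fun G => decide (G < γ)) post n K st Sys.init =
      ev (unif (pp.q - 1)) fun r => ev (unif (pp.q - 1)) fun r' =>
        val (envTest pp len (fun G => decide (G < γ)) γ (r + 1) (r' + 1)) post n K st Sys.init := by
    rw [val_envRo_eq (γ := γ)]
    exact ev_congr fun r _ => val_envGroup_eq len (by simp) _ _ _ _ _ _
  have hnd : ∀ r ∈ (unif (pp.q - 1)).support, ¬ pp.q ∣ r + 1 := fun r hr =>
    pp.succ_not_dvd (mem_support_unif pp.q1_ne hr)
  rw [h1, h2, badProb]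
  simp only [← ev_add]
  constructor
  · refine ev_mono fun r hr => ev_mono fun r' hr' => ?_
    have := val_le_val_add_bad (γ := γ) (hnd r hr) (hnd r hr) (hnd r' hr') len
      (fun G => decide (G < γ)) hpost n K st _ .init
    simpa only [init_sys] using this
  · refine ev_mono fun r hr => ev_mono fun r' hr' => ?_
    have := val_le_val_add_bad (γ := γ) (hnd r hr) (hnd r' hr') (hnd r hr) len
      (fun G => decide (G < γ)) hpost n K st _ .init
    simp only [init_sys] at this
    simpa only [or_comm] using this

/-- The differences of neighbours are summed up, in both directions to obtain an absolute value
later. -/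
theorem hybrid (len T : ℕ) {post : Option Data → ℝ≥0∞} (hpost : ∀ o, post o ≤ 1) (K st) :
    val (Sys.answer pp len true) post T K st Sys.init ≤
        val (Sys.answer pp len false) post T K st Sys.init +
          ∑ γ ∈ Finset.range T, badProb pp len γ T K st ∧
      val (Sys.answer pp len false) post T K st Sys.init ≤
        val (Sys.answer pp len true) post T K st Sys.init +
          ∑ γ ∈ Finset.range T, badProb pp len γ T K st := by
  rw [← val_envRo_real, ← val_envRo_sim]
  have : ∀ m, val (envRo pp len fun G => decide (G < m)) post T K st Sys.init ≤
        val (envRo pp len fun G => decide (G < 0)) post T K st Sys.init +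
          ∑ γ ∈ Finset.range m, badProb pp len γ T K st ∧
      val (envRo pp len fun G => decide (G < 0)) post T K st Sys.init ≤
        val (envRo pp len fun G => decide (G < m)) post T K st Sys.init +
          ∑ γ ∈ Finset.range m, badProb pp len γ T K st := by
    intro m
    induction m with
    | zero => simp
    | succ m ih =>
      obtain ⟨h1, h2⟩ := hybrid_step (pp := pp) (γ := m) len hpost T K st
      rw [Finset.sum_range_succ, ← add_assoc, ← add_assoc]
      refine ⟨h1.trans (by gcongr; exact ih.1), ih.2.trans ?_⟩
      rw [add_right_comm]
      gcongr
  exact this T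

end Handshake

namespace Handshake

open scoped ENNReal

/-! ### Bad states for random secrets -/

variable {pp : Params} {γ : ℕ}

/-- A union bound over pairs of table entries, each of which is fulfilled by at most one value of
the random number. -/
theorem ev_ind_pairs_le {n : ℕ} (hn : n ≠ 0) {α : Type} (l : List α) (P : α → α → ℕ → Prop)
    (h : ∀ x y, ∀ r < n, ∀ r' < n, P x y r → P x y r' → r = r') :
    ev (unif n) (fun r => ind (∃ x ∈ l, ∃ y ∈ l, P x y r)) ≤ (l.length : ℝ≥0∞) ^ 2 * (n : ℝ≥0∞)⁻¹ := by
  classical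
  calc ev (unif n) (fun r => ind (∃ x ∈ l, ∃ y ∈ l, P x y r))
      ≤ ev (unif n) (fun r => ∑ z ∈ l.toFinset ×ˢ l.toFinset, ind (P z.1 z.2 r)) := by
        refine ev_mono fun r _ => ?_
        refine le_trans (ind_mono ?_) (ind_exists_le _ fun z : α × α => P z.1 z.2 r)
        rintro ⟨x, hx, y, hy, hP⟩
        exact ⟨(x, y), by simp [hx, hy], hP⟩
    _ = ∑ z ∈ l.toFinset ×ˢ l.toFinset, ev (unif n) (fun r => ind (P z.1 z.2 r)) := ev_sum _ _ _
    _ ≤ ∑ z ∈ l.toFinset ×ˢ l.toFinset, (n : ℝ≥0∞)⁻¹ :=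
        Finset.sum_le_sum fun z _ => ev_unif_ind_le_one hn _ (h z.1 z.2)
    _ = ((l.toFinset ×ˢ l.toFinset).card : ℝ≥0∞) * (n : ℝ≥0∞)⁻¹ := by
        rw [Finset.sum_const, nsmul_eq_mul]
    _ ≤ (l.length : ℝ≥0∞) ^ 2 * (n : ℝ≥0∞)⁻¹ := by
        gcongr
        rw [Finset.card_product]
        have := l.toFinset_card_le
        calc ((l.toFinset.card * l.toFinset.card : ℕ) : ℝ≥0∞)
            ≤ ((l.length * l.length : ℕ) : ℝ≥0∞) := by gcongr
          _ = _ := by push_cast; ring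

theorem Params.exp_inj {w r r' : ℕ} (hw : pp.IsElt w) (h1 : w ≠ 1) (hr : r < pp.q)
    (hr' : r' < pp.q) (h : w ^ r % pp.p = w ^ r' % pp.p) : r = r' := by
  obtain ⟨c, -, rfl⟩ := pp.isElt_iff.mp hw
  rw [pp.gp_pow, pp.gp_pow, pp.gp_eq_iff] at h
  have hc : ¬ pp.q ∣ c := fun h => h1 (pp.gp_eq_one_iff.mpr h)
  have := Nat.ModEq.cancel_left_of_coprime (pp.coprime hc) h
  rwa [Nat.ModEq, Nat.mod_eq_of_lt hr, Nat.mod_eq_of_lt hr'] at this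

/-- The same point was asked for in a run of the target group and in the test run. -/
def IS.Collision (s : IS) : Prop := ∃ t z, look s.db (6, t, z) ≠ 0 ∧ look s.db (7, t, z) ≠ 0

/-- The secret `b` relates two points asked for. -/
def IS.Hit (pp : Params) (s : IS) (κ b : ℕ) : Prop := ∃ x ∈ s.db, ∃ y ∈ s.db,
  pp.IsElt x.1.2.2 ∧ x.1.2.2 ≠ 1 ∧ y.1 = (κ, x.1.2.1, x.1.2.2 ^ b % pp.p)

/-- The secrets `b` and `b'` relate two points asked for. -/
def IS.Hit₂ (pp : Params) (s : IS) (b b' : ℕ) : Prop := ∃ x ∈ s.db, ∃ y ∈ s.db,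
  ∃ w, pp.IsElt w ∧ w ≠ 1 ∧ x.1.2.2 = w ^ b % pp.p ∧ y.1.2.2 = w ^ b' % pp.p

/-- For equal secrets a coincidence of the two private tables is one of the stored keys themselves,
and no randomness of the secrets is left. This is the only case that counting does not settle and
for which Diffie-Hellman is needed. -/
theorem IS.Bad.cases {s : IS} {b b' : ℕ} (h : s.Bad pp b b') :
    s.Hit pp 6 b ∨ s.Hit pp 7 b' ∨
      ((b = b' → s.Collision) ∧ s.Hit₂ pp b b') := by
  obtain ⟨t, w, hw, h1, ⟨h5, h6⟩ | ⟨h5, h7⟩ | ⟨h6, h7⟩⟩ := h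
  · obtain ⟨v, h5⟩ := look_ne_zero_iff.mp h5
    obtain ⟨v', h6⟩ := look_ne_zero_iff.mp h6
    exact .inl ⟨_, h5, _, h6, hw, h1, rfl⟩
  · obtain ⟨v, h5⟩ := look_ne_zero_iff.mp h5
    obtain ⟨v', h7⟩ := look_ne_zero_iff.mp h7
    exact .inr (.inl ⟨_, h5, _, h7, hw, h1, rfl⟩)
  · refine .inr (.inr ⟨?_, ?_⟩)
    · rintro rfl
      exact ⟨t, _, h6, h7⟩
    · obtain ⟨v, h6⟩ := look_ne_zero_iff.mp h6
      obtain ⟨v', h7⟩ := look_ne_zero_iff.mp h7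
      exact ⟨_, h6, _, h7, w, hw, h1, rfl, rfl⟩

/-- For `w ≠ 1` the value `w^b` determines `b` modulo `q`. -/
theorem ev_hit_le (s : IS) (κ : ℕ) : ev (unif (pp.q - 1)) (fun r => ind (s.Hit pp κ (r + 1))) ≤
    (s.db.length : ℝ≥0∞) ^ 2 * ((pp.q - 1 : ℕ) : ℝ≥0∞)⁻¹ := by
  refine ev_ind_pairs_le pp.q1_ne _ _ ?_
  rintro x y r hr r' hr' ⟨h1, h2, h3⟩ ⟨-, -, h4⟩
  rw [h3] at h4
  simp only [Prod.mk.injEq, true_and] at h4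
  have := pp.exp_inj h1 h2 (by omega) (by omega) h4
  omega

/-- The first entry determines `w`, as `b` is invertible, and then the second one determines the
other exponent. -/
theorem ev_hit₂_le (s : IS) {b : ℕ} (hb : ¬ pp.q ∣ b) :
    ev (unif (pp.q - 1)) (fun r => ind (s.Hit₂ pp b (r + 1))) ≤
    (s.db.length : ℝ≥0∞) ^ 2 * ((pp.q - 1 : ℕ) : ℝ≥0∞)⁻¹ := by
  refine ev_ind_pairs_le pp.q1_ne _ _ ?_
  rintro x y r hr r' hr' ⟨w, h1, h2, h3, h4⟩ ⟨w', h1', h2', h3', h4'⟩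
  rw [h3] at h3'
  have := pp.pow_inj hb h1 h1' h3'
  subst this
  rw [h4] at h4'
  have := pp.exp_inj h1 h2 (by omega) (by omega) h4'
  omega

theorem chain_db_length (len : ℕ) : ∀ n x, ∀ y ∈ (chain pp len γ n x).support,
    y.s.db.length ≤ x.s.db.length + 3 * n := by
  intro n
  induction n with
  | zero => intro x y hy; simp [chain] at hy; simp [hy]
  | succ n ih =>
    intro x y hy
    simp only [chain, tick, PMF.mem_support_bind_iff, PMF.support_map, Set.mem_image] at hy
    obtain ⟨z, ⟨r, -, R, -, rfl⟩, hy⟩ := hy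
    have := ih _ y hy
    have := (next_db_suffix (pp := pp) (γ := γ) x r R).2
    omega

/-- The secrets are drawn after the experiment, when the tables, with at most `3n` entries, are
fixed. Four kinds of accidents, each of probability at most `(3n)²/(q-1)`, account for the constant
`36`. -/
theorem badProb_le (len n : ℕ) (K : List Cmd) (st : Store) : badProb pp len γ n K st ≤
    36 * (n : ℝ≥0∞) ^ 2 * ((pp.q - 1 : ℕ) : ℝ≥0∞)⁻¹ +
      ev (chain pp len γ n ⟨K, st, .init⟩) fun y => ind y.s.Collision := by
  unfold badProb
  have h1 : ∀ r : ℕ, (ev (unif (pp.q - 1)) fun r' => ev (chain pp len γ n ⟨K, st, .init⟩) fun y =>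
      ind (y.s.Bad pp (r + 1) (r + 1) ∨ y.s.Bad pp (r + 1) (r' + 1))) =
      ev (chain pp len γ n ⟨K, st, .init⟩) fun y => ev (unif (pp.q - 1)) fun r' =>
        ind (y.s.Bad pp (r + 1) (r + 1) ∨ y.s.Bad pp (r + 1) (r' + 1)) := fun r => ev_comm _ _ _
  simp only [h1]
  rw [ev_comm, ← ev_const (chain pp len γ n ⟨K, st, .init⟩)
    (36 * (n : ℝ≥0∞) ^ 2 * ((pp.q - 1 : ℕ) : ℝ≥0∞)⁻¹), ← ev_add]
  refine ev_mono fun y hy => ?_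
  have hl := chain_db_length len n _ y hy
  set c : ℝ≥0∞ := (y.s.db.length : ℝ≥0∞) ^ 2 * ((pp.q - 1 : ℕ) : ℝ≥0∞)⁻¹ with hc
  have hc' : 4 * c ≤ 36 * (n : ℝ≥0∞) ^ 2 * ((pp.q - 1 : ℕ) : ℝ≥0∞)⁻¹ := by
    have h : (y.s.db.length : ℝ≥0∞) ≤ 3 * n := by
      have : y.s.db.length ≤ 3 * n := by simpa [IS.init] using hl
      exact_mod_cast this
    calc 4 * c ≤ 4 * ((3 * n : ℝ≥0∞) ^ 2 * ((pp.q - 1 : ℕ) : ℝ≥0∞)⁻¹) := by rw [hc]; gcongr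
      _ = _ := by ring
  refine le_trans ?_ (add_le_add_left hc' _)
  calc _ ≤ ev (unif (pp.q - 1)) fun r => ev (unif (pp.q - 1)) fun r' =>
        ind y.s.Collision + (ind (y.s.Hit pp 6 (r + 1)) + (ind (y.s.Hit pp 7 (r + 1)) +
          (ind (y.s.Hit pp 7 (r' + 1)) + ind (y.s.Hit₂ pp (r + 1) (r' + 1))))) := by
        refine ev_mono fun r _ => ev_mono fun r' _ => ?_
        refine (ind_mono (Q := y.s.Collision ∨ y.s.Hit pp 6 (r + 1) ∨ y.s.Hit pp 7 (r + 1) ∨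
          y.s.Hit pp 7 (r' + 1) ∨ y.s.Hit₂ pp (r + 1) (r' + 1)) ?_).trans ?_
        · rintro (h | h)
          · rcases h.cases with h | h | h
            exacts [.inr (.inl h), .inr (.inr (.inl h)), .inl (h.1 rfl)]
          · rcases h.cases with h | h | h
            exacts [.inr (.inl h), .inr (.inr (.inr (.inl h))), .inr (.inr (.inr (.inr h.2)))]
        · refine (ind_or_le _ _).trans (add_le_add le_rfl ?_)
          refine (ind_or_le _ _).trans (add_le_add le_rfl ?_)
          refine (ind_or_le _ _).trans (add_le_add le_rfl ?_)
          exact ind_or_le _ _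
    _ ≤ ev (unif (pp.q - 1)) fun r => ind y.s.Collision + (ind (y.s.Hit pp 6 (r + 1)) +
          (ind (y.s.Hit pp 7 (r + 1)) + (c + c))) := by
        refine ev_mono fun r hr => ?_
        simp only [ev_add, ev_const]
        gcongr
        · exact ev_hit_le _ _
        · exact ev_hit₂_le _ (pp.succ_not_dvd (mem_support_unif pp.q1_ne hr))
    _ ≤ ind y.s.Collision + (c + (c + (c + c))) := by
        simp only [ev_add, ev_const]
        gcongr <;> exact ev_hit_le _ _
    _ = 4 * c + ind y.s.Collision := by ring

end Handshake

namespace Handshake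

open scoped ENNReal

/-! ### Collisions, and the moment when the later of the two runs begins -/

variable {pp : Params} {γ : ℕ}

theorem other_ss (c : Ctx) (s : IS) (d : Data) (R : Dr) :
    (s.other c d R).2.ss = s.ss ∧ (s.other c d R).2.tst = s.tst := by
  unfold IS.other
  split_ifs
  all_goals try unfold IS.deliver
  all_goals try unfold IS.reveal
  all_goals try unfold IS.corrupt
  all_goals try split_ifs
  all_goals exact ⟨rfl, rfl⟩

theorem step_length (s : IS) (d : Data) (R : Dr) :
    s.ss.length ≤ (s.step (pp.ctx γ) d R).2.ss.length ∧
      (s.step (pp.ctx γ) d R).2.ss.length ≤ s.ss.length + 1 := by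
  unfold IS.step
  split_ifs
  · rw [(other_ss _ _ _ _).1]; omega
  · rw [opening_length]; omega

theorem step_sess {s : IS} {k : ℕ} (hk : k < s.ss.length) (d : Data) (R : Dr) :
    (s.step (pp.ctx γ) d R).2.sess k = s.sess k := by
  unfold IS.step
  split_ifs
  · rw [IS.sess, (other_ss _ _ _ _).1]; rfl
  · exact sess_opening_lt hk

theorem step_peer_of_peer {s : IS} {k : ℕ} (hk : k < s.ss.length) (hp : s.peer k ≠ 0) (d : Data)
    (R : Dr) : (s.step (pp.ctx γ) d R).2.peer k = s.peer k := by
  unfold IS.peer at *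
  rw [step_sess hk]
  by_cases h : (s.sess k).v = 0
  · rw [if_pos h] at hp ⊢
    rw [if_pos h, look_suffix (step_db_suffix s d R).1 hp]
  · rw [if_neg h, if_neg h]

theorem step_closed {s : IS} {k : ℕ} (hk : k < s.ss.length) (hc : s.closed k ≠ 0) (d : Data)
    (R : Dr) : (s.step (pp.ctx γ) d R).2.closed k ≠ 0 := by
  have ht : s.tst ≠ 0 → (s.step (pp.ctx γ) d R).2.tst ≠ 0 := by
    intro ht
    unfold IS.step
    split_ifs
    · rwa [(other_ss _ _ _ _).2]
    · rw [opening_tst]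
      split_ifs <;> omega
  unfold IS.closed at *
  rw [step_sess hk]
  by_cases h : look s.db (3, k, 0) = 0
  · rw [if_pos h] at hc
    by_cases h1 : (s.sess k).kind = 1
    · rw [if_pos h1] at hc
      rw [if_pos h1, if_neg (ht (fun h => hc (if_pos h)))]
      split_ifs <;> simp
    · exact absurd (if_neg h1) hc
  · rw [look_suffix (step_db_suffix s d R).1 h, if_neg h]
    simp

/-- A run that is over accepts no message, so its common secret is frozen, even if it has received
nothing. -/
theorem step_peer_of_closed {s : IS} {k : ℕ} (hk : k < s.ss.length) (hc : s.closed k ≠ 0) (d : Data)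
    (R : Dr) : (s.step (pp.ctx γ) d R).2.peer k = s.peer k := by
  have hkey : ∀ (i u t : ℕ), s.key (pp.ctx γ) i u t ≠ (2, k, 0) := fun i u t h => by
    have := key_fst (pp.ctx γ) s i u t
    rw [h] at this
    omega
  unfold IS.step
  split_ifs with h0
  swap
  · exact peer_opening_lt hk
  unfold IS.other
  split_ifs
  · rfl
  · rfl
  · rfl
  · unfold IS.deliver
    split_ifs with h1 h2 h3 h4 h5
    · have : qx d ≠ k := by rintro h; rw [h] at h2; exact hc h2
      rw [peer_put_of_ne (hkey _ _ _), peer_put_of_ne (by simpa using this)]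
    · exact peer_put_of_ne (by simp)
    · rw [peer_put_of_ne (by simp), peer_put_of_ne (hkey _ _ _)]
    · rw [peer_put_of_ne (by simp), peer_put_of_ne (hkey _ _ _)]
    · rw [peer_put_of_ne (by simp), peer_put_of_ne (hkey _ _ _), peer_put_of_ne (hkey _ _ _)]
    · rw [peer_put_of_ne (by simp), peer_put_of_ne (hkey _ _ _), peer_put_of_ne (hkey _ _ _)]
    · rfl
    · rfl
  · unfold IS.reveal
    split_ifs <;> first | rfl | exact peer_put_of_ne (hkey _ _ _)
  · unfold IS.corrupt
    split_ifs <;> rfl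
  · exact peer_put_of_ne (by simp)
  · rfl

/-- The common secret of run `k`, or `1` if no element has been received. -/
def IS.point (c : Ctx) (s : IS) (k : ℕ) : ℕ := if s.peer k = 0 then 1 else s.zed c k (s.peer k - 1)

/-- One of the runs `i` and `j` is the test run, and they have the same secret. -/
def IS.Coll (c : Ctx) (i j : ℕ) (s : IS) : Prop := j < s.ss.length ∧
  (((s.sess i).kind = 1 ∧ (s.sess j).kind = 2) ∨ ((s.sess i).kind = 2 ∧ (s.sess j).kind = 3)) ∧
  s.point c i ≠ 1 ∧ s.peer j ≠ 0 ∧ s.zed c j (s.peer j - 1) = s.point c i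

/-- An entry of table `6` stems from a run before or after the test run, one of table `7` from the
test run. The order of the two decides which of them is called `i`. -/
theorem Inv.exists_coll {s : IS} (h : Inv pp γ s) (hc : s.Collision) :
    ∃ i j, i < j ∧ j < s.ss.length ∧ s.Coll (pp.ctx γ) i j := by
  obtain ⟨t, z, h6, h7⟩ := hc
  obtain ⟨i, hi, hi0, hi2, hip, hiz, hz⟩ := h.key_six t z h6
  obtain ⟨j, hj, hj2, hjp, hjz, -⟩ := h.key_seven t z h7
  have hle := h.kind_le i hi
  have hjt := (h.kind_two j hj).mp hj2
  rcases (by omega : (s.sess i).kind = 1 ∨ (s.sess i).kind = 3) with h1 | h3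
  · have := h.kind_one i hi h1 (by omega)
    exact ⟨i, j, by omega, hj, hj, .inl ⟨h1, hj2⟩, by rw [IS.point, if_neg hip, hiz]; exact hz, hjp,
      by rw [IS.point, if_neg hip, hjz, hiz]⟩
  · have := h.kind_three i hi h3
    exact ⟨j, i, by omega, hi, hi, .inr ⟨hj2, h3⟩, by rw [IS.point, if_neg hjp, hjz]; exact hz, hip,
      by rw [IS.point, if_neg hjp, hjz, hiz]⟩

/-- `1` if run `j`, of a member of the target group, is about to begin, and is the test run, or comes
after it. -/
def CF.fork (c : Ctx) (j : ℕ) (x : CF) : ℕ :=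
  match x.K with
  | .call _ e :: _ => if x.s.ss.length = j then if opens c x.s (e.eval x.st) < 3 then 0 else 1 else 0
  | _ => 0

theorem fork_eq_one {c : Ctx} {j : ℕ} {x : CF} (h : x.fork c j = 1) : ∃ y e K,
    x.K = .call y e :: K ∧ x.s.ss.length = j ∧ 3 ≤ opens c x.s (e.eval x.st) := by
  unfold CF.fork at h
  split at h
  · rename_i y e K hK
    split_ifs at h with h1 h2
    exact ⟨y, e, K, hK, h1, by omega⟩
  · simp at h

open Classical in
/-- The experiment that stops before run `j` begins. -/
noncomputable def pre (pp : Params) (len γ j : ℕ) : ℕ → CF → PMF CF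
  | 0, x => PMF.pure x
  | n + 1, x => if x.fork (pp.ctx γ) j = 1 then pre pp len γ j n x
      else (tick pp len γ x).bind (pre pp len γ j n)

theorem pre_of_fork {len j : ℕ} {x : CF} (h : x.fork (pp.ctx γ) j = 1) (n : ℕ) :
    pre pp len γ j n x = PMF.pure x := by
  induction n with
  | zero => rfl
  | succ n ih => rw [pre, if_pos h, ih]

theorem ev_chain_mono (len : ℕ) {P : CF → Prop}
    (hP : ∀ x r R, P x → P (x.next (pp.ctx γ) r R)) {n m : ℕ} (h : n ≤ m) :
    ∀ x, ev (chain pp len γ n x) (fun y => ind (P y)) ≤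
      ev (chain pp len γ m x) (fun y => ind (P y)) := by
  induction n generalizing m with
  | zero =>
    intro x
    simp only [chain, ev_pure]
    by_cases hx : P x
    · exact (ind_le_one _).trans (le_ev fun y hy => by
        rw [ind_true (chain_invariant len hP m x hx y hy)])
    · rw [ind_false hx]; exact zero_le
  | succ n ih =>
    intro x
    obtain ⟨m, rfl⟩ := Nat.exists_eq_succ_of_ne_zero (by omega : m ≠ 0)
    rw [ev_chain_succ, ev_chain_succ]
    exact ev_mono fun y _ => ih (by omega) y

/-- Run `j` leads to the secret `z`. -/
def IS.Leads (c : Ctx) (j z : ℕ) (s : IS) : Prop :=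
  j < s.ss.length ∧ s.peer j ≠ 0 ∧ s.zed c j (s.peer j - 1) = z

theorem IS.Leads.step {s : IS} {j z : ℕ} (h : s.Leads (pp.ctx γ) j z) (d : Data) (R : Dr) :
    (s.step (pp.ctx γ) d R).2.Leads (pp.ctx γ) j z := by
  obtain ⟨h1, h2, h3⟩ := h
  refine ⟨h1.trans_le (step_length s d R).1, ?_, ?_⟩
  · rwa [step_peer_of_peer h1 h2]
  · rwa [step_peer_of_peer h1 h2, IS.zed, step_sess h1]

/-- The value at the fork: the chance that run `j` leads to the secret of run `i`. -/
noncomputable def forkValue (pp : Params) (len γ T i j : ℕ) (x : CF) : ℝ≥0∞ :=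
  ind (x.fork (pp.ctx γ) j = 1) * (ind (x.s.point (pp.ctx γ) i ≠ 1) *
    ev (tick pp len γ x) fun y => ev (chain pp len γ T y) fun z =>
      ind (z.s.Leads (pp.ctx γ) j (x.s.point (pp.ctx γ) i)))

/-- The kind of a run never changes, so the wrong kinds preclude a collision for good. -/
theorem ev_coll_of_kind {len n i j : ℕ} {x : CF} (hij : i < j) (hj : j < x.s.ss.length)
    (hk : ¬ (((x.s.sess i).kind = 1 ∧ (x.s.sess j).kind = 2) ∨
      ((x.s.sess i).kind = 2 ∧ (x.s.sess j).kind = 3))) :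
    ev (chain pp len γ n x) (fun y => ind (y.s.Coll (pp.ctx γ) i j)) = 0 := by
  have h := chain_invariant (pp := pp) (γ := γ) len (P := fun y => j < y.s.ss.length ∧
    y.s.sess i = x.s.sess i ∧ y.s.sess j = x.s.sess j) (fun y r R h =>
      next_cases (P := fun s => j < s.ss.length ∧ s.sess i = x.s.sess i ∧ s.sess j = x.s.sess j)
      y r R h fun d => ⟨h.1.trans_le (step_length _ d R).1, by rw [step_sess (hij.trans h.1), h.2.1],
        by rw [step_sess h.1, h.2.2]⟩) n x ⟨hj, rfl, rfl⟩
  refine le_antisymm (ev_le fun y hy => ?_) zero_le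
  rw [ind_false]
  rintro ⟨-, h2, -⟩
  rw [(h y hy).2.1, (h y hy).2.2] at h2
  exact hk h2

/-- The experiment is cut at the moment when run `j` begins. As runs of the group do not overlap
with the test run, run `i` is over by then and its secret is already determined; a collision means
that run `j` is led to this given value. -/
theorem ev_coll_le {len T i j : ℕ} (hij : i < j) : ∀ n ≤ T, ∀ x : CF, Inv pp γ x.s →
    x.s.ss.length ≤ j → ev (chain pp len γ n x) (fun y => ind (y.s.Coll (pp.ctx γ) i j)) ≤
      ev (pre pp len γ j n x) (forkValue pp len γ T i j) := by
  intro n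
  induction n with
  | zero =>
    intro _ x _ hx
    simp only [chain, ev_pure]
    rw [ind_false]
    · exact zero_le
    · exact fun h => absurd h.1 (by omega)
  | succ n ih =>
    intro hn x hI hx
    rw [ev_chain_succ]
    by_cases hf : x.fork (pp.ctx γ) j = 1
    · rw [pre_of_fork hf, ev_pure, forkValue, ind_true hf, one_mul, ← ev_mul]
      obtain ⟨y, e, K, hK, hl, ho⟩ := fork_eq_one hf
      rw [ev_tick, ev_tick]
      refine ev_mono fun r _ => ev_mono fun R _ => ?_
      set x' := x.next (pp.ctx γ) r R with hx'
      have hs' : x'.s = (opening (pp.ctx γ) x.s (e.eval x.st) R).2 := by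
        rw [hx', CF.next, hK]
        simp only [IS.step]
        rw [if_neg (by omega)]
      have hI' : Inv pp γ x'.s := hI.next r R
      have hl' : x'.s.ss.length = j + 1 := by rw [hs', opening_length, hl]
      by_cases hk : ((x'.s.sess i).kind = 1 ∧ (x'.s.sess j).kind = 2) ∨
          ((x'.s.sess i).kind = 2 ∧ (x'.s.sess j).kind = 3)
      swap
      · rw [ev_coll_of_kind hij (by omega) hk]; exact zero_le
      have hil : i < x.s.ss.length := by omega
      -- If `j` is the test run, its start has aborted run `i`; if `i` is the test run, run `j`
      -- could begin only after its end.
      have hcl : x'.s.closed i ≠ 0 := by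
        rcases hk with ⟨h1, h2⟩ | ⟨h1, h2⟩
        · have := (hI'.kind_two j (by omega)).mp h2
          rw [IS.closed, h1, this]
          simp
        · have h3 := hI'.kind_three j (by omega) h2
          have h4 := (hI'.kind_two i (by omega)).mp h1
          rw [h4, Nat.add_sub_cancel] at h3
          rw [IS.closed, if_neg h3.2.2]
          simp
      have hpt : x'.s.point (pp.ctx γ) i = x.s.point (pp.ctx γ) i := by
        simp only [IS.point, IS.zed, hs', sess_opening_lt hil, peer_opening_lt hil]
      have hinv := chain_invariant (pp := pp) (γ := γ) len (P := fun y => i < y.s.ss.length ∧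
        y.s.closed i ≠ 0 ∧ y.s.point (pp.ctx γ) i = x.s.point (pp.ctx γ) i) (fun y r R h =>
          next_cases (P := fun s => i < s.ss.length ∧ s.closed i ≠ 0 ∧
            s.point (pp.ctx γ) i = x.s.point (pp.ctx γ) i) y r R h fun d =>
          ⟨h.1.trans_le (step_length _ d R).1, step_closed h.1 h.2.1 d R, by
            rw [← h.2.2]
            simp only [IS.point, IS.zed, step_sess h.1, step_peer_of_closed h.1 h.2.1]⟩)
      -- A frozen secret `1` is excluded from collisions. This case covers a run `i` that was
      -- aborted before it received an element.
      by_cases h1 : x.s.point (pp.ctx γ) i = 1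
      · refine (ev_le fun y hy => ?_).trans zero_le
        rw [ind_false]
        intro hc
        exact hc.2.2.1 ((hinv n x' ⟨by omega, hcl, hpt⟩ y hy).2.2.trans h1)
      · rw [ind_true h1, one_mul]
        refine le_trans (ev_mono fun y hy => ind_mono fun hc => ?_)
          (ev_chain_mono len (P := fun y => y.s.Leads (pp.ctx γ) j (x.s.point (pp.ctx γ) i))
            (fun y r R h => next_cases (P := fun s => s.Leads (pp.ctx γ) j _) y r R h
              fun d => h.step d R) (by omega : n ≤ T) x')
        exact ⟨hc.1, hc.2.2.2.1, by
          rw [hc.2.2.2.2, (hinv n x' ⟨by omega, hcl, hpt⟩ y hy).2.2]⟩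
    · rw [pre, if_neg hf, ev_bind, ev_tick, ev_tick]
      refine ev_mono fun r _ => ev_mono fun R _ => ?_
      by_cases hl : (x.next (pp.ctx γ) r R).s.ss.length ≤ j
      · exact ih (by omega) _ (hI.next r R) hl
      -- Run `j` has just begun without a fork, hence with kind `0` or `1`, and as the later run it
      -- then takes part in no collision.
      · refine (le_of_eq (ev_coll_of_kind hij (by omega) ?_)).trans zero_le
        unfold CF.next at hl ⊢
        split at hl
        all_goals try exact absurd hx hl
        rename_i y e K hK
        simp only at hl ⊢
        have hj : x.s.ss.length = j := by
          have := (step_length (pp := pp) (γ := γ) x.s (e.eval x.st) R).2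
          omega
        have h0 : opens (pp.ctx γ) x.s (e.eval x.st) ≠ 0 := by
          intro h0
          rw [IS.step, if_pos h0, (other_ss _ _ _ _).1] at hl
          omega
        have h3 : opens (pp.ctx γ) x.s (e.eval x.st) < 3 := by
          by_contra h3
          apply hf
          simp only [CF.fork, hK]
          rw [if_pos hj, if_neg h3]
        have : ((x.s.step (pp.ctx γ) (e.eval x.st) R).2.sess j).kind =
            opens (pp.ctx γ) x.s (e.eval x.st) - 1 := by
          rw [IS.step, if_neg h0, ← hj, sess_opening_self]
        omega

theorem chain_length (len : ℕ) : ∀ n x, ∀ y ∈ (chain pp len γ n x).support,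
    y.s.ss.length ≤ x.s.ss.length + n := by
  intro n
  induction n with
  | zero => intro x y hy; simp [chain] at hy; simp [hy]
  | succ n ih =>
    intro x y hy
    simp only [chain, tick, PMF.mem_support_bind_iff, PMF.support_map, Set.mem_image] at hy
    obtain ⟨z, ⟨r, -, R, -, rfl⟩, hy⟩ := hy
    have := ih _ y hy
    have := next_cases (pp := pp) (γ := γ) (P := fun s => s.ss.length ≤ x.s.ss.length + 1) x r R
      (by omega) (fun d => (step_length x.s d R).2)
    omega

/-- A union bound over the pairs of runs; as every step begins at most one run, their numbers are
below `n`. -/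
theorem ev_collision_le (len n : ℕ) (K : List Cmd) (st : Store) :
    (ev (chain pp len γ n ⟨K, st, .init⟩) fun y => ind y.s.Collision) ≤
      ∑ i ∈ Finset.range n, ∑ j ∈ Finset.range n,
        ev (pre pp len γ j n ⟨K, st, .init⟩) (forkValue pp len γ n i j) := by
  have hI : ∀ y ∈ (chain pp len γ n ⟨K, st, .init⟩).support, Inv pp γ y.s :=
    chain_invariant len (P := fun y => Inv pp γ y.s) (fun y r R h => h.next r R) n _ .init
  calc _ ≤ ev (chain pp len γ n ⟨K, st, .init⟩) fun y => ∑ i ∈ Finset.range n,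
        ∑ j ∈ Finset.range n, ind (i < j ∧ y.s.Coll (pp.ctx γ) i j) := by
        refine ev_mono fun y hy => ?_
        rw [← Finset.sum_product']
        refine (ind_mono fun hc => ?_).trans (ind_exists_le _ fun z : ℕ × ℕ => z.1 < z.2 ∧
          y.s.Coll (pp.ctx γ) z.1 z.2)
        obtain ⟨i, j, hij, hj, h⟩ := (hI y hy).exists_coll hc
        have := chain_length len n _ y hy
        simp only [IS.init, List.length_nil] at this
        exact ⟨(i, j), by simp; omega, hij, h⟩
    _ = ∑ i ∈ Finset.range n, ∑ j ∈ Finset.range n, ev (chain pp len γ n ⟨K, st, .init⟩)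
          fun y => ind (i < j ∧ y.s.Coll (pp.ctx γ) i j) := by
        simp only [ev_sum]
    _ ≤ _ := by
        refine Finset.sum_le_sum fun i _ => Finset.sum_le_sum fun j _ => ?_
        by_cases hij : i < j
        · refine (ev_mono fun y _ => ind_mono fun h => h.2).trans
            (ev_coll_le hij n le_rfl _ .init (by simp [IS.init]))
        · refine (ev_le fun y _ => ?_).trans zero_le
          rw [ind_false (fun h => hij h.1)]

end Handshake

namespace Handshake

open scoped ENNReal

/-! ### The exponent of a run is not needed until it has received its message -/

variable {pp : Params} {γ : ℕ}

/-- The states differ at most in the exponent of run `j`, which has not received its message. -/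
structure IS.Same (j : ℕ) (s s' : IS) : Prop where
  groups : s'.groups = s.groups
  nodes : s'.nodes = s.nodes
  tst : s'.tst = s.tst
  db : s'.db = s.db
  length : s'.ss.length = s.ss.length
  lt : j < s.ss.length
  sess : ∀ k, k ≠ j → s'.sess k = s.sess k
  node : (s'.sess j).node = (s.sess j).node
  kind : (s'.sess j).kind = (s.sess j).kind
  v : (s'.sess j).v = (s.sess j).v
  kind_ne : (s.sess j).kind ≠ 0
  peer_zero : s.peer j = 0

namespace IS.Same

variable {j : ℕ} {s s' : IS}

theorem kind_eq (h : Same j s s') (k : ℕ) : (s'.sess k).kind = (s.sess k).kind := by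
  by_cases hk : k = j
  · rw [hk, h.kind]
  · rw [h.sess k hk]

theorem v_eq (h : Same j s s') (k : ℕ) : (s'.sess k).v = (s.sess k).v := by
  by_cases hk : k = j
  · rw [hk, h.v]
  · rw [h.sess k hk]

theorem closed_eq (h : Same j s s') (k : ℕ) : s'.closed k = s.closed k := by
  unfold IS.closed
  rw [h.db, h.tst, h.kind_eq]

theorem peer_eq (h : Same j s s') (k : ℕ) : s'.peer k = s.peer k := by
  unfold IS.peer
  rw [h.db, h.v_eq]

theorem key_eq (h : Same j s s') (c : Ctx) {k : ℕ} (hk : k ≠ j) (u t : ℕ) :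
    s'.key c k u t = s.key c k u t := by
  unfold IS.key IS.zed
  rw [h.sess k hk]

theorem put (h : Same j s s') {k : ℕ × ℕ × ℕ} (hk : k ≠ (2, j, 0)) (v : ℕ) :
    Same j (s.put k v) (s'.put k v) :=
  { h with
    db := by rw [IS.put_db, IS.put_db, h.db]
    peer_zero := by rw [peer_put_of_ne hk, h.peer_zero] }

theorem get (h : Same j s s') (k : ℕ × ℕ × ℕ) : s'.get k = s.get k := by
  unfold IS.get; rw [h.db]

/-- What is to be shown about a query that does not begin a run. -/
def After (j : ℕ) (x x' : Data × IS) : Prop :=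
  x'.2.peer j = x.2.peer j ∧ (x.2.peer j = 0 → x'.1 = x.1 ∧ x.2.Same j x'.2)

theorem after (h : Same j s s') {d d' : Data} (hd : d' = d) : After j (d, s) (d', s') :=
  ⟨h.peer_eq j, fun _ => ⟨hd, h⟩⟩

theorem key_ne (c : Ctx) (s : IS) (i u t k : ℕ) : s.key c i u t ≠ (2, k, 0) := fun h => by
  have := key_fst c s i u t
  rw [h] at this
  omega

theorem deliver (h : Same j s s') (c : Ctx) (k m : ℕ) (R : Dr) :
    After j (s.deliver c k m R) (s'.deliver c k m R) := by
  have e2 : ∀ i, (2, i, 0) ≠ (2, j, 0) → i ≠ j := fun i hi h => hi (by rw [h])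
  unfold IS.deliver
  rw [h.length, h.closed_eq, h.peer_eq, h.v_eq]
  by_cases hk : k = j
  -- Only this delivery would read the unknown exponent. It either supplies the message of run `j`,
  -- the same in both states, after which nothing more is claimed, or it leaves the states alike.
  · subst hk
    rw [if_pos h.peer_zero, if_pos h.peer_zero]
    split_ifs
    · have h' : s'.peer k = 0 := by rw [h.peer_eq, h.peer_zero]
      have h1 := peer_put_self (v := m) h.peer_zero
      have h2 := peer_put_self (v := m) h'
      constructor
      · simp only
        rw [peer_put_of_ne (key_ne _ _ _ _ _ _), peer_put_of_ne (key_ne _ _ _ _ _ _), h1, h2]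
      · simp only
        rw [peer_put_of_ne (key_ne _ _ _ _ _ _), h1]
        simp
    · exact (h.put (by simp) _).after rfl
    · exact h.after rfl
    · exact h.after rfl
  · rw [h.key_eq c hk, h.key_eq c hk, h.key_eq c hk]
    have hk2 : ∀ t, s.key c k (s.peer k - 1) t ≠ (2, j, 0) := fun t => key_ne _ _ _ _ _ _
    have hm : s.key c k m 4 ≠ (2, j, 0) := key_ne _ _ _ _ _ _
    split_ifs
    · have h1 := (h.put (k := (2, k, 0)) (by simpa using hk) m).put hm R.h1
      exact h1.after (by rw [h1.get])
    · exact (h.put (by simp) _).after rfl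
    all_goals
      try simp only [(h.put (hk2 5) R.h1).get, (h.put (hk2 4) R.h1).get,
        ((h.put (hk2 4) R.h1).put (hk2 5) R.h2).get] at *
    all_goals try contradiction
    all_goals
      first
      | exact ((h.put (hk2 5) R.h1).put (by simp) _).after rfl
      | exact (((h.put (hk2 4) R.h1).put (hk2 5) R.h2).put (by simp) _).after rfl
      | exact h.after rfl

theorem reveal (h : Same j s s') (c : Ctx) (k : ℕ) (R : Dr) :
    After j (s.reveal c k R) (s'.reveal c k R) := by
  unfold IS.reveal
  rw [h.length, h.peer_eq]
  by_cases hk : k = j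
  · subst hk
    rw [if_pos h.peer_zero, if_pos h.peer_zero]
    split_ifs <;> exact h.after rfl
  · rw [h.key_eq c hk, h.db]
    have h1 := h.put (key_ne c s k (s.peer k - 1) 3 j) R.h1
    by_cases h2 : k < s.ss.length
    · rw [if_pos h2, if_pos h2]
      by_cases h3 : s.peer k = 0
      · rw [if_pos h3, if_pos h3]; exact h.after rfl
      · rw [if_neg h3, if_neg h3]; exact h1.after (by rw [h1.get])
    · rw [if_neg h2, if_neg h2]; exact h.after rfl

theorem secrets (h : Same j s s') {i : ℕ} (hi : (s.sess j).node ≠ i) :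
    s'.secrets i = s.secrets i := by
  unfold IS.secrets
  rw [foldl_secrets, foldl_secrets, reverse_eq_map_range, reverse_eq_map_range, h.length]
  simp only [List.filter_map, List.map_map, List.append_nil]
  have h1 : (fun k => decide ((rnth s'.ss k SR.zero).node = i)) =
      fun k => decide ((rnth s.ss k SR.zero).node = i) := by
    funext k
    by_cases hk : k = j
    · have : (rnth s'.ss k SR.zero).node = (rnth s.ss k SR.zero).node := by rw [hk]; exact h.node
      rw [this]
    · have := h.sess k hk
      rw [IS.sess] at this
      rw [this]; rfl
  simp only [Function.comp_def, h1]
  refine List.map_congr_left fun k hk => ?_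
  simp only [List.mem_filter, decide_eq_true_eq] at hk
  have hkj : k ≠ j := by
    rintro rfl
    exact hi hk.2
  have := h.sess k hkj
  rw [IS.sess] at this
  rw [this]; rfl

theorem corrupt (h : Same j s s') (hI : Inv pp γ s) (i : ℕ) :
    After j (s.corrupt (pp.ctx γ) i) (s'.corrupt (pp.ctx γ) i) := by
  unfold IS.corrupt
  rw [h.nodes, h.groups]
  by_cases hi : i < s.nodes.length
  swap
  · rw [if_neg hi, if_neg hi]; exact h.after rfl
  rw [if_pos hi, if_pos hi]
  by_cases hn : rnth s.nodes i 0 = (pp.ctx γ).γ + 1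
  · rw [if_pos hn, if_pos hn]; exact h.after rfl
  rw [if_neg hn, if_neg hn]
  -- Run `j` belongs to a member of the target group, whose exponents the ideal system never
  -- reveals.
  have hne : (s.sess j).node ≠ i := by
    rintro rfl
    exact hn ((hI.kind_iff j h.lt).mp h.kind_ne)
  rw [h.secrets hne]
  have h1 : ∀ l l', Same j ⟨s.groups, s.nodes, s.ss, s.tst, s.db, l⟩
      ⟨s.groups, s.nodes, s'.ss, s'.tst, s'.db, l'⟩ := fun l l' =>
    ⟨rfl, rfl, h.tst, h.db, h.length, h.lt, h.sess, h.node, h.kind, h.v, h.kind_ne, h.peer_zero⟩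
  exact (h1 _ _).after rfl

theorem other (h : Same j s s') (hI : Inv pp γ s) (d : Data) (R : Dr) :
    After j (s.other (pp.ctx γ) d R) (s'.other (pp.ctx γ) d R) := by
  have h1 : ∀ g n c c', Same j ⟨g, n, s.ss, s.tst, s.db, c⟩ ⟨g, n, s'.ss, s'.tst, s'.db, c'⟩ :=
    fun _ _ _ _ => ⟨rfl, rfl, h.tst, h.db, h.length, h.lt, h.sess, h.node, h.kind, h.v,
      h.kind_ne, h.peer_zero⟩
  unfold IS.other
  rw [h.groups, h.nodes]
  split_ifs
  · exact (h1 _ _ _ _).after rfl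
  · exact (h1 _ _ _ _).after rfl
  · exact h.after rfl
  · exact h.deliver _ _ _ _
  · exact h.reveal _ _ _
  · exact h.corrupt hI _
  · have h1 := h.put (k := (5, qx d, qy d)) (by simp) R.h1
    exact h1.after (by rw [h1.get])
  · exact h.after rfl

theorem opens_eq (h : Same j s s') (c : Ctx) (d : Data) : opens c s' d = opens c s d := by
  unfold opens IS.running
  rw [h.nodes, h.tst, h.db]

theorem step (h : Same j s s') (hI : Inv pp γ s) (d : Data) (R : Dr) :
    After j (s.step (pp.ctx γ) d R) (s'.step (pp.ctx γ) d R) := by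
  unfold IS.step
  rw [h.opens_eq]
  split_ifs with h0
  · exact h.other hI d R
  · have hlt := h.lt
    have hb : baseOf (pp.ctx γ) s' d R = baseOf (pp.ctx γ) s d R := by
      unfold baseOf; rw [h.nodes, h.groups]
    have hp : (opening (pp.ctx γ) s d R).2.peer j = 0 := by
      rw [peer_opening_lt h.lt, h.peer_zero]
    have hS : (opening (pp.ctx γ) s d R).2.Same j (opening (pp.ctx γ) s' d R).2 := by
      refine ⟨?_, ?_, ?_, ?_, ?_, ?_, ?_, ?_, ?_, ?_, ?_, hp⟩
      · rw [opening_groups, opening_groups, h.groups]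
      · rw [opening_nodes, opening_nodes, h.nodes]
      · rw [opening_tst, opening_tst, h.opens_eq, h.length, h.tst]
      · rw [opening_db, opening_db, h.db]
      · rw [opening_length, opening_length, h.length]
      · rw [opening_length]; omega
      · intro k hk
        rcases lt_trichotomy k s.ss.length with hl | hl | hl
        · rw [sess_opening_lt hl, sess_opening_lt (by rwa [h.length]), h.sess k hk]
        · have h1 := sess_opening_self (γ := γ) (pp := pp) (s := s) (d := d) (R := R)
          have h2 := sess_opening_self (γ := γ) (pp := pp) (s := s') (d := d) (R := R)
          rw [h.length] at h2
          rw [hl, h1, h2, h.opens_eq, hb]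
        · have e : ∀ t : IS, t.ss.length ≤ k → t.sess k = .zero := fun t ht => by
            simp [IS.sess, rnth, List.getD_eq_getElem?_getD,
              List.getElem?_eq_none (by simpa using ht : t.ss.reverse.length ≤ k)]
          rw [e (opening (pp.ctx γ) s' d R).2 (by rw [opening_length, h.length]; omega),
            e (opening (pp.ctx γ) s d R).2 (by rw [opening_length]; omega)]
      · rw [sess_opening_lt h.lt, sess_opening_lt (by rw [h.length]; exact h.lt), h.node]
      · rw [sess_opening_lt h.lt, sess_opening_lt (by rw [h.length]; exact h.lt), h.kind]
      · rw [sess_opening_lt h.lt, sess_opening_lt (by rw [h.length]; exact h.lt), h.v]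
      · rw [sess_opening_lt h.lt]; exact h.kind_ne
    refine ⟨hS.peer_eq j, fun _ => ⟨?_, hS⟩⟩
    unfold opening
    rw [h.opens_eq, hb, h.length]
    split_ifs <;> rfl

end IS.Same

/-- Until its message arrives the exponent of run `j` is never read, so with equal random choices
both experiments proceed alike; once it has arrived, it is permanent. -/
theorem ev_chain_same (len : ℕ) {j : ℕ} (f : ℕ → ℝ≥0∞) : ∀ n (x x' : CF), Inv pp γ x.s →
    x.K = x'.K → x.st = x'.st → x.s.Same j x'.s →
    ev (chain pp len γ n x) (fun y => f (y.s.peer j)) =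
      ev (chain pp len γ n x') fun y => f (y.s.peer j) := by
  have hfix : ∀ n (x : CF), j < x.s.ss.length → x.s.peer j ≠ 0 →
      ev (chain pp len γ n x) (fun y => f (y.s.peer j)) = f (x.s.peer j) := by
    intro n x hj hp
    rw [← ev_const (chain pp len γ n x) (f (x.s.peer j))]
    refine ev_congr fun y hy => ?_
    have := chain_invariant (pp := pp) (γ := γ) len (P := fun y => j < y.s.ss.length ∧
      y.s.peer j = x.s.peer j) (fun y r R h =>
        next_cases (P := fun s => j < s.ss.length ∧ s.peer j = x.s.peer j) y r R h fun d =>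
          ⟨h.1.trans_le (step_length _ d R).1, by
            rw [step_peer_of_peer h.1 (by rw [h.2]; exact hp), h.2]⟩) n x ⟨hj, rfl⟩ y hy
    rw [this.2]
  intro n
  induction n with
  | zero =>
    intro x x' _ _ _ h
    simp only [chain, ev_pure]
    rw [h.peer_eq]
  | succ n ih =>
    intro x x' hI hK hst h
    obtain ⟨K, st, s⟩ := x
    obtain ⟨K', st', s'⟩ := x'
    simp only at hK hst
    subst hK hst
    rw [ev_chain_succ, ev_chain_succ, ev_tick, ev_tick]
    refine ev_congr fun r _ => ev_congr fun R _ => ?_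
    cases K with
    | nil => exact ih _ _ hI rfl rfl h
    | cons c K =>
      cases c with
      | assign y e => exact ih ⟨_, _, _⟩ ⟨_, _, _⟩ hI rfl rfl h
      | rand y e => exact ih ⟨_, _, _⟩ ⟨_, _, _⟩ hI rfl rfl h
      | seq a b => exact ih ⟨_, _, _⟩ ⟨_, _, _⟩ hI rfl rfl h
      | ite e a b => exact ih ⟨_, _, _⟩ ⟨_, _, _⟩ hI rfl rfl h
      | loop e a => exact ih ⟨_, _, _⟩ ⟨_, _, _⟩ hI rfl rfl h
      | call y e =>
        obtain ⟨h1, h2⟩ := h.step hI (e.eval st) R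
        by_cases hp : (s.step (pp.ctx γ) (e.eval st) R).2.peer j = 0
        · obtain ⟨h3, h4⟩ := h2 hp
          refine ih ⟨_, _, _⟩ ⟨_, _, _⟩ (hI.step _ R) rfl ?_ h4
          simp only [h3]
        · have hl := h.lt.trans_le (step_length (pp := pp) (γ := γ) s (e.eval st) R).1
          have hl' := h.lt.trans_le (h.length ▸
            (step_length (pp := pp) (γ := γ) s' (e.eval st) R).1)
          have e1 := hfix n (CF.next (pp.ctx γ) ⟨.call y e :: K, st, s⟩ r R) hl hp
          have e2 := hfix n (CF.next (pp.ctx γ) ⟨.call y e :: K, st, s'⟩ r R) hl'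
            (by rw [← h1] at hp; exact hp)
          rw [e1, e2]
          exact congrArg f h1.symm

/-- Run `j` begins, with first message `X`, of unknown exponent. -/
def CF.graft (c : Ctx) (x : CF) (X : ℕ) : CF := x.next c 0 ⟨0, 0, X, 0, 0⟩

/-- The chance that `Z` is the secret that the adversary has in common with run `j`. -/
noncomputable def guess (pp : Params) (len γ T j Z : ℕ) (x : CF) : ℝ≥0∞ :=
  ev (unif pp.q) fun e => ev (chain pp len γ T (x.graft (pp.ctx γ) (pp.gp e))) fun z =>
    ind (z.s.peer j ≠ 0 ∧ (z.s.peer j - 1) ^ e % pp.p = Z)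

/-- The exponent stored for run `j` is replaced by `0`, while the message sent remains `g^e`. The
true exponent is then needed only for the final comparison with `Z`, not for running the experiment.
-/
theorem ev_tick_leads_le (len T : ℕ) {j : ℕ} (Z : ℕ) {x : CF} (hI : Inv pp γ x.s)
    (hf : x.fork (pp.ctx γ) j = 1) :
    (ev (tick pp len γ x) fun y => ev (chain pp len γ T y) fun z =>
      ind (z.s.Leads (pp.ctx γ) j Z)) ≤ guess pp len γ T j Z x := by
  obtain ⟨y, e, K, hK, hl, ho⟩ := fork_eq_one hf
  have hop : ∀ r R, (x.next (pp.ctx γ) r R) = ⟨K, Function.update x.st y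
      (opening (pp.ctx γ) x.s (e.eval x.st) R).1, (opening (pp.ctx γ) x.s (e.eval x.st) R).2⟩ := by
    intro r R
    rw [CF.next, hK]
    simp only [IS.step]
    rw [if_neg (by omega)]
  have h1 : ∀ r R, (ev (chain pp len γ T (x.next (pp.ctx γ) r R)) fun z =>
      ind (z.s.Leads (pp.ctx γ) j Z)) ≤ ev (chain pp len γ T (x.graft (pp.ctx γ) R.gx)) fun z =>
        ind (z.s.peer j ≠ 0 ∧ (z.s.peer j - 1) ^ R.r2 % pp.p = Z) := by
    intro r R
    have hI' : Inv pp γ (x.next (pp.ctx γ) r R).s := hI.next r R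
    have hs : (x.next (pp.ctx γ) r R).s.sess j =
        ⟨qx (e.eval x.st), opens (pp.ctx γ) x.s (e.eval x.st) - 1, qy (e.eval x.st), 0, R.r2⟩ := by
      rw [hop, ← hl]
      simp only [sess_opening_self]
      rw [if_neg (by omega)]
    have hs' : (x.graft (pp.ctx γ) R.gx).s.sess j =
        ⟨qx (e.eval x.st), opens (pp.ctx γ) x.s (e.eval x.st) - 1, qy (e.eval x.st), 0, 0⟩ := by
      rw [CF.graft, hop, ← hl]
      simp only [sess_opening_self]
      rw [if_neg (by omega)]
    have hjl : j < (x.next (pp.ctx γ) r R).s.ss.length := by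
      rw [hop]; simp only [opening_length]; omega
    have h2 : (ev (chain pp len γ T (x.next (pp.ctx γ) r R)) fun z =>
        ind (z.s.Leads (pp.ctx γ) j Z)) ≤ ev (chain pp len γ T (x.next (pp.ctx γ) r R)) fun z =>
          ind (z.s.peer j ≠ 0 ∧ (z.s.peer j - 1) ^ R.r2 % pp.p = Z) := by
      refine ev_mono fun z hz => ind_mono fun ⟨_, h3, h4⟩ => ⟨h3, ?_⟩
      have := chain_invariant (pp := pp) (γ := γ) len (P := fun y => j < y.s.ss.length ∧
        (y.s.sess j).exp = R.r2) (fun y r' R' h =>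
          next_cases (P := fun s => j < s.ss.length ∧ (s.sess j).exp = R.r2) y r' R' h fun d =>
            ⟨h.1.trans_le (step_length _ d R').1, by rw [step_sess h.1, h.2]⟩)
        T _ ⟨hjl, by rw [hs]⟩ z hz
      rw [← h4, IS.zed, this.2]
      exact (pp.pm_p _ _).symm
    refine h2.trans (le_of_eq ?_)
    have hpe : (x.graft (pp.ctx γ) R.gx).s.peer j = (x.next (pp.ctx γ) r R).s.peer j := by
      unfold IS.peer
      rw [hs, hs', CF.graft, hop, hop]
      simp only [opening_db]
    by_cases hp : (x.next (pp.ctx γ) r R).s.peer j = 0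
    · refine ev_chain_same len (fun u => ind (u ≠ 0 ∧ (u - 1) ^ R.r2 % pp.p = Z)) T _ _ hI' ?_ ?_ ?_
      · rw [CF.graft, hop, hop]
      · rw [CF.graft, hop, hop]
        simp only [opening]
        simp only [if_neg (show ¬ opens (pp.ctx γ) x.s (e.eval x.st) = 1 by omega)]
      · refine ⟨?_, ?_, ?_, ?_, ?_, hjl, ?_, by rw [hs, hs'], by rw [hs, hs'], by rw [hs, hs'],
          by rw [hs]; simp only; omega, hp⟩
        · rw [CF.graft, hop, hop]; simp only [opening_groups]
        · rw [CF.graft, hop, hop]; simp only [opening_nodes]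
        · rw [CF.graft, hop, hop]; simp only [opening_tst]
        · rw [CF.graft, hop, hop]; simp only [opening_db]
        · rw [CF.graft, hop, hop]; simp only [opening_length]
        · intro k hk
          rw [CF.graft, hop, hop]
          simp only
          by_cases hkl : k < x.s.ss.length
          · rw [sess_opening_lt hkl, sess_opening_lt hkl]
          · have e : ∀ t : IS, t.ss.length ≤ k → t.sess k = .zero := fun t ht => by
              simp [IS.sess, rnth, List.getD_eq_getElem?_getD,
                List.getElem?_eq_none (by simpa using ht : t.ss.reverse.length ≤ k)]
            rw [e _ (by rw [opening_length]; omega), e _ (by rw [opening_length]; omega)]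
    -- In the role of Bob, run `j` has its element from the start, so both sides are decided
    -- immediately.
    · have hfix : ∀ x' : CF, j < x'.s.ss.length → x'.s.peer j ≠ 0 →
          ∀ z ∈ (chain pp len γ T x').support, z.s.peer j = x'.s.peer j := by
        intro x' hj hp' z hz
        have := chain_invariant (pp := pp) (γ := γ) len (P := fun y => j < y.s.ss.length ∧
          y.s.peer j = x'.s.peer j) (fun y r R h =>
            next_cases (P := fun s => j < s.ss.length ∧ s.peer j = x'.s.peer j) y r R h fun d =>
              ⟨h.1.trans_le (step_length _ d R).1, by
                rw [step_peer_of_peer h.1 (by rw [h.2]; exact hp'), h.2]⟩) T x' ⟨hj, rfl⟩ z hz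
        exact this.2
      have e1 : ∀ x' : CF, j < x'.s.ss.length → x'.s.peer j ≠ 0 →
          (ev (chain pp len γ T x') fun z => ind (z.s.peer j ≠ 0 ∧
            (z.s.peer j - 1) ^ R.r2 % pp.p = Z)) =
          ind (x'.s.peer j ≠ 0 ∧ (x'.s.peer j - 1) ^ R.r2 % pp.p = Z) := by
        intro x' hj hp'
        rw [← ev_const (chain pp len γ T x') (ind (x'.s.peer j ≠ 0 ∧ _))]
        exact ev_congr fun z hz => by rw [hfix x' hj hp' z hz]
      rw [e1 _ hjl hp, e1 _ ?_ (by rw [hpe]; exact hp), hpe]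
      rw [CF.graft, hop]
      simp only [opening_length]
      omega
  rw [ev_tick]
  refine (ev_mono fun r _ => ev_mono fun R _ => h1 r R).trans (le_of_eq ?_)
  simp only [guess, ev_const, draws, ev_bind, ev_pure]

/-- The bound that the reduction has to beat. -/
noncomputable def chance (pp : Params) (len γ T i j : ℕ) (x : CF) : ℝ≥0∞ :=
  ind (x.fork (pp.ctx γ) j = 1 ∧ x.s.point (pp.ctx γ) i ≠ 1) *
    guess pp len γ T j (x.s.point (pp.ctx γ) i) x

theorem forkValue_le {len T i j : ℕ} {x : CF} (hI : Inv pp γ x.s) :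
    forkValue pp len γ T i j x ≤ chance pp len γ T i j x := by
  unfold forkValue chance
  by_cases hf : x.fork (pp.ctx γ) j = 1
  · rw [ind_true hf, one_mul]
    refine mul_le_mul' (ind_mono fun h => ⟨hf, h⟩) (ev_tick_leads_le len T _ hI hf)
  · rw [ind_false hf, zero_mul]; exact zero_le

theorem pre_invariant {len j : ℕ} {P : CF → Prop}
    (hP : ∀ x r R, P x → P (x.next (pp.ctx γ) r R)) :
    ∀ n x, P x → ∀ y ∈ (pre pp len γ j n x).support, P y := by
  intro n
  induction n with
  | zero => intro x hx y hy; simp [pre] at hy; exact hy ▸ hx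
  | succ n ih =>
    intro x hx y hy
    rw [pre] at hy
    split_ifs at hy
    · exact ih x hx y hy
    · simp only [tick, PMF.mem_support_bind_iff, PMF.support_map, Set.mem_image] at hy
      obtain ⟨z, ⟨r, -, R, -, rfl⟩, hy⟩ := hy
      exact ih _ (hP x r R hx) y hy

theorem badProb_le_chance (len n : ℕ) (K : List Cmd) (st : Store) : badProb pp len γ n K st ≤
    36 * (n : ℝ≥0∞) ^ 2 * ((pp.q - 1 : ℕ) : ℝ≥0∞)⁻¹ + ∑ i ∈ Finset.range n, ∑ j ∈ Finset.range n,
      ev (pre pp len γ j n ⟨K, st, .init⟩) (chance pp len γ n i j) := by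
  refine (badProb_le len n K st).trans (add_le_add le_rfl ?_)
  refine (ev_collision_le len n K st).trans ?_
  refine Finset.sum_le_sum fun i _ => Finset.sum_le_sum fun j _ => ev_mono fun y hy => ?_
  exact forkValue_le (pre_invariant (P := fun y => Inv pp γ y.s) (fun y r R h => h.next r R) n _
    .init y hy)

end Handshake

namespace Handshake

open scoped ENNReal

/-! ### Sampling in polynomial time -/

theorem SStep.val_le {S : Type} {c : Cmd} {t : ℕ} {st st' : Store} (h : SStep c t st st')
    (O : Env S) {post : Option Data → ℝ≥0∞} (hpost : post none = 0) (n : ℕ) (K : List Cmd) (s : S) :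
    val O post n K st' s ≤ val O post (n + t) (c :: K) st s := by
  obtain ⟨t', ht, h⟩ := h
  refine le_trans (le_of_eq ?_) (val_mono O post hpost (n + t') (n + t) _ _ _ (by omega))
  rw [val, val, h]

/-- The command `c` turns the contents `x` of register `b` into a value distributed as in `F`, or a
better one, in at most `t` steps, and does not change the registers below `b`. -/
def Runs {β : Type} [Enc β] (c : Cmd) (b t : ℕ) (x : Data) (F : PMF β) : Prop :=
  ∀ (S : Type) (O : Env S) (post : Option Data → ℝ≥0∞), post none = 0 → ∀ st : Store, st b = x →
    ∀ (n : ℕ) (K : List Cmd) (s : S) (g : β → ℝ≥0∞),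
    (∀ y ∈ F.support, ∀ st' : Store, st' b = enc y → (∀ i < b, st' i = st i) →
      g y ≤ val O post n K st' s) → ev F g ≤ val O post (n + t) (c :: K) st s

section

variable {α β γ : Type} [Enc α] [Enc β] [Enc γ]

theorem Runs.mono {c : Cmd} {b t t' : ℕ} {x : Data} {F : PMF β} (h : Runs c b t x F)
    (ht : t ≤ t') : Runs c b t' x F := fun S O post h0 st hst n K s g hg =>
  (h S O post h0 st hst n K s g hg).trans (val_mono O post h0 _ _ _ _ _ (by omega))

theorem Step.runs {c : Cmd} {b t : ℕ} {x : Data} {y : β} (h : Step c b t x (enc y)) :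
    Runs c b t x (PMF.pure y) := by
  intro S O post h0 st hst n K s g hg
  obtain ⟨st', h1, h2, h3⟩ := h st hst
  rw [ev_pure]
  exact (hg y (by simp) st' h1 h2).trans (h3.val_le O h0 n K s)

theorem Runs.seq {c d : Cmd} {b t u : ℕ} {x : Data} {F : PMF β} {G : β → PMF γ}
    (hF : Runs c b t x F) (hG : ∀ y ∈ F.support, Runs d b u (enc y) (G y)) :
    Runs (.seq c d) b (t + u + 1) x (F.bind G) := by
  intro S O post h0 st hst n K s g hg
  rw [ev_bind, show n + (t + u + 1) = (n + u) + t + 1 by omega, val_seq]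
  refine hF S O post h0 st hst _ _ _ _ fun y hy st' h1 h2 => ?_
  refine hG y hy S O post h0 st' h1 _ _ _ _ fun z hz st'' h3 h4 => ?_
  exact hg z ((PMF.mem_support_bind_iff _ _ _).mpr ⟨y, hy, hz⟩) st'' h3
    fun i hi => (h4 i hi).trans (h2 i hi)

/-- Families of distributions that can be sampled in time polynomial in the depth of the argument.
-/
def PTime (F : α → PMF β) : Prop :=
  ∃ (c : ℕ → Cmd) (p : Polynomial ℕ), ∀ a, (∀ y ∈ (F a).support, edepth y ≤ p.eval (edepth a)) ∧
    ∀ b, Runs (c b) b (p.eval (edepth a)) (enc a) (F a)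

theorem Comp.ptime {f : α → β} (hf : Comp f) : PTime fun a => PMF.pure (f a) := by
  obtain ⟨c, p, C, h⟩ := hf
  refine ⟨c, p + .X + .C C, fun a => ⟨?_, fun b => ?_⟩⟩
  · intro y hy
    simp only [PMF.support_pure, Set.mem_singleton_iff] at hy
    subst hy
    have := (h a).1
    simp only [Polynomial.eval_add, Polynomial.eval_X, Polynomial.eval_C]
    omega
  · refine (((h a).2 b).runs).mono ?_
    simp only [Polynomial.eval_add, Polynomial.eval_X, Polynomial.eval_C]
    omega

theorem PTime.unif : PTime unif := by
  refine ⟨fun b => .rand b (.var b), 1, fun a => ⟨fun y _ => by simp, fun b => ?_⟩⟩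
  intro S O post h0 st hst n K s g hg
  simp only [Polynomial.eval_one]
  rw [val_rand]
  simp only [Exp.eval, hst, enc_nat, Data.toNat]
  exact ev_mono fun r hr => hg r hr _ (by simp) fun i hi => by simp [Function.update_of_ne hi.ne]

theorem PTime.seq {F : α → PMF β} {G : β → PMF γ} (hF : PTime F) (hG : PTime G) :
    PTime fun a => (F a).bind G := by
  obtain ⟨c, p, hF⟩ := hF
  obtain ⟨d, r, hG⟩ := hG
  refine ⟨fun b => .seq (c b) (d b), p + r.comp p + 1, fun a => ⟨?_, fun b => ?_⟩⟩
  · intro z hz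
    obtain ⟨y, hy, hz⟩ := (PMF.mem_support_bind_iff _ _ _).mp hz
    have h1 := (hG y).1 z hz
    have h2 := poly_mono r ((hF a).1 y hy)
    simp only [Polynomial.eval_add, Polynomial.eval_comp, Polynomial.eval_one] at *
    omega
  · refine (((hF a).2 b).seq (u := r.eval (p.eval (edepth a))) fun y hy =>
      ((hG y).2 b).mono ?_).mono ?_
    · exact poly_mono r ((hF a).1 y hy)
    · simp

theorem PTime.comp {F : β → PMF γ} {f : α → β} (hF : PTime F) (hf : Comp f) :
    PTime fun a => F (f a) := by
  simpa using hf.ptime.seq hF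

theorem PTime.keep {F : α → PMF β} (hF : PTime F) :
    PTime fun a => (F a).map fun y => (a, y) := by
  obtain ⟨c, p, hF⟩ := hF
  refine ⟨fun b => .seq (.assign (b + 1) (.var b)) (.seq (c (b + 1))
    (.assign b (.pair (.var b) (.var (b + 1))))), p + .X + 4, fun a => ⟨?_, fun b => ?_⟩⟩
  · intro z hz
    simp only [PMF.support_map, Set.mem_image] at hz
    obtain ⟨y, hy, rfl⟩ := hz
    have := (hF a).1 y hy
    simp only [edepth_pair, Polynomial.eval_add, Polynomial.eval_X, Polynomial.eval_ofNat]
    omega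
  · intro S O post h0 st hst n K s g hg
    have e : n + (p + .X + 4).eval (edepth a) =
        (n + edepth a + 1) + p.eval (edepth a) + 1 + 1 + 1 := by
      simp only [Polynomial.eval_add, Polynomial.eval_X, Polynomial.eval_ofNat]; omega
    rw [e, val_seq, val_assign, val_seq, ev_map]
    refine (hF a).2 (b + 1) S O post h0 _ (by simp [Exp.eval, hst]) _ _ _ _ fun y hy st' h1 h2 => ?_
    have hb : st' b = enc a := by simp [h2 b (by omega), hst]
    rw [val_assign]
    refine le_trans ?_ (val_mono O post h0 n _ _ _ _ (by omega))
    refine hg (a, y) ?_ _ (by simp [Exp.eval, h1, hb]) fun i hi => ?_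
    · simp only [PMF.support_map, Set.mem_image]
      exact ⟨y, hy, rfl⟩
    · rw [Function.update_of_ne hi.ne, h2 i (by omega), Function.update_of_ne (by omega)]

theorem PTime.bind {F : α → PMF β} {G : α → β → PMF γ} (hF : PTime F)
    (hG : PTime fun z : α × β => G z.1 z.2) : PTime fun a => (F a).bind (G a) := by
  have := hF.keep.seq hG
  simpa [PMF.map, PMF.bind_bind] using this

/-- Iterated sampling. -/
noncomputable def iter {β : Type} (F : β → PMF β) : ℕ → β → PMF β
  | 0, y => PMF.pure y
  | n + 1, y => (F y).bind (iter F n)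

theorem iter_pure {β : Type} (f : β → β) : ∀ (n : ℕ) (y : β),
    iter (fun y => PMF.pure (f y)) n y = PMF.pure (f^[n] y)
  | 0, y => rfl
  | n + 1, y => by rw [iter, PMF.pure_bind, iter_pure f n, Function.iterate_succ_apply]

theorem edepth_iter {F : α → γ → PMF γ} {a : α} {D : ℕ}
    (hD : ∀ y, ∀ y' ∈ (F a y).support, edepth y' ≤ max (edepth a) (edepth y) + D) :
    ∀ (n : ℕ) (y : γ), ∀ y' ∈ (iter (F a) n y).support,
      max (edepth a) (edepth y') ≤ max (edepth a) (edepth y) + n * D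
  | 0, y, y', h => by
    simp only [iter, PMF.support_pure, Set.mem_singleton_iff] at h
    simp [h]
  | n + 1, y, y', h => by
    obtain ⟨z, hz, h⟩ := (PMF.mem_support_bind_iff _ _ _).mp h
    have h1 := hD y z hz
    have h2 := edepth_iter hD n z y' h
    rw [Nat.succ_mul]
    omega

/-- One iteration adds to the larger of two depths an amount that depends on `a` only. So depth
grows linearly with the number of iterations, and the total time stays polynomial, which composing
arbitrary polynomials would not ensure. -/
theorem PTime.iter {l : α → List ℕ} {i : α → γ} {F : α → γ → PMF γ} (hl : Comp l) (hi : Comp i)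
    (hF : PTime fun z : α × γ => F z.1 z.2) (P : Polynomial ℕ)
    (hP : ∀ a y, ∀ y' ∈ (F a y).support,
      edepth y' ≤ max (edepth a) (edepth y) + P.eval (edepth a)) :
    PTime fun a => iter (F a) (l a).length (i a) := by
  -- The loop state consists of the fixed argument, the list that serves as a counter, and the
  -- current value.
  let G (z : α × List ℕ × γ) : PMF (α × List ℕ × γ) :=
    (F z.1 z.2.2).bind fun y => PMF.pure (z.1, z.2.1.tail, y)
  have hG : PTime G := by
    refine PTime.bind (G := fun z y => PMF.pure (z.1, z.2.1.tail, y))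
      (hF.comp (f := fun z : α × List ℕ × γ => (z.1, z.2.2)) (by fun_prop)) ?_
    exact Comp.ptime (f := fun z : (α × List ℕ × γ) × γ => (z.1.1, z.1.2.1.tail, z.2)) (by fun_prop)
  obtain ⟨c, p, hG⟩ := hG
  obtain ⟨ci, pi, Ci, hi'⟩ := (Comp.id (α := α)).prodMk (hl.prodMk hi)
  have hloop : ∀ (b : ℕ) (a : α) (E : ℕ) (m : List ℕ) (y : γ), edepth m ≤ E →
      max (edepth a) (edepth y) + m.length * P.eval (edepth a) ≤ E →
      Runs (.loop (.isPair (.fst (.snd (.var b)))) (c b)) b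
        (m.length * (p.eval (E + 2) + 1) + 1) (enc (a, m, y))
        ((Handshake.iter (F a) m.length y).map fun y' => (a, ([] : List ℕ), y')) := by
    intro b a E m
    induction m with
    | nil =>
      intro y _ _ S O post h0 st hst n K s g hg
      rw [ev_map]
      simp only [List.length_nil, Handshake.iter, zero_mul, zero_add, ev_pure]
      rw [val_loop, if_neg (by simp [Exp.eval, hst, Data.fst, Data.snd, Data.isPair, Data.toNat])]
      exact hg _ (by simp [Handshake.iter]) st hst fun _ _ => rfl
    | cons x m ih =>
      intro y hm hy S O post h0 st hst n K s g hg
      have hm' : edepth m ≤ E := (edepth_tail x m).1.trans hm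
      simp only [List.length_cons, Nat.succ_mul] at hy ⊢
      rw [ev_map, Handshake.iter, ev_bind]
      rw [show n + (m.length * (p.eval (E + 2) + 1) + (p.eval (E + 2) + 1) + 1) =
        n + (m.length * (p.eval (E + 2) + 1) + 1) + p.eval (E + 2) + 1 by omega]
      rw [val_loop, if_pos (by simp [Exp.eval, hst, Data.fst, Data.snd, Data.isPair, Data.toNat])]
      have hd : edepth (a, x :: m, y) ≤ E + 2 := by
        simp only [edepth_pair]; omega
      have key := (((hG (a, x :: m, y)).2 b).mono (poly_mono p hd)) S O post h0 st hst
        (n + (m.length * (p.eval (E + 2) + 1) + 1))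
        (.loop (.isPair (.fst (.snd (.var b)))) (c b) :: K) s
        (fun z => ev (Handshake.iter (F a) m.length z.2.2) fun y' => g (a, [], y')) ?_
      · simpa only [G, ev_bind, ev_pure] using key
      · intro z hz st' h1 h2
        obtain ⟨w, hw, hz⟩ := (PMF.mem_support_bind_iff _ _ _).mp hz
        simp only [List.tail_cons, PMF.support_pure, Set.mem_singleton_iff] at hz
        subst hz
        have h3 := hP a y w hw
        refine le_trans (le_of_eq ?_) (ih w hm' (by omega) S O post h0 st' h1 n K s g ?_)
        · rw [ev_map]
        · intro y' hy' st'' h4 h5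
          refine hg y' ?_ st'' h4 fun i hi => (h5 i hi).trans (h2 i hi)
          simp only [PMF.support_map, Set.mem_image, Handshake.iter,
            PMF.mem_support_bind_iff, List.length_cons] at hy' ⊢
          obtain ⟨v, hv, rfl⟩ := hy'
          exact ⟨v, ⟨w, hw, hv⟩, rfl⟩
  -- `E` bounds the depths throughout: the initial ones, plus the growth per iteration times the
  -- number of iterations, the latter being at most the depth of the counter.
  let E : Polynomial ℕ := .X + .C Ci + (.X + .C Ci) * P
  have hE : ∀ a, edepth (l a) ≤ E.eval (edepth a) ∧
      max (edepth a) (edepth (i a)) + (l a).length * P.eval (edepth a) ≤ E.eval (edepth a) := by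
    intro a
    have h1 := (hi' a).1
    simp only [edepth_pair] at h1
    have h2 := length_le_edepth (l a)
    have h3 : (l a).length * P.eval (edepth a) ≤ (edepth a + Ci) * P.eval (edepth a) := by
      gcongr; omega
    simp only [E, Polynomial.eval_add, Polynomial.eval_X, Polynomial.eval_C, Polynomial.eval_mul]
    omega
  refine ⟨fun b => .seq (.seq (ci b) (.loop (.isPair (.fst (.snd (.var b)))) (c b)))
    (.assign b (.snd (.snd (.var b)))), pi + (.X + .C Ci) * (p.comp (E + 2) + 1) + E + 4,
    fun a => ⟨?_, fun b => ?_⟩⟩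
  · intro y hy
    have h1 := edepth_iter (hP a) (l a).length (i a) y hy
    have h2 := (hE a).2
    simp only [Polynomial.eval_add]
    omega
  · have h1 := hloop b a _ _ (i a) (hE a).1 (hE a).2
    have h2 := (((hi' a).2 b).runs (y := (a, l a, i a))).seq (G := fun z : α × List ℕ × γ =>
      (Handshake.iter (F a) z.2.1.length z.2.2).map fun y' => (a, ([] : List ℕ), y'))
      (fun z hz => by
        simp only [PMF.support_pure, Set.mem_singleton_iff] at hz
        subst hz
        exact h1)
    have h3 := h2.seq (G := fun z : α × List ℕ × γ => PMF.pure z.2.2)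
      (d := .assign b (.snd (.snd (.var b)))) (u := 1)
      (fun z hz => (Step.assign fun st hst => by simp [Exp.eval, hst, Data.snd]).runs)
    simp only [PMF.pure_bind, PMF.map, PMF.bind_bind, Function.comp_def, PMF.bind_pure] at h3
    refine h3.mono ?_
    have h4 : (l a).length ≤ edepth a + Ci := by
      have h1 := (hi' a).1
      simp only [edepth_pair] at h1
      have h2 := length_le_edepth (l a)
      omega
    have h5 : (l a).length * (p.eval (E.eval (edepth a) + 2) + 1) ≤
      (edepth a + Ci) * (p.eval (E.eval (edepth a) + 2) + 1) := by gcongr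
    simp only [Polynomial.eval_add, Polynomial.eval_X, Polynomial.eval_C, Polynomial.eval_mul,
      Polynomial.eval_comp, Polynomial.eval_one, Polynomial.eval_ofNat]
    omega

/-! Lists as unary numbers -/

theorem edepth_replicate_append (k : ℕ) (l : List ℕ) :
    edepth (List.replicate k 0 ++ l) ≤ edepth l + k := by
  induction k with
  | zero => simp
  | succ k ih =>
    simp only [List.replicate_succ, List.cons_append, edepth, enc_cons, enc_nat, Data.depth] at *
    omega

theorem PTime.append {f g : α → List ℕ} (hf : Comp f) (hg : Comp g) :
    PTime fun a => PMF.pure (List.replicate (f a).length 0 ++ g a) := by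
  have := PTime.iter (F := fun _ y => PMF.pure (0 :: y)) hf hg
    (Comp.ptime (f := fun z : α × List ℕ => 0 :: z.2) (by fun_prop)) 1 (by
      intro a y y' h
      simp only [PMF.support_pure, Set.mem_singleton_iff] at h
      subst h
      have := edepth_replicate_append 1 y
      simp only [List.replicate_one, List.singleton_append, Polynomial.eval_one] at *
      omega)
  refine (congrArg PTime ?_).mp this
  funext a
  rw [iter_pure]
  congr 1
  generalize (f a).length = n
  generalize g a = l
  induction n generalizing l with
  | zero => rfl
  | succ n ih => rw [Function.iterate_succ_apply, ih, List.replicate_succ',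
      List.append_assoc, List.singleton_append]

theorem PTime.mul {f g : α → List ℕ} (hf : Comp f) (hg : Comp g) :
    PTime fun a => PMF.pure (List.replicate ((f a).length * (g a).length) 0) := by
  obtain ⟨c, p, C, hf'⟩ := id hf
  have := PTime.iter (F := fun a y => PMF.pure (List.replicate (f a).length 0 ++ y))
    (i := fun _ => []) hg (by fun_prop)
    (PTime.append (f := fun z : α × List ℕ => f z.1) (g := fun z => z.2) (by fun_prop) (by fun_prop))
    (.X + .C C) (by
      intro a y y' h
      simp only [PMF.support_pure, Set.mem_singleton_iff] at h
      subst h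
      have h1 := edepth_replicate_append (f a).length y
      have h2 := length_le_edepth (f a)
      have h3 := (hf' a).1
      simp only [Polynomial.eval_add, Polynomial.eval_X, Polynomial.eval_C]
      omega)
  refine (congrArg PTime ?_).mp this
  funext a
  rw [iter_pure]
  congr 1
  generalize (f a).length = n
  have : ∀ m l, (fun y => List.replicate n 0 ++ y)^[m] (List.replicate l 0) =
      List.replicate (n * m + l) 0 := by
    intro m
    induction m with
    | zero => simp
    | succ m ih =>
      intro l
      rw [Function.iterate_succ_apply, List.replicate_append_replicate, ih]
      congr 1
      ring
  simpa using this (g a).length 0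

/-- Clocks and hash lengths are polynomials, and as loop counters they are needed in unary. They are
built by induction on the polynomial, by concatenation and repetition. -/
theorem PTime.poly (p : Polynomial ℕ) :
    PTime fun l : List ℕ => PMF.pure (List.replicate (p.eval l.length) 0) := by
  induction p using Polynomial.induction_on with
  | C a => simpa using (Comp.const (List.replicate a 0)).ptime
  | add p r hp hr =>
    have h1 := PTime.bind hp (G := fun l x => (PMF.pure (List.replicate (r.eval l.length) 0)).bind
      fun y => PMF.pure (List.replicate x.length 0 ++ y)) <| by
        refine PTime.bind (hr.comp (f := fun z : List ℕ × List ℕ => z.1) (by fun_prop))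
          (G := fun z y => PMF.pure (List.replicate z.2.length 0 ++ y)) ?_
        exact PTime.append (f := fun z : (List ℕ × List ℕ) × List ℕ => z.1.2) (g := fun z => z.2)
          (by fun_prop) (by fun_prop)
    simpa [List.replicate_append_replicate] using h1
  | monomial n a h =>
    have h1 := PTime.bind h (G := fun l x => PMF.pure (List.replicate (x.length * l.length) 0))
      (PTime.mul (f := fun z : List ℕ × List ℕ => z.2) (g := fun z => z.1) (by fun_prop)
        (by fun_prop))
    simpa [pow_succ, mul_assoc] using h1

/-- A machine that has the security parameter in unary can be turned into one that has it in binary.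
-/
theorem exists_machine {F : List ℕ × Data → PMF ℕ} (hF : PTime F) (D : ℕ) : ∃ B : PPT,
    ∀ (σ : ℕ) (d : Data) (c : ℕ) {S : Type} (O : Env S) (s : S), edepth d ≤ D → d.fst = .num σ →
      ev (F (List.replicate σ 0, d)) (fun y => ind (y = c)) ≤
        ev (B.run σ O s d) fun o => ind (o.map Data.toNat = some c) := by
  obtain ⟨c, p, hF⟩ := hF
  -- Register `2` counts down from `σ` while a list grows in register `1`; each of the `σ`
  -- iterations takes four steps.
  let lp : Cmd := .loop (.var 2)
    (.seq (.assign 1 (.pair (.lit 0) (.var 1))) (.assign 2 (.sub (.var 2) (.lit 1))))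
  let unary : Cmd := .seq (.assign 1 (.lit 0)) (.seq (.assign 2 (.fst (.var 0)))
    (.seq lp (.assign 0 (.pair (.var 1) (.var 0)))))
  have hlp : ∀ (n m : ℕ) (st : Store), st 2 = .num n → st 1 = enc (List.replicate m 0) →
      ∃ st' : Store, st' 1 = enc (List.replicate (n + m) 0) ∧ st' 0 = st 0 ∧
        SStep lp (4 * n + 1) st st' := by
    intro n
    induction n with
    | zero =>
      intro m st h2 h1
      exact ⟨st, by simpa using h1, rfl, SStep.loop_false (by simp [Exp.eval, h2, Data.toNat])⟩
    | succ n ih =>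
      intro m st h2 h1
      have s1 := SStep.assign 1 (.pair (.lit 0) (.var 1)) st
      have s2 := SStep.assign 2 (.sub (.var 2) (.lit 1))
        (Function.update st 1 ((Exp.pair (.lit 0) (.var 1)).eval st))
      obtain ⟨st', e1, e2, s3⟩ := ih (m + 1) (Function.update
        (Function.update st 1 ((Exp.pair (.lit 0) (.var 1)).eval st)) 2
          ((Exp.sub (.var 2) (.lit 1)).eval
            (Function.update st 1 ((Exp.pair (.lit 0) (.var 1)).eval st))))
        (by simp [Exp.eval, h2, Data.toNat]) (by simp [Exp.eval, h1, List.replicate_succ])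
      refine ⟨st', by rw [e1]; congr 2; omega, by rw [e2]; simp, ?_⟩
      exact ((s1.seq s2).loop_true (by simp [Exp.eval, h2, Data.toNat]) s3).mono (by omega)
  refine ⟨⟨.seq unary (c 0), 4 * .X + 10 + p.comp (.X + .C (D + 1))⟩, ?_⟩
  intro σ d y S O s hd hσ
  rw [PPT.run]
  set st : Store := Function.update (fun _ => .num 0) 0 d with hst
  set post : Option Data → ℝ≥0∞ := fun o => ind (o.map Data.toNat = some y) with hpost
  have h0 : post none = 0 := ind_false (by simp)
  have s1 := SStep.assign 1 (.lit 0) st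
  set st1 := Function.update st 1 ((Exp.lit 0).eval st) with hst1
  have s2 := SStep.assign 2 (.fst (.var 0)) st1
  set st2 := Function.update st1 2 ((Exp.fst (.var 0)).eval st1) with hst2
  obtain ⟨st3, e1, e0, s3⟩ := hlp σ 0 st2 (by simp [hst2, hst1, hst, Exp.eval, hσ])
    (by simp [hst2, hst1, Exp.eval])
  have s4 := SStep.assign 0 (.pair (.var 1) (.var 0)) st3
  have hs := (s1.seq (s2.seq (s3.seq s4))).val_le O h0
    (p.eval (edepth (List.replicate σ 0, d))) [c 0] s
  have hdep : edepth (List.replicate σ 0, d) ≤ σ + (D + 1) := by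
    have := edepth_replicate_append σ []
    simp only [List.append_nil] at this
    have h : edepth ([] : List ℕ) = 0 := rfl
    simp only [edepth_pair]
    omega
  have hr := (hF (List.replicate σ 0, d)).2 0 S O post h0
    (Function.update st3 0 ((Exp.pair (.var 1) (.var 0)).eval st3))
    (by simp [Exp.eval, e1, e0, hst2, hst1, hst]) 0 [] s (fun z => ind (z = y))
    (fun z _ st' h1 _ => by
      rw [val_nil, h1, hpost]
      exact ind_mono fun h => by simp [Data.toNat, h])
  rw [zero_add] at hr
  have := poly_mono p hdep
  refine (hr.trans hs).trans ?_
  change _ ≤ val O post _ _ _ _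
  have e : (4 * Polynomial.X + 10 + p.comp (Polynomial.X + Polynomial.C (D + 1))).eval σ =
      4 * σ + 9 + p.eval (σ + (D + 1)) + 1 := by
    simp; omega
  rw [e, val_seq]
  exact val_mono O post h0 _ _ _ _ _ (by simp only at this; omega)

end

end Handshake

namespace Handshake

open scoped ENNReal

/-! ### The ideal experiment as a program -/

/-- The value of a variable in a store that is a right-nested tree. -/
def Data.get : ℕ → Data → Data
  | 0, d => d.fst
  | i + 1, d => d.snd.get i

def Data.upd : ℕ → Data → Data → Data
  | 0, v, d => .pair v d.snd
  | i + 1, v, d => .pair d.fst (Data.upd i v d.snd)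

theorem Data.get_num (n : ℕ) : ∀ i, Data.get i (.num n) = .num 0
  | 0 => rfl
  | i + 1 => by
    rw [Data.get, Data.snd]
    exact Data.get_num 0 i

theorem Data.get_upd (v : Data) : ∀ (i k : ℕ) (d : Data),
    (Data.upd i v d).get k = if k = i then v else d.get k
  | 0, 0, d => rfl
  | 0, k + 1, d => rfl
  | i + 1, 0, d => rfl
  | i + 1, k + 1, d => by
    simp only [Data.upd, Data.get, Data.snd, Data.get_upd v i k, Nat.add_right_cancel_iff]

/-- The store that is represented by a tree. -/
def Data.store (d : Data) : Store := fun i => d.get i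

theorem Data.store_upd (i : ℕ) (v d : Data) :
    (Data.upd i v d).store = Function.update d.store i v := by
  funext k
  rw [Data.store, Data.get_upd, Function.update_apply]
  rfl

section

variable {α : Type} [Enc α]

@[fun_prop]
theorem Comp.get {f : α → Data} (i : ℕ) (hf : Comp f) : Comp fun a => (f a).get i := by
  induction i generalizing f with
  | zero => exact hf.dataFst
  | succ i ih => exact ih hf.dataSnd

@[fun_prop]
theorem Comp.upd {f g : α → Data} (i : ℕ) (hg : Comp g) (hf : Comp f) :
    Comp fun a => Data.upd i (g a) (f a) := by
  induction i generalizing f with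
  | zero => exact hg.dataPair hf.dataSnd
  | succ i ih => exact hf.dataFst.dataPair (ih hf.dataSnd)

@[fun_prop]
theorem Comp.eval {f : α → Data} (e : Exp) (hf : Comp f) : Comp fun a => e.eval (f a).store := by
  induction e with
  | var i => exact hf.get i
  | lit n => exact Comp.const (Data.num n)
  | pair a b iha ihb => exact iha.dataPair ihb
  | fst a ih => exact ih.dataFst
  | snd a ih => exact ih.dataSnd
  | isPair a ih => exact ih.dataIsPair
  | eq a b iha ihb =>
    have : Comp fun x => if (a.eval (f x).store).toNat = (b.eval (f x).store).toNat then 1 else 0 :=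
      by fun_prop
    simpa [Exp.eval, Data.ofBool] using this.dataNum
  | lt a b iha ihb =>
    have : Comp fun x => if (a.eval (f x).store).toNat < (b.eval (f x).store).toNat then 1 else 0 :=
      by fun_prop
    simpa [Exp.eval, Data.ofBool] using this.dataNum
  | add a b iha ihb => exact (iha.toNat.add ihb.toNat).dataNum
  | sub a b iha ihb => exact (iha.toNat.sub ihb.toNat).dataNum
  | mod a b iha ihb => exact (iha.toNat.mod ihb.toNat).dataNum
  | div a b iha ihb =>
    exact (Comp.natOp (fun x y => x / y) .div (fun _ _ _ => by simp [Exp.eval]) iha.toNat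
      ihb.toNat).dataNum
  | mulMod a b m iha ihb ihm =>
    convert (iha.toNat.mm ihb.toNat ihm.toNat).dataNum using 2
    simp only [Exp.eval, Handshake.mm]
    split_ifs <;> rfl
  | powMod a b m iha ihb ihm =>
    convert (iha.toNat.pm ihb.toNat ihm.toNat).dataNum using 2
    simp only [Exp.eval, Handshake.pm]
    split_ifs <;> rfl

end

/-- The commands that a program consists of. -/
def Cmd.subs : Cmd → List Cmd
  | .assign x e => [.assign x e]
  | .rand x e => [.rand x e]
  | .call x e => [.call x e]
  | .seq a b => .seq a b :: (a.subs ++ b.subs)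
  | .ite e a b => .ite e a b :: (a.subs ++ b.subs)
  | .loop e a => .loop e a :: a.subs

def Cmd.skip : Cmd := .assign 0 (.lit 0)

/-- Command number `i` of a program. -/
def Cmd.at (P : Cmd) (i : ℕ) : Cmd := P.subs.getD i .skip

open Classical in
/-- The number of a command. -/
noncomputable def Cmd.idx (P c : Cmd) : ℕ := P.subs.idxOf c

theorem Cmd.mem_subs (c : Cmd) : c ∈ c.subs := by cases c <;> simp [Cmd.subs]

theorem Cmd.at_zero (c : Cmd) : c.at 0 = c := by cases c <;> simp [Cmd.subs, Cmd.at]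

theorem Cmd.subs_trans {c d : Cmd} : ∀ {P : Cmd}, c ∈ P.subs → d ∈ c.subs → d ∈ P.subs := by
  intro P
  induction P with
  | assign x e => intro h1 h2; simp only [Cmd.subs, List.mem_singleton] at h1; exact h1 ▸ h2
  | rand x e => intro h1 h2; simp only [Cmd.subs, List.mem_singleton] at h1; exact h1 ▸ h2
  | call x e => intro h1 h2; simp only [Cmd.subs, List.mem_singleton] at h1; exact h1 ▸ h2
  | seq a b iha ihb =>
    intro h1 h2
    simp only [Cmd.subs, List.mem_cons, List.mem_append] at h1 ⊢
    rcases h1 with rfl | h1 | h1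
    · simpa [Cmd.subs] using h2
    · exact .inr (.inl (iha h1 h2))
    · exact .inr (.inr (ihb h1 h2))
  | ite e a b iha ihb =>
    intro h1 h2
    simp only [Cmd.subs, List.mem_cons, List.mem_append] at h1 ⊢
    rcases h1 with rfl | h1 | h1
    · simpa [Cmd.subs] using h2
    · exact .inr (.inl (iha h1 h2))
    · exact .inr (.inr (ihb h1 h2))
  | loop e a ih =>
    intro h1 h2
    simp only [Cmd.subs, List.mem_cons] at h1 ⊢
    rcases h1 with rfl | h1
    · simpa [Cmd.subs] using h2
    · exact .inr (ih h1 h2)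

theorem Cmd.at_idx {P c : Cmd} (h : c ∈ P.subs) : P.at (P.idx c) = c := by
  classical
  unfold Cmd.at Cmd.idx
  rw [List.getD_eq_getElem?_getD]
  have := List.idxOf_lt_length_iff.mpr h
  simp [List.getElem?_eq_getElem this]

/-- Numbers out of range denote `Cmd.skip`. For any other command the number is a genuine one, and
the parts of the command have numbers as well. -/
theorem Cmd.at_idx_of_at {P c d : Cmd} {i : ℕ} (h : P.at i = c) (hc : c ≠ .skip)
    (hd : d ∈ c.subs) : P.at (P.idx d) = d := by
  refine Cmd.at_idx (Cmd.subs_trans ?_ hd)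
  rw [← h]
  unfold Cmd.at at h ⊢
  rw [List.getD_eq_getElem?_getD] at h ⊢
  cases hi : P.subs[i]? with
  | none => rw [hi] at h; exact absurd h.symm hc
  | some x => exact List.mem_of_getElem? hi

/-- Configurations with commands represented by their numbers. -/
abbrev NC := List ℕ × Data × IS

def NC.toCF (P : Cmd) (x : NC) : CF := ⟨x.1.map P.at, x.2.1.store, x.2.2⟩

/-- The configuration after the execution of a command. -/
noncomputable def NC.exec (P : Cmd) : Cmd → Ctx × NC × ℕ × Dr → NC
  | .assign y e, z => (z.2.1.1, .upd y (e.eval z.2.1.2.1.store) z.2.1.2.1, z.2.1.2.2)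
  | .rand y _, z => (z.2.1.1, .upd y (.num z.2.2.1) z.2.1.2.1, z.2.1.2.2)
  | .call y e, z => (z.2.1.1,
      .upd y (z.2.1.2.2.step z.1 (e.eval z.2.1.2.1.store) z.2.2.2).1 z.2.1.2.1,
      (z.2.1.2.2.step z.1 (e.eval z.2.1.2.1.store) z.2.2.2).2)
  | .seq a b, z => (P.idx a :: P.idx b :: z.2.1.1, z.2.1.2)
  | .ite e a b, z =>
      (sel (e.eval z.2.1.2.1.store).toNat (P.idx a) (P.idx b) :: z.2.1.1, z.2.1.2)
  | .loop e a, z => (sel (e.eval z.2.1.2.1.store).toNat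
      (P.idx a :: P.idx (.loop e a) :: z.2.1.1) z.2.1.1, z.2.1.2)

noncomputable def NC.next (P : Cmd) (z : Ctx × NC × ℕ × Dr) : NC :=
  sel z.2.1.1.length (NC.exec P (P.subs.getD (z.2.1.1.headD 0) .skip)
    (z.1, (z.2.1.1.tail, z.2.1.2), z.2.2)) z.2.1

def NC.rangeAt : Cmd → NC → ℕ
  | .rand _ e, x => (e.eval x.2.1.store).toNat
  | _, _ => 1

def NC.range (P : Cmd) (x : NC) : ℕ :=
  sel x.1.length (NC.rangeAt (P.subs.getD (x.1.headD 0) .skip) x) 1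

def NC.forkAt : Cmd → Ctx × ℕ × NC → ℕ
  | .call _ e, z => if z.2.2.2.2.ss.length = z.2.1 then
      if opens z.1 z.2.2.2.2 (e.eval z.2.2.2.1.store) < 3 then 0 else 1 else 0
  | _, _ => 0

def NC.fork (P : Cmd) (z : Ctx × ℕ × NC) : ℕ :=
  sel z.2.2.1.length (NC.forkAt (P.subs.getD (z.2.2.1.headD 0) .skip) z) 0

theorem NC.comp_exec (P c : Cmd) : Comp (NC.exec P c) := by
  change Comp fun z => NC.exec P c z
  cases c <;> (simp only [NC.exec]; fun_prop)

/-- The interpreted program is fixed, so only finitely many commands have to be told apart, each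
with an effect computable in the sense of `Comp`. -/
theorem NC.comp_next (P : Cmd) : Comp (NC.next P) := by
  unfold NC.next
  have h := (Comp.dispatch (NC.exec P) (NC.comp_exec P) .skip P.subs).comp
    (f := fun z : Ctx × NC × ℕ × Dr =>
      (z.2.1.1.headD 0, z.1, (z.2.1.1.tail, z.2.1.2), z.2.2)) (by fun_prop)
  exact Comp.sel (by fun_prop) h (by fun_prop)

theorem NC.comp_range (P : Cmd) : Comp (NC.range P) := by
  unfold NC.range
  have h := (Comp.dispatch NC.rangeAt (fun c => by
      change Comp fun z => NC.rangeAt c z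
      cases c <;> (simp only [NC.rangeAt]; fun_prop))
    .skip P.subs).comp (f := fun x : NC => (x.1.headD 0, x)) (by fun_prop)
  exact Comp.sel (by fun_prop) h (by fun_prop)

theorem NC.comp_fork (P : Cmd) : Comp (NC.fork P) := by
  unfold NC.fork
  have h := (Comp.dispatch NC.forkAt (fun c => by
      change Comp fun z => NC.forkAt c z
      cases c <;> (simp only [NC.forkAt]; fun_prop))
    .skip P.subs).comp (f := fun z : Ctx × ℕ × NC => (z.2.2.1.headD 0, z)) (by fun_prop)
  exact Comp.sel (by fun_prop) h (by fun_prop)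

theorem NC.toCF_next (P : Cmd) (c : Ctx) (x : NC) (r : ℕ) (R : Dr) :
    (NC.next P (c, x, r, R)).toCF P = (x.toCF P).next c r R := by
  obtain ⟨K, d, s⟩ := x
  cases K with
  | nil => simp [NC.next, sel, NC.toCF, CF.next]
  | cons i K =>
    have h0 : NC.next P (c, (i :: K, d, s), r, R) = NC.exec P (P.at i) (c, (K, d, s), r, R) := by
      simp [NC.next, sel, Cmd.at]
    rw [h0, CF.next]
    simp only [NC.toCF, List.map_cons]
    cases h : P.at i with
    | assign y e => simp only [NC.exec, Data.store_upd]
    | rand y e => simp only [NC.exec, Data.store_upd]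
    | call y e => simp only [NC.exec, Data.store_upd]
    | seq a b =>
      simp only [NC.exec, List.map_cons]
      rw [Cmd.at_idx_of_at h (by simp [Cmd.skip]) (by simp [Cmd.subs, Cmd.mem_subs]),
        Cmd.at_idx_of_at h (by simp [Cmd.skip]) (by simp [Cmd.subs, Cmd.mem_subs])]
    | ite e a b =>
      have h1 := Cmd.at_idx_of_at (d := a) h (by simp [Cmd.skip]) (by simp [Cmd.subs, Cmd.mem_subs])
      have h2 := Cmd.at_idx_of_at (d := b) h (by simp [Cmd.skip]) (by simp [Cmd.subs, Cmd.mem_subs])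
      simp only [NC.exec, List.map_cons, sel]
      split_ifs
      · rw [h1]
      · rw [h2]
    | loop e a =>
      have h1 := Cmd.at_idx_of_at (d := a) h (by simp [Cmd.skip]) (by simp [Cmd.subs, Cmd.mem_subs])
      have h2 := Cmd.at_idx_of_at (d := .loop e a) h (by simp [Cmd.skip]) (by simp [Cmd.subs])
      simp only [NC.exec, sel]
      split_ifs
      · simp only [List.map_cons, h1, h2]
      · rfl

theorem NC.range_toCF (P : Cmd) (x : NC) : (x.toCF P).range = NC.range P x := by
  obtain ⟨K, d, s⟩ := x
  cases K with
  | nil => simp [NC.range, sel, NC.toCF, CF.range]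
  | cons i K =>
    have h0 : NC.range P (i :: K, d, s) = NC.rangeAt (P.at i) (i :: K, d, s) := by
      simp [NC.range, sel, Cmd.at]
    rw [h0, CF.range]
    simp only [NC.toCF, List.map_cons]
    cases h : P.at i <;> simp [NC.rangeAt]

theorem NC.fork_toCF (P : Cmd) (c : Ctx) (j : ℕ) (x : NC) :
    (x.toCF P).fork c j = NC.fork P (c, j, x) := by
  obtain ⟨K, d, s⟩ := x
  cases K with
  | nil => simp [NC.fork, sel, NC.toCF, CF.fork]
  | cons i K =>
    have h0 : NC.fork P (c, j, i :: K, d, s) = NC.forkAt (P.at i) (c, j, i :: K, d, s) := by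
      simp [NC.fork, sel, Cmd.at]
    rw [h0, CF.fork]
    simp only [NC.toCF, List.map_cons]
    cases h : P.at i <;> simp [NC.forkAt]

end Handshake

namespace Handshake

open scoped ENNReal

/-! ### Diffie-Hellman from a fixed power of the inverse of an exponent -/

/-- Finds `g^(x² + x)` from `g^x`. -/
noncomputable def square (att : ℕ → PMF ℕ) (c : Ctx) (A : ℕ) : PMF ℕ :=
  (att A).bind fun y => (att (mm A c.g c.p)).bind fun z => att (mm y (pm z (c.q - 1) c.p) c.p)

/-- Finds `g^(ab)` from `A = g^a` and `B = g^b`. -/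
noncomputable def solve (att : ℕ → PMF ℕ) (c : Ctx) (A B : ℕ) : PMF ℕ :=
  (square att c (mm A B c.p)).bind fun v =>
    (square att c (mm A (pm B (c.q - 1) c.p) c.p)).bind fun w =>
      PMF.pure (pm (mm (mm v (pm w (c.q - 1) c.p) c.p) (pm B ((c.q - 1) + (c.q - 1)) c.p) c.p)
        (pm 4 (c.q - 2) c.q) c.p)

theorem PTime.square {ι : Type} [Enc ι] {att : ι → ℕ → PMF ℕ} {c : ι → Ctx}
    (ha : PTime fun z : ι × ℕ => att z.1 z.2) (hc : Comp c) :
    PTime fun z : ι × ℕ => square (att z.1) (c z.1) z.2 := by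
  refine PTime.bind (G := fun z y => (att z.1 (mm z.2 (c z.1).g (c z.1).p)).bind fun w =>
    att z.1 (mm y (pm w ((c z.1).q - 1) (c z.1).p) (c z.1).p)) ha ?_
  refine PTime.bind (F := fun z : (ι × ℕ) × ℕ => att z.1.1 (mm z.1.2 (c z.1.1).g (c z.1.1).p))
    (G := fun z w => att z.1.1 (mm z.2 (pm w ((c z.1.1).q - 1) (c z.1.1).p) (c z.1.1).p)) ?_ ?_
  · exact ha.comp (f := fun z : (ι × ℕ) × ℕ => (z.1.1, mm z.1.2 (c z.1.1).g (c z.1.1).p))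
      (by fun_prop)
  · exact ha.comp (f := fun z : ((ι × ℕ) × ℕ) × ℕ => (z.1.1.1,
      mm z.1.2 (pm z.2 ((c z.1.1.1).q - 1) (c z.1.1.1).p) (c z.1.1.1).p)) (by fun_prop)

theorem PTime.solve {ι : Type} [Enc ι] {att : ι → ℕ → PMF ℕ} {c : ι → Ctx} {A B : ι → ℕ}
    (ha : PTime fun z : ι × ℕ => att z.1 z.2) (hc : Comp c) (hA : Comp A) (hB : Comp B) :
    PTime fun x => solve (att x) (c x) (A x) (B x) := by
  have hs := PTime.square ha hc
  refine PTime.bind (F := fun x => Handshake.square (att x) (c x) (mm (A x) (B x) (c x).p))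
    (hs.comp (f := fun x => (x, mm (A x) (B x) (c x).p)) (by fun_prop)) ?_
  refine PTime.bind (F := fun z : ι × ℕ => Handshake.square (att z.1) (c z.1)
    (mm (A z.1) (pm (B z.1) ((c z.1).q - 1) (c z.1).p) (c z.1).p))
    (hs.comp (f := fun z : ι × ℕ => (z.1, mm (A z.1) (pm (B z.1) ((c z.1).q - 1) (c z.1).p)
      (c z.1).p)) (by fun_prop)) ?_
  exact Comp.ptime (by fun_prop)

theorem mul_le_ev {α : Type*} {p : PMF α} {y : α} {G : ℝ≥0∞} (h : G ≤ ev p fun z => ind (z = y))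
    (f : α → ℝ≥0∞) : G * f y ≤ ev p f := by
  rw [mul_comm]
  refine (mul_le_mul_right h (f y)).trans ?_
  rw [← ev_mul]
  refine ev_mono fun z _ => ?_
  by_cases hz : z = y
  · simp [hz, ind_true]
  · simp [ind_false hz]

variable {pp : Params} {γ : ℕ}

/-- `att` finds `g^(ζ / e)` from `g^e` with probability at least `G`. -/
def Finds (pp : Params) (ζ : ℕ) (G : ℝ≥0∞) (att : ℕ → PMF ℕ) : Prop :=
  ∀ e, ¬ pp.q ∣ e → G ≤ ev (att (pp.gp e)) fun y => ind (y = pp.gp (ζ * pp.inv e))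

theorem Params.cast_ne {a : ℕ} (pp : Params) : (a : ZMod pp.q) ≠ 0 ↔ ¬ pp.q ∣ a := by
  rw [Ne, ZMod.natCast_eq_zero_iff]

theorem Params.cast_inv (pp : Params) [Fact pp.q.Prime] {a : ℕ} (ha : ¬ pp.q ∣ a) :
    ((pp.inv a : ℕ) : ZMod pp.q) = (a : ZMod pp.q)⁻¹ := by
  have h := (ZMod.natCast_eq_natCast_iff _ _ _).mpr (pp.mul_inv ha)
  push_cast at h
  exact eq_inv_of_mul_eq_one_right h

theorem Params.cast_pred (pp : Params) : ((pp.q - 1 : ℕ) : ZMod pp.q) = -1 := by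
  have := pp.q_pos
  rw [Nat.cast_sub this]
  simp

theorem Params.gp_congr (pp : Params) {a b : ℕ} (h : (a : ZMod pp.q) = b) : pp.gp a = pp.gp b :=
  pp.gp_eq_iff.mpr ((ZMod.natCast_eq_natCast_iff _ _ _).mp h)

/-- From `ζ/x` and `ζ/(x+1)` one obtains their difference `ζ/(x(x+1))`, and inverting this cancels
the unknown `ζ`. Three calls cost the factor `G ^ 3`. -/
theorem Finds.square {ζ : ℕ} {G : ℝ≥0∞} {att : ℕ → PMF ℕ} (h : Finds pp ζ G att) {x : ℕ}
    (hζ : ¬ pp.q ∣ ζ) (hx : ¬ pp.q ∣ x) (hx1 : ¬ pp.q ∣ x + 1) :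
    G ^ 3 ≤ ev (square att (pp.ctx γ) (pp.gp x)) fun y => ind (y = pp.gp (x * x + x)) := by
  have : Fact pp.q.Prime := ⟨pp.prime_q⟩
  simp only [Handshake.square, Params.ctx, ev_bind]
  have e1 : mm (pp.gp x) pp.g pp.p = pp.gp (x + 1) := by
    rw [pp.mm_p, ← pp.gp_mul, pp.gp_one]
  set e := ζ * pp.inv x + ζ * pp.inv (x + 1) * (pp.q - 1) with he
  have e2 : mm (pp.gp (ζ * pp.inv x)) (pm (pp.gp (ζ * pp.inv (x + 1))) (pp.q - 1) pp.p) pp.p =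
      pp.gp e := by
    rw [pp.mm_p, pp.pm_p, pp.gp_pow, pp.gp_mul]
  have c0 := pp.cast_ne.mpr hζ
  have c1 := pp.cast_ne.mpr hx
  have c2 := pp.cast_ne.mpr hx1
  push_cast at c2
  -- The exponent `q - 1` acts as `-1`, so `e` is the difference of the two inverses.
  have ce : (e : ZMod pp.q) = ζ * ((x : ZMod pp.q) * (x + 1))⁻¹ := by
    simp only [he, Nat.cast_add, Nat.cast_mul, pp.cast_inv hx, pp.cast_inv hx1, pp.cast_pred,
      Nat.cast_one]
    field_simp
    ring
  have ce0 : ¬ pp.q ∣ e := by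
    rw [← pp.cast_ne, ce]
    exact mul_ne_zero c0 (inv_ne_zero (mul_ne_zero c1 c2))
  have e3 : pp.gp (ζ * pp.inv e) = pp.gp (x * x + x) := by
    apply pp.gp_congr
    push_cast
    rw [pp.cast_inv ce0, ce]
    field_simp
  calc G ^ 3 = G * (G * G) := by ring
    _ ≤ G * (G * ev (att (pp.gp e)) fun y => ind (y = pp.gp (x * x + x))) := by
        gcongr
        rw [← e3]
        exact h e ce0
    _ ≤ _ := by
        refine le_trans ?_ (mul_le_ev (h x hx) _)
        gcongr
        rw [e1]
        refine le_trans (le_of_eq ?_) (mul_le_ev (h (x + 1) hx1) _)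
        rw [e2]

/-- The exponents for which Diffie-Hellman is solved. -/
def Good (pp : Params) (a b : ℕ) : Prop :=
  (¬ pp.q ∣ a + b ∧ ¬ pp.q ∣ a + b + 1) ∧
    ¬ pp.q ∣ a + b * (pp.q - 1) ∧ ¬ pp.q ∣ a + b * (pp.q - 1) + 1

/-- For `s = a + b` and `d = a - b` one has `(s² + s) - (d² + d) = 4ab + 2b`. Dividing by `g^(2b)`
and taking the power `1/4` gives `g^(ab)`, where `5 ≤ q` makes `4` invertible. -/
theorem Finds.solve {ζ : ℕ} {G : ℝ≥0∞} {att : ℕ → PMF ℕ} (h : Finds pp ζ G att) {a b : ℕ}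
    (hζ : ¬ pp.q ∣ ζ) (hq : 5 ≤ pp.q) (hab : Good pp a b) :
    G ^ 6 ≤ ev (solve att (pp.ctx γ) (pp.gp a) (pp.gp b)) fun y => ind (y = pp.gp (a * b)) := by
  have : Fact pp.q.Prime := ⟨pp.prime_q⟩
  obtain ⟨⟨h1, h2⟩, h3, h4⟩ := hab
  have hv := h.square (γ := γ) hζ h1 h2
  have hw := h.square (γ := γ) hζ h3 h4
  have d4 : ¬ pp.q ∣ 4 := fun h => by have := Nat.le_of_dvd (by norm_num) h; omega
  have c4 := pp.cast_ne.mpr d4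
  have e1 : mm (pp.gp a) (pp.gp b) (pp.ctx γ).p = pp.gp (a + b) := by
    simp only [Params.ctx, pp.mm_p, pp.gp_mul]
  have e2 : mm (pp.gp a) (pm (pp.gp b) ((pp.ctx γ).q - 1) (pp.ctx γ).p) (pp.ctx γ).p =
      pp.gp (a + b * (pp.q - 1)) := by
    simp only [Params.ctx, pp.mm_p, pp.pm_p, pp.gp_pow, pp.gp_mul]
  rw [show G ^ 6 = G ^ 3 * G ^ 3 by ring]
  simp only [Handshake.solve, ev_bind, ev_pure, e1, e2]
  refine le_trans ?_ (mul_le_ev hv _)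
  gcongr
  refine le_trans (le_of_eq ?_) (mul_le_ev hw _)
  rw [ind_true, mul_one]
  have e4 : pm 4 (pp.q - 2) pp.q = pp.inv 4 := by simp [pm, pp.q_ne, Params.inv]
  simp only [Params.ctx, e4, pp.mm_p, pp.pm_p, pp.gp_pow, pp.gp_mul]
  apply pp.gp_congr
  push_cast [pp.cast_inv d4, pp.cast_pred]
  push_cast at c4
  field_simp
  ring

/-- Each of the four conditions excludes at most one residue `b`, and `1 - 4/q` is at least `1/5`.
-/
theorem le_ev_good (hq : 5 ≤ pp.q) (a : ℕ) :
    (5 : ℝ≥0∞)⁻¹ ≤ ev (unif pp.q) fun b => ind (Good pp a b) := by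
  have : Fact pp.q.Prime := ⟨pp.prime_q⟩
  have hinj : ∀ r < pp.q, ∀ r' < pp.q, (r : ZMod pp.q) = r' → r = r' := by
    intro r hr r' hr' h
    have := (ZMod.natCast_eq_natCast_iff _ _ _).mp h
    rwa [Nat.ModEq, Nat.mod_eq_of_lt hr, Nat.mod_eq_of_lt hr'] at this
  have hu : ∀ (f : ℕ → ℕ), (∀ r r' : ℕ, (f r : ZMod pp.q) = f r' → (r : ZMod pp.q) = r') →
      ev (unif pp.q) (fun b => ind (pp.q ∣ f b)) ≤ (pp.q : ℝ≥0∞)⁻¹ := by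
    intro f hf
    refine ev_unif_ind_le_one pp.q_ne _ fun r hr r' hr' h h' => hinj r hr r' hr' (hf r r' ?_)
    rw [(ZMod.natCast_eq_zero_iff _ _).mpr h, (ZMod.natCast_eq_zero_iff _ _).mpr h']
  have h1 := hu (fun b => a + b) (fun r r' h => by push_cast at h; simpa using h)
  have h2 := hu (fun b => a + b + 1) (fun r r' h => by push_cast at h; simpa using h)
  have h3 := hu (fun b => a + b * (pp.q - 1))
    (fun r r' h => by push_cast [pp.cast_pred] at h; simpa using h)
  have h4 := hu (fun b => a + b * (pp.q - 1) + 1)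
    (fun r r' h => by push_cast [pp.cast_pred] at h; simpa using h)
  have hsum : 1 ≤ ev (unif pp.q) (fun b => ind (Good pp a b)) + 4 * (pp.q : ℝ≥0∞)⁻¹ := by
    calc (1 : ℝ≥0∞) = ev (unif pp.q) fun _ => 1 := (ev_const _ _).symm
      _ ≤ ev (unif pp.q) (fun b => ind (Good pp a b) + (ind (pp.q ∣ a + b) +
          ind (pp.q ∣ a + b + 1) + ind (pp.q ∣ a + b * (pp.q - 1)) +
          ind (pp.q ∣ a + b * (pp.q - 1) + 1))) := by
        refine ev_mono fun b _ => ?_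
        by_cases hg : Good pp a b
        · rw [ind_true hg]; exact le_self_add
        · rw [ind_false hg, zero_add]
          have h' : 1 ≤ ind ((pp.q ∣ a + b ∨ pp.q ∣ a + b + 1) ∨
              (pp.q ∣ a + b * (pp.q - 1) ∨ pp.q ∣ a + b * (pp.q - 1) + 1)) := by
            rw [ind_true]
            unfold Good at hg
            tauto
          refine h'.trans ((ind_or_le _ _).trans ?_)
          rw [add_assoc (_ + _)]
          exact add_le_add (ind_or_le _ _) (ind_or_le _ _)
      _ ≤ _ := by
        simp only [ev_add]
        gcongr
        refine (add_le_add (add_le_add (add_le_add h1 h2) h3) h4).trans (le_of_eq ?_)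
        ring
  have hq' : 4 * (pp.q : ℝ≥0∞)⁻¹ ≤ 4 * 5⁻¹ := by
    gcongr
    exact_mod_cast hq
  have h5 : (5 : ℝ≥0∞)⁻¹ + 4 * 5⁻¹ = 1 := by
    rw [← one_add_mul, show (1 : ℝ≥0∞) + 4 = 5 by norm_num]
    exact ENNReal.mul_inv_cancel (by norm_num) (by norm_num)
  have h6 : (5 : ℝ≥0∞)⁻¹ + 4 * 5⁻¹ ≤ ev (unif pp.q) (fun b => ind (Good pp a b)) + 4 * 5⁻¹ := by
    rw [h5]
    exact hsum.trans (by gcongr)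
  exact (ENNReal.add_le_add_iff_right (ENNReal.mul_ne_top (by norm_num) (by simp))).mp h6

end Handshake

namespace Handshake

open scoped ENNReal

/-! ### The reduction -/

/-- Makes the random choices of a step. -/
noncomputable def roll (c : Ctx) (M n : ℕ) (f : ℕ → Dr → NC) : PMF NC :=
  (unif n).bind fun r => (unif (c.q - 1)).bind fun r1 => (unif c.q).bind fun r2 =>
    (unif M).bind fun h1 => (unif M).bind fun h2 =>
      PMF.pure (f r ⟨r1, r2, pm c.g r2 c.p, h1, h2⟩)

theorem PTime.roll {α : Type} [Enc α] {c : α → Ctx} {M n : α → ℕ} {f : α × ℕ × Dr → NC}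
    (hc : Comp c) (hM : Comp M) (hn : Comp n) (hf : Comp f) :
    PTime fun a => roll (c a) (M a) (n a) fun r R => f (a, r, R) := by
  refine PTime.bind (F := fun a => Handshake.unif (n a)) (unif.comp hn) ?_
  refine PTime.bind (F := fun z : α × ℕ => Handshake.unif ((c z.1).q - 1))
    (unif.comp (by fun_prop)) ?_
  refine PTime.bind (F := fun z : (α × ℕ) × ℕ => Handshake.unif (c z.1.1).q)
    (unif.comp (by fun_prop)) ?_
  refine PTime.bind (F := fun z : ((α × ℕ) × ℕ) × ℕ => Handshake.unif (M z.1.1.1))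
    (unif.comp (by fun_prop)) ?_
  refine PTime.bind (F := fun z : (((α × ℕ) × ℕ) × ℕ) × ℕ => Handshake.unif (M z.1.1.1.1))
    (unif.comp (by fun_prop)) ?_
  exact Comp.ptime (hf.comp (f := fun z : ((((α × ℕ) × ℕ) × ℕ) × ℕ) × ℕ =>
    (z.1.1.1.1.1, z.1.1.1.1.2, (⟨z.1.1.1.2, z.1.1.2, pm (c z.1.1.1.1.1).g z.1.1.2
      (c z.1.1.1.1.1).p, z.1.2, z.2⟩ : Dr))) (by fun_prop))

theorem mem_support_roll {c : Ctx} {M n : ℕ} {f : ℕ → Dr → NC} {y : NC}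
    (h : y ∈ (roll c M n f).support) : ∃ r R, y = f r R := by
  simp only [roll, PMF.mem_support_bind_iff, PMF.support_pure, Set.mem_singleton_iff] at h
  obtain ⟨r, -, _, -, _, -, _, -, _, -, h⟩ := h
  exact ⟨r, _, h⟩

theorem edepth_dr (R : Dr) : edepth R ≤ 4 := by
  change edepth (R.r1, R.r2, R.gx, R.h1, R.h2) ≤ 4
  simp

theorem PTime.iter_roll {α : Type} [Enc α] {c : α → Ctx} {M : α → ℕ} {n : NC → ℕ}
    {f : (α × NC) × ℕ × Dr → NC} {l : α → List ℕ} {i : α → NC} (hc : Comp c) (hM : Comp M)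
    (hn : Comp n) (hf : Comp f) (hl : Comp l) (hi : Comp i) :
    PTime fun a => Handshake.iter
      (fun x => Handshake.roll (c a) (M a) (n x) fun r R => f ((a, x), r, R)) (l a).length (i a) := by
  obtain ⟨_, _, C, hC⟩ := id hf
  refine PTime.iter (F := fun a x => Handshake.roll (c a) (M a) (n x) fun r R => f ((a, x), r, R))
    -- The random choices have depth at most `4`; the `7` covers them together with the pairings
    -- around the state.
    hl hi ?_ (Polynomial.C (C + 7)) ?_
  · exact PTime.roll (c := fun z : α × NC => c z.1) (M := fun z => M z.1) (n := fun z => n z.2)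
      (by fun_prop) (by fun_prop) (by fun_prop) hf
  · intro a x y hy
    obtain ⟨r, R, rfl⟩ := mem_support_roll hy
    have h1 := (hC ((a, x), r, R)).1
    have h2 := edepth_dr R
    have h3 : edepth ((a, x), r, R) ≤ max (edepth a) (edepth x) + 7 := by
      rw [edepth_pair ((a, x), r, R), edepth_pair (a, x), edepth_pair (r, R)]
      simp only [edepth_nat]
      omega
    simp only [Polynomial.eval_C]
    omega

/-- The ideal experiment. -/
noncomputable def NC.chain (P : Cmd) (c : Ctx) (M n : ℕ) (x : NC) : PMF NC :=
  iter (fun x => roll c M (NC.range P x) fun r R => NC.next P (c, x, r, R)) n x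

/-- The ideal experiment that stops before run `j` begins. -/
noncomputable def NC.pre (P : Cmd) (c : Ctx) (M j n : ℕ) (x : NC) : PMF NC :=
  iter (fun x => roll c M (NC.range P x) fun r R =>
    if NC.fork P (c, j, x) = 1 then x else NC.next P (c, x, r, R)) n x

/-- Continues the experiment with an element derived from `E` as the message of run `j`. -/
noncomputable def NC.attempt (P : Cmd) (c : Ctx) (M n j : ℕ) (x : NC) (E : ℕ) : PMF ℕ :=
  (unif c.q).bind fun ρ =>
    (NC.chain P c M n (NC.next P (c, x, 0, ⟨0, 0, pm E ρ c.p, 0, 0⟩))).bind fun z =>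
      PMF.pure (pm (z.2.2.peer j - 1) ρ c.p)

/-- The parameters of the reduction: unary running time, number of hash values, context, number of a
run. -/
abbrev Task := List ℕ × ℕ × Ctx × ℕ

theorem NC.ptime_attempt (P : Cmd) : PTime fun z : (Task × NC) × ℕ =>
    NC.attempt P z.1.1.2.2.1 z.1.1.2.1 z.1.1.1.length z.1.1.2.2.2 z.1.2 z.2 := by
  refine PTime.bind (F := fun z : (Task × NC) × ℕ => Handshake.unif z.1.1.2.2.1.q)
    (PTime.unif.comp (by fun_prop)) ?_
  refine PTime.bind (F := fun w : ((Task × NC) × ℕ) × ℕ => NC.chain P w.1.1.1.2.2.1 w.1.1.1.2.1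
    w.1.1.1.1.length (NC.next P (w.1.1.1.2.2.1, w.1.1.2, 0,
      ⟨0, 0, pm w.1.2 w.2 w.1.1.1.2.2.1.p, 0, 0⟩))) ?_ ?_
  · exact PTime.iter_roll (c := fun w : ((Task × NC) × ℕ) × ℕ => w.1.1.1.2.2.1)
      (f := fun v => NC.next P (v.1.1.1.1.1.2.2.1, v.1.2, v.2)) (by fun_prop) (by fun_prop)
      (NC.comp_range P) ((NC.comp_next P).comp (by fun_prop)) (by fun_prop)
      ((NC.comp_next P).comp (by fun_prop))
  · exact Comp.ptime (by fun_prop)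

theorem NC.ptime_pre (P : Cmd) : PTime fun z : Task × NC =>
    NC.pre P z.1.2.2.1 z.1.2.1 z.1.2.2.2 z.1.1.length z.2 := by
  refine PTime.iter_roll (c := fun z : Task × NC => z.1.2.2.1)
      (f := fun v => if NC.fork P (v.1.1.1.2.2.1, v.1.1.1.2.2.2, v.1.2) = 1 then v.1.2
        else NC.next P (v.1.1.1.2.2.1, v.1.2, v.2)) (by fun_prop) (by fun_prop)
      (NC.comp_range P) (Comp.ite_eq ((NC.comp_fork P).comp (by fun_prop)) (by fun_prop)
        (by fun_prop) ((NC.comp_next P).comp (by fun_prop))) (by fun_prop) (by fun_prop)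

/-- Solves Diffie-Hellman for `A` and `B`. -/
noncomputable def NC.dh (P : Cmd) (t : Task) (x : NC) (A B : ℕ) : PMF ℕ :=
  (NC.pre P t.2.2.1 t.2.1 t.2.2.2 t.1.length x).bind fun y =>
    solve (NC.attempt P t.2.2.1 t.2.1 t.1.length t.2.2.2 y) t.2.2.1 A B

theorem NC.ptime_dh (P : Cmd) : PTime fun z : (Task × NC) × ℕ × ℕ =>
    NC.dh P z.1.1 z.1.2 z.2.1 z.2.2 := by
  refine PTime.bind (F := fun z : (Task × NC) × ℕ × ℕ => NC.pre P z.1.1.2.2.1 z.1.1.2.1 z.1.1.2.2.2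
    z.1.1.1.length z.1.2) ((NC.ptime_pre P).comp (f := fun z : (Task × NC) × ℕ × ℕ => z.1)
      (by fun_prop)) ?_
  exact PTime.solve (ι := ((Task × NC) × ℕ × ℕ) × NC) (c := fun z => z.1.1.1.2.2.1)
    ((NC.ptime_attempt P).comp (f := fun z : (((Task × NC) × ℕ × ℕ) × NC) × ℕ =>
      ((z.1.1.1.1, z.1.2), z.2)) (by fun_prop)) (by fun_prop) (by fun_prop) (by fun_prop)

/-- The configuration from which program `P` starts, with the given input. -/
def NC.start (d : Data) : NC := ([0], .pair d (.num 0), .init)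

/-- The reduction, for an input that consists of the security parameter, the parameters of the group,
and two group elements. -/
noncomputable def reduction (P : Cmd) (l m : List ℕ) (d : Data) : PMF ℕ :=
  (unif l.length).bind fun γ => (unif l.length).bind fun j =>
    NC.dh P (l, 2 ^ m.length, ⟨d.snd.fst.fst.toNat, d.snd.fst.snd.fst.toNat,
      d.snd.fst.snd.snd.toNat, γ⟩, j) (NC.start (.pair d.fst d.snd.fst)) d.snd.snd.fst.toNat
      d.snd.snd.snd.toNat

theorem Comp.two_pow {α : Type} [Enc α] {m : α → List ℕ} (hm : Comp m) :
    Comp fun a => 2 ^ (m a).length := by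
  have h : ∀ (l : List ℕ) (n : ℕ), l.foldl (fun y _ => y + y) n = n * 2 ^ l.length := by
    intro l
    induction l with
    | nil => simp
    | cons x l ih => intro n; simp only [List.foldl_cons, ih, List.length_cons]; ring
  have := Comp.foldl (i := fun _ => 1) (g := fun x : α × ℕ × ℕ => x.2.1 + x.2.1) hm
    (by fun_prop) (by fun_prop) 0 (by simp)
  simpa [h] using this

theorem ptime_reduction (P : Cmd) :
    PTime fun z : List ℕ × List ℕ × Data => reduction P z.1 z.2.1 z.2.2 := by
  refine PTime.bind (F := fun z : List ℕ × List ℕ × Data => Handshake.unif z.1.length)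
    (PTime.unif.comp (by fun_prop)) ?_
  refine PTime.bind (F := fun z : (List ℕ × List ℕ × Data) × ℕ => Handshake.unif z.1.1.length)
    (PTime.unif.comp (by fun_prop)) ?_
  have h2 : Comp fun z : ((List ℕ × List ℕ × Data) × ℕ) × ℕ => 2 ^ z.1.1.2.1.length :=
    Comp.two_pow (by fun_prop)
  have h3 : Comp fun z : ((List ℕ × List ℕ × Data) × ℕ) × ℕ =>
      NC.start (.pair z.1.1.2.2.fst z.1.1.2.2.snd.fst) := by
    unfold NC.start
    fun_prop
  exact (NC.ptime_dh P).comp (f := fun z : ((List ℕ × List ℕ × Data) × ℕ) × ℕ =>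
    (((z.1.1.1, 2 ^ z.1.1.2.1.length, (⟨z.1.1.2.2.snd.fst.fst.toNat,
      z.1.1.2.2.snd.fst.snd.fst.toNat, z.1.1.2.2.snd.fst.snd.snd.toNat, z.1.2⟩ : Ctx), z.2),
      NC.start (.pair z.1.1.2.2.fst z.1.1.2.2.snd.fst)),
      z.1.1.2.2.snd.snd.fst.toNat, z.1.1.2.2.snd.snd.snd.toNat)) (by fun_prop)

/-- The machine that carries out the reduction. -/
theorem exists_reduction (P : Cmd) (T len : Polynomial ℕ) : ∃ B : PPT, ∀ (σ : ℕ) (pp : Params)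
    (A A' c : ℕ) {S : Type} (O : Env S) (s : S),
    ev (reduction P (List.replicate (T.eval σ) 0) (List.replicate (len.eval σ) 0)
        (.pair (.num σ) (.pair pp.toData (.pair (.num A) (.num A'))))) (fun y => ind (y = c)) ≤
      ev (B.run σ O s (.pair (.num σ) (.pair pp.toData (.pair (.num A) (.num A')))))
        fun o => ind (o.map Data.toNat = some c) := by
  have h : PTime fun z : List ℕ × Data =>
      (PMF.pure (List.replicate (T.eval z.1.length) 0)).bind fun l =>
        (PMF.pure (List.replicate (len.eval z.1.length) 0)).bind fun m => reduction P l m z.2 := by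
    refine PTime.bind (F := fun z : List ℕ × Data =>
      PMF.pure (List.replicate (T.eval z.1.length) 0)) ((PTime.poly T).comp (by fun_prop)) ?_
    refine PTime.bind (F := fun z : (List ℕ × Data) × List ℕ =>
      PMF.pure (List.replicate (len.eval z.1.1.length) 0))
        ((PTime.poly len).comp (f := fun z : (List ℕ × Data) × List ℕ => z.1.1) (by fun_prop)) ?_
    exact (ptime_reduction P).comp (f := fun z : ((List ℕ × Data) × List ℕ) × List ℕ =>
      (z.1.2, z.2, z.1.1.2)) (by fun_prop)
  -- The input tree has depth `4`, whatever the size of the numbers in it.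
  obtain ⟨B, hB⟩ := exists_machine h 4
  refine ⟨B, fun σ pp A A' c S O s => ?_⟩
  have := hB σ (.pair (.num σ) (.pair pp.toData (.pair (.num A) (.num A')))) c O s
    (by simp [edepth, Data.depth, Params.toData]) rfl
  simpa using this

/-! Correctness -/

variable {pp : Params} {γ : ℕ}

theorem ev_roll (len n : ℕ) (f : ℕ → Dr → NC) (g : NC → ℝ≥0∞) :
    ev (roll (pp.ctx γ) (2 ^ len) n f) g =
      ev (unif n) fun r => ev (draws pp len) fun R => g (f r R) := by
  simp [roll, draws, Params.ctx, pp.pm_p, Params.gp]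

theorem NC.ev_chain (P : Cmd) (len : ℕ) (f : CF → ℝ≥0∞) : ∀ (n : ℕ) (x : NC),
    ev (NC.chain P (pp.ctx γ) (2 ^ len) n x) (fun y => f (y.toCF P)) =
      ev (Handshake.chain pp len γ n (x.toCF P)) f := by
  intro n
  induction n with
  | zero => intro x; simp [NC.chain, Handshake.iter, Handshake.chain]
  | succ n ih =>
    intro x
    rw [NC.chain, Handshake.iter, ev_bind, ev_roll, ev_chain_succ, ev_tick, NC.range_toCF]
    refine ev_congr fun r _ => ev_congr fun R _ => ?_
    rw [← NC.toCF_next]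
    exact ih _

theorem NC.ev_pre (P : Cmd) (len j : ℕ) (f : CF → ℝ≥0∞) : ∀ (n : ℕ) (x : NC),
    ev (NC.pre P (pp.ctx γ) (2 ^ len) j n x) (fun y => f (y.toCF P)) =
      ev (Handshake.pre pp len γ j n (x.toCF P)) f := by
  intro n
  induction n with
  | zero => intro x; simp [NC.pre, Handshake.iter, Handshake.pre]
  | succ n ih =>
    intro x
    rw [NC.pre, Handshake.iter, ev_bind, ev_roll, Handshake.pre, NC.fork_toCF]
    split_ifs with h
    · simp only [ev_const]
      exact ih x
    · rw [ev_bind, ev_tick, NC.range_toCF]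
      refine ev_congr fun r _ => ev_congr fun R _ => ?_
      rw [← NC.toCF_next]
      exact ih _

theorem Inv.isElt_peer {s : IS} (h : Inv pp γ s) {k : ℕ} (hk : s.peer k ≠ 0) :
    pp.IsElt (s.peer k - 1) := by
  by_cases hl : k < s.ss.length
  · exact h.peer_elt k hl hk
  · refine absurd ?_ hk
    have e : s.sess k = .zero := by
      simp [IS.sess, rnth, List.getD_eq_getElem?_getD, List.getElem?_eq_none
        (by simpa using hl : s.ss.reverse.length ≤ k)]
    rw [IS.peer, e]
    exact (h.look_ge k (by omega)).1

/-- For `ρ` uniform the planted message `(g^e)^ρ` has the uniform exponent `ρe`, so the adversary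
behaves as in the experiment for every `e`. A reply `u` with `u^(ρe) = g^ζ` gives `u^ρ = g^(ζ/e)`.
-/
theorem NC.finds_attempt (P : Cmd) (len n j ζ : ℕ) {x : NC} (hx : Inv pp γ x.2.2) :
    Finds pp ζ (guess pp len γ n j (pp.gp ζ) (x.toCF P))
      (NC.attempt P (pp.ctx γ) (2 ^ len) n j x) := by
  intro e he
  have : Fact pp.q.Prime := ⟨pp.prime_q⟩
  have c0 := pp.cast_ne.mpr he
  have hmod : ∀ n : ℕ, n % pp.q < pp.q := fun n => Nat.mod_lt _ pp.q_pos
  rw [NC.attempt, ev_bind, guess]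
  -- The exponent of run `j` in the experiment is expressed as `ρe` modulo `q`.
  rw [← ev_unif_perm pp.q_ne (fun ρ => ρ * e % pp.q) (fun _ _ => hmod _) (fun r hr r' hr' h => by
    have h1 : r * e ≡ r' * e [MOD pp.q] := h
    have h2 := Nat.ModEq.cancel_right_of_coprime (pp.coprime he) h1
    rwa [Nat.ModEq, Nat.mod_eq_of_lt hr, Nat.mod_eq_of_lt hr'] at h2)]
  refine ev_mono fun ρ _ => ?_
  have e1 : pm (pp.gp e) ρ (pp.ctx γ).p = pp.gp (ρ * e % pp.q) := by
    simp only [Params.ctx, pp.pm_p, pp.gp_pow]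
    apply pp.gp_congr
    simp [mul_comm]
  rw [CF.graft, ← NC.toCF_next, ← NC.ev_chain, ev_bind, e1]
  simp only [ev_pure]
  have hI := fun f => NC.ev_chain (pp := pp) (γ := γ) P len f n
    (NC.next P (pp.ctx γ, x, 0, ⟨0, 0, pp.gp (ρ * e % pp.q), 0, 0⟩))
  have h1 := hI fun y => ind (y.s.peer j ≠ 0 ∧
    (y.s.peer j - 1) ^ (ρ * e % pp.q) % pp.p = pp.gp ζ)
  have h2 := hI fun y => ind (pm (y.s.peer j - 1) ρ pp.p = pp.gp (ζ * pp.inv e))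
  refine (le_of_eq h1).trans (le_trans ?_ (le_of_eq h2.symm))
  refine ev_mono fun y hy => ind_mono fun ⟨h3, h4⟩ => ?_
  have hy' : Inv pp γ y.s := chain_invariant (P := fun y => Inv pp γ y.s) len
    (fun y r R h => h.next r R) n _ (by
      rw [NC.toCF_next]
      exact Inv.next (x := x.toCF P) hx _ _) y hy
  obtain ⟨r, -, hr⟩ := pp.isElt_iff.mp (hy'.isElt_peer h3)
  rw [hr, pp.gp_pow] at h4
  rw [hr, pp.pm_p, pp.gp_pow]
  apply pp.gp_congr
  have h5 := (ZMod.natCast_eq_natCast_iff _ _ _).mpr (pp.gp_eq_iff.mp h4)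
  push_cast [pp.cast_inv he] at h5 ⊢
  simp only [ZMod.natCast_mod] at h5
  push_cast at h5
  rw [← h5]
  field_simp

/-- All six calls continue independently from the same configuration, in which the secret `g^ζ` of
run `i` is fixed. It is not `1`, so `ζ` is invertible. -/
theorem chance_pow_le_solve (P : Cmd) (len n i j : ℕ) {x : NC} (hx : Inv pp γ x.2.2) {a b : ℕ}
    (hq : 5 ≤ pp.q) (hab : Good pp a b) : chance pp len γ n i j (x.toCF P) ^ 6 ≤
      ev (solve (NC.attempt P (pp.ctx γ) (2 ^ len) n j x) (pp.ctx γ) (pp.gp a) (pp.gp b))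
        fun y => ind (y = pp.gp (a * b)) := by
  unfold chance
  by_cases h : (x.toCF P).fork (pp.ctx γ) j = 1 ∧ (x.toCF P).s.point (pp.ctx γ) i ≠ 1
  · rw [ind_true h, one_mul]
    have hz : ∃ ζ, (x.toCF P).s.point (pp.ctx γ) i = pp.gp ζ := by
      have h1 := h.2
      unfold IS.point at h1 ⊢
      split_ifs at h1 ⊢ with h0
      · exact absurd rfl h1
      · obtain ⟨r, -, hr⟩ := pp.isElt_iff.mp (Inv.isElt_peer hx (k := i) h0)
        refine ⟨r * ((x.toCF P).s.sess i).exp, ?_⟩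
        have hr' : (x.toCF P).s.peer i - 1 = pp.gp r := hr
        rw [IS.zed, hr']
        exact (pp.pm_p _ _).trans (pp.gp_pow _ _)
    obtain ⟨ζ, hζ⟩ := hz
    have h1 := h.2
    rw [hζ] at h1 ⊢
    exact (NC.finds_attempt P len n j ζ hx).solve (fun h => h1 (pp.gp_eq_one_iff.mpr h)) hq hab
  · rw [ind_false h, zero_mul, zero_pow (by norm_num)]
    exact zero_le

theorem NC.toCF_start (P : Cmd) (d : Data) : (NC.start d).toCF P =
    ⟨[P], Function.update (fun _ => .num 0) 0 d, .init⟩ := by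
  simp only [NC.start, NC.toCF, List.map_cons, List.map_nil, Cmd.at_zero, CF.mk.injEq, true_and,
    and_true]
  funext i
  cases i with
  | zero => rfl
  | succ i =>
    rw [Function.update_of_ne (by omega)]
    exact Data.get_num 0 i

/-- The six calls share one execution up to the fork, so the success is the mean of a sixth power,
which Jensen's inequality turns later into a power of the mean. -/
theorem chance_pow_le_dh (P : Cmd) (len i j : ℕ) (l : List ℕ) {a b : ℕ} (d : Data)
    (hq : 5 ≤ pp.q) (hab : Good pp a b) :
    ev (pre pp len γ j l.length ⟨[P], Function.update (fun _ => .num 0) 0 d, .init⟩)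
        (fun y => chance pp len γ l.length i j y ^ 6) ≤
      ev (NC.dh P (l, 2 ^ len, pp.ctx γ, j) (NC.start d) (pp.gp a) (pp.gp b))
        fun y => ind (y = pp.gp (a * b)) := by
  rw [← NC.toCF_start, ← NC.ev_pre, NC.dh, ev_bind]
  refine ev_mono fun y hy => chance_pow_le_solve P len _ i j ?_ hq hab
  have hI : ∀ (n : ℕ) (x : NC), Inv pp γ x.2.2 →
      ∀ y ∈ (NC.pre P (pp.ctx γ) (2 ^ len) j n x).support, Inv pp γ y.2.2 := by
    intro n
    induction n with
    | zero =>
      intro x hx y hy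
      simp only [NC.pre, Handshake.iter, PMF.support_pure, Set.mem_singleton_iff] at hy
      exact hy ▸ hx
    | succ n ih =>
      intro x hx y hy
      simp only [NC.pre, Handshake.iter, PMF.mem_support_bind_iff] at hy
      obtain ⟨z, hz, hy⟩ := hy
      obtain ⟨r, R, rfl⟩ := mem_support_roll hz
      refine ih _ ?_ y hy
      split_ifs
      · exact hx
      · have := Inv.next (x := x.toCF P) hx r R
        rwa [← NC.toCF_next] at this
  exact hI _ _ .init y hy

/-- The success of the reduction, for `T` steps of the program. -/
theorem sum_chance_pow_le (P : Cmd) (len T σ : ℕ) (hq : 5 ≤ pp.q) :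
    ∑ γ ∈ Finset.range T, ∑ i ∈ Finset.range T, ∑ j ∈ Finset.range T,
      ev (pre pp len γ j T ⟨[P], Function.update (fun _ => .num 0) 0
        (.pair (.num σ) pp.toData), .init⟩) (fun y => chance pp len γ T i j y ^ 6) ≤
    5 * (T : ℝ≥0∞) ^ 3 * ev (unif pp.q) fun a => ev (unif pp.q) fun b =>
      ev (reduction P (List.replicate T 0) (List.replicate len 0)
        (.pair (.num σ) (.pair pp.toData (.pair (.num (pp.gp a)) (.num (pp.gp b))))))
        fun y => ind (y = pp.gp (a * b)) := by
  rcases Nat.eq_zero_or_pos T with rfl | hT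
  · simp
  set X := fun i γ j => ev (pre pp len γ j T ⟨[P], Function.update (fun _ => .num 0) 0
    (.pair (.num σ) pp.toData), .init⟩) (fun y => chance pp len γ T i j y ^ 6) with hX
  have hT0 : (T : ℝ≥0∞) ≠ 0 := by exact_mod_cast hT.ne'
  have hT1 : (T : ℝ≥0∞) ≠ ⊤ := ENNReal.natCast_ne_top T
  -- The reduction guesses `γ` and `j`, each correctly with probability `1/T`. It need not guess
  -- `i`, as `ζ` cancels in the computation.
  have h1 : ∀ i a b, Good pp a b → (∑ γ ∈ Finset.range T, ∑ j ∈ Finset.range T, X i γ j) *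
      ((T : ℝ≥0∞)⁻¹ * (T : ℝ≥0∞)⁻¹) ≤
        ev (reduction P (List.replicate T 0) (List.replicate len 0)
          (.pair (.num σ) (.pair pp.toData (.pair (.num (pp.gp a)) (.num (pp.gp b))))))
          fun y => ind (y = pp.gp (a * b)) := by
    intro i a b hab
    simp only [reduction, ev_bind, List.length_replicate]
    rw [ev_unif hT.ne', ← mul_assoc, Finset.sum_mul]
    gcongr with γ hγ
    rw [ev_unif hT.ne']
    gcongr with j hj
    have := chance_pow_le_dh (pp := pp) (γ := γ) P len i j (List.replicate T 0) (a := a) (b := b)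
      (.pair (.num σ) pp.toData) hq hab
    simp only [List.length_replicate] at this
    exact this
  have h2 : ∀ i, (∑ γ ∈ Finset.range T, ∑ j ∈ Finset.range T, X i γ j) *
      ((T : ℝ≥0∞)⁻¹ * (T : ℝ≥0∞)⁻¹) * 5⁻¹ ≤ ev (unif pp.q) fun a => ev (unif pp.q) fun b =>
        ev (reduction P (List.replicate T 0) (List.replicate len 0)
          (.pair (.num σ) (.pair pp.toData (.pair (.num (pp.gp a)) (.num (pp.gp b))))))
          fun y => ind (y = pp.gp (a * b)) := by
    intro i
    refine le_ev fun a _ => ?_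
    -- Restricting to good pairs of exponents costs the factor `5`.
    refine (mul_le_mul_right (le_ev_good hq a) _).trans ?_
    rw [← ev_mul]
    refine ev_mono fun b _ => ?_
    by_cases hg : Good pp a b
    · rw [ind_true hg, mul_one]; exact h1 i a b hg
    · rw [ind_false hg, mul_zero]; exact zero_le
  set W := ev (unif pp.q) fun a => ev (unif pp.q) fun b =>
        ev (reduction P (List.replicate T 0) (List.replicate len 0)
          (.pair (.num σ) (.pair pp.toData (.pair (.num (pp.gp a)) (.num (pp.gp b))))))
          fun y => ind (y = pp.gp (a * b)) with hW
  have h3 : ∀ i, ∑ γ ∈ Finset.range T, ∑ j ∈ Finset.range T, X i γ j ≤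
      5 * (T : ℝ≥0∞) ^ 2 * W := by
    intro i
    calc ∑ γ ∈ Finset.range T, ∑ j ∈ Finset.range T, X i γ j
        = 5 * (T : ℝ≥0∞) ^ 2 * ((∑ γ ∈ Finset.range T, ∑ j ∈ Finset.range T, X i γ j) *
            ((T : ℝ≥0∞)⁻¹ * (T : ℝ≥0∞)⁻¹) * 5⁻¹) := by
          generalize ∑ γ ∈ Finset.range T, ∑ j ∈ Finset.range T, X i γ j = Y
          have e1 : (5 : ℝ≥0∞) * 5⁻¹ = 1 := ENNReal.mul_inv_cancel (by norm_num) (by norm_num)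
          have e2 : (T : ℝ≥0∞) * (T : ℝ≥0∞)⁻¹ = 1 := ENNReal.mul_inv_cancel hT0 hT1
          calc Y = (5 * 5⁻¹) * (((T : ℝ≥0∞) * (T : ℝ≥0∞)⁻¹) * ((T : ℝ≥0∞) * (T : ℝ≥0∞)⁻¹)) * Y := by
                rw [e1, e2]; simp
            _ = _ := by ring
      _ ≤ _ := by gcongr; exact h2 i
  calc ∑ γ ∈ Finset.range T, ∑ i ∈ Finset.range T, ∑ j ∈ Finset.range T, X i γ j
      = ∑ i ∈ Finset.range T, ∑ γ ∈ Finset.range T, ∑ j ∈ Finset.range T, X i γ j :=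
        Finset.sum_comm
    _ ≤ ∑ i ∈ Finset.range T, 5 * (T : ℝ≥0∞) ^ 2 * W := Finset.sum_le_sum fun i _ => h3 i
    _ = 5 * (T : ℝ≥0∞) ^ 3 * W := by
      rw [Finset.sum_const, Finset.card_range, nsmul_eq_mul]; ring

end Handshake

namespace Handshake

open scoped ENNReal

/-! ### The advantage is bounded by the success of machines for Diffie-Hellman -/

theorem apply_true (p : PMF Prop) : p True = ev p ind := by
  rw [ev, tsum_eq_single True]
  · rw [ind_true trivial, mul_one]
  · intro P hP
    rw [ind_false (fun h => hP (eq_true h)), mul_zero]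

theorem ev_ne_top {α : Type*} {p : PMF α} {f : α → ℝ≥0∞} (hf : ∀ a, f a ≤ 1) : ev p f ≠ ⊤ :=
  ne_top_of_le_ne_top ENNReal.one_ne_top (ev_le fun a _ => hf a)

/-- The probability that `B` solves Diffie-Hellman for given parameters. -/
noncomputable def success (B : PPT) (σ : ℕ) (pp : Params) : ℝ≥0∞ :=
  ev (unif pp.q) fun a => ev (unif pp.q) fun b =>
    ev (B.run σ (fun (_ : Unit) _ => PMF.pure (.num 0, ())) ()
      (.pair (.num σ) (.pair pp.toData (.pair (.num (pp.gp a)) (.num (pp.gp b))))))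
      fun o => ind (o.map Data.toNat = some (pp.gp (a * b)))

theorem success_le_one (B : PPT) (σ : ℕ) (pp : Params) : success B σ pp ≤ 1 :=
  ev_le fun _ _ => ev_le fun _ _ => ev_le fun _ _ => ind_le_one _

theorem dhSuccess_eq (gen : ℕ → PMF Params) (B : PPT) (σ : ℕ) :
    dhSuccess gen B σ = (ev (gen σ) (success B σ)).toReal := by
  rw [dhSuccess, apply_true]
  simp only [ev_bind, ev_map]
  rfl

theorem outputsOne_eq (gen : ℕ → PMF Params) (len : Polynomial ℕ) (A : PPT) (real : Bool) (σ : ℕ) :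
    outputsOne gen len A real σ = (ev (gen σ) fun pp => val (Sys.answer pp (len.eval σ) real)
      (fun o => ind (o.map Data.toNat = some 1)) (A.clock.eval σ) [A.prog]
      (Function.update (fun _ => .num 0) 0 (.pair (.num σ) pp.toData)) Sys.init).toReal := by
  rw [outputsOne, apply_true]
  simp only [ev_bind, ev_map]
  rfl

theorem abs_toReal_sub_le {x y b : ℝ≥0∞} (hx : x ≠ ⊤) (hy : y ≠ ⊤) (hb : b ≠ ⊤) (h1 : x ≤ y + b)
    (h2 : y ≤ x + b) : |x.toReal - y.toReal| ≤ b.toReal := by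
  have h1' := ENNReal.toReal_mono (ENNReal.add_ne_top.mpr ⟨hy, hb⟩) h1
  have h2' := ENNReal.toReal_mono (ENNReal.add_ne_top.mpr ⟨hx, hb⟩) h2
  rw [ENNReal.toReal_add hy hb] at h1'
  rw [ENNReal.toReal_add hx hb] at h2'
  rw [abs_sub_le_iff]
  constructor <;> linarith

theorem val_le_one {S : Type} (O : Env S) {post : Option Data → ℝ≥0∞} (hpost : ∀ o, post o ≤ 1)
    (n K st s) : val O post n K st s ≤ 1 := ev_le fun o _ => hpost o

theorem advantage_le (gen : ℕ → PMF Params) (len : Polynomial ℕ) (A : PPT) (σ : ℕ) {b : ℝ≥0∞}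
    (hb : b ≠ ⊤) (h : (ev (gen σ) fun pp => ∑ γ ∈ Finset.range (A.clock.eval σ),
      badProb pp (len.eval σ) γ (A.clock.eval σ) [A.prog]
        (Function.update (fun _ => .num 0) 0 (.pair (.num σ) pp.toData))) ≤ b) :
    detectionAdvantage gen len A σ ≤ b.toReal := by
  have hpost : ∀ o : Option Data, ind (o.map Data.toNat = some 1) ≤ 1 := fun _ => ind_le_one _
  rw [detectionAdvantage, outputsOne_eq, outputsOne_eq]
  refine abs_toReal_sub_le (ev_ne_top fun pp => val_le_one _ hpost _ _ _ _)
    (ev_ne_top fun pp => val_le_one _ hpost _ _ _ _) hb ?_ ?_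
  · refine le_trans ?_ (add_le_add le_rfl h)
    rw [← ev_add]
    exact ev_mono fun pp _ => (hybrid _ _ hpost _ _).1
  · refine le_trans ?_ (add_le_add le_rfl h)
    rw [← ev_add]
    exact ev_mono fun pp _ => (hybrid _ _ hpost _ _).2

theorem chance_le_one (pp : Params) (len γ T i j : ℕ) (x : CF) : chance pp len γ T i j x ≤ 1 :=
  mul_le_one' (ind_le_one _) (ev_le fun _ _ => ev_le fun _ _ => ind_le_one _)

theorem inv_pred_le {q : ℕ} (hq : 2 ≤ q) : ((q - 1 : ℕ) : ℝ≥0∞)⁻¹ ≤ 2 * (q : ℝ≥0∞)⁻¹ := by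
  have h1 : ((2 * (q - 1) : ℕ) : ℝ≥0∞)⁻¹ ≤ (q : ℝ≥0∞)⁻¹ := by
    gcongr
    omega
  calc ((q - 1 : ℕ) : ℝ≥0∞)⁻¹ = 2 * ((2 * (q - 1) : ℕ) : ℝ≥0∞)⁻¹ := by
        rw [Nat.cast_mul, ENNReal.mul_inv (by simp) (by simp), ← mul_assoc]
        simp [ENNReal.mul_inv_cancel]
    _ ≤ _ := by gcongr

/-- Here `u` is in essence the sixth root of the success probability with its polynomial factor. The
constant is `76 = 2 · 36 + 4`: the `2` comes from replacing `q - 1` by `q`, the `4` from the orders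
`q < 5`. -/
theorem sum_badProb_le (B : PPT) (P : Cmd) (T len σ : ℕ) (pp : Params)
    (hB : (ev (unif pp.q) fun a => ev (unif pp.q) fun b =>
      ev (reduction P (List.replicate T 0) (List.replicate len 0)
        (.pair (.num σ) (.pair pp.toData (.pair (.num (pp.gp a)) (.num (pp.gp b))))))
        fun y => ind (y = pp.gp (a * b))) ≤ success B σ pp) :
    ∃ u ≤ 1, u ^ 6 ≤ 5 * (T : ℝ≥0∞) ^ 3 * success B σ pp ∧
      ∑ γ ∈ Finset.range T, badProb pp len γ T [P]
        (Function.update (fun _ => .num 0) 0 (.pair (.num σ) pp.toData)) ≤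
      76 * (T : ℝ≥0∞) ^ 3 * (pp.q : ℝ≥0∞)⁻¹ + (T : ℝ≥0∞) ^ 3 * u := by
  set st : Store := Function.update (fun _ => .num 0) 0 (.pair (.num σ) pp.toData) with hst
  set X := fun γ i j => ev (pre pp len γ j T ⟨[P], st, .init⟩) (chance pp len γ T i j) with hX
  have hX1 : ∀ γ i j, X γ i j ≤ 1 := fun γ i j => ev_le fun _ _ => chance_le_one _ _ _ _ _ _ _
  have key : ∃ u : ℝ≥0∞, u ≤ 1 ∧ u ^ 6 ≤ 5 * (T : ℝ≥0∞) ^ 3 * success B σ pp ∧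
      ∀ γ ∈ Finset.range T, ∀ i ∈ Finset.range T, ∀ j ∈ Finset.range T,
        X γ i j ≤ 4 * (pp.q : ℝ≥0∞)⁻¹ + u := by
    by_cases hq : 5 ≤ pp.q
    · have h6 : ∀ w : ℝ≥0∞, (w ^ (6⁻¹ : ℝ)) ^ 6 = w := fun w => by
        rw [← ENNReal.rpow_natCast, ← ENNReal.rpow_mul]; norm_num
      set W := 5 * (T : ℝ≥0∞) ^ 3 * success B σ pp with hW
      refine ⟨min (W ^ (6⁻¹ : ℝ)) 1, min_le_right _ _, ?_, fun γ hγ i hi j hj => ?_⟩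
      · calc (min (W ^ (6⁻¹ : ℝ)) 1) ^ 6 ≤ (W ^ (6⁻¹ : ℝ)) ^ 6 := by gcongr; exact min_le_left _ _
          _ = W := h6 W
      · refine le_trans (le_min ?_ (hX1 γ i j)) le_add_self
        rw [← ENNReal.pow_le_pow_left_iff (n := 6) (by norm_num), h6]
        -- Jensen's inequality; then a single term is bounded by the whole sum over `γ`, `i` and
        -- `j`.
        refine (ev_pow_six _ _ fun y => chance_le_one _ _ _ _ _ _ _).trans ?_
        refine le_trans ?_ ((sum_chance_pow_le P len T σ hq).trans (mul_le_mul_right hB _))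
        let Y := fun γ i j => ev (pre pp len γ j T ⟨[P], st, .init⟩)
          fun y => chance pp len γ T i j y ^ 6
        exact (Finset.single_le_sum (f := fun j => Y γ i j) (fun _ _ => zero_le) hj).trans
          ((Finset.single_le_sum (f := fun i => ∑ j ∈ Finset.range T, Y γ i j)
            (fun _ _ => zero_le) hi).trans
          (Finset.single_le_sum (f := fun γ => ∑ i ∈ Finset.range T, ∑ j ∈ Finset.range T, Y γ i j)
            (fun _ _ => zero_le) hγ))
    -- For `q ≤ 4` the reduction is not available, but the bound `4/q` is then at least `1`.
    · refine ⟨0, zero_le, by simp, fun γ _ i _ j _ => (hX1 γ i j).trans ?_⟩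
      rw [add_zero]
      have h4 : (4 : ℝ≥0∞)⁻¹ ≤ (pp.q : ℝ≥0∞)⁻¹ := by
        gcongr
        exact_mod_cast (by omega : pp.q ≤ 4)
      calc (1 : ℝ≥0∞) = 4 * 4⁻¹ := (ENNReal.mul_inv_cancel (by norm_num) (by norm_num)).symm
        _ ≤ _ := by gcongr
  obtain ⟨u, hu1, hu6, hu⟩ := key
  refine ⟨u, hu1, hu6, ?_⟩
  calc ∑ γ ∈ Finset.range T, badProb pp len γ T [P] st
      ≤ ∑ γ ∈ Finset.range T, (36 * (T : ℝ≥0∞) ^ 2 * (2 * (pp.q : ℝ≥0∞)⁻¹) +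
          ∑ i ∈ Finset.range T, ∑ j ∈ Finset.range T, (4 * (pp.q : ℝ≥0∞)⁻¹ + u)) := by
        refine Finset.sum_le_sum fun γ hγ => (badProb_le_chance len T [P] st).trans ?_
        gcongr with i hi j hj
        · exact inv_pred_le pp.prime_q.two_le
        · exact hu γ hγ i hi j hj
    _ = _ := by
      simp only [Finset.sum_const, Finset.card_range, nsmul_eq_mul]
      ring

/-- A machine that always answers `1`. -/
noncomputable def guessOne : PPT := ⟨.assign 0 (.lit 1), 1⟩

/-- The answer `1` is right whenever `a = 0`, which has probability `1/q`. So the assumption itself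
forces `1/q` to be small. -/
theorem inv_le_success (σ : ℕ) (pp : Params) : (pp.q : ℝ≥0∞)⁻¹ ≤ success guessOne σ pp := by
  refine le_trans (le_of_eq ?_) (single_le_ev_unif pp.q_ne pp.q_pos _)
  conv_lhs => rw [← one_mul (pp.q : ℝ≥0∞)⁻¹]
  congr 1
  rw [← ev_const (unif pp.q) 1]
  refine ev_congr fun b _ => ?_
  simp [PPT.run, guessOne, exec, Exp.eval, Data.toNat, pp.gp_zero, ind_true]

/-- The bound is raised to the sixth power to avoid roots, and averaged over the parameters by
Jensen's inequality once more. The machine `B` depends on the adversary but not on `σ`. -/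
theorem advantage_pow_le (gen : ℕ → PMF Params) (len : Polynomial ℕ) (A : PPT) : ∃ B : PPT, ∀ σ,
    detectionAdvantage gen len A σ ^ 6 ≤
      (32 * (76 ^ 6 * ((A.clock.eval σ : ℕ) : ℝ) ^ 18 + 5 * ((A.clock.eval σ : ℕ) : ℝ) ^ 21)) *
        (dhSuccess gen guessOne σ + dhSuccess gen B σ) := by
  obtain ⟨B, hB⟩ := exists_reduction A.prog A.clock len
  refine ⟨B, fun σ => ?_⟩
  set T := A.clock.eval σ with hT
  have h := fun pp => sum_badProb_le B A.prog T (len.eval σ) σ pp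
    (ev_mono fun a _ => ev_mono fun b _ => hB σ pp _ _ _ _ _)
  choose u hu1 hu6 hu using h
  set d0 := ev (gen σ) (success guessOne σ) with hd0
  set d := ev (gen σ) (success B σ) with hd
  set U := ev (gen σ) u with hU
  have hd0t : d0 ≤ 1 := ev_le fun pp _ => success_le_one _ _ _
  have hdt : d ≤ 1 := ev_le fun pp _ => success_le_one _ _ _
  have hUt : U ≤ 1 := ev_le fun pp _ => hu1 pp
  have hd0n := ne_top_of_le_ne_top ENNReal.one_ne_top hd0t
  have hdn := ne_top_of_le_ne_top ENNReal.one_ne_top hdt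
  have hUn := ne_top_of_le_ne_top ENNReal.one_ne_top hUt
  have hU6 : U ^ 6 ≤ 5 * (T : ℝ≥0∞) ^ 3 * d := by
    rw [hd, ← ev_mul]
    exact (ev_pow_six _ _ hu1).trans (ev_mono fun pp _ => hu6 pp)
  have hTn : (T : ℝ≥0∞) ^ 3 ≠ ⊤ := ENNReal.pow_ne_top (ENNReal.natCast_ne_top T)
  have h76 : 76 * (T : ℝ≥0∞) ^ 3 ≠ ⊤ := ENNReal.mul_ne_top (by norm_num) hTn
  have hadv := advantage_le gen len A σ (b := 76 * (T : ℝ≥0∞) ^ 3 * d0 + (T : ℝ≥0∞) ^ 3 * U)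
    (ENNReal.add_ne_top.mpr ⟨ENNReal.mul_ne_top h76 hd0n, ENNReal.mul_ne_top hTn hUn⟩) (by
      refine (ev_mono fun pp _ => hu pp).trans ?_
      rw [ev_add, ev_mul, ev_mul]
      gcongr
      exact ev_mono fun pp _ => inv_le_success σ pp)
  rw [ENNReal.toReal_add (ENNReal.mul_ne_top h76 hd0n) (ENNReal.mul_ne_top hTn hUn)] at hadv
  simp only [ENNReal.toReal_mul, ENNReal.toReal_pow, ENNReal.toReal_natCast,
    ENNReal.toReal_ofNat] at hadv
  have hU6' := ENNReal.toReal_mono (ENNReal.mul_ne_top (ENNReal.mul_ne_top (by norm_num) hTn) hdn)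
    hU6
  simp only [ENNReal.toReal_mul, ENNReal.toReal_pow, ENNReal.toReal_natCast,
    ENNReal.toReal_ofNat] at hU6'
  rw [dhSuccess_eq, dhSuccess_eq]
  have hx0 : (0 : ℝ) ≤ d0.toReal := ENNReal.toReal_nonneg
  have hx1 : d0.toReal ≤ 1 := by
    simpa using ENNReal.toReal_mono ENNReal.one_ne_top hd0t
  have hy0 : (0 : ℝ) ≤ d.toReal := ENNReal.toReal_nonneg
  have hU0 : (0 : ℝ) ≤ U.toReal := ENNReal.toReal_nonneg
  generalize d0.toReal = x at *
  generalize d.toReal = y at *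
  generalize U.toReal = w at *
  have hT0 : (0 : ℝ) ≤ (T : ℝ) := Nat.cast_nonneg T
  generalize (T : ℝ) = t at *
  have hx6 : x ^ 6 ≤ x := pow_le_of_le_one hx0 hx1 (by norm_num)
  calc detectionAdvantage gen len A σ ^ 6 ≤ (76 * t ^ 3 * x + t ^ 3 * w) ^ 6 :=
        pow_le_pow_left₀ (abs_nonneg _) hadv 6
    -- Convexity of the sixth power, whence the factor `32`; after that `x ^ 6 ≤ x` since `x` is a
    -- probability.
    _ ≤ 2 ^ 5 * ((76 * t ^ 3 * x) ^ 6 + (t ^ 3 * w) ^ 6) :=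
        add_pow_le (by positivity) (by positivity) 6
    _ = 32 * (76 ^ 6 * t ^ 18 * x ^ 6 + t ^ 18 * w ^ 6) := by ring
    _ ≤ 32 * (76 ^ 6 * t ^ 18 * x + t ^ 18 * (5 * t ^ 3 * y)) := by gcongr
    _ = 32 * (76 ^ 6 * t ^ 18 * x + 5 * t ^ 21 * y) := by ring
    _ ≤ (32 * (76 ^ 6 * t ^ 18 + 5 * t ^ 21)) * (x + y) := by
        have h1 : 0 ≤ 76 ^ 6 * t ^ 18 * y := by positivity
        have h2 : 0 ≤ 5 * t ^ 21 * x := by positivity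
        nlinarith

/-! Asymptotics -/

/-- The decay of `f ^ n` against `σ^(nk)` gives that of `f` against `σ^k` by taking continuous
`n`-th roots. -/
theorem Negligible.of_pow {f : ℕ → ℝ} (n : ℕ) (hn : n ≠ 0) (h : Negligible fun σ => f σ ^ n) :
    Negligible f := by
  unfold Negligible at *
  rw [Asymptotics.superpolynomialDecay_iff_abs_tendsto_zero] at *
  intro k
  have h1 := (h (n * k)).rpow_const (p := (n : ℝ)⁻¹) (.inr (by positivity))
  rw [Real.zero_rpow (by positivity)] at h1
  refine h1.congr fun σ => ?_
  rw [mul_comm n k, pow_mul, ← mul_pow, abs_pow, Real.pow_rpow_inv_natCast (abs_nonneg _) hn]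

theorem negligible_half_pow : Negligible fun σ => (1 / 2 : ℝ) ^ σ := fun n =>
  tendsto_pow_const_mul_const_pow_of_lt_one n (by norm_num) (by norm_num)

end Handshake

/-! ### The two asymptotic conclusions. -/

theorem mainTheorem1 (gen : ℕ → PMF Handshake.Params)
    (hgen : ∃ L : Polynomial ℕ, ∀ σ, ∀ pp ∈ (gen σ).support, pp.p < 2 ^ L.eval σ)
    (len : Polynomial ℕ) :
    (Handshake.DHAssumption gen →
      ∀ A : Handshake.PPT, Handshake.Negligible (Handshake.detectionAdvantage gen len A)) ∧
    (Handshake.StrongDHAssumption gen →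
      ∀ A : Handshake.PPT, ∀ᶠ σ in Filter.atTop,
        Handshake.detectionAdvantage gen len A σ < 1 / 2 ^ σ) := by
  have hQ : ∀ A : Handshake.PPT, ∃ Q : Polynomial ℝ, ∀ σ : ℕ, Q.eval (σ : ℝ) =
      32 * (76 ^ 6 * ((A.clock.eval σ : ℕ) : ℝ) ^ 18 + 5 * ((A.clock.eval σ : ℕ) : ℝ) ^ 21) := fun A =>
    ⟨32 * (76 ^ 6 * (A.clock.map (Nat.castRingHom ℝ)) ^ 18 +
      5 * (A.clock.map (Nat.castRingHom ℝ)) ^ 21), fun σ => by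
        have : (A.clock.map (Nat.castRingHom ℝ)).eval (σ : ℝ) = ((A.clock.eval σ : ℕ) : ℝ) := by
          simp
        simp only [Polynomial.eval_mul, Polynomial.eval_add, Polynomial.eval_pow, this,
          Polynomial.eval_ofNat]⟩
  constructor
  · intro hdh A
    obtain ⟨B, hB⟩ := Handshake.advantage_pow_le gen len A
    obtain ⟨Q, hQ⟩ := hQ A
    refine Handshake.Negligible.of_pow 6 (by norm_num) ?_
    refine (((hdh Handshake.guessOne).add (hdh B)).polynomial_mul Q).trans_abs_le fun σ => ?_
    rw [abs_of_nonneg (pow_nonneg (abs_nonneg _) 6)]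
    exact (hB σ).trans ((le_abs_self _).trans (by rw [hQ]; rfl))
  · intro hdh A
    obtain ⟨B, hB⟩ := Handshake.advantage_pow_le gen len A
    obtain ⟨Q, hQ⟩ := hQ A
    have h1 : Filter.Tendsto (fun σ : ℕ => (2 * Q.eval (σ : ℝ)) * (1 / 2) ^ σ) Filter.atTop
        (nhds 0) := by
      simpa using (Handshake.negligible_half_pow.polynomial_mul (2 * Q)) 0
    -- The rate `7` is one more than the power `6`: six factors `2^(-σ)` give the sixth power of the
    -- bound claimed, the seventh absorbs the polynomial.
    filter_upwards [hdh Handshake.guessOne 7, hdh B 7, h1.eventually_lt_const zero_lt_one]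
      with σ h2 h3 h4
    refine lt_of_pow_lt_pow_left₀ 6 (by positivity) ((hB σ).trans_lt ?_)
    rw [← hQ]
    have hQ0 : 0 ≤ Q.eval (σ : ℝ) := by rw [hQ]; positivity
    calc Q.eval (σ : ℝ) * (Handshake.dhSuccess gen Handshake.guessOne σ +
          Handshake.dhSuccess gen B σ)
        ≤ Q.eval (σ : ℝ) * (1 / 2 ^ (7 * σ) + 1 / 2 ^ (7 * σ)) := by gcongr
      _ = ((2 * Q.eval (σ : ℝ)) * (1 / 2) ^ σ) * (1 / 2 ^ σ) ^ 6 := by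
          rw [one_div_pow, pow_mul']
          field_simp
          ring
      _ < 1 * (1 / 2 ^ σ) ^ 6 := by gcongr
      _ = (1 / 2 ^ σ) ^ 6 := one_mul _
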